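/- **Setting.** Let $n\ge 0$, let $\mathcal I=\{\mathtt j_1,\dots,\mathtt j_n\}\subset\mathbb Z$ have $n$ distinct elements, $\kappa:=\max_l|\mathtt j_l|$ ($\kappa:=0$ if $n=0$), $a\ge 0$, $p>1/2$, $\langle j\rangle:=\max\{1,|j|\}$. Let $\ell^{a,p}_{\mathcal I}$ be the Hilbert space of the sequences $z=(z_j)_{j\in\mathbb Z\setminus\mathcal I}$ of complex numbers with $\|z\|_{a,p}^2:=\sum_j|z_j|^2e^{2a|j|}\langle j\rangle^{2p}<\infty$, and $E:=\mathbb C^n\times\mathbb C^n\times\ell^{a,p}_{\mathcal I}\times\ell^{a,p}_{\mathcal I}\ni v=(x,y,z,\bar z)$ ($z$ and $\bar z$ are independent; $z^+:=z$, $z^-:=\bar z$), with $\|v\|_{E,s,r}:=|x|_\infty/s+|y|_1/r^2+\|z\|_{a,p}/r+\|\bar z\|_{a,p}/r$ for $s,r>0$. Let $D(r)$ be the set of $(y,z,\bar z)$ with $|y|_1<r^2$, $\|z\|_{a,p}<r$, $\|\bar z\|_{a,p}<r$, and $D(s,r):=\{v\in E:\ |\mathrm{Im}\,x_h|<s\ \forall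 h,\ (y,z,\bar z)\in D(r)\}$. Functions $f$ on $D(s,r)$ may depend on a parameter $\xi\in\mathcal O\subset\mathbb R^n$. They are sums of absolutely convergent series $f=\sum f_{k,i,\alpha,\beta}(\xi)\,e^{\mathrm i k\cdot x}y^iz^\alpha\bar z^\beta$, $k\in\mathbb Z^n$, $i\in\mathbb N^n$, $\alpha,\beta\in\mathbb N^{\mathbb Z\setminus\mathcal I}$ with finite support (the coefficients are unique). With $X_f:=(\partial_yf,-\partial_xf,-\mathrm i\partial_{\bar z}f,\mathrm i\partial_zf)$, with coefficient vectors $X_{k,i,\alpha,\beta}$, put $$\|X_f\|_{s,r}:=\sup_{\xi\in\mathcal O}\ \sup_{(y,z,\bar z)\in D(r)}\Big\|\sum_{k,i,\alpha,\beta}|X_{k,i,\alpha,\beta}|\,e^{|k|s}|y^i||z^\alpha||\bar z^\beta|\Big\|_{E,s,r},$$ moduli being taken componentwise and $|k|=\sum_h|k_h|$. Let $\mathcal H_{s,r}$ be the set of $f$ with $\|X_f\|_{s,r}<\infty$, let $$\{H,K\}:=\partial_xH\cdot\partial_yK-\partial_xK\cdot\partial_yH+\mathrm i(\partial_zH\cdot\partial_{\bar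 z}K-\partial_{\bar z}H\cdot\partial_zK),\qquad \mathrm{ad}_F:=\{\,\cdot\,,F\},\qquad e^{\mathrm{ad}_F}:=\sum_{j\ge0}\frac{\mathrm{ad}_F^j}{j!},$$ $\mathcal M:=\sum_l\mathtt j_ly_l+\sum_jjz_j\bar z_j$, $\mathcal H^{\rm null}_{s,r}:=\{f\in\mathcal H_{s,r}:\{f,\mathcal M\}=0\}$, and $\pi(k,\alpha,\beta):=\sum_l\mathtt j_lk_l+\sum_jj(\alpha_j-\beta_j)$. **Quasi-Töplitz functions.** Fix $0<b<L<1$. A monomial $e^{\mathrm i k\cdot x}y^iz^\alpha\bar z^\beta$ is $(N,\mu)$-low momentum if $\sum_j|j|(\alpha_j+\beta_j)<\mu N^L$ and $|k|<N^b$; $\mathcal L_{s,r}(N,\mu,h)$ is the set of $g\in\mathcal H_{s,r}$ all of whose monomials are $(N,\mu)$-low momentum with $\pi(k,\alpha,\beta)+h=0$. $\Pi_{N,\theta,\mu}$ is the projection on the monomials $e^{\mathrm i k\cdot x}y^iz^\alpha\bar z^\beta z_m^\sigma z_{n}^{\sigma'}$ with $\sigma,\sigma'=\pm$, $|m|,|n|>\theta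 N$, where $e^{\mathrm i k\cdot x}y^iz^\alpha\bar z^\beta$ is $(N,\mu)$-low momentum and $\pi(k,\alpha,\beta)=-\sigma m-\sigma'n$. A function in $\mathcal H_{s,r}$ is $(N,\theta,\mu)$-Töplitz, i.e. belongs to $\mathcal T_{s,r}(N,\theta,\mu)$, if it equals $\sum_{|m|,|n|>\theta N,\ \sigma,\sigma'=\pm}f^{\sigma,\sigma'}(\mathrm{sign}(m),\sigma m+\sigma'n)\,z_m^\sigma z_n^{\sigma'}$ for some $f^{\sigma,\sigma'}(\varsigma,h)\in\mathcal L_{s,r}(N,\mu,h)$, $\varsigma=\pm$, $h\in\mathbb Z$. For $f\in\mathcal H_{s,r}^{\rm null}$ put $$\|f\|^T_{s,r,N_0,\theta,\mu}:=\sup_{N\ge N_0}\ \inf_{\tilde f\in\mathcal T_{s,r}(N,\theta,\mu)}\max\big\{\|X_f\|_{s,r},\ \|X_{\tilde f}\|_{s,r},\ \|X_{N(\Pi_{N,\theta,\mu}f-\tilde f)}\|_{s,r}\big\},$$ and let $\mathcal Q^T_{s,r}(N_0,\theta,\mu)$ be the set of $f\in\mathcal H^{\rm null}_{s,r}$ for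 which this is finite. **Proposition 3.2 (Lie transform).** For each $n\ge0$ there are constants $c=c(n)>0$ and $C=C(n)>0$ such that the following holds for all $\mathcal I,a,p,b,L$ as above. Let $N_0\ge1$ be an integer, $1<\theta,\mu<6$, $12N_0^{L-1}+2\kappa N_0^{b-1}<1$, $s,r>0$, $s/2\le s'<s$, $r/2\le r'<r$, $\delta:=\min\{1-s'/s,\,1-r'/r\}$, and let $f,g\in\mathcal Q^T_{s,r}(N_0,\theta,\mu)$ satisfy $$\|f\|^T_{s,r,N_0,\theta,\mu}\le c(n)\,\delta .$$ (i) For each parameter value, the Hamiltonian flow of $f$ at time $1$, $\Phi^1_f:D(s',r')\to D(s,r)$, is well defined (for each $v\in D(s',r')$ there is exactly one curve $\gamma:[0,1]\to D(s,r)$ with $\gamma(0)=v$ and $\dot\gamma=X_f(\gamma)$, and $\Phi^1_f(v)=\gamma(1)$), analytic (continuously Fréchet differentiable over $\mathbb C$) and symplectic (for the form $dx\wedge dy+\mathrm i\,dz\wedge d\bar z$, of which $X_f$ is the Hamiltonian vector field of $f$). (ii) Let $\mu'<\mu$, $\theta'>\theta$ and let $N_0'\ge\max\{N_0,\bar N\}$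 be an integer, $\bar N:=\exp\big(\max\{\frac2b,\frac1{L-b},\frac1{1-L},8\}\big)$, with $$\kappa(N_0')^{b-L}\ln N_0'\le\mu-\mu',\qquad(6+\kappa)(N_0')^{L-1}\ln N_0'\le\theta'-\theta,\qquad 2(N_0')^{-b}\ln^2N_0'\le b(s-s').$$ Then the series $e^{\mathrm{ad}_f}g$ converges absolutely at each point of $D(s',r')$, $e^{\mathrm{ad}_f}g\in\mathcal Q^T_{s',r'}(N_0',\theta',\mu')$ and $$\|e^{\mathrm{ad}_f}g\|^T_{s',r',N_0',\theta',\mu'}\le 2\max\Big\{\frac s{s'},\Big(\frac r{r'}\Big)^2\Big\}\|g\|^T_{s,r,N_0,\theta,\mu}.$$ Moreover, for $h=0,1,2$ and all coefficients $0\le b_j\le1/j!$, $j\in\mathbb N$, the series $\sum_{j\ge h}b_j\,\mathrm{ad}_f^jg$ converges absolutely at each point of $D(s',r')$ to a function in $\mathcal Q^T_{s',r'}(N_0',\theta',\mu')$; for $h=0$ its norm $\|\cdot\|^T_{s',r',N_0',\theta',\mu'}$ is at most $2\max\{s/s',(r/r')^2\}\,\|g\|^T_{s,r,N_0,\theta,\mu}$,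 and for $h=1,2$ $$\Big\|\sum_{j\ge h}b_j\,\mathrm{ad}_f^jg\Big\|^T_{s',r',N_0',\theta',\mu'}\le2\big(C\delta^{-1}\|f\|^T_{s,r,N_0,\theta,\mu}\big)^h\,\|g\|^T_{s,r,N_0,\theta,\mu}.$$ -/

import Mathlib

open scoped ENNReal BigOperators

noncomputable section

namespace QuasiToeplitz

/-! ## Phase space -/

/-- The index set `ℤ ∖ 𝓘`, where `𝓘 = {𝚓 1, …, 𝚓 n}`. -/
abbrev Site {n : ℕ} (jj : Fin n → ℤ) : Type := {j : ℤ // j ∉ Set.range jj}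

/-- `⟨j⟩ = max {1, |j|}`. -/
def bracket (j : ℤ) : ℝ := max 1 |(j : ℝ)|

/-- The weight `e^{a|j|} ⟨j⟩^p`. -/
def weight (a p : ℝ) (j : ℤ) : ℝ := Real.exp (a * |(j : ℝ)|) * bracket j ^ p

theorem bracket_pos (j : ℤ) : 0 < bracket j := lt_of_lt_of_le one_pos (le_max_left _ _)

theorem weight_pos (a p : ℝ) (j : ℤ) : 0 < weight a p j :=
  mul_pos (Real.exp_pos _) (Real.rpow_pos_of_pos (bracket_pos j) _)

theorem weight_sq (a p : ℝ) (j : ℤ) :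
    weight a p j ^ 2 = Real.exp (2 * a * |(j : ℝ)|) * bracket j ^ (2 * p) := by
  unfold weight
  rw [mul_pow, ← Real.exp_nat_mul, ← Real.rpow_natCast, ← Real.rpow_mul (bracket_pos j).le]
  congr 1
  · congr 1; push_cast; ring
  · congr 1; push_cast; ring

theorem memlp_iff {n : ℕ} (jj : Fin n → ℤ) (a p : ℝ) (z : Site jj → ℂ) :
    Memℓp (fun j : Site jj => (weight a p j : ℂ) * z j) 2 ↔
      Summable fun j : Site jj =>
        ‖z j‖ ^ 2 * (Real.exp (2 * a * |((j : ℤ) : ℝ)|) * bracket j ^ (2 * p)) := by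
  rw [memℓp_gen_iff (by norm_num)]
  apply summable_congr
  intro j
  rw [← weight_sq, norm_mul, Complex.norm_real, Real.norm_of_nonneg (weight_pos a p j).le]
  norm_num
  ring

/-- The sequences `z : ℤ ∖ 𝓘 → ℂ` with `∑ |z_j|² e^{2a|j|} ⟨j⟩^{2p} < ∞`. -/
def seqSubmodule {n : ℕ} (jj : Fin n → ℤ) (a p : ℝ) : Submodule ℂ (Site jj → ℂ) where
  carrier := {z | Summable fun j : Site jj =>
    ‖z j‖ ^ 2 * (Real.exp (2 * a * |((j : ℤ) : ℝ)|) * bracket j ^ (2 * p))}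
  zero_mem' := by simp [summable_zero]
  add_mem' := by
    intro z w hz hw
    rw [Set.mem_ofPred_eq, ← memlp_iff] at *
    convert hz.add hw using 1
    funext j
    simp [mul_add]
  smul_mem' := by
    intro c z hz
    rw [Set.mem_ofPred_eq, ← memlp_iff] at *
    convert hz.const_smul c using 1
    funext j
    simp [mul_left_comm]

/-- The Hilbert space `ℓ^{a,p}_𝓘`.  It is a type of its own, so that its topology is the one of
the norm below and not the topology of pointwise convergence. -/
def SeqSpace {n : ℕ} (jj : Fin n → ℤ) (a p : ℝ) : Type := seqSubmodule jj a p

variable {n : ℕ} {jj : Fin n → ℤ} {a p : ℝ}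

instance : AddCommGroup (SeqSpace jj a p) := inferInstanceAs (AddCommGroup (seqSubmodule jj a p))

instance : Module ℂ (SeqSpace jj a p) := inferInstanceAs (Module ℂ (seqSubmodule jj a p))

/-- The `j`-th entry of a sequence. -/
def SeqSpace.entry (z : SeqSpace jj a p) (j : Site jj) : ℂ := z.1 j

/-- The embedding `z ↦ (e^{a|j|} ⟨j⟩^p z_j)_j` into the unweighted `ℓ²`. -/
def SeqSpace.toLp : SeqSpace jj a p →ₗ[ℂ] lp (fun _ : Site jj => ℂ) 2 where
  toFun z := ⟨fun j => (weight a p j : ℂ) * z.entry j, (memlp_iff jj a p _).2 z.2⟩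
  map_add' z w := by
    ext j
    exact mul_add _ _ _
  map_smul' c z := by
    ext j
    exact mul_left_comm _ _ _

theorem SeqSpace.toLp_injective :
    Function.Injective (SeqSpace.toLp : SeqSpace jj a p →ₗ[ℂ] lp (fun _ : Site jj => ℂ) 2) := by
  intro z w h
  apply Subtype.ext
  funext j
  have h1 : (weight a p j : ℂ) * z.entry j = (weight a p j : ℂ) * w.entry j :=
    congrFun (congrArg Subtype.val h) j
  exact mul_left_cancel₀ (Complex.ofReal_ne_zero.2 (weight_pos a p j).ne') h1

instance : NormedAddCommGroup (SeqSpace jj a p) :=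
  NormedAddCommGroup.induced (SeqSpace jj a p) (lp (fun _ : Site jj => ℂ) 2)
    SeqSpace.toLp SeqSpace.toLp_injective

instance : NormedSpace ℂ (SeqSpace jj a p) :=
  NormedSpace.induced ℂ (SeqSpace jj a p) (lp (fun _ : Site jj => ℂ) 2) SeqSpace.toLp

/-- The norm is `‖z‖² = ∑ |z_j|² e^{2a|j|} ⟨j⟩^{2p}`. -/
theorem SeqSpace.norm_sq (z : SeqSpace jj a p) :
    ‖z‖ ^ 2 = ∑' j : Site jj,
      ‖z.entry j‖ ^ 2 * (Real.exp (2 * a * |((j : ℤ) : ℝ)|) * bracket j ^ (2 * p)) := by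
  have h := lp.norm_rpow_eq_tsum (p := 2) (by norm_num) (SeqSpace.toLp z)
  have h2 : ‖z‖ = ‖SeqSpace.toLp z‖ := rfl
  rw [h2]
  norm_num at h
  rw [h]
  apply tsum_congr
  intro j
  rw [← weight_sq]
  change ‖(weight a p j : ℂ) * z.entry j‖ ^ 2 = _
  rw [norm_mul, Complex.norm_real, Real.norm_of_nonneg (weight_pos a p j).le]
  ring

open Classical in
/-- The basis sequence `e_j`. -/
def SeqSpace.basis (j : Site jj) : SeqSpace jj a p :=
  ⟨Pi.single j 1, by
    apply summable_of_ne_finset_zero (s := {j})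
    intro i hi
    rw [Finset.mem_singleton] at hi
    simp [Pi.single_eq_of_ne hi]⟩

/-- The phase space `E = ℂⁿ × ℂⁿ × ℓ^{a,p}_𝓘 × ℓ^{a,p}_𝓘` of the variables `(x, y, z, z̄)`.
The norms `‖·‖_{E,s,r}` are all equivalent to the norm that Mathlib puts on this product. -/
abbrev Phase (jj : Fin n → ℤ) (a p : ℝ) : Type :=
  (Fin n → ℂ) × (Fin n → ℂ) × SeqSpace jj a p × SeqSpace jj a p

namespace Phase

/-- The angles `x`. -/
def x (v : Phase jj a p) : Fin n → ℂ := v.1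

/-- The actions `y`. -/
def y (v : Phase jj a p) : Fin n → ℂ := v.2.1

/-- The normal variables: `z⁺ = z` (for `true`) and `z⁻ = z̄` (for `false`), two independent
sequences. -/
def z (v : Phase jj a p) (σ : Bool) : SeqSpace jj a p := if σ then v.2.2.1 else v.2.2.2

/-- The basis vector of the variable `x_h`. -/
def eX (h : Fin n) : Phase jj a p := (Pi.single h 1, 0, 0, 0)

/-- The basis vector of the variable `y_h`. -/
def eY (h : Fin n) : Phase jj a p := (0, Pi.single h 1, 0, 0)

/-- The basis vector of the variable `z_j^σ`. -/
def eZ (σ : Bool) (j : Site jj) : Phase jj a p :=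
  if σ then (0, 0, SeqSpace.basis j, 0) else (0, 0, 0, SeqSpace.basis j)

end Phase

/-- The conditions `|y|₁ < r²`, `‖z‖_{a,p} < r`, `‖z̄‖_{a,p} < r`, i.e. `(y, z, z̄) ∈ D(r)`. -/
def ballR (jj : Fin n → ℤ) (a p r : ℝ) : Set (Phase jj a p) :=
  {v | ∑ h, ‖v.y h‖ < r ^ 2 ∧ ‖v.z true‖ < r ∧ ‖v.z false‖ < r}

/-- The domain `D(s,r)`: `|Im x_h| < s` for all `h`, and `(y, z, z̄) ∈ D(r)`. -/
def dom (jj : Fin n → ℤ) (a p s r : ℝ) : Set (Phase jj a p) :=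
  {v | (∀ h, |(v.x h).im| < s) ∧ v ∈ ballR jj a p r}

/-! ## Formal Taylor–Fourier series -/

/-- A multi-index `(k, i, α, β) ∈ ℤⁿ × ℕⁿ × ℕ^(ℤ∖𝓘) × ℕ^(ℤ∖𝓘)`; the index `α` is `ab true`, the
exponent of `z⁺ = z`, and `β` is `ab false`, the exponent of `z⁻ = z̄`. -/
structure MultiIndex (jj : Fin n → ℤ) : Type where
  k : Fin n → ℤ
  i : Fin n → ℕ
  ab : Bool → (Site jj →₀ ℕ)

namespace MultiIndex

/-- Multiplication of the monomial by `y_h`. -/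
def raiseY (h : Fin n) (I : MultiIndex jj) : MultiIndex jj :=
  { I with i := I.i + Pi.single h 1 }

open Classical in
/-- Multiplication of the monomial by `z_j^σ`. -/
def raiseZ (σ : Bool) (j : Site jj) (I : MultiIndex jj) : MultiIndex jj :=
  { I with ab := Function.update I.ab σ (I.ab σ + Finsupp.single j 1) }

/-- `|k| = |k₁| + … + |k_n|`. -/
def kNorm (I : MultiIndex jj) : ℕ := ∑ h, (I.k h).natAbs

/-- The momentum `π(k,α,β) = ∑ 𝚓_l k_l + ∑ j (α_j - β_j)`. -/
def momentum (I : MultiIndex jj) : ℤ :=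
  ∑ l, jj l * I.k l + ((I.ab true).sum fun j e => (j : ℤ) * e)
    - ((I.ab false).sum fun j e => (j : ℤ) * e)

/-- The monomial `e^{i k·x} y^i z^α z̄^β`. -/
def monomial (I : MultiIndex jj) (v : Phase jj a p) : ℂ :=
  Complex.exp (Complex.I * ∑ h, (I.k h : ℂ) * v.x h) * (∏ h, v.y h ^ I.i h) *
    ((I.ab true).prod fun j e => (v.z true).entry j ^ e) *
    ((I.ab false).prod fun j e => (v.z false).entry j ^ e)

/-- `e^{|k|s} |y^i| |z^α| |z̄^β|`. -/
def majorant (s : ℝ) (I : MultiIndex jj) (v : Phase jj a p) : ℝ :=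
  Real.exp (I.kNorm * s) * (∏ h, ‖v.y h‖ ^ I.i h) *
    ((I.ab true).prod fun j e => ‖(v.z true).entry j‖ ^ e) *
    ((I.ab false).prod fun j e => ‖(v.z false).entry j‖ ^ e)

end MultiIndex

/-- A formal power series, given by its coefficients. -/
abbrev Series (jj : Fin n → ℤ) : Type := MultiIndex jj → ℂ

/-- `H` is on `D(s,r)` the sum of the absolutely convergent formal series `c`. -/
def IsExpansion (s r : ℝ) (H : Phase jj a p → ℂ) (c : Series jj) : Prop :=
  ∀ v ∈ dom jj a p s r, HasSum (fun I => c I * I.monomial v) (H v)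

namespace Series

/-- The formal derivative `∂_{x_h}`. -/
def dX (h : Fin n) (c : Series jj) : Series jj := fun I => Complex.I * I.k h * c I

/-- The formal derivative `∂_{y_h}`. -/
def dY (h : Fin n) (c : Series jj) : Series jj := fun I => (I.i h + 1) * c (I.raiseY h)

/-- The formal derivative `∂_{z_j^σ}`. -/
def dZ (σ : Bool) (j : Site jj) (c : Series jj) : Series jj :=
  fun I => (I.ab σ j + 1) * c (I.raiseZ σ j)

open Classical in
/-- Multiplication by the variable `z_j^σ`: the coefficient of `z_j^σ 𝔪` is the coefficient of `𝔪`
in `c`, and the monomials that are not divisible by `z_j^σ` have coefficient `0`. -/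
def mulZ (σ : Bool) (j : Site jj) (c : Series jj) : Series jj := fun I =>
  if I.ab σ j = 0 then 0
  else c { I with ab := Function.update I.ab σ (I.ab σ - Finsupp.single j 1) }

/-- `∑ |c_{k,i,α,β}| e^{|k|s} |y^i| |z^α| |z̄^β|`, possibly infinite. -/
def maj (s : ℝ) (c : Series jj) (v : Phase jj a p) : ℝ≥0∞ :=
  ∑' I, ‖c I‖ₑ * ENNReal.ofReal (I.majorant s v)

end Series

/-- The norm of `ℓ^{a,p}_𝓘` of a sequence of elements of `[0,∞]`. -/
def extNorm (a p : ℝ) (u : Site jj → ℝ≥0∞) : ℝ≥0∞ :=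
  (∑' j : Site jj, u j ^ 2 *
    ENNReal.ofReal (Real.exp (2 * a * |((j : ℤ) : ℝ)|) * bracket j ^ (2 * p))) ^ (1 / 2 : ℝ)

/-- The majorant norm `‖X_c‖_{s,r}` of the Hamiltonian vector field
`X_c = (∂_y c, -∂_x c, -i ∂_{z̄} c, i ∂_z c)`: the supremum over `(y,z,z̄) ∈ D(r)` of the norm
`|x|_∞ / s + |y|₁ / r² + ‖z‖_{a,p} / r + ‖z̄‖_{a,p} / r` of the vector of the majorants of the
components.  (The factors `-1`, `-i`, `i` do not change the absolute values.) -/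
def vfNorm (a p s r : ℝ) (c : Series jj) : ℝ≥0∞ :=
  ⨆ v ∈ ballR jj a p r,
    (⨆ h, (c.dY h).maj s v) / ENNReal.ofReal s
      + (∑ h, (c.dX h).maj s v) / ENNReal.ofReal (r ^ 2)
      + extNorm a p (fun j => (c.dZ false j).maj s v) / ENNReal.ofReal r
      + extNorm a p (fun j => (c.dZ true j).maj s v) / ENNReal.ofReal r

variable {Ξ : Type}

/-- The majorant norm of a family that depends on a parameter, uniform in the parameter. -/
def vfNormSup (a p s r : ℝ) (c : Ξ → Series jj) : ℝ≥0∞ := ⨆ ξ, vfNorm a p s r (c ξ)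

/-! ## Hamiltonian functions -/

/-- The majorant norm `‖X_f‖_{s,r}` of a parameter dependent function on `D(s,r)`.  The
Taylor–Fourier expansion is unique; a function without expansion has infinite norm. -/
def hamNorm (s r : ℝ) (f : Ξ → Phase jj a p → ℂ) : ℝ≥0∞ :=
  ⨅ (c : Ξ → Series jj) (_ : ∀ ξ, IsExpansion s r (f ξ) (c ξ)), vfNormSup a p s r c

/-- `f` is M-regular, `f ∈ 𝓗_{s,r}`. -/
def MRegular (s r : ℝ) (f : Ξ → Phase jj a p → ℂ) : Prop := hamNorm s r f < ⊤

/-- `∂_{x_h} H`. -/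
def partialX (h : Fin n) (H : Phase jj a p → ℂ) (v : Phase jj a p) : ℂ :=
  lineDeriv ℂ H v (Phase.eX h)

/-- `∂_{y_h} H`. -/
def partialY (h : Fin n) (H : Phase jj a p → ℂ) (v : Phase jj a p) : ℂ :=
  lineDeriv ℂ H v (Phase.eY h)

/-- `∂_{z_j^σ} H`. -/
def partialZ (σ : Bool) (j : Site jj) (H : Phase jj a p → ℂ) (v : Phase jj a p) : ℂ :=
  lineDeriv ℂ H v (Phase.eZ σ j)

/-- The Poisson bracket
`{H,K} = ∂_x H · ∂_y K - ∂_x K · ∂_y H + i (∂_z H · ∂_{z̄} K - ∂_{z̄} H · ∂_z K)`. -/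
def poisson (H K : Phase jj a p → ℂ) (v : Phase jj a p) : ℂ :=
  ∑ h, (partialX h H v * partialY h K v - partialX h K v * partialY h H v)
    + Complex.I * ∑' j : Site jj, (partialZ true j H v * partialZ false j K v
        - partialZ false j H v * partialZ true j K v)

/-- `ad_F = { · , F}`. -/
def ad (F : Phase jj a p → ℂ) (H : Phase jj a p → ℂ) : Phase jj a p → ℂ := poisson H F

/-- `∑_{j ≥ h} b_j ad_F^j H`. -/
def adTail (b : ℕ → ℝ) (h : ℕ) (F H : Phase jj a p → ℂ) (v : Phase jj a p) : ℂ :=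
  ∑' j : ℕ, (b (h + j) : ℂ) * ((ad F)^[h + j] H) v

/-- `e^{ad_F} H = ∑_j ad_F^j H / j!`. -/
def expAd (F H : Phase jj a p → ℂ) (v : Phase jj a p) : ℂ :=
  ∑' j : ℕ, ((ad F)^[j] H) v / (j.factorial : ℂ)

/-- The momentum `𝓜 = ∑ 𝚓_l y_l + ∑ j z_j z̄_j`. -/
def momentumFun (v : Phase jj a p) : ℂ :=
  ∑ l, (jj l : ℂ) * v.y l
    + ∑' j : Site jj, ((j : ℤ) : ℂ) * (v.z true).entry j * (v.z false).entry j

/-- `H` satisfies momentum conservation on `D(s,r)`: `{H, 𝓜} = 0`. -/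
def ConservesMomentum (s r : ℝ) (H : Phase jj a p → ℂ) : Prop :=
  ∀ v ∈ dom jj a p s r, poisson H momentumFun v = 0

/-! ## Töplitz and quasi-Töplitz functions -/

/-- The sign `±1`. -/
def sgn (σ : Bool) : ℤ := if σ then 1 else -1

/-- The monomial of index `I` is `(N,μ)`-low momentum:
`∑ |j| (α_j + β_j) < μ N^L` and `|k| < N^b`. -/
def IsLow (b L : ℝ) (N : ℕ) (μ : ℝ) (I : MultiIndex jj) : Prop :=
  ((((I.ab true).sum fun j e => (j : ℤ).natAbs * e)
      + ((I.ab false).sum fun j e => (j : ℤ).natAbs * e) : ℕ) : ℝ) < μ * (N : ℝ) ^ L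
    ∧ (I.kNorm : ℝ) < (N : ℝ) ^ b

/-- The space `𝓛_{s,r}(N,μ,h)`: M-regular, with `(N,μ)`-low momentum monomials of momentum
`-h` only. -/
def IsLowSeries (a p b L s r : ℝ) (N : ℕ) (μ : ℝ) (h : ℤ) (c : Ξ → Series jj) : Prop :=
  vfNormSup a p s r c < ⊤ ∧
    ∀ ξ I, c ξ I ≠ 0 → IsLow b L N μ I ∧ I.momentum + h = 0

/-- The site `m` is high: `|m| > θ N`. -/
def IsHigh (N : ℕ) (θ : ℝ) (m : Site jj) : Prop := θ * (N : ℝ) < |((m : ℤ) : ℝ)|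

/-- The index of a monomial `e^{i k·x} y^i z^α z̄^β z_m^σ z_n^{σ'}` with `|m|, |n| > θ N`, where
`e^{i k·x} y^i z^α z̄^β` is `(N,μ)`-low momentum and `π(k,α,β) = - σ m - σ' n`. -/
def IsBilinearIndex (b L : ℝ) (N : ℕ) (θ μ : ℝ) (I : MultiIndex jj) : Prop :=
  ∃ (σ σ' : Bool) (m m' : Site jj) (I₀ : MultiIndex jj), IsHigh N θ m ∧ IsHigh N θ m' ∧
    IsLow b L N μ I₀ ∧ I₀.momentum = - sgn σ * m - sgn σ' * m' ∧
    I = (I₀.raiseZ σ' m').raiseZ σ m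

open Classical in
/-- The projection `Π_{N,θ,μ}` onto the `(N,θ,μ)`-bilinear monomials. -/
def bilinearProj (b L : ℝ) (N : ℕ) (θ μ : ℝ) (c : Series jj) : Series jj :=
  fun I => if IsBilinearIndex b L N θ μ I then c I else 0

open Classical in
/-- The series `∑_{|m|,|n| > θN, σ,σ' = ±} φ^{σ,σ'}_{m,n} z_m^σ z_n^{σ'}`.  For each
coefficient, only finitely many summands do not vanish. -/
def bilinearSeries (N : ℕ) (θ : ℝ) (φ : Bool → Bool → Site jj → Site jj → Series jj) :
    Series jj := fun I =>
  ∑ σ : Bool, ∑ σ' : Bool, ∑ᶠ q : Site jj × Site jj,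
    if IsHigh N θ q.1 ∧ IsHigh N θ q.2 then
      ((φ σ σ' q.1 q.2).mulZ σ' q.2).mulZ σ q.1 I else 0

/-- `(N,θ,μ)`-Töplitz series: M-regular and
`∑ φ^{σ,σ'}(sign m, σ m + σ' n) z_m^σ z_n^{σ'}` with `φ^{σ,σ'}(ς,h) ∈ 𝓛_{s,r}(N,μ,h)`. -/
def IsToeplitz (a p b L s r : ℝ) (N : ℕ) (θ μ : ℝ) (t : Ξ → Series jj) : Prop :=
  vfNormSup a p s r t < ⊤ ∧
    ∃ φ : Bool → Bool → Bool → ℤ → Ξ → Series jj,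
      (∀ σ σ' ς h, IsLowSeries a p b L s r N μ h (φ σ σ' ς h)) ∧
      ∀ ξ, t ξ = bilinearSeries N θ fun σ σ' m m' =>
        φ σ σ' (decide (0 < (m : ℤ))) (sgn σ * m + sgn σ' * m') ξ

/-- The quasi-Töplitz semi-norm of a series: the supremum over `N ≥ N₀` of the infimum over the
`(N,θ,μ)`-Töplitz `t` of `max {‖X_c‖, ‖X_t‖, ‖X_{N (Π_{N,θ,μ} c - t)}‖}`. -/
def seriesTNorm (a p b L s r : ℝ) (N₀ : ℕ) (θ μ : ℝ) (c : Ξ → Series jj) : ℝ≥0∞ :=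
  ⨆ (N : ℕ) (_ : N₀ ≤ N), ⨅ (t : Ξ → Series jj) (_ : IsToeplitz a p b L s r N θ μ t),
    max (vfNormSup a p s r c) (max (vfNormSup a p s r t)
      (vfNormSup a p s r fun ξ I => (N : ℂ) * (bilinearProj b L N θ μ (c ξ) I - t ξ I)))

/-- The quasi-Töplitz semi-norm `‖f‖^T_{s,r,N₀,θ,μ}` of a function, i.e. that of its (unique)
Taylor–Fourier expansion; it is infinite if there is none. -/
def tNorm (b L s r : ℝ) (N₀ : ℕ) (θ μ : ℝ) (f : Ξ → Phase jj a p → ℂ) : ℝ≥0∞ :=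
  ⨅ (c : Ξ → Series jj) (_ : ∀ ξ, IsExpansion s r (f ξ) (c ξ)), seriesTNorm a p b L s r N₀ θ μ c

/-- `f` is `(N₀,θ,μ)`-quasi-Töplitz, `f ∈ 𝓠^T_{s,r}(N₀,θ,μ)`. -/
def IsQuasiToeplitz (b L s r : ℝ) (N₀ : ℕ) (θ μ : ℝ) (f : Ξ → Phase jj a p → ℂ) : Prop :=
  MRegular s r f ∧ (∀ ξ, ConservesMomentum s r (f ξ)) ∧ tNorm b L s r N₀ θ μ f < ⊤

/-! ## The Hamiltonian flow -/

/-- `w` is the value at `v` of the Hamiltonian vector field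
`X_H = (∂_y H, -∂_x H, -i ∂_{z̄} H, i ∂_z H)`. -/
def IsHamVector (H : Phase jj a p → ℂ) (v w : Phase jj a p) : Prop :=
  (∀ h, w.x h = partialY h H v) ∧ (∀ h, w.y h = - partialX h H v) ∧
    (∀ j, (w.z true).entry j = - Complex.I * partialZ false j H v) ∧
    (∀ j, (w.z false).entry j = Complex.I * partialZ true j H v)

/-- `γ` is on `[0,1]` a solution in `D(s,r)` of `γ' = X_H(γ)`. -/
def IsSolution (s r : ℝ) (H : Phase jj a p → ℂ) (γ : ℝ → Phase jj a p) : Prop :=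
  ∀ t ∈ Set.Icc (0 : ℝ) 1, γ t ∈ dom jj a p s r ∧
    ∃ w, IsHamVector H (γ t) w ∧ HasDerivWithinAt γ w (Set.Icc 0 1) t

/-- The symplectic form `dx ∧ dy + i dz ∧ dz̄`, for which `X_H` is the Hamiltonian vector field
of `H` (`ω(X_H, ·) = dH`). -/
def symplForm (u w : Phase jj a p) : ℂ :=
  ∑ h, (u.x h * w.y h - u.y h * w.x h)
    + Complex.I * ∑' j : Site jj, ((u.z true).entry j * (w.z false).entry j
        - (u.z false).entry j * (w.z true).entry j)

/-- Analytic on an open set: continuously differentiable over `ℂ`, in the sense of Fréchet. -/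
def IsAnalyticMap (Φ : Phase jj a p → Phase jj a p) (D : Set (Phase jj a p)) : Prop :=
  ContDiffOn ℂ 1 Φ D

/-- `Φ` preserves the symplectic form on `D`. -/
def IsSymplecticMap (Φ : Phase jj a p → Phase jj a p) (D : Set (Phase jj a p)) : Prop :=
  ∀ v ∈ D, ∀ u w, symplForm (fderiv ℂ Φ v u) (fderiv ℂ Φ v w) = symplForm u w

/-- The Hamiltonian flow of `H` up to time `1` is well defined from `D(s',r')` to `D(s,r)`
(each solution that starts in `D(s',r')` exists in `D(s,r)` on `[0,1]` and is unique), and the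
time-`1` map is analytic and symplectic. -/
def HasGoodFlow (s' r' s r : ℝ) (H : Phase jj a p → ℂ) : Prop :=
  ∃ Φ : ℝ → Phase jj a p → Phase jj a p,
    (∀ v ∈ dom jj a p s' r', Φ 0 v = v ∧ IsSolution s r H (fun t => Φ t v) ∧
      ∀ γ, γ 0 = v → IsSolution s r H γ → ∀ t ∈ Set.Icc (0 : ℝ) 1, γ t = Φ t v) ∧
    Set.MapsTo (Φ 1) (dom jj a p s' r') (dom jj a p s r) ∧
    IsAnalyticMap (Φ 1) (dom jj a p s' r') ∧ IsSymplecticMap (Φ 1) (dom jj a p s' r')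

/-! ## Parameters -/

/-- `κ = max |𝚓_l|` (`0` if `n = 0`). -/
def kappa (jj : Fin n → ℤ) : ℕ := Finset.univ.sup fun l => (jj l).natAbs

/-- `δ = min {1 - s'/s, 1 - r'/r}`. -/
def delta (s' s r' r : ℝ) : ℝ := min (1 - s' / s) (1 - r' / r)

/-- The threshold `N̄ = exp (max {2/b, 1/(L-b), 1/(1-L), 8})`. -/
def nBar (b L : ℝ) : ℝ := Real.exp (max (max (2 / b) (1 / (L - b))) (max (1 / (1 - L)) 8))

end QuasiToeplitz

end

/-!
Functions are handled through the moduli of their Taylor–Fourier coefficients, with values in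
`[0, ∞]`.  By positivity the majorant of a series at a displaced point dominates the first order
part of its Taylor expansion (`posMon_taylor`, `dposMon_taylor`); this is the Cauchy estimate in
positive terms, and it gives `‖X_{{f, g}}‖ ≤ 2 ‖X_f‖ ‖X_g‖ / δ` when the domain shrinks by the
fraction `δ` (`majNorm_majBracket_le`).  Here and below vectors are measured in the norm of the
large domain, so that only the last step, the return to the norm of the small domain, costs a
factor `max {s/s', (r/r')²}`.  If each of `j` brackets gets a `j`-th part of the available shrinking,
`ad_f^j g` has norm at most `(C j ‖f‖ / δ)^j ‖g‖`, and as `j^j ≤ e^j j!` the Lie series is dominated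
by a geometric series.

For the quasi-Töplitz semi-norm the same scheme is run at each scale `N`.  The Töplitz functions
are the series of bilinear monomials whose coefficients do not change when both far variables are
moved away from the origin by the same number of sites (`ToepE`, `toepE_of_isToeplitz`,
`isToeplitz_of_toepE`); momentum conservation forces the two far variables to have momenta of
opposite signs, so that this move preserves the momentum.  When the bilinear part of a bracket is
computed, momentum conservation leaves only two kinds of pairs of monomials of low frequency
(`BilCases`): either a high variable is contracted and both monomials are bilinear, or one of them
is bilinear and the other one has no far variable.  If the coefficients of the bilinear monomials
are replaced by their Töplitz approximations, the result is invariant under the shift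
(`cBracket_toepWeight_shift`), and the error consists of brackets with one factor of size `1/N`,
and of brackets with high frequencies `|k| ≥ N^b`, which are exponentially small on a smaller strip.
This is the estimate `QT.bracket` for one bracket.  Each bracket changes `μ N^L` and `θ N` by a
fixed amount, so that the gap between the parameters `μ, θ` and `μ', θ'` leaves room for `ln N`
brackets only.  For `j ≥ ln N`, however, the factor `N ≤ e^j` in front of the error can be absorbed
into the geometric series, and `0` is a sufficient approximation (`exists_qt_iterate`).  Summation
over `j` gives `isQuasiToeplitz_lieSeries` and `lieSeries_estimate`.

For the flow, the expansion of `f` makes `X_f` holomorphic as a map into phase space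
(`differentiableAt_hamVec`).  After a rescaling of the variables it is bounded by the majorant norm
of `f`, hence by a quarter of the distance `δ / (n + 1)` from the small domain to the boundary of
the large one; `n + 1` is the price for comparing the `ℓ¹` norm of the actions with the supremum
norm, and the reason why `c` depends on `n`.  Cauchy's estimate then bounds the Lipschitz constant
by `1`.  The Picard–Lindelöf theorem gives the curves, and the time-one map is the uniform limit of
the Euler iterates `(1 + X_f / N)^N`, which are holomorphic.  A uniform limit of holomorphic maps is
holomorphic, with convergence of the derivatives, so the time-one map inherits from these both the
regularity and, as `X_f` is an infinitesimal symmetry of the symplectic form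
(`HasExp.symplCLM_fderiv_add`), the invariance of the form, which the iterates preserve up to
`O(1/N)` (`exists_flow`).
-/

open scoped ENNReal BigOperators Topology

noncomputable section

namespace QuasiToeplitz

variable {n : ℕ} {jj : Fin n → ℤ} {a p : ℝ}

/-! ### Weighted `ℓ²` norms of sequences in `[0, ∞]` -/

/-- The `ℓ²` norm of a family of elements of `[0, ∞]`. -/
def ellTwo {ι : Type*} (u : ι → ℝ≥0∞) : ℝ≥0∞ := (∑' j, u j ^ 2) ^ (1 / 2 : ℝ)

theorem ellTwo_sq {ι : Type*} (u : ι → ℝ≥0∞) : ellTwo u ^ 2 = ∑' j, u j ^ 2 := by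
  rw [ellTwo, ← ENNReal.rpow_two, ← ENNReal.rpow_mul]; norm_num

theorem le_of_sq_le_sq {x y : ℝ≥0∞} (h : x ^ 2 ≤ y ^ 2) : x ≤ y := by
  by_contra hc
  exact absurd h (not_le.2 (ENNReal.pow_lt_pow_left (n := 2) (by norm_num) (not_le.1 hc)))

theorem ellTwo_mono {ι : Type*} {u v : ι → ℝ≥0∞} (h : ∀ j, u j ≤ v j) : ellTwo u ≤ ellTwo v := by
  unfold ellTwo
  gcongr
  exact h _

theorem ellTwo_const_mul {ι : Type*} (c : ℝ≥0∞) (u : ι → ℝ≥0∞) :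
    ellTwo (fun j => c * u j) = c * ellTwo u := by
  unfold ellTwo
  simp_rw [mul_pow]
  rw [ENNReal.tsum_mul_left, ENNReal.mul_rpow_of_nonneg _ _ (by norm_num), ← ENNReal.rpow_two,
    ← ENNReal.rpow_mul]
  norm_num

theorem sum_sq_le_ellTwo {ι : Type*} (u : ι → ℝ≥0∞) (S : Finset ι) :
    (∑ j ∈ S, u j ^ (2 : ℝ)) ^ (1 / 2 : ℝ) ≤ ellTwo u := by
  unfold ellTwo
  simp only [ENNReal.rpow_two]
  gcongr
  exact ENNReal.sum_le_tsum S

theorem ellTwo_le_iff {ι : Type*} {u : ι → ℝ≥0∞} {B : ℝ≥0∞} :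
    ellTwo u ≤ B ↔ ∀ S : Finset ι, (∑ j ∈ S, u j ^ (2 : ℝ)) ^ (1 / 2 : ℝ) ≤ B := by
  refine ⟨fun h S => (sum_sq_le_ellTwo u S).trans h, fun h => le_of_sq_le_sq ?_⟩
  rw [ellTwo_sq, ENNReal.tsum_eq_iSup_sum]
  refine iSup_le fun S => ?_
  have := pow_le_pow_left' (h S) 2
  rw [← ENNReal.rpow_two, ← ENNReal.rpow_mul] at this
  norm_num at this
  exact this

theorem ellTwo_add {ι : Type*} (u v : ι → ℝ≥0∞) :
    ellTwo (fun j => u j + v j) ≤ ellTwo u + ellTwo v :=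
  ellTwo_le_iff.2 fun S => (ENNReal.Lp_add_le S u v (by norm_num : (1 : ℝ) ≤ 2)).trans
    (add_le_add (sum_sq_le_ellTwo u S) (sum_sq_le_ellTwo v S))

theorem tsum_mul_le_ellTwo {ι : Type*} (u v : ι → ℝ≥0∞) :
    ∑' j, u j * v j ≤ ellTwo u * ellTwo v := by
  rw [ENNReal.tsum_eq_iSup_sum]
  refine iSup_le fun S => (ENNReal.inner_le_Lp_mul_Lq S u v
    Real.HolderConjugate.two_two).trans ?_
  exact mul_le_mul' (sum_sq_le_ellTwo u S) (sum_sq_le_ellTwo v S)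

theorem ellTwo_sum {ι κ : Type*} (S : Finset κ) (u : κ → ι → ℝ≥0∞) :
    ellTwo (fun j => ∑ i ∈ S, u i j) ≤ ∑ i ∈ S, ellTwo (u i) := by
  classical
  induction S using Finset.induction_on with
  | empty => simp [ellTwo]
  | insert i S hi ih =>
    simp only [Finset.sum_insert hi]
    exact (ellTwo_add _ _).trans (add_le_add le_rfl ih)

theorem ellTwo_tsum {ι κ : Type*} (u : κ → ι → ℝ≥0∞) :
    ellTwo (fun j => ∑' i, u i j) ≤ ∑' i, ellTwo (u i) := by
  rw [ellTwo_le_iff]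
  intro T
  have hlim : Filter.Tendsto
      (fun S : Finset κ => (∑ j ∈ T, (∑ i ∈ S, u i j) ^ (2 : ℝ)) ^ (1 / 2 : ℝ)) Filter.atTop
      (nhds ((∑ j ∈ T, (∑' i, u i j) ^ (2 : ℝ)) ^ (1 / 2 : ℝ))) := by
    refine (ENNReal.continuous_rpow_const.tendsto _).comp ?_
    refine tendsto_finsetSum _ fun j _ => ?_
    exact (ENNReal.continuous_rpow_const.tendsto _).comp ENNReal.summable.hasSum
  refine le_of_tendsto' hlim fun S => (sum_sq_le_ellTwo _ T).trans ?_
  exact (ellTwo_sum S u).trans (ENNReal.sum_le_tsum S)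

/-- The weight `e^{a|j|} ⟨j⟩^p` as an element of `[0, ∞]`. -/
def eweight (a p : ℝ) (j : ℤ) : ℝ≥0∞ := ENNReal.ofReal (weight a p j)

theorem eweight_sq (a p : ℝ) (j : ℤ) : eweight a p j ^ 2 =
    ENNReal.ofReal (Real.exp (2 * a * |(j : ℝ)|) * bracket j ^ (2 * p)) := by
  rw [eweight, ← ENNReal.ofReal_pow (weight_pos a p j).le, weight_sq]

theorem extNorm_eq (u : Site jj → ℝ≥0∞) :
    extNorm a p u = ellTwo fun j : Site jj => eweight a p j * u j := by
  simp_rw [extNorm, ellTwo, mul_pow, eweight_sq, mul_comm]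

theorem extNorm_mono {u v : Site jj → ℝ≥0∞} (h : ∀ j, u j ≤ v j) :
    extNorm a p u ≤ extNorm a p v := by
  simp only [extNorm_eq]
  exact ellTwo_mono fun j => mul_le_mul' le_rfl (h j)

theorem extNorm_const_mul (c : ℝ≥0∞) (u : Site jj → ℝ≥0∞) :
    extNorm a p (fun j => c * u j) = c * extNorm a p u := by
  simp only [extNorm_eq, ← ellTwo_const_mul]
  congr 1; funext j; ring

theorem extNorm_add (u v : Site jj → ℝ≥0∞) :
    extNorm a p (fun j => u j + v j) ≤ extNorm a p u + extNorm a p v := by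
  simp only [extNorm_eq, mul_add]
  exact ellTwo_add _ _

theorem extNorm_tsum {κ : Type*} (u : κ → Site jj → ℝ≥0∞) :
    extNorm a p (fun j => ∑' i, u i j) ≤ ∑' i, extNorm a p (u i) := by
  simp only [extNorm_eq, ← ENNReal.tsum_mul_left]
  exact ellTwo_tsum _

theorem one_le_weight (ha : 0 ≤ a) (hp : 0 ≤ p) (j : ℤ) : 1 ≤ weight a p j := by
  unfold weight
  have h1 : 1 ≤ Real.exp (a * |(j : ℝ)|) := Real.one_le_exp (by positivity)
  have h2 : 1 ≤ bracket j ^ p := Real.one_le_rpow (le_max_left _ _) hp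
  nlinarith

theorem abs_le_weight_sq (ha : 0 ≤ a) (hp : 1 / 2 < p) (j : ℤ) : |(j : ℝ)| ≤ weight a p j ^ 2 := by
  rw [weight_sq]
  have h1 : 1 ≤ Real.exp (2 * a * |(j : ℝ)|) := Real.one_le_exp (by positivity)
  have h2 : bracket j ≤ bracket j ^ (2 * p) := by
    conv_lhs => rw [← Real.rpow_one (bracket j)]
    exact Real.rpow_le_rpow_of_exponent_le (le_max_left _ _) (by linarith)
  have h3 : |(j : ℝ)| ≤ bracket j := le_max_right _ _
  have h4 : 0 < bracket j := bracket_pos j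
  nlinarith

theorem tsum_abs_mul_le_extNorm (ha : 0 ≤ a) (hp : 1 / 2 < p) (u v : Site jj → ℝ≥0∞) :
    ∑' j : Site jj, ENNReal.ofReal |((j : ℤ) : ℝ)| * (u j * v j)
      ≤ extNorm a p u * extNorm a p v := by
  rw [extNorm_eq, extNorm_eq]
  refine le_trans (ENNReal.tsum_le_tsum fun j => ?_) (tsum_mul_le_ellTwo _ _)
  have : ENNReal.ofReal |((j : ℤ) : ℝ)| ≤ eweight a p j ^ 2 := by
    rw [eweight, ← ENNReal.ofReal_pow (weight_pos a p j).le]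
    exact ENNReal.ofReal_le_ofReal (abs_le_weight_sq ha hp _)
  calc _ ≤ eweight a p j ^ 2 * (u j * v j) := by gcongr
    _ = _ := by ring

theorem tsum_mul_le_extNorm (ha : 0 ≤ a) (hp : 0 ≤ p) (u v : Site jj → ℝ≥0∞) :
    ∑' j : Site jj, u j * v j ≤ extNorm a p u * extNorm a p v := by
  rw [extNorm_eq, extNorm_eq]
  refine le_trans (ENNReal.tsum_le_tsum fun j => ?_) (tsum_mul_le_ellTwo _ _)
  have : 1 ≤ eweight a p j := by
    rw [eweight, ← ENNReal.ofReal_one]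
    exact ENNReal.ofReal_le_ofReal (one_le_weight ha hp _)
  calc u j * v j = (1 * u j) * (1 * v j) := by ring
    _ ≤ _ := by gcongr

theorem eweight_ne_zero (j : ℤ) : eweight a p j ≠ 0 := by
  simp [eweight, weight_pos]

theorem eweight_ne_top (j : ℤ) : eweight a p j ≠ ⊤ := ENNReal.ofReal_ne_top

theorem le_extNorm (u : Site jj → ℝ≥0∞) (j : Site jj) : eweight a p j * u j ≤ extNorm a p u := by
  rw [extNorm_eq]
  refine le_of_sq_le_sq ?_
  rw [ellTwo_sq]
  exact ENNReal.le_tsum (f := fun j : Site jj => (eweight a p j * u j) ^ 2) j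

/-! ### Exponents and directions -/

/-- The variables in which a Taylor–Fourier series is a power series: the actions `y_h` and the
normal variables `z_j^σ`. -/
abbrev Var (jj : Fin n → ℤ) : Type := Fin n ⊕ (Bool × Site jj)

/-- The exponents `(k, m)` of a monomial `e^{i k·x} ∏ v^{m_v}`, where `v` runs over the variables
`y_h`, `z_j^σ`.  Unlike `MultiIndex`, this is an additive cancellative monoid on the nose. -/
abbrev Expo (jj : Fin n → ℤ) : Type := (Fin n → ℤ) × (Var jj →₀ ℕ)

/-- The coordinate directions of the phase space: the angles `x_h` (on the left) and the
variables of the power series. -/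
abbrev Dir (jj : Fin n → ℤ) : Type := Fin n ⊕ Var jj

/-- The direction that is canonically conjugate to a direction: `x_h ↔ y_h` and `z_j ↔ z̄_j`. -/
def dual : Dir jj → Dir jj
  | Sum.inl h => Sum.inr (Sum.inl h)
  | Sum.inr (Sum.inl h) => Sum.inl h
  | Sum.inr (Sum.inr (σ, j)) => Sum.inr (Sum.inr (!σ, j))

theorem dual_dual (d : Dir jj) : dual (dual d) = d := by
  rcases d with h | h | ⟨σ, j⟩ <;> simp [dual]

/-- The duality of directions as a permutation. -/
def dualEquiv : Dir jj ≃ Dir jj := ⟨dual, dual, dual_dual, dual_dual⟩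

/-- The absolute value of the numerical factor that the derivative in the direction `d` puts in
front of a monomial. -/
def mult : Dir jj → Expo jj → ℕ
  | Sum.inl h, J => (J.1 h).natAbs
  | Sum.inr v, J => J.2 v

/-- The exponents of the derivative of a monomial in the direction `d` (meaningful if
`mult d J ≠ 0`). -/
def lower : Dir jj → Expo jj → Expo jj
  | Sum.inl _, J => J
  | Sum.inr v, J => (J.1, J.2 - Finsupp.single v 1)

/-- `|k₁| + … + |k_n|`. -/
def kabs (k : Fin n → ℤ) : ℕ := ∑ h, (k h).natAbs

theorem kabs_add_le (k l : Fin n → ℤ) : kabs (k + l) ≤ kabs k + kabs l := by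
  unfold kabs
  rw [← Finset.sum_add_distrib]
  exact Finset.sum_le_sum fun h _ => Int.natAbs_add_le _ _

@[simp] theorem lower_fst (d : Dir jj) (J : Expo jj) : (lower d J).1 = J.1 := by
  rcases d with h | v <;> rfl

theorem mult_lower_comm (d e : Dir jj) (J : Expo jj) :
    mult d J * mult e (lower d J) = mult e J * mult d (lower e J) := by
  classical
  rcases d with h | v <;> rcases e with h' | v'
  · simp [mult, lower, mul_comm]
  · simp [mult, lower, mul_comm]
  · simp [mult, lower, mul_comm]
  · by_cases hv : v = v'
    · subst hv; rfl
    · simp [mult, lower, Finsupp.single_apply, hv, Ne.symm hv, mul_comm]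

theorem lower_comm (d e : Dir jj) (J : Expo jj) : lower d (lower e J) = lower e (lower d J) := by
  rcases d with h | v <;> rcases e with h' | v' <;> simp [lower]
  exact tsub_right_comm

theorem mult_add_le (d : Dir jj) (J K : Expo jj) : mult d (J + K) ≤ mult d J + mult d K := by
  rcases d with h | v
  · exact Int.natAbs_add_le _ _
  · exact le_rfl

theorem lower_add_single {v : Var jj} {J : Expo jj} (h : mult (Sum.inr v) J ≠ 0) :
    lower (Sum.inr v) J + (0, Finsupp.single v 1) = J := by
  classical
  have h1 : Finsupp.single v 1 ≤ J.2 := by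
    rw [Finsupp.single_le_iff]; exact Nat.one_le_iff_ne_zero.2 h
  refine Prod.ext (by simp [lower]) ?_
  simp [lower, tsub_add_cancel_of_le h1]

/-! ### Positive monomials -/

/-- The value `e^{|k|σ} ∏ w_v^{m_v}` of the majorant of a monomial. -/
def posMon (σ : ℝ) (w : Var jj → ℝ≥0∞) (J : Expo jj) : ℝ≥0∞ :=
  ENNReal.ofReal (Real.exp (kabs J.1 * σ)) * J.2.prod fun v e => w v ^ e

/-- The value of the majorant of the derivative of a monomial. -/
def dposMon (d : Dir jj) (σ : ℝ) (w : Var jj → ℝ≥0∞) (J : Expo jj) : ℝ≥0∞ :=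
  mult d J * posMon σ w (lower d J)

theorem posMon_add_single (σ : ℝ) (w : Var jj → ℝ≥0∞) (J : Expo jj) (v : Var jj) :
    posMon σ w (J + (0, Finsupp.single v 1)) = posMon σ w J * w v := by
  classical
  unfold posMon
  simp only [Prod.fst_add, Prod.snd_add, add_zero]
  rw [Finsupp.prod_add_index' (by simp) (by intros; exact pow_add _ _ _),
    Finsupp.prod_single_index (by simp), pow_one, mul_assoc]

theorem posMon_add_le {σ : ℝ} (hσ : 0 ≤ σ) (w : Var jj → ℝ≥0∞) (J K : Expo jj) :
    posMon σ w (J + K) ≤ posMon σ w J * posMon σ w K := by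
  classical
  unfold posMon
  simp only [Prod.fst_add, Prod.snd_add]
  rw [Finsupp.prod_add_index' (by simp) (by intros; exact pow_add _ _ _), mul_mul_mul_comm,
    ← ENNReal.ofReal_mul (Real.exp_pos _).le, ← Real.exp_add]
  gcongr
  rw [← add_mul]
  gcongr
  exact_mod_cast kabs_add_le _ _

theorem posMon_mono {σ σ' : ℝ} (h : σ ≤ σ') {w w' : Var jj → ℝ≥0∞} (hw : ∀ v, w v ≤ w' v)
    (J : Expo jj) : posMon σ w J ≤ posMon σ' w' J := by
  unfold posMon Finsupp.prod
  gcongr with v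
  exact pow_le_pow_left' (hw v) _

theorem dposMon_mono {σ σ' : ℝ} (h : σ ≤ σ') {w w' : Var jj → ℝ≥0∞} (hw : ∀ v, w v ≤ w' v)
    (d : Dir jj) (J : Expo jj) : dposMon d σ w J ≤ dposMon d σ' w' J := by
  unfold dposMon
  gcongr
  exact posMon_mono h hw _

theorem lower_add_of_ne {v : Var jj} {J : Expo jj} (h : mult (Sum.inr v) J ≠ 0) (K : Expo jj) :
    lower (Sum.inr v) (J + K) = lower (Sum.inr v) J + K := by
  have h1 : Finsupp.single v 1 ≤ J.2 := by
    classical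
    rw [Finsupp.single_le_iff]; exact Nat.one_le_iff_ne_zero.2 h
  refine Prod.ext (by simp [lower]) ?_
  simp only [lower, Prod.snd_add]
  exact tsub_add_eq_add_tsub h1 |>.symm

/-- Leibniz rule for majorants. -/
theorem dposMon_add_le {σ : ℝ} (hσ : 0 ≤ σ) (w : Var jj → ℝ≥0∞) (d : Dir jj) (J K : Expo jj) :
    dposMon d σ w (J + K) ≤ dposMon d σ w J * posMon σ w K + posMon σ w J * dposMon d σ w K := by
  have key : ∀ J K : Expo jj, (mult d J : ℝ≥0∞) * posMon σ w (lower d (J + K)) ≤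
      (mult d J : ℝ≥0∞) * (posMon σ w (lower d J) * posMon σ w K) := by
    intro J K
    rcases d with h | v
    · exact mul_le_mul' le_rfl (posMon_add_le hσ _ _ _)
    · by_cases h : mult (Sum.inr v) J = 0
      · simp [h]
      · rw [lower_add_of_ne h]
        exact mul_le_mul' le_rfl (posMon_add_le hσ _ _ _)
  calc dposMon d σ w (J + K)
      ≤ ((mult d J : ℝ≥0∞) + mult d K) * posMon σ w (lower d (J + K)) := by
        unfold dposMon
        gcongr
        exact_mod_cast mult_add_le d J K
    _ = mult d J * posMon σ w (lower d (J + K)) + mult d K * posMon σ w (lower d (K + J)) := by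
        rw [add_mul, add_comm K J]
    _ ≤ _ := add_le_add (key J K) (key K J)
    _ = _ := by unfold dposMon; ring

/-- The terms of order `0` and `1` in `u` of the polynomial `∏ (w_v + u_v)^{m_v}`; the other ones
are positive. -/
theorem prod_pow_taylor (w u : Var jj → ℝ≥0∞) (m : Var jj →₀ ℕ) :
    (m.prod fun v e => w v ^ e)
      + ∑' v, u v * (m v * (m - Finsupp.single v 1).prod fun v e => w v ^ e)
      ≤ m.prod fun v e => (w v + u v) ^ e := by
  classical
  have hadd : ∀ (x : Var jj → ℝ≥0∞) (m : Var jj →₀ ℕ) (v : Var jj),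
      ((m + Finsupp.single v 1).prod fun v e => x v ^ e) = (m.prod fun v e => x v ^ e) * x v := by
    intro x m v
    rw [Finsupp.prod_add_index' (by simp) (by intros; exact pow_add _ _ _),
      Finsupp.prod_single_index (by simp), pow_one]
  have hstep : ∀ (m : Var jj →₀ ℕ) (v₀ : Var jj),
      (m.prod fun v e => w v ^ e)
        + ∑' v, u v * (m v * (m - Finsupp.single v 1).prod fun v e => w v ^ e)
        ≤ (m.prod fun v e => (w v + u v) ^ e) →
      ((m + Finsupp.single v₀ 1).prod fun v e => w v ^ e)
        + ∑' v, u v * (((m + Finsupp.single v₀ 1 : Var jj →₀ ℕ) v : ℝ≥0∞) *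
            (m + Finsupp.single v₀ 1 - Finsupp.single v 1).prod fun v e => w v ^ e)
        ≤ ((m + Finsupp.single v₀ 1).prod fun v e => (w v + u v) ^ e) := by
    intro m v₀ ih
    have hterm : ∀ v, u v * (((m + Finsupp.single v₀ 1 : Var jj →₀ ℕ) v : ℝ≥0∞) *
            (m + Finsupp.single v₀ 1 - Finsupp.single v 1).prod fun v e => w v ^ e)
        ≤ u v * (m v * (m - Finsupp.single v 1).prod fun v e => w v ^ e) * w v₀
          + if v = v₀ then u v₀ * (m.prod fun v e => w v ^ e) else 0 := by
      intro v
      have h1 : (m v : ℝ≥0∞) *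
            (m + Finsupp.single v₀ 1 - Finsupp.single v 1).prod (fun v e => w v ^ e)
          = (m v : ℝ≥0∞) * ((m - Finsupp.single v 1).prod (fun v e => w v ^ e) * w v₀) := by
        by_cases hm : m v = 0
        · simp [hm]
        · have : Finsupp.single v 1 ≤ m := by
            rw [Finsupp.single_le_iff]; exact Nat.one_le_iff_ne_zero.2 hm
          rw [← hadd, tsub_add_eq_add_tsub this]
      by_cases hv : v = v₀
      · subst hv
        simp only [Finsupp.add_apply, Finsupp.single_eq_same, Nat.cast_add, Nat.cast_one, if_true,
          add_mul, one_mul, h1, mul_add]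
        rw [add_tsub_cancel_right]
        exact le_of_eq (by ring)
      · simp only [Finsupp.add_apply, Finsupp.single_apply, Ne.symm hv, if_false, add_zero, h1, hv]
        exact le_of_eq (by ring)
    calc _ ≤ (m.prod fun v e => w v ^ e) * w v₀
          + ∑' v, (u v * (m v * (m - Finsupp.single v 1).prod fun v e => w v ^ e) * w v₀
          + if v = v₀ then u v₀ * (m.prod fun v e => w v ^ e) else 0) := by
          rw [hadd]
          gcongr with v
          exact hterm v
      _ = ((m.prod fun v e => w v ^ e)
          + ∑' v, u v * (m v * (m - Finsupp.single v 1).prod fun v e => w v ^ e)) * w v₀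
          + (m.prod fun v e => w v ^ e) * u v₀ := by
          rw [ENNReal.tsum_add, tsum_ite_eq, ENNReal.tsum_mul_right]; ring
      _ ≤ (m.prod fun v e => (w v + u v) ^ e) * w v₀
          + (m.prod fun v e => (w v + u v) ^ e) * u v₀ := by
          gcongr
          exact le_trans le_self_add ih
      _ = _ := by rw [hadd]; ring
  induction m using Finsupp.induction_linear with
  | zero => simp
  | add f g hf hg =>
    clear hf
    induction f using Finsupp.induction_linear generalizing g with
    | zero => simpa using hg
    | add f₁ f₂ h₁ h₂ => rw [add_assoc]; exact h₁ _ (h₂ _ hg)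
    | single v k =>
      induction k with
      | zero => simpa using hg
      | succ k ih =>
        have : Finsupp.single v (k + 1) + g = Finsupp.single v k + g + Finsupp.single v 1 := by
          rw [Finsupp.single_add]; abel
        rw [this]
        exact hstep _ _ ih
  | single v k =>
    induction k with
    | zero => simp
    | succ k ih => rw [Finsupp.single_add]; exact hstep _ _ ih

/-- First order Taylor inequality for majorants: by positivity, the value at a shifted point
dominates the first two terms of the Taylor expansion. -/
theorem posMon_taylor {σ σ' : ℝ} (hσ : σ' ≤ σ) (w : Var jj → ℝ≥0∞) (u : Dir jj → ℝ≥0∞)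
    (hu : ∀ h, u (Sum.inl h) ≤ ENNReal.ofReal (σ - σ')) (J : Expo jj) :
    posMon σ' w J + ∑' d, u d * dposMon d σ' w J
      ≤ posMon σ (fun v => w v + u (Sum.inr v)) J := by
  have hsplit : ∑' d, u d * dposMon d σ' w J
      = ∑ h, u (Sum.inl h) * dposMon (Sum.inl h) σ' w J
        + ∑' v, u (Sum.inr v) * dposMon (Sum.inr v) σ' w J := by
    rw [Summable.tsum_sum (by exact ENNReal.summable) (by exact ENNReal.summable), tsum_fintype]
  set E' := ENNReal.ofReal (Real.exp (kabs J.1 * σ')) with hE'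
  set Q := J.2.prod fun v e => w v ^ e with hQ
  set V := ∑' v, u (Sum.inr v) * (J.2 v * (J.2 - Finsupp.single v 1).prod fun v e => w v ^ e)
  have hV : ∑' v, u (Sum.inr v) * dposMon (Sum.inr v) σ' w J = E' * V := by
    rw [← ENNReal.tsum_mul_left]
    refine tsum_congr fun v => ?_
    simp only [dposMon, mult, posMon, lower]
    ring
  have hX : ∑ h, u (Sum.inl h) * dposMon (Sum.inl h) σ' w J
      ≤ ENNReal.ofReal (kabs J.1 * (σ - σ')) * (E' * Q) := by
    calc _ ≤ ∑ h, ENNReal.ofReal (σ - σ') * (((J.1 h).natAbs : ℝ≥0∞) * (E' * Q)) := by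
          refine Finset.sum_le_sum fun h _ => mul_le_mul' (hu h) (le_of_eq rfl)
      _ = _ := by
          rw [← Finset.mul_sum, ← Finset.sum_mul, ENNReal.ofReal_mul (by positivity),
            ENNReal.ofReal_natCast, kabs]
          push_cast
          ring
  have hexp : E' + ENNReal.ofReal (kabs J.1 * (σ - σ')) * E'
      ≤ ENNReal.ofReal (Real.exp (kabs J.1 * σ)) := by
    have h0 : 0 ≤ (kabs J.1 : ℝ) * (σ - σ') := mul_nonneg (by positivity) (by linarith)
    rw [hE', ← ENNReal.ofReal_mul h0, ← ENNReal.ofReal_add (by positivity) (by positivity)]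
    apply ENNReal.ofReal_le_ofReal
    have : (kabs J.1 : ℝ) * σ = kabs J.1 * (σ - σ') + kabs J.1 * σ' := by ring
    rw [this, Real.exp_add]
    nlinarith [Real.add_one_le_exp ((kabs J.1 : ℝ) * (σ - σ')), Real.exp_pos (kabs J.1 * σ')]
  calc posMon σ' w J + ∑' d, u d * dposMon d σ' w J
      ≤ E' * Q + (ENNReal.ofReal (kabs J.1 * (σ - σ')) * (E' * Q) + E' * V) := by
        rw [hsplit, hV]
        exact add_le_add le_rfl (add_le_add hX le_rfl)
    _ = (E' + ENNReal.ofReal (kabs J.1 * (σ - σ')) * E') * Q + E' * V := by ring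
    _ ≤ ENNReal.ofReal (Real.exp (kabs J.1 * σ)) * Q
        + ENNReal.ofReal (Real.exp (kabs J.1 * σ)) * V :=
        add_le_add (mul_le_mul' hexp le_rfl) (mul_le_mul' (le_self_add.trans hexp) le_rfl)
    _ = ENNReal.ofReal (Real.exp (kabs J.1 * σ)) * (Q + V) := by ring
    _ ≤ _ := by
        unfold posMon
        exact mul_le_mul' le_rfl (prod_pow_taylor w (fun v => u (Sum.inr v)) J.2)

/-- The same inequality for the derivative of a monomial. -/
theorem dposMon_taylor {σ σ' : ℝ} (hσ : σ' ≤ σ) (w : Var jj → ℝ≥0∞) (u : Dir jj → ℝ≥0∞)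
    (hu : ∀ h, u (Sum.inl h) ≤ ENNReal.ofReal (σ - σ')) (e : Dir jj) (J : Expo jj) :
    ∑' d, u d * (mult d J * dposMon e σ' w (lower d J))
      ≤ dposMon e σ (fun v => w v + u (Sum.inr v)) J := by
  calc _ = mult e J * ∑' d, u d * dposMon d σ' w (lower e J) := by
        rw [← ENNReal.tsum_mul_left]
        refine tsum_congr fun d => ?_
        unfold dposMon
        have h1 := congrArg (fun x : ℕ => (x : ℝ≥0∞)) (mult_lower_comm d e J)
        push_cast at h1
        rw [lower_comm e d J]
        calc _ = u d * ((mult d J * mult e (lower d J) : ℝ≥0∞) *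
              posMon σ' w (lower d (lower e J))) := by ring
          _ = _ := by rw [h1]; ring
    _ ≤ mult e J * posMon σ (fun v => w v + u (Sum.inr v)) (lower e J) := by
        gcongr
        exact le_trans le_add_self (posMon_taylor hσ w u hu (lower e J))
    _ = _ := rfl

/-! ### The majorant norm -/

/-- The norm `‖·‖_{E,s,r}` of the Hamiltonian vector field whose components are, up to the
symplectic structure, the entries of the gradient `g`. -/
def vecNorm (a p s r : ℝ) (g : Dir jj → ℝ≥0∞) : ℝ≥0∞ :=
  (⨆ h, g (Sum.inr (Sum.inl h))) / ENNReal.ofReal s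
    + (∑ h, g (Sum.inl h)) / ENNReal.ofReal (r ^ 2)
    + extNorm a p (fun j => g (Sum.inr (Sum.inr (false, j)))) / ENNReal.ofReal r
    + extNorm a p (fun j => g (Sum.inr (Sum.inr (true, j)))) / ENNReal.ofReal r

theorem vecNorm_mono {s r : ℝ} {g g' : Dir jj → ℝ≥0∞} (h : ∀ d, g d ≤ g' d) :
    vecNorm a p s r g ≤ vecNorm a p s r g' := by
  unfold vecNorm
  gcongr with i i
  · exact h _
  · exact h _
  · exact extNorm_mono fun j => h _
  · exact extNorm_mono fun j => h _

theorem vecNorm_const_mul {s r : ℝ} (c : ℝ≥0∞) (g : Dir jj → ℝ≥0∞) :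
    vecNorm a p s r (fun d => c * g d) = c * vecNorm a p s r g := by
  unfold vecNorm
  rw [← ENNReal.mul_iSup, ← Finset.mul_sum, extNorm_const_mul, extNorm_const_mul]
  simp only [div_eq_mul_inv]
  ring

theorem vecNorm_tsum {s r : ℝ} {κ : Type*} (g : κ → Dir jj → ℝ≥0∞) :
    vecNorm a p s r (fun d => ∑' i, g i d) ≤ ∑' i, vecNorm a p s r (g i) := by
  unfold vecNorm
  rw [ENNReal.tsum_add, ENNReal.tsum_add, ENNReal.tsum_add]
  simp only [div_eq_mul_inv]
  rw [ENNReal.tsum_mul_right, ENNReal.tsum_mul_right, ENNReal.tsum_mul_right,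
    ENNReal.tsum_mul_right]
  gcongr
  · exact iSup_le fun h => ENNReal.tsum_le_tsum fun i => le_iSup (fun h => g i _) h
  · rw [Summable.tsum_finsetSum fun i _ => ENNReal.summable]
  · exact extNorm_tsum _
  · exact extNorm_tsum _

theorem vecNorm_add {s r : ℝ} (g g' : Dir jj → ℝ≥0∞) :
    vecNorm a p s r (fun d => g d + g' d) ≤ vecNorm a p s r g + vecNorm a p s r g' := by
  have := vecNorm_tsum (a := a) (p := p) (s := s) (r := r) (fun b : Bool => if b then g else g')
  simpa [tsum_fintype] using this

theorem le_mul_of_div_le {x y c : ℝ≥0∞} (hc : c ≠ 0) (hc' : c ≠ ⊤) (h : x / c ≤ y) :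
    x ≤ c * y := by
  rwa [ENNReal.div_le_iff hc hc', mul_comm] at h

section components

variable {s r : ℝ} (hs : 0 < s) (hr : 0 < r) (g : Dir jj → ℝ≥0∞)
include hs in
theorem iSup_actions_le_vecNorm :
    (⨆ h, g (Sum.inr (Sum.inl h))) ≤ ENNReal.ofReal s * vecNorm a p s r g := by
  refine le_mul_of_div_le (by simpa using hs) ENNReal.ofReal_ne_top ?_
  unfold vecNorm
  exact le_self_add.trans (le_self_add.trans le_self_add)

include hr in
theorem sum_angles_le_vecNorm :
    (∑ h, g (Sum.inl h)) ≤ ENNReal.ofReal (r ^ 2) * vecNorm a p s r g := by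
  refine le_mul_of_div_le (by simpa using hr.ne') ENNReal.ofReal_ne_top ?_
  unfold vecNorm
  exact le_add_self.trans (le_self_add.trans le_self_add)

include hr in
theorem extNorm_le_vecNorm (σ : Bool) :
    extNorm a p (fun j => g (Sum.inr (Sum.inr (σ, j)))) ≤ ENNReal.ofReal r * vecNorm a p s r g := by
  refine le_mul_of_div_le (by simpa using hr) ENNReal.ofReal_ne_top ?_
  unfold vecNorm
  cases σ
  · exact le_add_self.trans le_self_add
  · exact le_add_self

end components

/-- The majorants of the partial derivatives of a series with coefficients `A`. -/
def gradMaj (A : Expo jj → ℝ≥0∞) (σ : ℝ) (w : Var jj → ℝ≥0∞) (d : Dir jj) : ℝ≥0∞ :=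
  ∑' J, A J * dposMon d σ w J

theorem gradMaj_mono {A A' : Expo jj → ℝ≥0∞} (hA : ∀ J, A J ≤ A' J) {σ σ' : ℝ} (h : σ ≤ σ')
    {w w' : Var jj → ℝ≥0∞} (hw : ∀ v, w v ≤ w' v) (d : Dir jj) :
    gradMaj A σ w d ≤ gradMaj A' σ' w' d :=
  ENNReal.tsum_le_tsum fun J => mul_le_mul' (hA J) (dposMon_mono h hw d J)

theorem gradMaj_tsum {κ : Type*} (A : κ → Expo jj → ℝ≥0∞) (σ : ℝ) (w : Var jj → ℝ≥0∞)
    (d : Dir jj) : gradMaj (fun J => ∑' i, A i J) σ w d = ∑' i, gradMaj (A i) σ w d := by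
  unfold gradMaj
  rw [ENNReal.tsum_comm]
  exact tsum_congr fun J => ENNReal.tsum_mul_right.symm

theorem gradMaj_const_mul (c : ℝ≥0∞) (A : Expo jj → ℝ≥0∞) (σ : ℝ) (w : Var jj → ℝ≥0∞)
    (d : Dir jj) : gradMaj (fun J => c * A J) σ w d = c * gradMaj A σ w d := by
  unfold gradMaj
  rw [← ENNReal.tsum_mul_left]
  exact tsum_congr fun J => mul_assoc _ _ _

/-- The absolute values of the points `(y, z, z̄)` of `D(ρ)`. -/
def absBall (jj : Fin n → ℤ) (a p ρ : ℝ) : Set (Var jj → ℝ≥0∞) :=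
  {w | ∑ h, w (Sum.inl h) < ENNReal.ofReal (ρ ^ 2) ∧
    ∀ σ, extNorm a p (fun j => w (Sum.inr (σ, j))) < ENNReal.ofReal ρ}

theorem absBall_mono {ρ ρ' : ℝ} (h0 : 0 ≤ ρ) (h : ρ ≤ ρ') :
    absBall jj a p ρ ⊆ absBall jj a p ρ' := fun _ hw =>
  ⟨hw.1.trans_le (ENNReal.ofReal_le_ofReal (pow_le_pow_left₀ h0 h 2)),
    fun σ => (hw.2 σ).trans_le (ENNReal.ofReal_le_ofReal h)⟩

theorem absBall_of_le {ρ : ℝ} {w w' : Var jj → ℝ≥0∞} (h : ∀ v, w' v ≤ w v)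
    (hw : w ∈ absBall jj a p ρ) : w' ∈ absBall jj a p ρ :=
  ⟨(Finset.sum_le_sum fun _ _ => h _).trans_lt hw.1,
    fun σ => (extNorm_mono fun _ => h _).trans_lt (hw.2 σ)⟩

theorem absBall_add {ρ ρ' : ℝ} (h0 : 0 ≤ ρ') (h : ρ' ≤ ρ) {w u : Var jj → ℝ≥0∞}
    (hw : w ∈ absBall jj a p ρ')
    (h1 : ∑ h, u (Sum.inl h) ≤ ENNReal.ofReal (ρ ^ 2 - ρ' ^ 2))
    (h2 : ∀ σ, extNorm a p (fun j => u (Sum.inr (σ, j))) ≤ ENNReal.ofReal (ρ - ρ')) :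
    (fun v => w v + u v) ∈ absBall jj a p ρ := by
  constructor
  · rw [Finset.sum_add_distrib]
    calc _ < ENNReal.ofReal (ρ' ^ 2) + ENNReal.ofReal (ρ ^ 2 - ρ' ^ 2) :=
          ENNReal.add_lt_add_of_lt_of_le (h1.trans_lt ENNReal.ofReal_lt_top).ne hw.1 h1
      _ = _ := by
          rw [← ENNReal.ofReal_add (by positivity) (by nlinarith)]; congr 1; ring
  · intro σ
    refine (extNorm_add _ _).trans_lt ?_
    calc _ < ENNReal.ofReal ρ' + ENNReal.ofReal (ρ - ρ') :=
          ENNReal.add_lt_add_of_lt_of_le ((h2 σ).trans_lt ENNReal.ofReal_lt_top).ne (hw.2 σ) (h2 σ)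
      _ = _ := by
          rw [← ENNReal.ofReal_add h0 (by linarith)]; congr 1; ring

/-- The majorant norm on `D(σ,ρ)` of a series with coefficients of modulus `A`; vectors are
measured in the norm `‖·‖_{E,s,r}` of fixed `s`, `r`, so that shrinking the domain costs nothing. -/
def majNorm (a p s r σ ρ : ℝ) (A : Expo jj → ℝ≥0∞) : ℝ≥0∞ :=
  ⨆ w ∈ absBall jj a p ρ, vecNorm a p s r (gradMaj A σ w)

section majNorm

variable {s r σ ρ : ℝ}

theorem le_majNorm {w : Var jj → ℝ≥0∞} (hw : w ∈ absBall jj a p ρ) (A : Expo jj → ℝ≥0∞) :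
    vecNorm a p s r (gradMaj A σ w) ≤ majNorm a p s r σ ρ A :=
  le_iSup₂ (f := fun w (_ : w ∈ absBall jj a p ρ) => vecNorm a p s r (gradMaj A σ w)) w hw

theorem majNorm_mono {A A' : Expo jj → ℝ≥0∞} (hA : ∀ J, A J ≤ A' J) :
    majNorm a p s r σ ρ A ≤ majNorm a p s r σ ρ A' :=
  iSup₂_mono fun _ _ => vecNorm_mono fun d => gradMaj_mono hA le_rfl (fun _ => le_rfl) d

theorem majNorm_anti {σ' ρ' : ℝ} (hσ : σ' ≤ σ) (h0 : 0 ≤ ρ') (hρ : ρ' ≤ ρ)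
    (A : Expo jj → ℝ≥0∞) : majNorm a p s r σ' ρ' A ≤ majNorm a p s r σ ρ A :=
  iSup₂_le fun _ hw => (vecNorm_mono fun d => gradMaj_mono (fun _ => le_rfl) hσ
    (fun _ => le_rfl) d).trans (le_majNorm (absBall_mono h0 hρ hw) A)

theorem majNorm_tsum {κ : Type*} (A : κ → Expo jj → ℝ≥0∞) :
    majNorm a p s r σ ρ (fun J => ∑' i, A i J) ≤ ∑' i, majNorm a p s r σ ρ (A i) := by
  refine iSup₂_le fun w hw => ?_
  have : gradMaj (fun J => ∑' i, A i J) σ w = fun d => ∑' i, gradMaj (A i) σ w d := by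
    funext d; exact gradMaj_tsum A σ w d
  rw [this]
  exact (vecNorm_tsum _).trans (ENNReal.tsum_le_tsum fun i => le_majNorm hw _)

theorem majNorm_add (A A' : Expo jj → ℝ≥0∞) :
    majNorm a p s r σ ρ (fun J => A J + A' J)
      ≤ majNorm a p s r σ ρ A + majNorm a p s r σ ρ A' := by
  have := majNorm_tsum (a := a) (p := p) (s := s) (r := r) (σ := σ) (ρ := ρ)
    (fun b : Bool => if b then A else A')
  simpa [tsum_fintype] using this

theorem majNorm_const_mul (c : ℝ≥0∞) (A : Expo jj → ℝ≥0∞) :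
    majNorm a p s r σ ρ (fun J => c * A J) = c * majNorm a p s r σ ρ A := by
  unfold majNorm
  simp_rw [ENNReal.mul_iSup]
  refine iSup_congr fun w => iSup_congr fun _ => ?_
  rw [← vecNorm_const_mul]
  congr 1
  funext d
  exact gradMaj_const_mul c A σ w d

/-- A series without Fourier modes `|k| < K` is exponentially small on a smaller strip. -/
theorem majNorm_ultraviolet {σ' K : ℝ} (hσ : σ' ≤ σ) {A : Expo jj → ℝ≥0∞}
    (hA : ∀ J, A J ≠ 0 → K ≤ kabs J.1) :
    majNorm a p s r σ' ρ A
      ≤ ENNReal.ofReal (Real.exp (-(K * (σ - σ')))) * majNorm a p s r σ ρ A := by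
  refine iSup₂_le fun w hw => ?_
  refine le_trans ?_ (mul_le_mul' le_rfl (le_majNorm hw A))
  rw [← vecNorm_const_mul]
  refine vecNorm_mono fun d => ?_
  rw [gradMaj, gradMaj, ← ENNReal.tsum_mul_left]
  refine ENNReal.tsum_le_tsum fun J => ?_
  by_cases h0 : A J = 0
  · simp [h0]
  have hexp : ENNReal.ofReal (Real.exp (kabs J.1 * σ')) ≤
      ENNReal.ofReal (Real.exp (-(K * (σ - σ')))) * ENNReal.ofReal (Real.exp (kabs J.1 * σ)) := by
    rw [← ENNReal.ofReal_mul (Real.exp_pos _).le, ← Real.exp_add]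
    apply ENNReal.ofReal_le_ofReal
    apply Real.exp_le_exp.2
    nlinarith [hA J h0]
  unfold dposMon posMon
  rw [lower_fst]
  calc _ ≤ A J * (mult d J * (ENNReal.ofReal (Real.exp (-(K * (σ - σ')))) *
        ENNReal.ofReal (Real.exp (kabs J.1 * σ)) *
        (lower d J).2.prod fun v e => w v ^ e)) := by gcongr
    _ = _ := by ring

end majNorm

/-! ### Values of majorants -/

/-- The value of the majorant of a series. -/
def valMaj (A : Expo jj → ℝ≥0∞) (σ : ℝ) (w : Var jj → ℝ≥0∞) : ℝ≥0∞ := ∑' J, A J * posMon σ w J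

/-- Each monomial is dominated by the sum of its (scaled) derivatives, except for the constant. -/
theorem valMaj_le (A : Expo jj → ℝ≥0∞) (σ : ℝ) (w : Var jj → ℝ≥0∞) :
    valMaj A σ w ≤ A 0 + (∑ h, gradMaj A σ w (Sum.inl h) +
      ∑' v, w v * gradMaj A σ w (Sum.inr v)) := by
  classical
  have hmon : ∀ J : Expo jj, posMon σ w J ≤ (if J = 0 then 1 else 0) +
      (∑ h, dposMon (Sum.inl h) σ w J + ∑' v, w v * dposMon (Sum.inr v) σ w J) := by
    intro J
    by_cases hJ : J = 0
    · subst hJ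
      simp [posMon, kabs]
    by_cases hk : J.1 = 0
    · have hm : J.2 ≠ 0 := fun h => hJ (Prod.ext hk h)
      obtain ⟨v, hv⟩ := Finsupp.ne_iff.1 hm
      refine le_trans ?_ (le_add_self.trans le_add_self)
      refine le_trans ?_ (ENNReal.le_tsum v)
      have h1 : posMon σ w J = posMon σ w (lower (Sum.inr v) J) * w v := by
        rw [← posMon_add_single, lower_add_single hv]
      have h2 : (1 : ℝ≥0∞) ≤ (mult (Sum.inr v) J : ℝ≥0∞) := by
        exact_mod_cast Nat.one_le_iff_ne_zero.2 hv
      rw [h1, dposMon]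
      calc _ = w v * (1 * posMon σ w (lower (Sum.inr v) J)) := by ring
        _ ≤ _ := by gcongr
    · obtain ⟨h, hh⟩ := Function.ne_iff.1 hk
      refine le_trans ?_ (le_self_add.trans le_add_self)
      refine le_trans ?_ (Finset.single_le_sum (f := fun h => dposMon (Sum.inl h) σ w J)
        (fun _ _ => zero_le) (Finset.mem_univ h))
      have h2 : (1 : ℝ≥0∞) ≤ (mult (Sum.inl h) J : ℝ≥0∞) := by
        have : 1 ≤ (J.1 h).natAbs := Nat.one_le_iff_ne_zero.2 (Int.natAbs_ne_zero.2 hh)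
        exact_mod_cast this
      calc _ = 1 * posMon σ w J := (one_mul _).symm
        _ ≤ _ := by unfold dposMon; gcongr; exact le_rfl
  calc valMaj A σ w ≤ ∑' J, (A J * (if J = 0 then 1 else 0) +
        (∑ h, A J * dposMon (Sum.inl h) σ w J + ∑' v, w v * (A J * dposMon (Sum.inr v) σ w J))) := by
        refine ENNReal.tsum_le_tsum fun J => (mul_le_mul' le_rfl (hmon J)).trans (le_of_eq ?_)
        rw [mul_add, mul_add, Finset.mul_sum, ← ENNReal.tsum_mul_left]
        congr 2
        exact tsum_congr fun v => by ring
    _ = _ := by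
        rw [ENNReal.tsum_add, ENNReal.tsum_add, ENNReal.tsum_comm,
          Summable.tsum_finsetSum fun _ _ => ENNReal.summable]
        simp only [mul_ite, mul_one, mul_zero, tsum_ite_eq, ENNReal.tsum_mul_left]
        rfl

theorem ne_top_of_mul_ofReal {x : ℝ≥0∞} {c : ℝ} (h : x ≠ ⊤) : ENNReal.ofReal c * x ≠ ⊤ :=
  ENNReal.mul_ne_top ENNReal.ofReal_ne_top h

/-- The value of the majorant of a series is controlled by its majorant norm, up to the constant
term. -/
theorem valMaj_le_majNorm (ha : 0 ≤ a) (hp : 0 ≤ p) {s r σ ρ : ℝ} (hr : 0 < r)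
    (hs : 0 < s) (A : Expo jj → ℝ≥0∞) {w : Var jj → ℝ≥0∞} (hw : w ∈ absBall jj a p ρ) :
    valMaj A σ w ≤ A 0 + (ENNReal.ofReal (r ^ 2) + (ENNReal.ofReal (ρ ^ 2) * ENNReal.ofReal s +
      2 * (ENNReal.ofReal ρ * ENNReal.ofReal r))) * majNorm a p s r σ ρ A := by
  refine (valMaj_le A σ w).trans (add_le_add le_rfl ?_)
  refine le_trans ?_ (mul_le_mul' le_rfl (le_majNorm (s := s) (r := r) (σ := σ) hw A))
  set V := vecNorm a p s r (gradMaj A σ w)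
  rw [add_mul]
  refine add_le_add (sum_angles_le_vecNorm hr _) ?_
  rw [Summable.tsum_sum (by exact ENNReal.summable) (by exact ENNReal.summable), tsum_fintype,
    add_mul]
  refine add_le_add ?_ ?_
  · calc _ ≤ ∑ h, w (Sum.inl h) * (ENNReal.ofReal s * V) :=
          Finset.sum_le_sum fun h _ => mul_le_mul' le_rfl
            ((le_iSup (fun h => gradMaj A σ w (Sum.inr (Sum.inl h))) h).trans
              (iSup_actions_le_vecNorm hs _))
      _ ≤ _ := by
          rw [← Finset.sum_mul, mul_assoc]
          exact mul_le_mul' hw.1.le le_rfl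
  · rw [ENNReal.tsum_prod', tsum_fintype, Fintype.sum_bool]
    have key : ∀ b, ∑' j, w (Sum.inr (b, j)) * gradMaj A σ w (Sum.inr (Sum.inr (b, j))) ≤
        ENNReal.ofReal ρ * ENNReal.ofReal r * V := by
      intro b
      rw [mul_assoc]
      exact (tsum_mul_le_extNorm ha hp _ _).trans
        (mul_le_mul' (hw.2 b).le (extNorm_le_vecNorm hr _ b))
    refine (add_le_add (key true) (key false)).trans (le_of_eq (by ring))

/-- A series with finite majorant norm and finite constant term converges absolutely. -/
theorem valMaj_ne_top (ha : 0 ≤ a) (hp : 0 ≤ p) {s r σ ρ : ℝ} (hr : 0 < r)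
    {A : Expo jj → ℝ≥0∞} (h0 : A 0 ≠ ⊤) (hA : majNorm a p s r σ ρ A ≠ ⊤) {w : Var jj → ℝ≥0∞}
    (hw : w ∈ absBall jj a p ρ) (hs : 0 < s) : valMaj A σ w ≠ ⊤ := by
  refine ne_top_of_le_ne_top ?_ (valMaj_le_majNorm ha hp hr hs A hw)
  refine ENNReal.add_ne_top.2 ⟨h0, ENNReal.mul_ne_top ?_ hA⟩
  simp [ENNReal.mul_eq_top]

theorem tsum_dir (f : Dir jj → ℝ≥0∞) : ∑' d, f d = ∑ h, f (Sum.inl h) +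
    (∑ h, f (Sum.inr (Sum.inl h)) + (∑' j, f (Sum.inr (Sum.inr (true, j))) +
      ∑' j, f (Sum.inr (Sum.inr (false, j))))) := by
  rw [Summable.tsum_sum (by exact ENNReal.summable) (by exact ENNReal.summable), tsum_fintype,
    Summable.tsum_sum (by exact ENNReal.summable) (by exact ENNReal.summable), tsum_fintype,
    ENNReal.tsum_prod', tsum_fintype, Fintype.sum_bool]

/-- The symplectic pairing of two gradients converges absolutely. -/
theorem tsum_mul_dual_le (ha : 0 ≤ a) (hp : 0 ≤ p) {s r : ℝ} (hs : 0 < s) (hr : 0 < r)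
    (g g' : Dir jj → ℝ≥0∞) :
    ∑' d, g d * g' (dual d) ≤ (2 * ENNReal.ofReal (r ^ 2) * ENNReal.ofReal s
      + 2 * ENNReal.ofReal r * ENNReal.ofReal r) * vecNorm a p s r g * vecNorm a p s r g' := by
  have key : ∀ g g' : Dir jj → ℝ≥0∞, ∑ h, g (Sum.inl h) * g' (Sum.inr (Sum.inl h)) ≤
      ENNReal.ofReal (r ^ 2) * vecNorm a p s r g * (ENNReal.ofReal s * vecNorm a p s r g') := by
    intro g g'
    calc _ ≤ ∑ h, g (Sum.inl h) * ⨆ h, g' (Sum.inr (Sum.inl h)) :=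
          Finset.sum_le_sum fun h _ => mul_le_mul' le_rfl
            (le_iSup (fun h => g' (Sum.inr (Sum.inl h))) h)
      _ ≤ _ := by
          rw [← Finset.sum_mul]
          exact mul_le_mul' (sum_angles_le_vecNorm hr g) (iSup_actions_le_vecNorm hs g')
  have keyZ : ∀ σ, ∑' j, g (Sum.inr (Sum.inr (σ, j))) * g' (Sum.inr (Sum.inr (!σ, j))) ≤
      ENNReal.ofReal r * vecNorm a p s r g * (ENNReal.ofReal r * vecNorm a p s r g') := fun σ =>
    (tsum_mul_le_extNorm ha hp _ _).trans
      (mul_le_mul' (extNorm_le_vecNorm hr g σ) (extNorm_le_vecNorm hr g' (!σ)))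
  rw [tsum_dir]
  have k2 := key g' g
  simp_rw [mul_comm (g' _)] at k2
  refine (add_le_add (key g g') (add_le_add k2 (add_le_add (keyZ true) (keyZ false)))).trans
    (le_of_eq ?_)
  ring

/-! ### The bracket of majorants -/

/-- The data of one summand of a Poisson bracket: a direction and a monomial of each factor. -/
abbrev Triple (jj : Fin n → ℤ) : Type := Dir jj × Expo jj × Expo jj

/-- The exponents of the monomial `∂_d 𝔪₁ · ∂_{d*} 𝔪₂`. -/
def out (τ : Triple jj) : Expo jj := lower τ.1 τ.2.1 + lower (dual τ.1) τ.2.2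

/-- The modulus of the numerical factor of `∂_d 𝔪₁ · ∂_{d*} 𝔪₂`. -/
def pairMult (τ : Triple jj) : ℕ := mult τ.1 τ.2.1 * mult (dual τ.1) τ.2.2

open Classical in
/-- The majorant of the Poisson bracket, for an arbitrary weight `Q` in place of the product of
the coefficients of the two factors. -/
def majBracket (Q : Triple jj → ℝ≥0∞) : Expo jj → ℝ≥0∞ := fun I =>
  ∑' τ, if out τ = I then (pairMult τ : ℝ≥0∞) * Q τ else 0

theorem tsum_majBracket_mul (Q : Triple jj → ℝ≥0∞) (φ : Expo jj → ℝ≥0∞) :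
    ∑' I, majBracket Q I * φ I = ∑' τ, (pairMult τ : ℝ≥0∞) * Q τ * φ (out τ) := by
  classical
  unfold majBracket
  simp_rw [← ENNReal.tsum_mul_right]
  rw [ENNReal.tsum_comm]
  refine tsum_congr fun τ => ?_
  rw [tsum_eq_single (out τ)]
  · simp
  · intro I hI
    simp [Ne.symm hI]

theorem majBracket_mono {Q Q' : Triple jj → ℝ≥0∞} (h : ∀ τ, Q τ ≤ Q' τ) (I : Expo jj) :
    majBracket Q I ≤ majBracket Q' I := by
  refine ENNReal.tsum_le_tsum fun τ => ?_
  split_ifs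
  · exact mul_le_mul' le_rfl (h τ)
  · exact le_rfl

theorem majBracket_add (Q Q' : Triple jj → ℝ≥0∞) (I : Expo jj) :
    majBracket (fun τ => Q τ + Q' τ) I = majBracket Q I + majBracket Q' I := by
  unfold majBracket
  rw [← ENNReal.tsum_add]
  refine tsum_congr fun τ => ?_
  split_ifs <;> ring

theorem majBracket_const_mul (c : ℝ≥0∞) (Q : Triple jj → ℝ≥0∞) (I : Expo jj) :
    majBracket (fun τ => c * Q τ) I = c * majBracket Q I := by
  unfold majBracket
  rw [← ENNReal.tsum_mul_left]
  refine tsum_congr fun τ => ?_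
  split_ifs <;> ring

theorem tsum_triple_mul (F G : Dir jj → Expo jj → ℝ≥0∞) :
    ∑' τ : Triple jj, F τ.1 τ.2.1 * G τ.1 τ.2.2 = ∑' d, (∑' J, F d J) * ∑' J, G d J := by
  rw [ENNReal.tsum_prod']
  refine tsum_congr fun d => ?_
  rw [ENNReal.tsum_prod']
  simp_rw [ENNReal.tsum_mul_left, ENNReal.tsum_mul_right]

theorem valMaj_majBracket_le {σ : ℝ} (hσ : 0 ≤ σ) (A B : Expo jj → ℝ≥0∞) (w : Var jj → ℝ≥0∞) :
    ∑' τ : Triple jj, (pairMult τ : ℝ≥0∞) * (A τ.2.1 * B τ.2.2) * posMon σ w (out τ)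
      ≤ ∑' d, gradMaj A σ w d * gradMaj B σ w (dual d) := by
  unfold gradMaj
  rw [← tsum_triple_mul (fun d J => A J * dposMon d σ w J)
    (fun d J => B J * dposMon (dual d) σ w J)]
  refine ENNReal.tsum_le_tsum fun τ => ?_
  calc _ ≤ (pairMult τ : ℝ≥0∞) * (A τ.2.1 * B τ.2.2) *
        (posMon σ w (lower τ.1 τ.2.1) * posMon σ w (lower (dual τ.1) τ.2.2)) := by
        gcongr
        exact posMon_add_le hσ _ _ _
    _ = _ := by
        unfold dposMon pairMult
        push_cast
        ring

/-- The Lie derivative part of the gradient of a bracket. -/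
def lieMaj (A : Expo jj → ℝ≥0∞) (u : Dir jj → ℝ≥0∞) (σ : ℝ) (w : Var jj → ℝ≥0∞)
    (e : Dir jj) : ℝ≥0∞ :=
  ∑' J, A J * ∑' d, u d * (mult d J * dposMon e σ w (lower d J))

/-- The product rule for the gradient of a bracket: `X_{{A, B}}` is the derivative of `X_A` along
`X_B` minus that of `X_B` along `X_A`, and in moduli the two are added. -/
theorem gradMaj_majBracket_le {σ : ℝ} (hσ : 0 ≤ σ) (A B : Expo jj → ℝ≥0∞) (w : Var jj → ℝ≥0∞)
    (e : Dir jj) :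
    gradMaj (majBracket fun τ => A τ.2.1 * B τ.2.2) σ w e
      ≤ lieMaj A (fun d => gradMaj B σ w (dual d)) σ w e
        + lieMaj B (fun d => gradMaj A σ w (dual d)) σ w e := by
  have h1 : lieMaj A (fun d => gradMaj B σ w (dual d)) σ w e = ∑' d,
      (∑' J, A J * (mult d J * dposMon e σ w (lower d J))) *
        ∑' J, B J * dposMon (dual d) σ w J := by
    unfold lieMaj gradMaj
    simp_rw [← ENNReal.tsum_mul_left, ← ENNReal.tsum_mul_right]
    rw [ENNReal.tsum_comm]
    refine tsum_congr fun d => ?_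
    simp_rw [← ENNReal.tsum_mul_left]
    rw [ENNReal.tsum_comm]
    exact tsum_congr fun K => tsum_congr fun J => by ring
  have h2 : lieMaj B (fun d => gradMaj A σ w (dual d)) σ w e = ∑' d,
      (∑' J, A J * dposMon d σ w J) *
        (∑' J, B J * (mult (dual d) J * dposMon e σ w (lower (dual d) J))) := by
    rw [← dualEquiv.tsum_eq]
    unfold lieMaj gradMaj
    simp_rw [← ENNReal.tsum_mul_left, ← ENNReal.tsum_mul_right]
    rw [ENNReal.tsum_comm]
    refine tsum_congr fun d => tsum_congr fun J => ?_
    simp_rw [← ENNReal.tsum_mul_left]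
    refine tsum_congr fun K => ?_
    simp only [dualEquiv, Equiv.coe_fn_mk, dual_dual]
    ring
  rw [h1, h2, ← tsum_triple_mul
    (fun d J => A J * (mult d J * dposMon e σ w (lower d J)))
    (fun d J => B J * dposMon (dual d) σ w J),
    ← tsum_triple_mul (fun d J => A J * dposMon d σ w J)
    (fun d J => B J * (mult (dual d) J * dposMon e σ w (lower (dual d) J))), ← ENNReal.tsum_add,
    gradMaj, tsum_majBracket_mul]
  refine ENNReal.tsum_le_tsum fun τ => ?_
  calc _ ≤ (pairMult τ : ℝ≥0∞) * (A τ.2.1 * B τ.2.2) *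
        (dposMon e σ w (lower τ.1 τ.2.1) * posMon σ w (lower (dual τ.1) τ.2.2)
          + posMon σ w (lower τ.1 τ.2.1) * dposMon e σ w (lower (dual τ.1) τ.2.2)) := by
        gcongr
        exact dposMon_add_le hσ _ _ _ _
    _ = _ := by
        rw [mul_add]
        congr 1
        · unfold pairMult
          conv_rhs => rw [dposMon.eq_1 (dual τ.1)]
          push_cast
          ring
        · unfold pairMult
          conv_rhs => rw [dposMon.eq_1 τ.1]
          push_cast
          ring

/-- Cauchy estimate for the Lie derivative, in positive terms: the derivative of `X_A` along the
vector field of gradient `g` is dominated by `X_A` at a displaced point. -/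
theorem mul_vecNorm_lieMaj_le {s r σ σ' ρ ρ' δ b : ℝ} (hs : 0 < s) (hr : 0 < r) (hδ : 0 < δ)
    (hb : 0 < b) (hσ : δ * s ≤ σ - σ') (hρ : δ * r ≤ ρ - ρ') (hρ0 : 0 ≤ ρ') (hρr : r ≤ ρ + ρ')
    (A : Expo jj → ℝ≥0∞) {g : Dir jj → ℝ≥0∞} (hg : vecNorm a p s r g ≤ ENNReal.ofReal b)
    {w : Var jj → ℝ≥0∞} (hw : w ∈ absBall jj a p ρ') :
    vecNorm a p s r (lieMaj A (fun d => g (dual d)) σ' w)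
      ≤ ENNReal.ofReal (b / δ) * majNorm a p s r σ ρ A := by
  set t := ENNReal.ofReal (δ / b) with ht
  have hδs : 0 < δ * s := mul_pos hδ hs
  have hδr : 0 < δ * r := mul_pos hδ hr
  have htb : ∀ c : ℝ, 0 ≤ c → t * (ENNReal.ofReal c * ENNReal.ofReal b) = ENNReal.ofReal (δ * c) := by
    intro c hc
    rw [ht, ← ENNReal.ofReal_mul hc, ← ENNReal.ofReal_mul (by positivity)]
    congr 1; field_simp
  set u : Dir jj → ℝ≥0∞ := fun d => t * g (dual d) with hu
  have hmem : (fun v => w v + u (Sum.inr v)) ∈ absBall jj a p ρ := by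
    refine absBall_add hρ0 (by linarith) hw ?_ ?_
    · simp only [hu, dual, ← Finset.mul_sum]
      calc _ ≤ t * (ENNReal.ofReal (r ^ 2) * ENNReal.ofReal b) :=
            mul_le_mul' le_rfl ((sum_angles_le_vecNorm hr g).trans (mul_le_mul' le_rfl hg))
        _ ≤ _ := by
            rw [htb _ (by positivity)]
            apply ENNReal.ofReal_le_ofReal
            nlinarith
    · intro τ
      simp only [hu, dual]
      rw [extNorm_const_mul]
      calc _ ≤ t * (ENNReal.ofReal r * ENNReal.ofReal b) :=
            mul_le_mul' le_rfl ((extNorm_le_vecNorm hr g _).trans (mul_le_mul' le_rfl hg))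
        _ ≤ _ := by
            rw [htb _ hr.le]
            exact ENNReal.ofReal_le_ofReal hρ
  have hux : ∀ h, u (Sum.inl h) ≤ ENNReal.ofReal (σ - σ') := by
    intro h
    calc _ ≤ t * (ENNReal.ofReal s * ENNReal.ofReal b) :=
          mul_le_mul' le_rfl (((le_iSup (fun h => g (Sum.inr (Sum.inl h))) h).trans
            (iSup_actions_le_vecNorm hs g)).trans (mul_le_mul' le_rfl hg))
      _ ≤ _ := by
          rw [htb _ hs.le]
          exact ENNReal.ofReal_le_ofReal hσ
  have hkey : ∀ e, t * lieMaj A (fun d => g (dual d)) σ' w e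
      ≤ gradMaj A σ (fun v => w v + u (Sum.inr v)) e := by
    intro e
    unfold lieMaj gradMaj
    rw [← ENNReal.tsum_mul_left]
    refine ENNReal.tsum_le_tsum fun J => ?_
    refine le_trans (le_of_eq ?_) (mul_le_mul' le_rfl
      (dposMon_taylor (by linarith : σ' ≤ σ) w u hux e J))
    rw [mul_left_comm, ← ENNReal.tsum_mul_left]
    congr 1
    exact tsum_congr fun d => by simp only [hu]; ring
  have hfin : t * vecNorm a p s r (lieMaj A (fun d => g (dual d)) σ' w)
      ≤ majNorm a p s r σ ρ A := by
    rw [← vecNorm_const_mul]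
    exact (vecNorm_mono hkey).trans (le_majNorm hmem A)
  calc _ = ENNReal.ofReal (b / δ) * (t * vecNorm a p s r (lieMaj A (fun d => g (dual d)) σ' w)) := by
        rw [← mul_assoc, ht, ← ENNReal.ofReal_mul (by positivity)]
        have : b / δ * (δ / b) = 1 := by field_simp
        rw [this]; simp
    _ ≤ _ := mul_le_mul' le_rfl hfin

/-- The majorant norm of a Poisson bracket. -/
theorem majNorm_majBracket_le {s r σ σ' ρ ρ' δ x y : ℝ} (hs : 0 < s) (hr : 0 < r) (hδ : 0 < δ)
    (hx : 0 < x) (hy : 0 < y) (hσ0 : 0 ≤ σ') (hσ : δ * s ≤ σ - σ') (hρ : δ * r ≤ ρ - ρ')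
    (hρ0 : 0 ≤ ρ') (hρr : r ≤ ρ + ρ') {A B : Expo jj → ℝ≥0∞}
    (hA : majNorm a p s r σ ρ A ≤ ENNReal.ofReal x)
    (hB : majNorm a p s r σ ρ B ≤ ENNReal.ofReal y) :
    majNorm a p s r σ' ρ' (majBracket fun τ => A τ.2.1 * B τ.2.2)
      ≤ ENNReal.ofReal (2 * x * y / δ) := by
  have hδs : 0 < δ * s := mul_pos hδ hs
  have hδr : 0 < δ * r := mul_pos hδ hr
  refine iSup₂_le fun w hw => ?_
  have hdom : ∀ C : Expo jj → ℝ≥0∞, vecNorm a p s r (gradMaj C σ' w) ≤ majNorm a p s r σ ρ C :=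
    fun C => (le_majNorm hw C).trans (majNorm_anti (by linarith) hρ0 (by linarith) C)
  refine (vecNorm_mono (gradMaj_majBracket_le hσ0 A B w)).trans ((vecNorm_add _ _).trans ?_)
  calc _ ≤ ENNReal.ofReal (y / δ) * ENNReal.ofReal x + ENNReal.ofReal (x / δ) * ENNReal.ofReal y :=
        add_le_add
          ((mul_vecNorm_lieMaj_le hs hr hδ hy hσ hρ hρ0 hρr A ((hdom B).trans hB) hw).trans
            (mul_le_mul' le_rfl hA))
          ((mul_vecNorm_lieMaj_le hs hr hδ hx hσ hρ hρ0 hρr B ((hdom A).trans hA) hw).trans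
            (mul_le_mul' le_rfl hB))
    _ = _ := by
        rw [← ENNReal.ofReal_mul (by positivity), ← ENNReal.ofReal_mul (by positivity),
          ← ENNReal.ofReal_add (by positivity) (by positivity)]
        congr 1; field_simp; ring

/-! ### Multi-indices as exponents -/

theorem injective_inr_mk (σ : Bool) :
    Function.Injective fun j : Site jj => (Sum.inr (σ, j) : Var jj) := fun i j h => by
  simpa using h

/-- The exponents of the power series variables of a multi-index. -/
def varExpo (I : MultiIndex jj) : Var jj →₀ ℕ :=
  (Finsupp.equivFunOnFinite.symm I.i).mapDomain Sum.inl
    + ((I.ab true).mapDomain (fun j => Sum.inr (true, j))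
    + (I.ab false).mapDomain fun j => Sum.inr (false, j))

theorem varExpo_inl (I : MultiIndex jj) (h : Fin n) : varExpo I (Sum.inl h) = I.i h := by
  simp only [varExpo, Finsupp.add_apply]
  rw [Finsupp.mapDomain_apply Sum.inl_injective, Finsupp.mapDomain_of_notMem_range,
    Finsupp.mapDomain_of_notMem_range]
  · simp
  · simp
  · simp

theorem varExpo_inr (I : MultiIndex jj) (σ : Bool) (j : Site jj) :
    varExpo I (Sum.inr (σ, j)) = I.ab σ j := by
  simp only [varExpo, Finsupp.add_apply]
  rw [Finsupp.mapDomain_of_notMem_range _ (Sum.inr (σ, j) : Var jj) (by simp)]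
  cases σ
  · rw [Finsupp.mapDomain_of_notMem_range _ (Sum.inr (false, j) : Var jj) (by simp),
      Finsupp.mapDomain_apply (injective_inr_mk false)]
    simp
  · rw [Finsupp.mapDomain_apply (injective_inr_mk true), Finsupp.mapDomain_of_notMem_range]
    · simp
    · simp

/-- The identification of multi-indices with exponents. -/
def expoEquiv : MultiIndex jj ≃ Expo jj where
  toFun I := (I.k, varExpo I)
  invFun J :=
    { k := J.1
      i := fun h => J.2 (Sum.inl h)
      ab := fun σ => J.2.comapDomain (fun j => Sum.inr (σ, j)) (injective_inr_mk σ).injOn }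
  left_inv I := by
    rcases I with ⟨k, i, ab⟩
    simp only [varExpo_inl, MultiIndex.mk.injEq, true_and]
    funext σ
    ext j
    simp [varExpo_inr]
  right_inv J := by
    refine Prod.ext rfl ?_
    ext v
    rcases v with h | ⟨σ, j⟩
    · simp [varExpo_inl]
    · simp [varExpo_inr]

theorem prod_varExpo {M : Type*} [CommMonoid M] (x : Var jj → M) (I : MultiIndex jj) :
    ((varExpo I).prod fun v e => x v ^ e) = (∏ h, x (Sum.inl h) ^ I.i h)
      * ((I.ab true).prod fun j e => x (Sum.inr (true, j)) ^ e)
      * ((I.ab false).prod fun j e => x (Sum.inr (false, j)) ^ e) := by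
  classical
  unfold varExpo
  rw [Finsupp.prod_add_index' (by simp) (by intros; exact pow_add _ _ _),
    Finsupp.prod_add_index' (by simp) (by intros; exact pow_add _ _ _),
    Finsupp.prod_mapDomain_index (by simp) (by intros; exact pow_add _ _ _),
    Finsupp.prod_mapDomain_index (by simp) (by intros; exact pow_add _ _ _),
    Finsupp.prod_mapDomain_index (by simp) (by intros; exact pow_add _ _ _),
    Finsupp.prod_fintype _ _ (by simp), mul_assoc]
  simp

theorem sum_varExpo {M : Type*} [CommSemiring M] (x : Var jj → M) (I : MultiIndex jj) :
    ((varExpo I).sum fun v e => x v * e) = (∑ h, x (Sum.inl h) * I.i h)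
      + ((I.ab true).sum fun j e => x (Sum.inr (true, j)) * e)
      + ((I.ab false).sum fun j e => x (Sum.inr (false, j)) * e) := by
  classical
  have h0 : ∀ (v : Var jj) (b c : ℕ), x v * ((b + c : ℕ) : M) = x v * b + x v * c := by
    intros; push_cast; ring
  have h0' : ∀ (v : Site jj) (y : Site jj → Var jj) (b c : ℕ),
      x (y v) * ((b + c : ℕ) : M) = x (y v) * b + x (y v) * c := by
    intros; push_cast; ring
  unfold varExpo
  rw [Finsupp.sum_add_index' (by simp) h0, Finsupp.sum_add_index' (by simp) h0,
    Finsupp.sum_mapDomain_index (by simp) h0, Finsupp.sum_mapDomain_index (by simp) h0,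
    Finsupp.sum_mapDomain_index (by simp) h0, Finsupp.sum_fintype _ _ (by simp), add_assoc]
  simp

theorem expoEquiv_raiseY (h : Fin n) (I : MultiIndex jj) :
    expoEquiv (I.raiseY h) = expoEquiv I + (0, Finsupp.single (Sum.inl h) 1) := by
  classical
  refine Prod.ext (by simp [expoEquiv, MultiIndex.raiseY]) ?_
  ext v
  rcases v with h' | ⟨σ, j⟩
  · simp [expoEquiv, MultiIndex.raiseY, varExpo_inl, Finsupp.single_apply, Pi.single_apply,
      eq_comm]
  · simp [expoEquiv, MultiIndex.raiseY, varExpo_inr]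

theorem expoEquiv_raiseZ (σ : Bool) (j : Site jj) (I : MultiIndex jj) :
    expoEquiv (I.raiseZ σ j) = expoEquiv I + (0, Finsupp.single (Sum.inr (σ, j)) 1) := by
  classical
  refine Prod.ext (by simp [expoEquiv, MultiIndex.raiseZ]) ?_
  ext v
  rcases v with h' | ⟨τ, i⟩
  · simp [expoEquiv, MultiIndex.raiseZ, varExpo_inl]
  · simp only [expoEquiv, MultiIndex.raiseZ, Equiv.coe_fn_mk, varExpo_inr, Prod.snd_add,
      Finsupp.add_apply]
    by_cases h : τ = σ
    · subst h; simp [Finsupp.single_apply]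
    · simp [Function.update_of_ne h, Ne.symm h]

/-- The coefficients of a formal series, indexed by exponents. -/
def coeffs (c : Series jj) : Expo jj → ℂ := fun J => c (expoEquiv.symm J)

/-- The formal series with given coefficients. -/
def ofCoeffs (c : Expo jj → ℂ) : Series jj := fun I => c (expoEquiv I)

@[simp] theorem coeffs_ofCoeffs (c : Expo jj → ℂ) : coeffs (ofCoeffs c) = c := by
  funext J; simp [coeffs, ofCoeffs]

@[simp] theorem ofCoeffs_coeffs (c : Series jj) : ofCoeffs (coeffs c) = c := by
  funext J; simp [coeffs, ofCoeffs]

/-- The moduli of a family of coefficients. -/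
def absC (c : Expo jj → ℂ) : Expo jj → ℝ≥0∞ := fun J => ‖c J‖ₑ

/-! ### Points of the phase space -/

/-- The value at `v` of a variable of the power series. -/
def coord (v : Phase jj a p) : Var jj → ℂ
  | Sum.inl h => v.y h
  | Sum.inr (σ, j) => (v.z σ).entry j

/-- The absolute values of the coordinates `y`, `z`, `z̄`. -/
def absCoord (v : Phase jj a p) : Var jj → ℝ≥0∞ := fun x => ‖coord v x‖ₑ

/-- The monomial `e^{i k·x} ∏ v^{m_v}`. -/
def expMon (v : Phase jj a p) (J : Expo jj) : ℂ :=
  Complex.exp (Complex.I * ∑ h, (J.1 h : ℂ) * v.x h) * J.2.prod fun x e => coord v x ^ e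

theorem monomial_eq (v : Phase jj a p) (I : MultiIndex jj) :
    I.monomial v = expMon v (expoEquiv I) := by
  simp only [expMon, expoEquiv, Equiv.coe_fn_mk, prod_varExpo, MultiIndex.monomial, coord]
  ring

theorem ofReal_majorant (s : ℝ) (v : Phase jj a p) (I : MultiIndex jj) :
    ENNReal.ofReal (I.majorant s v) = posMon s (absCoord v) (expoEquiv I) := by
  have hpr : ∀ (f : Site jj →₀ ℕ) (x : Site jj → ℂ),
      ENNReal.ofReal (f.prod fun j e => ‖x j‖ ^ e) = f.prod fun j e => ‖x j‖ₑ ^ e := by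
    intro f x
    unfold Finsupp.prod
    rw [ENNReal.ofReal_prod_of_nonneg (fun _ _ => by positivity)]
    refine Finset.prod_congr rfl fun j _ => ?_
    rw [ENNReal.ofReal_pow (norm_nonneg _), ofReal_norm]
  have hnn : ∀ (f : Site jj →₀ ℕ) (x : Site jj → ℂ), 0 ≤ f.prod fun j e => ‖x j‖ ^ e :=
    fun f x => Finset.prod_nonneg fun _ _ => by positivity
  simp only [posMon, expoEquiv, Equiv.coe_fn_mk, prod_varExpo, MultiIndex.majorant]
  rw [ENNReal.ofReal_mul (mul_nonneg (by positivity) (hnn _ _)),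
    ENNReal.ofReal_mul (by positivity), ENNReal.ofReal_mul (by positivity), hpr, hpr,
    ENNReal.ofReal_prod_of_nonneg (fun _ _ => by positivity)]
  simp only [ENNReal.ofReal_pow (norm_nonneg _), ofReal_norm, absCoord, coord,
    MultiIndex.kNorm, kabs, mul_assoc]

theorem isExpansion_iff {s r : ℝ} {H : Phase jj a p → ℂ} {c : Series jj} :
    IsExpansion s r H c ↔
      ∀ v ∈ dom jj a p s r, HasSum (fun J => coeffs c J * expMon v J) (H v) := by
  refine forall₂_congr fun v _ => ?_
  rw [← expoEquiv.hasSum_iff]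
  simp [Function.comp_def, coeffs, monomial_eq]

/-- The modulus of the factor that the derivative in a direction puts in front of a monomial, with
its phase. -/
def cmult : Dir jj → Expo jj → ℂ
  | Sum.inl h, J => Complex.I * J.1 h
  | Sum.inr v, J => J.2 v

theorem enorm_cmult (d : Dir jj) (J : Expo jj) : ‖cmult d J‖ₑ = mult d J := by
  rcases d with h | v
  · simp only [cmult, mult, enorm_mul]
    rw [← ofReal_norm, ← ofReal_norm, Complex.norm_I, Complex.norm_intCast,
      ENNReal.ofReal_one, one_mul, ← ENNReal.ofReal_natCast, Nat.cast_natAbs, Int.cast_abs]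
  · simp only [cmult, mult, enorm_eq_nnnorm]
    rw [← ENNReal.coe_natCast, ENNReal.coe_inj, ← NNReal.coe_inj]
    simp

theorem maj_eq (s : ℝ) (c : Series jj) (v : Phase jj a p) :
    c.maj s v = ∑' J, absC (coeffs c) J * posMon s (absCoord v) J := by
  unfold Series.maj
  rw [← expoEquiv.tsum_eq]
  simp [ofReal_majorant, absC, coeffs]

theorem injective_add_single (x : Var jj) :
    Function.Injective fun J : Expo jj => J + (0, Finsupp.single x 1) :=
  fun _ _ h => add_right_cancel h

theorem tsum_lower (x : Var jj) (F : Expo jj → ℝ≥0∞) :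
    ∑' J : Expo jj, ((mult (Sum.inr x) (J + (0, Finsupp.single x 1)) : ℕ) : ℝ≥0∞) *
        F (J + (0, Finsupp.single x 1)) = ∑' J, (mult (Sum.inr x) J : ℝ≥0∞) * F J := by
  refine (injective_add_single x).tsum_eq (f := fun J => (mult (Sum.inr x) J : ℝ≥0∞) * F J) ?_
  intro J hJ
  refine ⟨lower (Sum.inr x) J, lower_add_single fun h => ?_⟩
  simp [h] at hJ

theorem lower_add_self (x : Var jj) (J : Expo jj) :
    lower (Sum.inr x) (J + (0, Finsupp.single x 1)) = J := by
  simp [lower]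

theorem maj_dX (s : ℝ) (c : Series jj) (v : Phase jj a p) (h : Fin n) :
    (c.dX h).maj s v = gradMaj (absC (coeffs c)) s (absCoord v) (Sum.inl h) := by
  rw [maj_eq]
  refine tsum_congr fun J => ?_
  have : coeffs (c.dX h) J = cmult (Sum.inl h) J * coeffs c J := rfl
  simp only [absC, this, enorm_mul, enorm_cmult, dposMon]
  simp only [lower]
  ring

theorem maj_raise (s : ℝ) (c c' : Series jj) (v : Phase jj a p) (x : Var jj)
    (hc : ∀ J, coeffs c' J
      = (mult (Sum.inr x) (J + (0, Finsupp.single x 1)) : ℕ) * coeffs c (J + (0, Finsupp.single x 1))) :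
    c'.maj s v = gradMaj (absC (coeffs c)) s (absCoord v) (Sum.inr x) := by
  rw [maj_eq, gradMaj]
  have h1 : ∀ J, absC (coeffs c) J * dposMon (Sum.inr x) s (absCoord v) J =
      (mult (Sum.inr x) J : ℝ≥0∞) *
        (absC (coeffs c) J * posMon s (absCoord v) (lower (Sum.inr x) J)) := by
    intro J; unfold dposMon; ring
  simp_rw [h1]
  rw [← tsum_lower]
  refine tsum_congr fun J => ?_
  rw [lower_add_self, absC, hc, enorm_mul]
  have : ∀ m : ℕ, ‖(m : ℂ)‖ₑ = (m : ℝ≥0∞) := by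
    intro m
    rw [enorm_eq_nnnorm, ← ENNReal.coe_natCast, ENNReal.coe_inj, ← NNReal.coe_inj]
    simp
  rw [this, mul_assoc]
  rfl

theorem symm_add_single_inl (h : Fin n) (J : Expo jj) :
    expoEquiv.symm (J + (0, Finsupp.single (Sum.inl h) 1)) = (expoEquiv.symm J).raiseY h := by
  rw [Equiv.symm_apply_eq, expoEquiv_raiseY, Equiv.apply_symm_apply]

theorem symm_add_single_inr (σ : Bool) (j : Site jj) (J : Expo jj) :
    expoEquiv.symm (J + (0, Finsupp.single (Sum.inr (σ, j)) 1))
      = (expoEquiv.symm J).raiseZ σ j := by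
  rw [Equiv.symm_apply_eq, expoEquiv_raiseZ, Equiv.apply_symm_apply]

theorem maj_dY (s : ℝ) (c : Series jj) (v : Phase jj a p) (h : Fin n) :
    (c.dY h).maj s v = gradMaj (absC (coeffs c)) s (absCoord v) (Sum.inr (Sum.inl h)) := by
  refine maj_raise s c _ v _ fun J => ?_
  simp only [coeffs, symm_add_single_inl, Series.dY, mult, Prod.snd_add, Finsupp.add_apply,
    Finsupp.single_eq_same]
  push_cast
  rfl

theorem maj_dZ (s : ℝ) (c : Series jj) (v : Phase jj a p) (σ : Bool) (j : Site jj) :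
    (c.dZ σ j).maj s v = gradMaj (absC (coeffs c)) s (absCoord v) (Sum.inr (Sum.inr (σ, j))) := by
  refine maj_raise s c _ v _ fun J => ?_
  simp only [coeffs, symm_add_single_inr, Series.dZ, mult, Prod.snd_add, Finsupp.add_apply,
    Finsupp.single_eq_same]
  push_cast
  rfl

/-! ### The norm of the sequence space -/

theorem enorm_seq_eq (z : SeqSpace jj a p) : ‖z‖ₑ = extNorm a p fun j => ‖z.entry j‖ₑ := by
  have hs : Summable fun j : Site jj =>
      ‖z.entry j‖ ^ 2 * (Real.exp (2 * a * |((j : ℤ) : ℝ)|) * bracket j ^ (2 * p)) := z.2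
  have h1 : ‖z‖ₑ ^ 2 = (extNorm a p fun j => ‖z.entry j‖ₑ) ^ 2 := by
    rw [extNorm_eq, ellTwo_sq, ← ofReal_norm, ← ENNReal.ofReal_pow (norm_nonneg _),
      SeqSpace.norm_sq, ENNReal.ofReal_tsum_of_nonneg _ hs]
    · refine tsum_congr fun j => ?_
      rw [mul_pow, eweight_sq, ENNReal.ofReal_mul (by positivity),
        ENNReal.ofReal_pow (norm_nonneg _), ofReal_norm, mul_comm]
    · intro j
      have := bracket_pos j
      positivity
  exact le_antisymm (le_of_sq_le_sq h1.le) (le_of_sq_le_sq h1.ge)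

open Classical in
/-- The element of `ℓ^{a,p}_𝓘` with given entries (`0` if they do not form an element). -/
def seqOf (a p : ℝ) (u : Site jj → ℂ) : SeqSpace jj a p :=
  if h : u ∈ seqSubmodule jj a p then ⟨u, h⟩ else 0

theorem mem_seqSubmodule {u : Site jj → ℂ} (h : extNorm a p (fun j => ‖u j‖ₑ) ≠ ⊤) :
    u ∈ seqSubmodule jj a p := by
  have h2 : (∑' j : Site jj, ENNReal.ofReal
      (‖u j‖ ^ 2 * (Real.exp (2 * a * |((j : ℤ) : ℝ)|) * bracket j ^ (2 * p)))) ≠ ⊤ := by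
    have : (extNorm a p fun j => ‖u j‖ₑ) ^ 2 ≠ ⊤ := ENNReal.pow_ne_top h
    rw [extNorm_eq, ellTwo_sq] at this
    convert this using 3 with j
    rw [mul_pow, eweight_sq, ENNReal.ofReal_mul (by positivity),
        ENNReal.ofReal_pow (norm_nonneg _), ofReal_norm, mul_comm]
  change Summable _
  refine (ENNReal.summable_toReal h2).congr fun j => ?_
  have := bracket_pos j
  rw [ENNReal.toReal_ofReal (by positivity)]

theorem entry_seqOf {u : Site jj → ℂ} (h : extNorm a p (fun j => ‖u j‖ₑ) ≠ ⊤) (j : Site jj) :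
    (seqOf a p u).entry j = u j := by
  have : seqOf a p u = ⟨u, mem_seqSubmodule h⟩ := dif_pos (mem_seqSubmodule h)
  rw [this]
  rfl

theorem SeqSpace.ext_entry {z w : SeqSpace jj a p} (h : ∀ j, z.entry j = w.entry j) : z = w :=
  Subtype.ext (funext h)

@[simp] theorem entry_add (z w : SeqSpace jj a p) (j : Site jj) :
    (z + w).entry j = z.entry j + w.entry j := rfl

@[simp] theorem entry_smul (c : ℂ) (z : SeqSpace jj a p) (j : Site jj) :
    (c • z).entry j = c * z.entry j := rfl

@[simp] theorem entry_zero (j : Site jj) : (0 : SeqSpace jj a p).entry j = 0 := rfl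

theorem entry_basis [DecidableEq (Site jj)] (i j : Site jj) :
    (SeqSpace.basis i : SeqSpace jj a p).entry j = if j = i then 1 else 0 := by
  unfold SeqSpace.basis SeqSpace.entry
  simp [Pi.single_apply]

theorem enorm_lt_ofReal {E : Type*} [SeminormedAddCommGroup E] {z : E} {r : ℝ} :
    ‖z‖ₑ < ENNReal.ofReal r ↔ ‖z‖ < r := by
  rw [← ofReal_norm]
  refine ⟨fun h => ?_, fun h => ?_⟩
  · exact lt_of_not_ge fun h' => absurd h (not_lt.2 (ENNReal.ofReal_le_ofReal h'))
  · exact (ENNReal.ofReal_lt_ofReal_iff (lt_of_le_of_lt (norm_nonneg _) h)).2 h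

theorem mem_ballR_iff {r : ℝ} (v : Phase jj a p) :
    v ∈ ballR jj a p r ↔ absCoord v ∈ absBall jj a p r := by
  have hy : (∑ h, ‖v.y h‖ < r ^ 2) ↔ ∑ h, ‖v.y h‖ₑ < ENNReal.ofReal (r ^ 2) := by
    have : ∑ h, ‖v.y h‖ₑ = ENNReal.ofReal (∑ h, ‖v.y h‖) := by
      rw [ENNReal.ofReal_sum_of_nonneg fun _ _ => norm_nonneg _]
      simp [ofReal_norm]
    rw [this]
    refine ⟨fun h => ?_, fun h => ?_⟩
    · exact (ENNReal.ofReal_lt_ofReal_iff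
        (lt_of_le_of_lt (Finset.sum_nonneg fun _ _ => norm_nonneg _) h)).2 h
    · exact lt_of_not_ge fun h' => absurd h (not_lt.2 (ENNReal.ofReal_le_ofReal h'))
  unfold ballR absBall
  rw [Set.mem_ofPred_eq, Set.mem_ofPred_eq, hy, ← enorm_lt_ofReal, ← enorm_lt_ofReal,
    enorm_seq_eq, enorm_seq_eq, Bool.forall_bool, and_comm (a := extNorm _ _ _ < _)]
  rfl

theorem exists_absCoord {r : ℝ} {w : Var jj → ℝ≥0∞} (hw : w ∈ absBall jj a p r) :
    ∃ v : Phase jj a p, absCoord v = w ∧ v.x = 0 := by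
  have hfy : ∀ h, w (Sum.inl h) ≠ ⊤ := fun h =>
    ((Finset.single_le_sum (f := fun h => w (Sum.inl h)) (fun _ _ => zero_le)
      (Finset.mem_univ h)).trans_lt (hw.1.trans ENNReal.ofReal_lt_top)).ne
  have hfz : ∀ σ j, w (Sum.inr (σ, j)) ≠ ⊤ := by
    intro σ j h
    have := (le_extNorm (a := a) (p := p) (fun j => w (Sum.inr (σ, j))) j).trans_lt
      ((hw.2 σ).trans ENNReal.ofReal_lt_top)
    rw [h, ENNReal.mul_top (eweight_ne_zero _)] at this
    exact absurd this (lt_irrefl _)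
  have hen : ∀ x : ℝ≥0∞, x ≠ ⊤ → ‖((x.toReal : ℝ) : ℂ)‖ₑ = x := by
    intro x hx
    rw [← ofReal_norm, Complex.norm_real, Real.norm_of_nonneg ENNReal.toReal_nonneg,
      ENNReal.ofReal_toReal hx]
  have hmem : ∀ σ, extNorm a p (fun j : Site jj => ‖(((w (Sum.inr (σ, j))).toReal : ℝ) : ℂ)‖ₑ) ≠ ⊤ := by
    intro σ
    simp_rw [hen _ (hfz _ _)]
    exact ((hw.2 σ).trans ENNReal.ofReal_lt_top).ne
  refine ⟨(0, fun h => ((w (Sum.inl h)).toReal : ℂ),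
    seqOf a p fun j => ((w (Sum.inr (true, j))).toReal : ℂ),
    seqOf a p fun j => ((w (Sum.inr (false, j))).toReal : ℂ)), ?_, rfl⟩
  funext x
  rcases x with h | ⟨σ, j⟩
  · exact hen _ (hfy h)
  · cases σ
    · simp only [absCoord, coord, Phase.z, Bool.false_eq_true, if_false]
      rw [entry_seqOf (hmem false), hen _ (hfz _ _)]
    · simp only [absCoord, coord, Phase.z, if_true]
      rw [entry_seqOf (hmem true), hen _ (hfz _ _)]

/-- The majorant norm of a series, in terms of its coefficients. -/
theorem vfNorm_eq (s r : ℝ) (c : Series jj) :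
    vfNorm a p s r c = majNorm a p s r s r (absC (coeffs c)) := by
  have hval : ∀ v : Phase jj a p, (⨆ h, (c.dY h).maj s v) / ENNReal.ofReal s
      + (∑ h, (c.dX h).maj s v) / ENNReal.ofReal (r ^ 2)
      + extNorm a p (fun j => (c.dZ false j).maj s v) / ENNReal.ofReal r
      + extNorm a p (fun j => (c.dZ true j).maj s v) / ENNReal.ofReal r
      = vecNorm a p s r (gradMaj (absC (coeffs c)) s (absCoord v)) := by
    intro v
    simp only [maj_dX, maj_dY, maj_dZ, vecNorm]
  unfold vfNorm
  simp only [hval]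
  refine le_antisymm (iSup₂_le fun v hv => le_majNorm ((mem_ballR_iff v).1 hv) _)
    (iSup₂_le fun w hw => ?_)
  obtain ⟨v, rfl, -⟩ := exists_absCoord hw
  exact le_iSup₂ (f := fun v (_ : v ∈ ballR jj a p r) =>
    vecNorm a p s r (gradMaj (absC (coeffs c)) s (absCoord v))) v ((mem_ballR_iff v).2 hw)

/-- Changing the normalisation of the norm of vectors. -/
theorem vecNorm_le_max_mul {s r s' r' : ℝ} (hs0 : 0 < s) (hs : 0 < s') (hr : 0 < r') (hr2 : r' ≤ r)
    (g : Dir jj → ℝ≥0∞) :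
    vecNorm a p s' r' g ≤ ENNReal.ofReal (max (s / s') ((r / r') ^ 2)) * vecNorm a p s r g := by
  have hM : ∀ (x : ℝ≥0∞) (t t' : ℝ), 0 < t → 0 < t' → t / t' ≤ max (s / s') ((r / r') ^ 2) →
      x / ENNReal.ofReal t' ≤ ENNReal.ofReal (max (s / s') ((r / r') ^ 2)) *
        (x / ENNReal.ofReal t) := by
    intro x t t' ht ht' h
    rw [div_eq_mul_inv x, div_eq_mul_inv x, mul_left_comm]
    refine mul_le_mul' le_rfl ?_
    rw [← ENNReal.ofReal_inv_of_pos ht, ← ENNReal.ofReal_inv_of_pos ht',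
      ← ENNReal.ofReal_mul ((by positivity : 0 ≤ t / t').trans h)]
    apply ENNReal.ofReal_le_ofReal
    calc t'⁻¹ = t / t' * t⁻¹ := by field_simp
      _ ≤ _ := by gcongr
  have hr1 : 1 ≤ r / r' := by rwa [le_div_iff₀ hr, one_mul]
  have hrr : r / r' ≤ max (s / s') ((r / r') ^ 2) :=
    le_trans (by nlinarith) (le_max_right _ _)
  unfold vecNorm
  simp only [mul_add]
  have hr0 : 0 < r := hr.trans_le hr2
  refine add_le_add (add_le_add (add_le_add ?_ ?_) ?_) ?_
  · exact hM _ _ _ hs0 hs (le_max_left _ _)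
  · exact hM _ _ _ (pow_pos hr0 2) (pow_pos hr 2) (by rw [← div_pow]; exact le_max_right _ _)
  · exact hM _ _ _ hr0 hr hrr
  · exact hM _ _ _ hr0 hr hrr

theorem majNorm_le_max_mul {s r s' r' σ ρ : ℝ} (hs0 : 0 < s) (hs : 0 < s') (hr : 0 < r') (hr2 : r' ≤ r)
    (A : Expo jj → ℝ≥0∞) :
    majNorm a p s' r' σ ρ A
      ≤ ENNReal.ofReal (max (s / s') ((r / r') ^ 2)) * majNorm a p s r σ ρ A :=
  iSup₂_le fun _ hw => (vecNorm_le_max_mul hs0 hs hr hr2 _).trans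
    (mul_le_mul' le_rfl (le_majNorm hw A))

/-! ### Second order Cauchy estimates -/

/-- Second order Taylor estimate for a bounded holomorphic function on the unit disc. -/
theorem norm_taylor_le {f : ℂ → ℂ} {M : ℝ} (hf : Differentiable ℂ f)
    (hM : ∀ t, ‖t‖ ≤ 1 → ‖f t‖ ≤ M) :
    ‖deriv f 0‖ ≤ M ∧ ∀ t, ‖t‖ ≤ 1 / 2 → ‖f t - f 0 - t * deriv f 0‖ ≤ 16 * M * ‖t‖ ^ 2 := by
  have hdf : Differentiable ℂ (deriv f) := fun z =>
    ((hf.analyticAt z).deriv).differentiableAt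
  have h1 : ∀ z : ℂ, ‖z‖ ≤ 3 / 4 → ‖deriv f z‖ ≤ 4 * M := by
    intro z hz
    have := Complex.norm_deriv_le_of_forall_mem_sphere_norm_le (c := z) (R := 1 / 4) (C := M)
      (by norm_num) hf.diffContOnCl (fun t ht => hM t (by
        have h2 : ‖t - z‖ = 1 / 4 := by simpa [dist_eq_norm] using ht
        calc ‖t‖ = ‖z + (t - z)‖ := by congr 1; ring
          _ ≤ ‖z‖ + ‖t - z‖ := norm_add_le _ _
          _ ≤ 1 := by linarith))
    linarith
  have h2 : ∀ z : ℂ, ‖z‖ ≤ 1 / 2 → ‖deriv (deriv f) z‖ ≤ 16 * M := by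
    intro z hz
    have := Complex.norm_deriv_le_of_forall_mem_sphere_norm_le (c := z) (R := 1 / 4) (C := 4 * M)
      (by norm_num) hdf.diffContOnCl (fun t ht => h1 t (by
        have h2 : ‖t - z‖ = 1 / 4 := by simpa [dist_eq_norm] using ht
        calc ‖t‖ = ‖z + (t - z)‖ := by congr 1; ring
          _ ≤ ‖z‖ + ‖t - z‖ := norm_add_le _ _
          _ ≤ 3 / 4 := by linarith))
    linarith
  refine ⟨?_, fun t ht => ?_⟩
  · have := Complex.norm_deriv_le_of_forall_mem_sphere_norm_le (c := (0 : ℂ)) (R := 1) (C := M)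
      (by norm_num) hf.diffContOnCl (fun t ht => hM t (by simpa using (by simpa using ht : ‖t‖ = 1).le))
    simpa using this
  have hM0 : 0 ≤ M := (norm_nonneg _).trans (hM 0 (by simp))
  have h3 : ∀ z ∈ Metric.closedBall (0 : ℂ) ‖t‖, ‖deriv f z - deriv f 0‖ ≤ 16 * M * ‖t‖ := by
    intro z hz
    have hz' : ‖z‖ ≤ ‖t‖ := by simpa using hz
    have := Convex.norm_image_sub_le_of_norm_deriv_le (𝕜 := ℂ) (f := deriv f) (C := 16 * M)
      (s := Metric.closedBall 0 ‖t‖) (x := 0) (y := z) (fun x _ => hdf x)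
      (fun x hx => h2 x ((by simpa using hx : ‖x‖ ≤ ‖t‖).trans ht)) (convex_closedBall _ _)
      (by simp) hz
    refine this.trans ?_
    rw [sub_zero]
    gcongr
  have h4 := Convex.norm_image_sub_le_of_norm_deriv_le (𝕜 := ℂ)
      (f := fun z => f z - z * deriv f 0) (C := 16 * M * ‖t‖)
      (s := Metric.closedBall 0 ‖t‖) (x := 0) (y := t)
      (fun x _ => (hf x).sub (differentiableAt_fun_id.mul_const _))
      (fun x hx => by
        have : deriv (fun z => f z - z * deriv f 0) x = deriv f x - deriv f 0 := by
          rw [deriv_fun_sub (hf x) (differentiableAt_fun_id.mul_const _), deriv_mul_const_field]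
          simp
        rw [this]; exact h3 x hx) (convex_closedBall _ _)
      (by simp) (by simp)
  calc ‖f t - f 0 - t * deriv f 0‖ = ‖f t - t * deriv f 0 - (f 0 - 0 * deriv f 0)‖ := by
        congr 1; ring
    _ ≤ _ := h4
    _ = _ := by rw [sub_zero]; ring

/-- The same estimate along a complex line, with bounds in `[0, ∞]`. -/
theorem enorm_taylor_le {E : Type*} [NormedAddCommGroup E] [NormedSpace ℂ E] {P : E → ℂ}
    (hP : Differentiable ℂ P) {v u : E} {B : ℝ≥0∞}
    (hB : ∀ t : ℂ, ‖t‖ ≤ 1 → ‖P (v + t • u)‖ₑ ≤ B) :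
    ‖fderiv ℂ P v u‖ₑ ≤ B ∧ ∀ t : ℂ, ‖t‖ ≤ 1 / 2 →
      ‖P (v + t • u) - P v - t * fderiv ℂ P v u‖ₑ ≤ 16 * ENNReal.ofReal (‖t‖ ^ 2) * B := by
  by_cases hBt : B = ⊤
  · refine ⟨by simp [hBt], fun t _ => ?_⟩
    by_cases ht : t = 0
    · simp [ht]
    · rw [hBt, ENNReal.mul_top]
      · exact le_top
      · simp [ht]
  have hline : ∀ t : ℂ, HasDerivAt (fun t : ℂ => v + t • u) u t := fun t => by
    simpa using ((hasDerivAt_id t).smul_const u).const_add v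
  have hf : Differentiable ℂ fun t : ℂ => P (v + t • u) := fun t =>
    (hP _).comp t (hline t).differentiableAt
  have hd : deriv (fun t : ℂ => P (v + t • u)) 0 = fderiv ℂ P v u := by
    have h1 : HasFDerivAt P (fderiv ℂ P v) (v + (0 : ℂ) • u) := by simpa using (hP v).hasFDerivAt
    exact (h1.comp_hasDerivAt 0 (hline 0)).deriv
  have hreal : ∀ (x : ℂ) (c : ℝ), ‖x‖ ≤ c → ‖x‖ₑ ≤ ENNReal.ofReal c := fun x c h => by
    rw [← ofReal_norm]; exact ENNReal.ofReal_le_ofReal h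
  obtain ⟨h1, h2⟩ := norm_taylor_le (M := B.toReal) hf (fun t ht => by
    have := hB t ht
    rw [← ofReal_norm] at this
    exact (ENNReal.ofReal_le_iff_le_toReal hBt).1 this)
  rw [hd] at h1 h2
  refine ⟨?_, fun t ht => ?_⟩
  · simpa [ENNReal.ofReal_toReal hBt] using hreal _ _ h1
  · have h3 := h2 t ht
    simp only [zero_smul, add_zero] at h3
    refine (hreal _ _ h3).trans (le_of_eq ?_)
    rw [ENNReal.ofReal_mul (by positivity), ENNReal.ofReal_mul (by norm_num),
      ENNReal.ofReal_toReal hBt]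
    norm_num
    ring

/-! ### Geometry of the domains -/

theorem norm_x_le (u : Phase jj a p) (h : Fin n) : ‖u.x h‖ ≤ ‖u‖ :=
  (norm_le_pi_norm u.1 h).trans (norm_fst_le u)

theorem norm_y_le (u : Phase jj a p) (h : Fin n) : ‖u.y h‖ ≤ ‖u‖ :=
  (norm_le_pi_norm u.2.1 h).trans ((norm_fst_le u.2).trans (norm_snd_le u))

theorem norm_z_le (u : Phase jj a p) (σ : Bool) : ‖u.z σ‖ ≤ ‖u‖ := by
  have h : ‖u.2.2‖ ≤ ‖u‖ := (norm_snd_le u.2).trans (norm_snd_le u)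
  cases σ
  · exact (norm_snd_le u.2.2).trans h
  · exact (norm_fst_le u.2.2).trans h

theorem phase_norm_le {u : Phase jj a p} {B : ℝ} (hB : 0 ≤ B) (hx : ∀ h, ‖u.x h‖ ≤ B)
    (hy : ∀ h, ‖u.y h‖ ≤ B) (hz : ∀ σ, ‖u.z σ‖ ≤ B) : ‖u‖ ≤ B := by
  refine norm_prod_le_iff.2 ⟨(pi_norm_le_iff_of_nonneg hB).2 hx, norm_prod_le_iff.2
    ⟨(pi_norm_le_iff_of_nonneg hB).2 hy, norm_prod_le_iff.2 ⟨hz true, hz false⟩⟩⟩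

@[simp] theorem x_add (v u : Phase jj a p) (h : Fin n) : (v + u).x h = v.x h + u.x h := rfl
@[simp] theorem y_add (v u : Phase jj a p) (h : Fin n) : (v + u).y h = v.y h + u.y h := rfl
@[simp] theorem z_add (v u : Phase jj a p) (σ : Bool) : (v + u).z σ = v.z σ + u.z σ := by
  cases σ <;> rfl
@[simp] theorem x_smul (c : ℂ) (u : Phase jj a p) (h : Fin n) : (c • u).x h = c * u.x h := rfl
@[simp] theorem y_smul (c : ℂ) (u : Phase jj a p) (h : Fin n) : (c • u).y h = c * u.y h := rfl
@[simp] theorem z_smul (c : ℂ) (u : Phase jj a p) (σ : Bool) : (c • u).z σ = c • u.z σ := by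
  cases σ <;> rfl

theorem coord_add (v u : Phase jj a p) (x : Var jj) : coord (v + u) x = coord v x + coord u x := by
  rcases x with h | ⟨σ, j⟩
  · rfl
  · simp [coord]

theorem coord_smul (c : ℂ) (u : Phase jj a p) (x : Var jj) : coord (c • u) x = c * coord u x := by
  rcases x with h | ⟨σ, j⟩
  · rfl
  · simp [coord]

theorem absCoord_add_le (v u : Phase jj a p) (x : Var jj) :
    absCoord (v + u) x ≤ absCoord v x + absCoord u x := by
  simp only [absCoord, coord_add]
  exact enorm_add_le _ _

theorem absCoord_smul (c : ℂ) (u : Phase jj a p) (x : Var jj) :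
    absCoord (c • u) x = ‖c‖ₑ * absCoord u x := by
  simp only [absCoord, coord_smul, enorm_mul]

/-- Around a point of `D(s,r)` there is a ball whose points, added in modulus, stay in it. -/
theorem exists_ball_dom {s r : ℝ} {v : Phase jj a p} (hv : v ∈ dom jj a p s r) :
    ∃ ε > 0, ∀ u : Phase jj a p, ‖u‖ ≤ ε → (∀ h, |(v.x h).im| + ‖u.x h‖ < s) ∧
      (fun x => absCoord v x + absCoord u x) ∈ absBall jj a p r := by
  obtain ⟨hx, hy, hz1, hz2⟩ := hv
  have hlim : ∀ c d k : ℝ, c < d → ∀ᶠ ε in nhdsWithin (0 : ℝ) (Set.Ioi 0), c + k * ε < d := by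
    intro c d k h
    have : Filter.Tendsto (fun ε : ℝ => c + k * ε) (nhds 0) (nhds (c + k * 0)) := by
      apply Continuous.tendsto; fun_prop
    rw [mul_zero, add_zero] at this
    exact (this.mono_left nhdsWithin_le_nhds).eventually (gt_mem_nhds h)
  have h1 : ∀ᶠ ε in nhdsWithin (0 : ℝ) (Set.Ioi 0), ∀ h, |(v.x h).im| + 1 * ε < s :=
    Filter.eventually_all.2 fun h => hlim _ _ 1 (hx h)
  obtain ⟨ε, ⟨⟨⟨h1, h2⟩, h3⟩, h4⟩, hε⟩ := ((((h1.and (hlim _ _ n hy)).and (hlim _ _ 1 hz1)).and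
    (hlim _ _ 1 hz2)).and self_mem_nhdsWithin).exists
  refine ⟨ε, hε, fun u hu => ⟨fun h => ?_, ?_, ?_⟩⟩
  · exact lt_of_le_of_lt (add_le_add le_rfl (by simpa using (norm_x_le u h).trans hu)) (h1 h)
  · have hs : ∑ h, (‖v.y h‖ + ‖u.y h‖) < r ^ 2 := by
      rw [Finset.sum_add_distrib]
      refine lt_of_le_of_lt (add_le_add le_rfl ?_) h2
      calc ∑ h, ‖u.y h‖ ≤ ∑ _h : Fin n, ε := Finset.sum_le_sum fun h _ => (norm_y_le u h).trans hu
        _ = _ := by simp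
    have h0 : (0 : ℝ) < r ^ 2 := lt_of_le_of_lt (Finset.sum_nonneg fun _ _ => by positivity) hs
    rw [← ENNReal.ofReal_lt_ofReal_iff h0,
      ENNReal.ofReal_sum_of_nonneg fun _ _ => by positivity] at hs
    refine lt_of_le_of_lt (le_of_eq (Finset.sum_congr rfl fun h _ => ?_)) hs
    rw [ENNReal.ofReal_add (norm_nonneg _) (norm_nonneg _), ofReal_norm,
      ofReal_norm]
    rfl
  · intro σ
    refine lt_of_le_of_lt (extNorm_add _ _) ?_
    have : ‖v.z σ‖ + ‖u.z σ‖ < r := by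
      refine lt_of_le_of_lt (add_le_add le_rfl ((norm_z_le u σ).trans hu)) ?_
      cases σ
      · simpa using h4
      · simpa using h3
    have h0 : 0 < r := lt_of_le_of_lt (by positivity) this
    rw [← ENNReal.ofReal_lt_ofReal_iff h0, ENNReal.ofReal_add (norm_nonneg _) (norm_nonneg _),
      ofReal_norm, ofReal_norm, enorm_seq_eq, enorm_seq_eq] at this
    exact this

theorem add_mem_dom {s r : ℝ} {v u : Phase jj a p} (h1 : ∀ h, |(v.x h).im| + ‖u.x h‖ < s)
    (h2 : (fun x => absCoord v x + absCoord u x) ∈ absBall jj a p r) : v + u ∈ dom jj a p s r := by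
  refine ⟨fun h => lt_of_le_of_lt ?_ (h1 h), (mem_ballR_iff _).2
    (absBall_of_le (absCoord_add_le v u) h2)⟩
  simp only [x_add, Complex.add_im]
  exact (abs_add_le _ _).trans (add_le_add le_rfl (Complex.abs_im_le_norm _))

theorem isOpen_dom (s r : ℝ) : IsOpen (dom jj a p s r) := by
  rw [Metric.isOpen_iff]
  intro v hv
  obtain ⟨ε, hε, h⟩ := exists_ball_dom hv
  refine ⟨ε, hε, fun w hw => ?_⟩
  have hw' : ‖w - v‖ ≤ ε := by simpa [dist_eq_norm] using (Metric.mem_ball.1 hw).le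
  have := add_mem_dom (h _ hw').1 (h _ hw').2
  simpa using this

/-! ### Monomials as functions on the phase space -/

/-- The entries of a sequence as continuous functionals. -/
def entryCLM (a p : ℝ) (j : Site jj) : SeqSpace jj a p →L[ℂ] ℂ :=
  LinearMap.mkContinuous ⟨⟨fun z => z.entry j, fun _ _ => rfl⟩, fun _ _ => rfl⟩ (weight a p j)⁻¹
    (fun z => by
      have h := le_extNorm (a := a) (p := p) (fun j => ‖z.entry j‖ₑ) j
      rw [← enorm_seq_eq, eweight, ← ofReal_norm, ← ofReal_norm,
        ← ENNReal.ofReal_mul (weight_pos a p j).le,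
        ENNReal.ofReal_le_ofReal_iff (norm_nonneg _)] at h
      change ‖z.entry j‖ ≤ _
      rw [inv_mul_eq_div, le_div_iff₀ (weight_pos a p j), mul_comm]
      exact h)

@[simp] theorem entryCLM_apply (j : Site jj) (z : SeqSpace jj a p) :
    entryCLM a p j z = z.entry j := rfl

theorem differentiable_coord (x : Var jj) :
    Differentiable ℂ fun v : Phase jj a p => coord v x := by
  rcases x with h | ⟨σ, j⟩
  · change Differentiable ℂ fun v : Phase jj a p => v.2.1 h
    fun_prop
  · cases σ
    · change Differentiable ℂ fun v : Phase jj a p => entryCLM a p j v.2.2.2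
      fun_prop
    · change Differentiable ℂ fun v : Phase jj a p => entryCLM a p j v.2.2.1
      fun_prop

theorem differentiable_expMon (J : Expo jj) :
    Differentiable ℂ fun v : Phase jj a p => expMon v J := by
  unfold expMon Finsupp.prod
  refine Differentiable.mul ?_ ?_
  · change Differentiable ℂ fun v : Phase jj a p =>
      Complex.exp (Complex.I * ∑ h, (J.1 h : ℂ) * v.1 h)
    fun_prop
  · have h : ∀ x, Differentiable ℂ fun v : Phase jj a p => coord v x ^ J.2 x :=
      fun x => (differentiable_coord x).fun_pow _
    induction J.2.support using Finset.cons_induction with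
    | empty => simp
    | cons i S hi ih =>
      simp only [Finset.prod_cons]
      exact (h i).mul ih

theorem expMon_add (v : Phase jj a p) (J K : Expo jj) :
    expMon v (J + K) = expMon v J * expMon v K := by
  classical
  unfold expMon
  simp only [Prod.fst_add, Prod.snd_add]
  rw [Finsupp.prod_add_index' (by simp) (by intros; exact pow_add _ _ _), mul_mul_mul_comm,
    ← Complex.exp_add]
  congr 2
  rw [← mul_add, ← Finset.sum_add_distrib]
  congr 1
  exact Finset.sum_congr rfl fun h _ => by simp [add_mul]

theorem enorm_expMon_le {σ : ℝ} {v : Phase jj a p} (hv : ∀ h, |(v.x h).im| ≤ σ)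
    {w : Var jj → ℝ≥0∞} (hw : ∀ x, absCoord v x ≤ w x) (J : Expo jj) :
    ‖expMon v J‖ₑ ≤ posMon σ w J := by
  refine le_trans ?_ (posMon_mono le_rfl hw J)
  unfold expMon posMon
  rw [enorm_mul]
  refine mul_le_mul' ?_ ?_
  · rw [← ofReal_norm, Complex.norm_exp]
    apply ENNReal.ofReal_le_ofReal
    apply Real.exp_le_exp.2
    have : (Complex.I * ∑ h, (J.1 h : ℂ) * v.x h).re = ∑ h, -((J.1 h : ℝ) * (v.x h).im) := by
      rw [Complex.I_mul_re, Complex.im_sum, ← Finset.sum_neg_distrib]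
      refine Finset.sum_congr rfl fun h _ => ?_
      simp [Complex.mul_im]
    rw [this, kabs, Nat.cast_sum, Finset.sum_mul]
    refine Finset.sum_le_sum fun h _ => ?_
    calc -((J.1 h : ℝ) * (v.x h).im) ≤ |(J.1 h : ℝ) * (v.x h).im| := neg_le_abs _
      _ ≤ _ := by
        rw [abs_mul, Nat.cast_natAbs, Int.cast_abs]
        exact mul_le_mul_of_nonneg_left (hv h) (abs_nonneg _)
  · unfold Finsupp.prod
    refine le_of_eq ?_
    induction J.2.support using Finset.cons_induction with
    | empty => simp
    | cons i S hi ih => rw [Finset.prod_cons, Finset.prod_cons, enorm_mul, ih, enorm_pow]; rfl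

/-- The basis vector of a direction. -/
def eDir (a p : ℝ) : Dir jj → Phase jj a p
  | Sum.inl h => Phase.eX h
  | Sum.inr (Sum.inl h) => Phase.eY h
  | Sum.inr (Sum.inr (σ, j)) => Phase.eZ σ j

theorem coord_eDir [DecidableEq (Var jj)] (x y : Var jj) :
    coord (eDir a p (Sum.inr x)) y = if y = x then 1 else 0 := by
  classical
  rcases x with h | ⟨σ, j⟩ <;> rcases y with h' | ⟨τ, i⟩
  · simp [eDir, coord, Phase.eY, Phase.y, Pi.single_apply]
  · cases τ <;> simp [eDir, coord, Phase.eY, Phase.z]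
  · cases σ <;> simp [eDir, coord, Phase.eZ, Phase.y]
  · cases σ <;> cases τ <;> simp [eDir, coord, Phase.eZ, Phase.z, entry_basis]

theorem coord_eDir_inl (h : Fin n) (y : Var jj) : coord (eDir a p (Sum.inl h)) y = 0 := by
  rcases y with h' | ⟨τ, i⟩
  · rfl
  · cases τ <;> rfl

theorem x_eDir_inr (x : Var jj) (h : Fin n) : (eDir a p (Sum.inr x)).x h = 0 := by
  rcases x with h | ⟨σ, j⟩
  · rfl
  · cases σ <;> rfl

/-- The derivative of a monomial in a coordinate direction. -/
theorem fderiv_expMon (v : Phase jj a p) (J : Expo jj) (d : Dir jj) :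
    fderiv ℂ (fun v : Phase jj a p => expMon v J) v (eDir a p d)
      = cmult d J * expMon v (lower d J) := by
  classical
  have hline : HasDerivAt (fun t : ℂ => v + t • eDir a p d) (eDir a p d) 0 := by
    simpa using ((hasDerivAt_id (0 : ℂ)).smul_const (eDir a p d)).const_add v
  have h1 : HasFDerivAt (fun v : Phase jj a p => expMon v J)
      (fderiv ℂ (fun v : Phase jj a p => expMon v J) v) (v + (0 : ℂ) • eDir a p d) := by
    simpa using (differentiable_expMon J v).hasFDerivAt
  have h2 := h1.comp_hasDerivAt 0 hline
  refine h2.unique ?_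
  rcases d with h | x
  · have h3 : ((fun v : Phase jj a p => expMon v J) ∘ fun t : ℂ => v + t • eDir a p (Sum.inl h))
        = fun t : ℂ => Complex.exp (Complex.I * J.1 h * t) * expMon v J := by
      funext t
      simp only [Function.comp, expMon, coord_add, coord_smul, coord_eDir_inl, mul_zero, add_zero,
        x_add, x_smul, mul_add, Finset.sum_add_distrib, Complex.exp_add]
      have : ∑ i, (J.1 i : ℂ) * (t * (eDir a p (Sum.inl h) : Phase jj a p).x i) = J.1 h * t := by
        rw [Finset.sum_eq_single h]
        · simp [eDir, Phase.eX, Phase.x]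
        · intro i _ hi
          simp [eDir, Phase.eX, Phase.x, Pi.single_apply, hi]
        · simp
      rw [this, mul_comm (Complex.exp _) (Complex.exp (Complex.I * (J.1 h * t))), ← mul_assoc,
        mul_assoc]
    rw [h3]
    have h4 := (((hasDerivAt_id (0 : ℂ)).const_mul (Complex.I * J.1 h)).cexp).mul_const (expMon v J)
    simpa [cmult, lower] using h4
  · have h3 : ((fun v : Phase jj a p => expMon v J) ∘ fun t : ℂ => v + t • eDir a p (Sum.inr x))
        = fun t : ℂ => (coord v x + t) ^ J.2 x * (Complex.exp (Complex.I * ∑ h, (J.1 h : ℂ) * v.x h)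
          * (J.2.erase x).prod fun y e => coord v y ^ e) := by
      funext t
      simp only [Function.comp, expMon, x_add, x_smul, x_eDir_inr, mul_zero, add_zero]
      rw [← Finsupp.mul_prod_erase' J.2 x _ (by simp)]
      have : ((J.2.erase x).prod fun y e => coord (v + t • eDir a p (Sum.inr x)) y ^ e)
          = (J.2.erase x).prod fun y e => coord v y ^ e := by
        refine Finset.prod_congr rfl fun y hy => ?_
        have hyx : y ≠ x := by
          rintro rfl; simp at hy
        simp [coord_add, coord_smul, coord_eDir, hyx]
      rw [this]
      simp only [coord_add, coord_smul, coord_eDir, if_true, mul_one]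
      ring
    rw [h3]
    have h4 := ((((hasDerivAt_id (0 : ℂ)).const_add (coord v x)).pow (J.2 x)).mul_const
      (Complex.exp (Complex.I * ∑ h, (J.1 h : ℂ) * v.x h)
          * (J.2.erase x).prod fun y e => coord v y ^ e))
    refine HasDerivAt.congr_deriv h4 (Eq.symm ?_)
    simp only [cmult, lower, expMon, id, add_zero, mul_one]
    rw [← Finsupp.mul_prod_erase' (J.2 - Finsupp.single x 1) x _ (by simp)]
    have : (J.2 - Finsupp.single x 1).erase x = J.2.erase x := by
      ext y
      by_cases hy : y = x
      · simp [hy]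
      · simp [Finsupp.erase_ne hy, Finsupp.single_apply, Ne.symm hy]
    rw [this]
    simp only [Finsupp.coe_tsub, Pi.sub_apply, Finsupp.single_eq_same]
    ring

/-! ### Differentiation of expansions -/

theorem summable_of_tsum_enorm {ι : Type*} {f : ι → ℂ} (h : ∑' i, ‖f i‖ₑ ≠ ⊤) : Summable f := by
  refine Summable.of_norm ?_
  refine (ENNReal.summable_toReal h).congr fun i => ?_
  simp

theorem enorm_tsum_le_of_le {ι : Type*} {f : ι → ℂ} {B : ι → ℝ≥0∞} (h : ∀ i, ‖f i‖ₑ ≤ B i) :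
    ‖∑' i, f i‖ₑ ≤ ∑' i, B i :=
  enorm_tsum_le_tsum_enorm.trans (ENNReal.tsum_le_tsum h)

/-- A function that satisfies a second order Taylor estimate is differentiable. -/
theorem exists_hasFDerivAt_of_quadratic {E F : Type*} [NormedAddCommGroup E] [NormedSpace ℂ E]
    [NormedAddCommGroup F] [NormedSpace ℂ F] {f : E → F} (L : E →ₗ[ℂ] F) {v : E} {ε K : ℝ}
    (hε : 0 < ε) (hL : ∀ u, ‖u‖ ≤ ε → ‖L u‖ ≤ K)
    (hq : ∀ u, ‖u‖ ≤ ε → ∀ t : ℂ, ‖t‖ ≤ 1 / 2 →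
      ‖f (v + t • u) - f v - t • L u‖ ≤ 16 * ‖t‖ ^ 2 * K) :
    ∃ L' : E →L[ℂ] F, (∀ u, L' u = L u) ∧ HasFDerivAt f L' v := by
  have hscale : ∀ u : E, u ≠ 0 → ‖((ε / ‖u‖ : ℝ) : ℂ) • u‖ ≤ ε := by
    intro u hu
    have : 0 < ‖u‖ := norm_pos_iff.2 hu
    rw [norm_smul, Complex.norm_real, Real.norm_of_nonneg (by positivity)]
    field_simp
    exact le_rfl
  have hunit : ∀ u : E, u ≠ 0 → ((‖u‖ / ε : ℝ) : ℂ) • ((ε / ‖u‖ : ℝ) : ℂ) • u = u := by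
    intro u hu
    have : 0 < ‖u‖ := norm_pos_iff.2 hu
    rw [smul_smul, ← Complex.ofReal_mul, div_mul_div_cancel₀ hε.ne', div_self this.ne']
    simp
  have hbound : ∀ u, ‖L u‖ ≤ K / ε * ‖u‖ := by
    intro u
    by_cases hu : u = 0
    · simp [hu]
    conv_lhs => rw [← hunit u hu]
    rw [map_smul, norm_smul, Complex.norm_real, Real.norm_of_nonneg (by positivity)]
    calc _ ≤ ‖u‖ / ε * K := by gcongr; exact hL _ (hscale u hu)
      _ = _ := by ring
  refine ⟨L.mkContinuous (K / ε) hbound, fun u => rfl, ?_⟩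
  rw [hasFDerivAt_iff_isLittleO_nhds_zero]
  have hO : (fun h : E => f (v + h) - f v - (L.mkContinuous (K / ε) hbound) h)
      =O[nhds 0] fun h : E => ‖h‖ ^ 2 := by
    refine Asymptotics.IsBigO.of_bound (16 * K / ε ^ 2) ?_
    filter_upwards [Metric.ball_mem_nhds (0 : E) (half_pos hε)] with u hu
    have hu2 : ‖u‖ < ε / 2 := by simpa using hu
    by_cases h0 : u = 0
    · simp [h0]
    have := hq _ (hscale u h0) ((‖u‖ / ε : ℝ) : ℂ) (by
      rw [Complex.norm_real, Real.norm_of_nonneg (by positivity), div_le_iff₀ hε]; linarith)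
    rw [hunit u h0, ← map_smul, hunit u h0, Complex.norm_real,
      Real.norm_of_nonneg (by positivity)] at this
    refine this.trans (le_of_eq ?_)
    rw [Real.norm_of_nonneg (by positivity)]
    field_simp
  refine hO.trans_isLittleO ?_
  have := Asymptotics.isLittleO_norm_pow_id (E' := E) (n := 2) (by norm_num)
  simpa using this

/-- The expansion of a function, indexed by exponents. -/
def HasExp (σ ρ : ℝ) (H : Phase jj a p → ℂ) (c : Expo jj → ℂ) : Prop :=
  ∀ v ∈ dom jj a p σ ρ, HasSum (fun J => c J * expMon v J) (H v)

theorem hasExp_coeffs {s r : ℝ} {H : Phase jj a p → ℂ} {c : Series jj}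
    (h : IsExpansion s r H c) : HasExp s r H (coeffs c) := isExpansion_iff.1 h

theorem isExpansion_ofCoeffs {s r : ℝ} {H : Phase jj a p → ℂ} {c : Expo jj → ℂ}
    (h : HasExp s r H c) : IsExpansion s r H (ofCoeffs c) :=
  isExpansion_iff.2 (by simpa [HasExp] using h)

theorem HasExp.mono {σ ρ σ' ρ' : ℝ} {H : Phase jj a p → ℂ} {c : Expo jj → ℂ}
    (h : HasExp σ ρ H c) (hσ : σ' ≤ σ) (h0 : 0 ≤ ρ') (hρ : ρ' ≤ ρ) : HasExp σ' ρ' H c := by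
  intro v hv
  refine h v ⟨fun i => (hv.1 i).trans_le hσ, (mem_ballR_iff v).2 ?_⟩
  exact absBall_mono h0 hρ ((mem_ballR_iff v).1 hv.2)

/-- The partial derivative in the direction `d` of the sum of a series. -/
def gradC (c : Expo jj → ℂ) (v : Phase jj a p) (d : Dir jj) : ℂ :=
  ∑' J, c J * (cmult d J * expMon v (lower d J))

theorem enorm_gradC_term_le {σ : ℝ} {v : Phase jj a p} (hv : ∀ h, |(v.x h).im| ≤ σ)
    {w : Var jj → ℝ≥0∞} (hw : ∀ x, absCoord v x ≤ w x) (c : Expo jj → ℂ) (d : Dir jj)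
    (J : Expo jj) :
    ‖c J * (cmult d J * expMon v (lower d J))‖ₑ ≤ absC c J * dposMon d σ w J := by
  rw [enorm_mul, enorm_mul, enorm_cmult]
  unfold dposMon absC
  gcongr
  exact enorm_expMon_le hv hw _

theorem enorm_gradC_le {σ : ℝ} {v : Phase jj a p} (hv : ∀ h, |(v.x h).im| ≤ σ)
    {w : Var jj → ℝ≥0∞} (hw : ∀ x, absCoord v x ≤ w x) (c : Expo jj → ℂ) (d : Dir jj) :
    ‖gradC c v d‖ₑ ≤ gradMaj (absC c) σ w d :=
  enorm_tsum_le_of_le fun J => enorm_gradC_term_le hv hw c d J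

theorem ne_top_of_vecNorm {s r : ℝ} (hs : 0 < s) (hr : 0 < r) {g : Dir jj → ℝ≥0∞}
    (h : vecNorm a p s r g ≠ ⊤) (d : Dir jj) : g d ≠ ⊤ := by
  rcases d with i | i | ⟨σ, j⟩
  · exact ne_top_of_le_ne_top (ne_top_of_mul_ofReal h)
      ((Finset.single_le_sum (f := fun i => g (Sum.inl i)) (fun _ _ => zero_le)
        (Finset.mem_univ i)).trans (sum_angles_le_vecNorm hr g))
  · exact ne_top_of_le_ne_top (ne_top_of_mul_ofReal h)
      ((le_iSup (fun i => g (Sum.inr (Sum.inl i))) i).trans (iSup_actions_le_vecNorm hs g))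
  · intro hd
    have h1 := (le_extNorm (a := a) (p := p) (fun j => g (Sum.inr (Sum.inr (σ, j)))) j).trans
      (extNorm_le_vecNorm (s := s) hr g σ)
    rw [hd, ENNReal.mul_top (eweight_ne_zero _), top_le_iff] at h1
    exact ne_top_of_mul_ofReal h h1

theorem vecNorm_ne_top {s r σ ρ : ℝ} {A : Expo jj → ℝ≥0∞} (hA : majNorm a p s r σ ρ A ≠ ⊤)
    {w : Var jj → ℝ≥0∞} (hw : w ∈ absBall jj a p ρ) :
    vecNorm a p s r (gradMaj A σ w) ≠ ⊤ := ne_top_of_le_ne_top hA (le_majNorm hw A)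

section frechet

variable {s r σ ρ : ℝ}

/-- The sum of an expansion with finite majorant norm is Fréchet differentiable, and its
derivative is the termwise derivative. -/
theorem HasExp.exists_hasFDerivAt (ha : 0 ≤ a) (hp : 0 ≤ p) (hs : 0 < s) (hr : 0 < r)
    {H : Phase jj a p → ℂ} {c : Expo jj → ℂ} (hH : HasExp σ ρ H c)
    (hc : majNorm a p s r σ ρ (absC c) ≠ ⊤) {v : Phase jj a p} (hv : v ∈ dom jj a p σ ρ) :
    ∃ L : Phase jj a p →L[ℂ] ℂ,
      (∀ u, L u = ∑' J, c J * fderiv ℂ (fun v : Phase jj a p => expMon v J) v u) ∧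
      HasFDerivAt H L v := by
  obtain ⟨ε, hε, hball⟩ := exists_ball_dom hv
  set K : ℝ≥0∞ := absC c 0 + (ENNReal.ofReal (r ^ 2) + (ENNReal.ofReal (ρ ^ 2) * ENNReal.ofReal s +
      2 * (ENNReal.ofReal ρ * ENNReal.ofReal r))) * majNorm a p s r σ ρ (absC c) with hK
  have hKt : K ≠ ⊤ := by
    refine ENNReal.add_ne_top.2 ⟨enorm_ne_top, ENNReal.mul_ne_top ?_ hc⟩
    simp [ENNReal.mul_eq_top]
  have hval : ∀ u : Phase jj a p, ‖u‖ ≤ ε →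
      ∑' J, absC c J * posMon σ (fun x => absCoord v x + absCoord u x) J ≤ K :=
    fun u hu => valMaj_le_majNorm ha hp hr hs _ (hball u hu).2
  have hmem : ∀ u : Phase jj a p, ‖u‖ ≤ ε → ∀ t : ℂ, ‖t‖ ≤ 1 → v + t • u ∈ dom jj a p σ ρ := by
    intro u hu t ht
    have h1 : ‖t • u‖ ≤ ε := by
      rw [norm_smul]; exact (mul_le_of_le_one_left (norm_nonneg _) ht).trans hu
    exact add_mem_dom (hball _ h1).1 (hball _ h1).2
  have hterm : ∀ u : Phase jj a p, ‖u‖ ≤ ε → ∀ J, ∀ t : ℂ, ‖t‖ ≤ 1 →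
      ‖expMon (v + t • u) J‖ₑ ≤ posMon σ (fun x => absCoord v x + absCoord u x) J := by
    intro u hu J t ht
    refine enorm_expMon_le (fun h => ((hmem u hu t ht).1 h).le) (fun x => ?_) J
    refine (absCoord_add_le _ _ x).trans (add_le_add le_rfl ?_)
    rw [absCoord_smul]
    refine mul_le_of_le_one_left' ?_
    rw [← ofReal_norm]
    exact ENNReal.ofReal_le_one.2 ht
  have htay := fun (u : Phase jj a p) (hu : ‖u‖ ≤ ε) (J : Expo jj) =>
    enorm_taylor_le (differentiable_expMon J) (hterm u hu J)
  have hsmall : ∀ u : Phase jj a p, ‖u‖ ≤ ε →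
      ∑' J, ‖c J * fderiv ℂ (fun v : Phase jj a p => expMon v J) v u‖ₑ ≤ K := by
    intro u hu
    refine le_trans (ENNReal.tsum_le_tsum fun J => ?_) (hval u hu)
    rw [enorm_mul]
    exact mul_le_mul' le_rfl (htay u hu J).1
  have hsum : ∀ u : Phase jj a p,
      Summable fun J => c J * fderiv ℂ (fun v : Phase jj a p => expMon v J) v u := by
    intro u
    have hpos : 0 < ‖u‖ + 1 := by positivity
    have h1 : ‖((ε / (‖u‖ + 1) : ℝ) : ℂ) • u‖ ≤ ε := by
      rw [norm_smul, Complex.norm_real, Real.norm_of_nonneg (by positivity), div_mul_eq_mul_div,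
        div_le_iff₀ hpos]
      nlinarith [norm_nonneg u]
    have h2 := (summable_of_tsum_enorm (ne_top_of_le_ne_top hKt (hsmall _ h1))).mul_left
      (((‖u‖ + 1) / ε : ℝ) : ℂ)
    refine h2.congr fun J => ?_
    rw [map_smul, smul_eq_mul, mul_left_comm, ← mul_assoc _ _ ((fderiv ℂ _ v) u), ← mul_assoc,
      ← Complex.ofReal_mul, mul_comm (c J)]
    have : (‖u‖ + 1) / ε * (ε / (‖u‖ + 1)) = 1 := by field_simp
    rw [this, Complex.ofReal_one, one_mul]
  let L : Phase jj a p →ₗ[ℂ] ℂ :=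
    { toFun := fun u => ∑' J, c J * fderiv ℂ (fun v : Phase jj a p => expMon v J) v u
      map_add' := fun u u' => by
        simp only [map_add, mul_add]
        exact (hsum u).tsum_add (hsum u')
      map_smul' := fun t u => by
        simp only [map_smul, smul_eq_mul, RingHom.id_apply, mul_left_comm _ t, tsum_mul_left] }
  have hL1 : ∀ u : Phase jj a p, ‖u‖ ≤ ε → ‖L u‖ ≤ K.toReal := by
    intro u hu
    have := enorm_tsum_le_tsum_enorm.trans (hsmall u hu)
    rw [← ofReal_norm] at this
    exact (ENNReal.ofReal_le_iff_le_toReal hKt).1 this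
  have hq : ∀ u : Phase jj a p, ‖u‖ ≤ ε → ∀ t : ℂ, ‖t‖ ≤ 1 / 2 →
      ‖H (v + t • u) - H v - t • L u‖ ≤ 16 * ‖t‖ ^ 2 * K.toReal := by
    intro u hu t ht
    have ht1 : ‖t‖ ≤ 1 := ht.trans (by norm_num)
    have h1 := hH _ (hmem u hu t ht1)
    have h2 := hH v hv
    have h3 := (h1.sub h2).sub ((hsum u).hasSum.mul_left t)
    have h4 : ‖H (v + t • u) - H v - t • L u‖ₑ ≤ ENNReal.ofReal (16 * ‖t‖ ^ 2 * K.toReal) := by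
      rw [smul_eq_mul]
      change ‖H (v + t • u) - H v - t *
        ∑' J, c J * fderiv ℂ (fun v : Phase jj a p => expMon v J) v u‖ₑ ≤ _
      rw [← h3.tsum_eq]
      refine (enorm_tsum_le_of_le (B := fun J => 16 * ENNReal.ofReal (‖t‖ ^ 2) *
        (absC c J * posMon σ (fun x => absCoord v x + absCoord u x) J)) fun J => ?_).trans ?_
      · have := mul_le_mul' (le_refl ‖c J‖ₑ) ((htay u hu J).2 t ht)
        rw [← enorm_mul] at this
        refine le_trans (le_of_eq (congrArg _ (by ring))) (this.trans (le_of_eq ?_))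
        unfold absC
        ring
      · rw [ENNReal.tsum_mul_left]
        refine (mul_le_mul' le_rfl (hval u hu)).trans (le_of_eq ?_)
        rw [ENNReal.ofReal_mul (by positivity), ENNReal.ofReal_mul (by norm_num),
          ENNReal.ofReal_toReal hKt]
        norm_num
    rw [← ofReal_norm] at h4
    exact (ENNReal.ofReal_le_ofReal_iff (by positivity)).1 h4
  obtain ⟨L', hL', hd⟩ := exists_hasFDerivAt_of_quadratic L hε hL1 hq
  exact ⟨L', hL', hd⟩

/-- The partial derivatives of the sum of an expansion. -/
theorem HasExp.lineDeriv_eq (ha : 0 ≤ a) (hp : 0 ≤ p) (hs : 0 < s) (hr : 0 < r)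
    {H : Phase jj a p → ℂ} {c : Expo jj → ℂ} (hH : HasExp σ ρ H c)
    (hc : majNorm a p s r σ ρ (absC c) ≠ ⊤) {v : Phase jj a p} (hv : v ∈ dom jj a p σ ρ)
    (d : Dir jj) : lineDeriv ℂ H v (eDir a p d) = gradC c v d := by
  obtain ⟨L, hL, hd⟩ := hH.exists_hasFDerivAt ha hp hs hr hc hv
  rw [(hd.hasLineDerivAt _).lineDeriv, hL]
  exact tsum_congr fun J => by rw [fderiv_expMon]

end frechet

/-! ### Uniqueness of the coefficients -/

/-- The degree of a monomial for the rotation of one coordinate. -/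
def degree : Dir jj → Expo jj → ℤ
  | Sum.inl h, J => J.1 h
  | Sum.inr x, J => J.2 x

/-- Rotation by the angle `φ` of one coordinate: translation for the angles `x_h`, multiplication
by `e^{iφ}` for the other variables. -/
def rotate : Dir jj → ℝ → Phase jj a p → Phase jj a p
  | Sum.inl h, φ, v => v + (φ : ℂ) • eDir a p (Sum.inl h)
  | Sum.inr x, φ, v =>
    v + ((Complex.exp (Complex.I * φ) - 1) * coord v x) • eDir a p (Sum.inr x)

theorem coord_rotate_inr [DecidableEq (Var jj)] (x y : Var jj) (φ : ℝ) (v : Phase jj a p) :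
    coord (rotate (Sum.inr x) φ v) y
      = (if y = x then Complex.exp (Complex.I * φ) else 1) * coord v y := by
  simp only [rotate, coord_add, coord_smul, coord_eDir]
  split_ifs with h
  · subst h; ring
  · ring

theorem expMon_rotate (d : Dir jj) (φ : ℝ) (v : Phase jj a p) (J : Expo jj) :
    expMon (rotate d φ v) J = Complex.exp (Complex.I * φ * degree d J) * expMon v J := by
  classical
  rcases d with h | x
  · simp only [rotate, expMon, coord_add, coord_smul, coord_eDir_inl, mul_zero, add_zero,
        x_add, x_smul, Pi.add_apply, Pi.smul_apply, smul_eq_mul, mul_add, Finset.sum_add_distrib, Complex.exp_add, degree]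
    have : ∑ i, (J.1 i : ℂ) * (φ * (eDir a p (Sum.inl h) : Phase jj a p).x i) = J.1 h * φ := by
      rw [Finset.sum_eq_single h]
      · simp [eDir, Phase.eX, Phase.x]
      · intro i _ hi
        simp [eDir, Phase.eX, Phase.x, Pi.single_apply, hi]
      · simp
    rw [this, mul_comm (Complex.exp _) (Complex.exp (Complex.I * (J.1 h * φ))), mul_assoc]
    congr 2
    ring
  · have hx : ∀ h, (rotate (Sum.inr x) φ v).x h = v.x h := by
      intro h
      simp [rotate, x_eDir_inr]
    have h1 : (J.2.prod fun y e => coord (rotate (Sum.inr x) φ v) y ^ e)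
        = Complex.exp (Complex.I * φ * degree (Sum.inr x) J) *
          J.2.prod fun y e => coord v y ^ e := by
      rw [← Finsupp.mul_prod_erase' J.2 x _ (by simp), ← Finsupp.mul_prod_erase' J.2 x _ (by simp)]
      have : ((J.2.erase x).prod fun y e => coord (rotate (Sum.inr x) φ v) y ^ e)
          = (J.2.erase x).prod fun y e => coord v y ^ e := by
        refine Finset.prod_congr rfl fun y hy => ?_
        have hyx : y ≠ x := by
          rintro rfl; simp at hy
        simp [coord_rotate_inr, hyx]
      rw [this, coord_rotate_inr, if_pos rfl, mul_pow, ← Complex.exp_nat_mul, mul_assoc]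
      congr 2
      simp only [degree]
      push_cast
      ring
    simp only [expMon, hx, h1]
    ring

theorem rotate_mem_dom {s r : ℝ} (d : Dir jj) (φ : ℝ) {v : Phase jj a p}
    (hv : v ∈ dom jj a p s r) : rotate d φ v ∈ dom jj a p s r := by
  classical
  obtain ⟨h1, h2⟩ := hv
  rw [mem_ballR_iff] at h2
  rcases d with h | x
  · refine ⟨fun i => ?_, (mem_ballR_iff _).2 ?_⟩
    · have h3 : (eDir a p (Sum.inl h) : Phase jj a p).x i = if i = h then 1 else 0 := by
        simp [eDir, Phase.eX, Phase.x, Pi.single_apply]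
      have : ((rotate (Sum.inl h) φ v).x i).im = (v.x i).im := by
        simp only [rotate, x_add, x_smul, Pi.add_apply, Pi.smul_apply, smul_eq_mul, h3]
        split_ifs <;> simp
      rw [this]; exact h1 i
    · have h3 : absCoord (rotate (Sum.inl h) φ v) = absCoord v := by
        funext y
        rw [absCoord, absCoord]
        simp only [rotate, coord_add, coord_smul, coord_eDir_inl, mul_zero, add_zero]
      rw [h3]; exact h2
  · refine ⟨fun i => ?_, (mem_ballR_iff _).2 ?_⟩
    · simpa [rotate, x_eDir_inr] using h1 i
    · convert h2 using 1
      funext y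
      rw [absCoord, absCoord, coord_rotate_inr, enorm_mul]
      have : ‖Complex.exp (Complex.I * φ)‖ₑ = 1 := by
        rw [mul_comm, ← ofReal_norm, Complex.norm_exp_ofReal_mul_I, ENNReal.ofReal_one]
      split_ifs <;> simp [this]

open MeasureTheory in
/-- A trigonometric series that vanishes identically has vanishing homogeneous parts. -/
theorem tsum_degree_eq_zero {ι : Type*} [Countable ι] {f : ι → ℂ} (hf : Summable f) (deg : ι → ℤ)
    (h : ∀ φ : ℝ, ∑' i, f i * Complex.exp (Complex.I * φ * deg i) = 0) (m : ℤ) :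
    ∑' i, (if deg i = m then f i else 0) = 0 := by
  have hint : ∀ k : ℤ, ∫ φ : ℝ in (0 : ℝ)..(2 * Real.pi), Complex.exp (Complex.I * φ * k)
      = if k = 0 then 2 * Real.pi else 0 := by
    intro k
    split_ifs with hk
    · subst hk; simp
    · have h1 : ∀ φ : ℝ, Complex.I * φ * k = (Complex.I * k) * φ := fun φ => by ring
      simp_rw [h1]
      rw [integral_exp_mul_complex (mul_ne_zero Complex.I_ne_zero (by exact_mod_cast hk))]
      have : Complex.exp (Complex.I * k * ((2 * Real.pi : ℝ) : ℂ)) = 1 := by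
        rw [Complex.exp_eq_one_iff]
        exact ⟨k, by push_cast; ring⟩
      rw [this]; simp
  have hsum := intervalIntegral.hasSum_intervalIntegral_of_summable_norm (a := 0) (b := 2 * Real.pi)
    (f := fun i => (⟨fun φ : ℝ => f i * Complex.exp (Complex.I * φ * (deg i - m : ℤ)),
      by fun_prop⟩ : C(ℝ, ℂ)))
    (by
      refine Summable.of_nonneg_of_le (fun i => norm_nonneg _) (fun i => ?_) hf.norm
      refine (ContinuousMap.norm_le _ (norm_nonneg _)).2 fun φ => ?_
      change ‖f i * Complex.exp (Complex.I * ((φ : ℝ) : ℂ) * (deg i - m : ℤ))‖ ≤ _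
      rw [norm_mul, show Complex.I * ((φ : ℝ) : ℂ) * ((deg i - m : ℤ) : ℂ)
        = (((φ : ℝ) * (deg i - m : ℤ) : ℝ) : ℂ) * Complex.I by push_cast; ring,
        Complex.norm_exp_ofReal_mul_I, mul_one])
  have h0 : ∀ φ : ℝ, ∑' i, f i * Complex.exp (Complex.I * φ * (deg i - m : ℤ)) = 0 := by
    intro φ
    have : ∀ i, f i * Complex.exp (Complex.I * φ * (deg i - m : ℤ)) =
        f i * Complex.exp (Complex.I * φ * deg i) * Complex.exp (-(Complex.I * φ * m)) := by
      intro i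
      rw [mul_assoc (f i), ← Complex.exp_add]
      congr 2; push_cast; ring
    simp_rw [this]
    rw [tsum_mul_right, h φ, zero_mul]
  simp only [ContinuousMap.coe_mk, h0, intervalIntegral.integral_const_mul, hint] at hsum
  have h2 := hsum.tsum_eq

  have h3 : ∀ i, (f i * ((if deg i - m = 0 then 2 * Real.pi else 0 : ℝ) : ℂ))
      = (if deg i = m then f i else 0) * (2 * Real.pi) := by
    intro i
    simp only [sub_eq_zero]
    split_ifs <;> simp
  simp only [h3, intervalIntegral.integral_zero] at h2
  rw [tsum_mul_right] at h2
  have hpi : (2 * Real.pi : ℂ) ≠ 0 := by simp [Real.pi_ne_zero]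
  exact (mul_eq_zero.1 h2).resolve_right hpi

/-- For each finite set of variables there are points of the domain whose non-vanishing
coordinates are exactly those. -/
theorem exists_absBall_support {ρ : ℝ} (hρ : 0 < ρ) (S : Finset (Var jj)) :
    ∃ w ∈ absBall jj a p ρ, ∀ x, w x ≠ 0 ↔ x ∈ S := by
  classical
  set e : Var jj → ℝ≥0∞ := fun x => if x ∈ S then 1 else 0 with he
  have hfin : ∀ σ, extNorm a p (fun j => e (Sum.inr (σ, j))) ≠ ⊤ := by
    intro σ
    rw [extNorm_eq]
    have h2 : ∑' j : Site jj, (eweight a p j * e (Sum.inr (σ, j))) ^ 2 ≠ ⊤ := by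
      set T : Finset (Site jj) := S.preimage (fun j => Sum.inr (σ, j)) (injective_inr_mk σ).injOn
      rw [tsum_eq_sum (s := T)]
      · refine ENNReal.sum_ne_top.2 fun j _ => ENNReal.pow_ne_top
          (ENNReal.mul_ne_top (eweight_ne_top _) ?_)
        simp only [he]; split_ifs <;> simp
      · intro j hj
        simp only [T, Finset.mem_preimage] at hj
        simp [he, hj]
    rw [← ellTwo_sq] at h2
    intro h
    rw [h] at h2
    simp at h2
  have hlim : ∀ C D : ℝ≥0∞, C ≠ ⊤ → 0 < D →
      ∀ᶠ ε in nhdsWithin (0 : ℝ≥0∞) (Set.Ioi 0), ε * C < D := by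
    intro C D hC hD
    have h1 : Filter.Tendsto (fun ε : ℝ≥0∞ => ε * C) (nhds 0) (nhds (0 * C)) :=
      ENNReal.Tendsto.mul_const Filter.tendsto_id (Or.inr hC)
    rw [zero_mul] at h1
    exact (h1.mono_left nhdsWithin_le_nhds).eventually (gt_mem_nhds hD)
  have hne : (nhdsWithin (0 : ℝ≥0∞) (Set.Ioi 0)).NeBot :=
    nhdsGT_neBot_of_exists_gt ⟨1, one_pos⟩
  obtain ⟨ε, ⟨⟨h1, h2⟩, h3⟩, hε⟩ := (((hlim n (ENNReal.ofReal (ρ ^ 2)) (by simp)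
    (ENNReal.ofReal_pos.2 (by positivity))).and (hlim _ (ENNReal.ofReal ρ) (hfin true) (by simpa using hρ))).and
    (hlim _ (ENNReal.ofReal ρ) (hfin false) (by simpa using hρ))).and self_mem_nhdsWithin |>.exists
  have hε0 : ε ≠ 0 := (ne_of_gt hε)
  refine ⟨fun x => ε * e x, ⟨?_, ?_⟩, ?_⟩
  · rw [← Finset.mul_sum]
    refine lt_of_le_of_lt (mul_le_mul' le_rfl ?_) h1
    calc ∑ h, e (Sum.inl h) ≤ ∑ _h : Fin n, (1 : ℝ≥0∞) :=
          Finset.sum_le_sum fun h _ => by simp only [he]; split_ifs <;> simp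
      _ = n := by simp
  · intro σ
    rw [extNorm_const_mul]
    cases σ
    · exact h3
    · exact h2
  · intro x
    simp only [he]
    split_ifs with hx <;> simp [hx, hε0]

/-- The homogeneous parts of a series whose sum vanishes have vanishing sums. -/
theorem HasExp.degree_eq {σ ρ : ℝ} {c : Expo jj → ℂ}
    (hc : HasExp (a := a) (p := p) σ ρ (fun _ => 0) c) (d : Dir jj) (m : ℤ)
    :
    HasExp (a := a) (p := p) σ ρ (fun _ => 0) fun J => if degree d J = m then c J else 0 := by
  intro v hv
  have hs := (hc v hv).summable
  have h0 := tsum_degree_eq_zero hs (degree d) (fun φ => by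
    have := (hc _ (rotate_mem_dom d φ hv)).tsum_eq
    refine Eq.trans (tsum_congr fun J => ?_) this
    rw [expMon_rotate]; ring) m
  have hs2 : Summable fun J => if degree d J = m then c J * expMon v J else 0 := by
    refine Summable.of_norm (Summable.of_nonneg_of_le (fun _ => norm_nonneg _) (fun J => ?_)
      hs.norm)
    split_ifs
    · exact le_rfl
    · rw [norm_zero]; positivity
  have h1 := hs2.hasSum
  rw [h0] at h1
  refine Eq.mp (congrArg (fun F => HasSum F (0 : ℂ)) (funext fun J => ?_)) h1
  show (if degree d J = m then c J * expMon v J else 0)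
    = (if degree d J = m then c J else 0) * expMon v J
  rw [ite_mul, zero_mul]

/-- A series whose sum vanishes on a domain has vanishing coefficients. -/
theorem HasExp.eq_zero {σ ρ : ℝ} (hσ : 0 < σ) (hρ : 0 < ρ) {c : Expo jj → ℂ}
    (h : HasExp (a := a) (p := p) σ ρ (fun _ => 0) c) : c = 0 := by
  classical
  funext J₀
  have hind : ∀ Q : Finset (Dir jj), HasExp (a := a) (p := p) σ ρ (fun _ => 0)
      fun J => if ∀ d ∈ Q, degree d J = degree d J₀ then c J else 0 := by
    intro Q
    induction Q using Finset.induction_on with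
    | empty => simpa only [Finset.notMem_empty, false_imp_iff, implies_true, if_true] using h
    | insert d Q hd ih =>
      have := ih.degree_eq d (degree d J₀)
      refine Eq.mp (congrArg (fun F => HasExp (a := a) (p := p) σ ρ (fun _ => 0) F)
        (funext fun J => ?_)) this
      by_cases h1 : degree d J = degree d J₀
      · rw [if_pos h1]
        refine if_congr ?_ rfl rfl
        simp only [Finset.forall_mem_insert, h1, true_and]
      · rw [if_neg h1, if_neg]
        exact fun h2 => h1 (h2 d (Finset.mem_insert_self _ _))
  obtain ⟨w, hw, hsupp⟩ := exists_absBall_support (a := a) (p := p) hρ J₀.2.support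
  obtain ⟨v, hvw, hvx⟩ := exists_absCoord hw
  have hv : v ∈ dom jj a p σ ρ := ⟨fun i => by simp [hvx, hσ], (mem_ballR_iff v).2 (hvw ▸ hw)⟩
  have hcoord : ∀ x, coord v x ≠ 0 ↔ x ∈ J₀.2.support := by
    intro x
    rw [← hsupp, ← hvw, absCoord, ne_eq, ne_eq, enorm_eq_zero]
  obtain ⟨Q, hQ1, hQ2⟩ : ∃ Q : Finset (Dir jj), (∀ i, Sum.inl i ∈ Q) ∧
      ∀ x ∈ J₀.2.support, Sum.inr x ∈ Q :=
    ⟨Finset.univ.image Sum.inl ∪ J₀.2.support.image Sum.inr, by simp, fun x hx =>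
      Finset.mem_union_right _ (Finset.mem_image_of_mem _ hx)⟩
  have h1 := hind Q v hv
  have h2 : ∀ J, J ≠ J₀ →
      (if ∀ d ∈ Q, degree d J = degree d J₀ then c J else 0) * expMon v J = 0 := by
    intro J hJ
    split_ifs with hd
    · refine mul_eq_zero_of_right _ ?_
      have hk : J.1 = J₀.1 := funext fun i => by
        simpa [degree] using hd (Sum.inl i) (hQ1 i)
      have hm : J.2 ≠ J₀.2 := fun h => hJ (Prod.ext hk h)
      obtain ⟨x, hx⟩ := Finsupp.ne_iff.1 hm
      have hx0 : x ∉ J₀.2.support := fun hmem => hx (by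
        have := hd (Sum.inr x) (hQ2 x hmem)
        simpa [degree] using this)
      have hJx : J.2 x ≠ 0 := by
        rw [Finsupp.notMem_support_iff.1 hx0] at hx; exact hx
      refine mul_eq_zero_of_right _ (Finset.prod_eq_zero (i := x) (by simpa using hJx) ?_)
      have : coord v x = 0 := by_contra fun h => hx0 ((hcoord x).1 h)
      change coord v x ^ J.2 x = 0
      rw [this, zero_pow hJx]
    · exact zero_mul _
  have h3 := h1.unique (hasSum_single J₀ h2)
  simp only [implies_true, if_true] at h3
  refine (mul_eq_zero.1 h3.symm).resolve_right ?_
  refine mul_ne_zero (Complex.exp_ne_zero _) (Finset.prod_ne_zero_iff.2 fun x hx => ?_)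
  exact pow_ne_zero _ ((hcoord x).2 hx)

/-! ### The Poisson bracket of two expansions -/

/-- The coefficients of the symplectic structure: `{H, K} = ∑_d sgnD d · ∂_d H · ∂_{dual d} K`. -/
def sgnD : Dir jj → ℂ
  | Sum.inl _ => 1
  | Sum.inr (Sum.inl _) => -1
  | Sum.inr (Sum.inr (σ, _)) => if σ then Complex.I else -Complex.I

theorem enorm_sgnD (d : Dir jj) : ‖sgnD d‖ₑ = 1 := by
  rcases d with h | h | ⟨σ, j⟩
  · simp [sgnD]
  · simp [sgnD]
  · cases σ <;> simp [sgnD, ← ofReal_norm]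

/-- The partial derivative in the direction `d`. -/
def pderiv (H : Phase jj a p → ℂ) (v : Phase jj a p) (d : Dir jj) : ℂ :=
  lineDeriv ℂ H v (eDir a p d)

theorem hasSum_dir {f : Dir jj → ℂ} {S : ℂ} (h : HasSum (fun x => f (Sum.inr x)) S) :
    HasSum f (∑ h, f (Sum.inl h) + S) :=
  HasSum.sum (f := f) (hasSum_fintype fun h => f (Sum.inl h)) h

theorem tsum_dir_complex {f : Dir jj → ℂ} (hf : Summable f) :
    ∑' d, f d = ∑ h, f (Sum.inl h) + (∑ h, f (Sum.inr (Sum.inl h)) +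
      ∑' j, (f (Sum.inr (Sum.inr (true, j))) + f (Sum.inr (Sum.inr (false, j))))) := by
  have h2 : Summable fun x => f (Sum.inr x) := hf.comp_injective Sum.inr_injective
  have h3 : Summable fun q => f (Sum.inr (Sum.inr q)) := h2.comp_injective Sum.inr_injective
  have h4 : ∀ σ : Bool, Summable fun j => f (Sum.inr (Sum.inr (σ, j))) :=
    fun σ => h3.comp_injective (i := fun j => (σ, j)) fun i j hij => by simpa using hij
  have e2 : HasSum (fun x => f (Sum.inr x)) _ :=
    HasSum.sum (f := fun x => f (Sum.inr x)) (hasSum_fintype fun h => f (Sum.inr (Sum.inl h)))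
      h3.hasSum
  have e3 := h3.tsum_prod' h4
  rw [tsum_fintype (L := .unconditional Bool), Fintype.sum_bool,
    ← (h4 true).tsum_add (h4 false)] at e3
  rw [(hasSum_dir e2).tsum_eq, e3]

theorem poisson_eq_tsum {H K : Phase jj a p → ℂ} {v : Phase jj a p}
    (h : ∑' d, ‖pderiv H v d‖ₑ * ‖pderiv K v (dual d)‖ₑ ≠ ⊤) :
    poisson H K v = ∑' d, sgnD d * pderiv H v d * pderiv K v (dual d) := by
  have hs : Summable fun d => sgnD d * pderiv H v d * pderiv K v (dual d) := by
    refine summable_of_tsum_enorm (ne_top_of_le_ne_top h (ENNReal.tsum_le_tsum fun d => ?_))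
    rw [enorm_mul, enorm_mul, enorm_sgnD, one_mul]
  rw [tsum_dir_complex hs]
  unfold poisson
  beta_reduce
  rw [← tsum_mul_left, ← add_assoc, ← Finset.sum_add_distrib]
  congr 1
  · refine Finset.sum_congr rfl fun i _ => ?_
    simp only [sgnD, pderiv, dual, partialX, partialY, eDir]
    ring
  · refine tsum_congr fun j => ?_
    simp only [sgnD, pderiv, dual, partialZ, eDir, Bool.not_true, Bool.not_false, if_true,
      Bool.false_eq_true, if_false]
    ring

/-- The numerical factor of a pair of monomials in their Poisson bracket. -/
def cfac (τ : Triple jj) : ℂ := sgnD τ.1 * cmult τ.1 τ.2.1 * cmult (dual τ.1) τ.2.2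

theorem enorm_cfac (τ : Triple jj) : ‖cfac τ‖ₑ = pairMult τ := by
  rw [cfac, enorm_mul, enorm_mul, enorm_sgnD, enorm_cmult, enorm_cmult, one_mul, pairMult]
  push_cast
  rfl

open Classical in
/-- The coefficients of the Poisson bracket, for an arbitrary weight `Q` in place of the product
of the coefficients of the two factors. -/
def cBracket (Q : Triple jj → ℂ) : Expo jj → ℂ := fun I =>
  ∑' τ, if out τ = I then cfac τ * Q τ else 0

theorem enorm_cBracket_term [DecidableEq (Expo jj)] (Q : Triple jj → ℂ) (I : Expo jj)
    (τ : Triple jj) : ‖if out τ = I then cfac τ * Q τ else 0‖ₑ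
      = if out τ = I then (pairMult τ : ℝ≥0∞) * ‖Q τ‖ₑ else 0 := by
  split_ifs
  · rw [enorm_mul, enorm_cfac]
  · exact enorm_zero

theorem absC_cBracket_le (Q : Triple jj → ℂ) (I : Expo jj) :
    absC (cBracket Q) I ≤ majBracket (fun τ => ‖Q τ‖ₑ) I := by
  classical
  unfold absC cBracket majBracket
  refine enorm_tsum_le_of_le fun τ => ?_
  exact (enorm_cBracket_term Q I τ).le

theorem summable_cBracket [DecidableEq (Expo jj)] {Q : Triple jj → ℂ} {I : Expo jj}
    (h : majBracket (fun τ => ‖Q τ‖ₑ) I ≠ ⊤) :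
    Summable fun τ => if out τ = I then cfac τ * Q τ else 0 := by
  refine summable_of_tsum_enorm (ne_top_of_le_ne_top h (ENNReal.tsum_le_tsum fun τ => ?_))
  rw [enorm_cBracket_term Q I τ]
  split_ifs <;> exact le_rfl

theorem enorm_cBracket_sub_le {Q Q' : Triple jj → ℂ} {I : Expo jj}
    (h : majBracket (fun τ => ‖Q τ‖ₑ) I ≠ ⊤) (h' : majBracket (fun τ => ‖Q' τ‖ₑ) I ≠ ⊤) :
    ‖cBracket Q I - cBracket Q' I‖ₑ ≤ majBracket (fun τ => ‖Q τ - Q' τ‖ₑ) I := by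
  classical
  have : cBracket Q I - cBracket Q' I = cBracket (fun τ => Q τ - Q' τ) I := by
    unfold cBracket
    rw [← (summable_cBracket h).tsum_sub (summable_cBracket h')]
    refine tsum_congr fun τ => ?_
    split_ifs <;> ring
  rw [this]
  exact absC_cBracket_le _ I

/-- The coefficients of the bracket of two series converge absolutely. -/
theorem majBracket_ne_top (ha : 0 ≤ a) (hp : 0 ≤ p) {s r σ ρ : ℝ} (hs : 0 < s) (hr : 0 < r)
    (hσ : 0 ≤ σ) (hρ : 0 < ρ) {A B : Expo jj → ℝ≥0∞} (hA : majNorm a p s r σ ρ A ≠ ⊤)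
    (hB : majNorm a p s r σ ρ B ≠ ⊤) (I : Expo jj) :
    majBracket (fun τ => A τ.2.1 * B τ.2.2) I ≠ ⊤ := by
  obtain ⟨w, hw, hsupp⟩ := exists_absBall_support (a := a) (p := p) hρ I.2.support
  have h1 := valMaj_majBracket_le hσ A B w
  rw [← tsum_majBracket_mul (fun τ => A τ.2.1 * B τ.2.2) (posMon σ w)] at h1
  have h2 := (ENNReal.le_tsum (f := fun I => majBracket (fun τ => A τ.2.1 * B τ.2.2) I
    * posMon σ w I) I).trans (h1.trans (tsum_mul_dual_le ha hp hs hr _ _))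
  intro htop
  have h3 : posMon σ w I ≠ 0 := by
    unfold posMon
    refine mul_ne_zero (by simp [Real.exp_pos]) (Finset.prod_ne_zero_iff.2 fun x hx => ?_)
    exact pow_ne_zero _ ((hsupp x).2 hx)
  simp only [htop, ENNReal.top_mul h3, top_le_iff] at h2
  refine ENNReal.mul_ne_top (ENNReal.mul_ne_top ?_ (vecNorm_ne_top hA hw)) (vecNorm_ne_top hB hw) h2
  simp [ENNReal.mul_eq_top]

section bracket

variable {s r σ ρ : ℝ}

theorem HasExp.pderiv_eq (ha : 0 ≤ a) (hp : 0 ≤ p) (hs : 0 < s) (hr : 0 < r)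
    {H : Phase jj a p → ℂ} {c : Expo jj → ℂ} (hH : HasExp σ ρ H c)
    (hc : majNorm a p s r σ ρ (absC c) ≠ ⊤) {v : Phase jj a p} (hv : v ∈ dom jj a p σ ρ) :
    pderiv H v = gradC c v := funext fun d => hH.lineDeriv_eq ha hp hs hr hc hv d

/-- The Poisson bracket of two functions with expansions has an expansion on the same domain. -/
theorem HasExp.poisson (ha : 0 ≤ a) (hp : 0 ≤ p) (hs : 0 < s) (hr : 0 < r)
    {H K : Phase jj a p → ℂ} {c e : Expo jj → ℂ} (hH : HasExp σ ρ H c) (hK : HasExp σ ρ K e)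
    (hc : majNorm a p s r σ ρ (absC c) ≠ ⊤) (he : majNorm a p s r σ ρ (absC e) ≠ ⊤) :
    HasExp σ ρ (poisson H K) (cBracket fun τ => c τ.2.1 * e τ.2.2) := by
  classical
  intro v hv
  have hw : absCoord v ∈ absBall jj a p ρ := (mem_ballR_iff v).1 hv.2
  have hx : ∀ h, |(v.x h).im| ≤ σ := fun h => (hv.1 h).le
  have hfin : ∑' d, gradMaj (absC c) σ (absCoord v) d * gradMaj (absC e) σ (absCoord v) (dual d)
      ≠ ⊤ := by
    refine ne_top_of_le_ne_top ?_ (tsum_mul_dual_le ha hp hs hr _ _)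
    refine ENNReal.mul_ne_top (ENNReal.mul_ne_top ?_ (vecNorm_ne_top hc hw)) (vecNorm_ne_top he hw)
    simp [ENNReal.mul_eq_top]
  have hpo := poisson_eq_tsum (H := H) (K := K) (v := v) (by
    rw [hH.pderiv_eq ha hp hs hr hc hv, hK.pderiv_eq ha hp hs hr he hv]
    exact ne_top_of_le_ne_top hfin (ENNReal.tsum_le_tsum fun d => mul_le_mul'
      (enorm_gradC_le hx (fun _ => le_rfl) _ _) (enorm_gradC_le hx (fun _ => le_rfl) _ _)))
  rw [hH.pderiv_eq ha hp hs hr hc hv, hK.pderiv_eq ha hp hs hr he hv] at hpo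
  set T : (Expo jj → ℂ) → Dir jj → Expo jj → ℂ :=
    fun c d J => c J * (cmult d J * expMon v (lower d J)) with hT
  have hgr : ∀ (c : Expo jj → ℂ), majNorm a p s r σ ρ (absC c) ≠ ⊤ → ∀ d, Summable (T c d) := by
    intro c hc d
    refine summable_of_tsum_enorm (ne_top_of_le_ne_top
      (ne_top_of_vecNorm hs hr (vecNorm_ne_top hc hw) d) (ENNReal.tsum_le_tsum fun J => ?_))
    exact enorm_gradC_term_le hx (fun _ => le_rfl) c d J
  set F : Triple jj → ℂ := fun τ => sgnD τ.1 * (T c τ.1 τ.2.1 * T e (dual τ.1) τ.2.2) with hF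
  have hFs : Summable F := by
    refine summable_of_tsum_enorm (ne_top_of_le_ne_top hfin ?_)
    have := tsum_triple_mul (fun d J => absC c J * dposMon d σ (absCoord v) J)
      (fun d J => absC e J * dposMon (dual d) σ (absCoord v) J)
    refine le_trans (ENNReal.tsum_le_tsum fun τ => ?_) this.le
    rw [hF, enorm_mul, enorm_mul, enorm_sgnD, one_mul]
    exact mul_le_mul' (enorm_gradC_term_le hx (fun _ => le_rfl) _ _ _)
      (enorm_gradC_term_le hx (fun _ => le_rfl) _ _ _)
  have hsumF : HasSum F (QuasiToeplitz.poisson H K v) := by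
    convert hFs.hasSum using 1
    rw [hpo, hFs.tsum_prod' fun d => hFs.comp_injective fun x y hxy => by simpa using hxy]
    refine tsum_congr fun d => ?_
    rw [hF]
    simp only
    rw [tsum_mul_left, mul_assoc]
    congr 1
    exact tsum_mul_tsum_of_summable_norm (hgr c hc d).norm (hgr e he (dual d)).norm
  have hterm : ∀ τ, F τ = cfac τ * (c τ.2.1 * e τ.2.2) * expMon v (out τ) := by
    intro τ
    simp only [hF, hT, cfac, out, expMon_add]
    ring
  have hfib : ∀ I, HasSum (fun τ : {τ // out τ = I} => F τ)
      (cBracket (fun τ => c τ.2.1 * e τ.2.2) I * expMon v I) := by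
    intro I
    have h1 := (hFs.indicator {τ | out τ = I}).hasSum
    have h2 : ({τ | out τ = I}.indicator F) =
        fun τ => (if out τ = I then cfac τ * (c τ.2.1 * e τ.2.2) else 0) * expMon v I := by
      funext τ
      by_cases h : out τ = I
      · rw [Set.indicator_of_mem (by exact h), if_pos h, hterm, h]
      · rw [Set.indicator_of_notMem (by exact h), if_neg h, zero_mul]
    have h3 : ∑' τ, ({τ | out τ = I}.indicator F) τ
        = cBracket (fun τ => c τ.2.1 * e τ.2.2) I * expMon v I := by
      rw [h2, tsum_mul_right, cBracket]
    rw [h3] at h1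
    exact hasSum_subtype_iff_indicator.2 h1
  exact (((Equiv.sigmaFiberEquiv out).hasSum_iff).2 hsumF).sigma hfib

end bracket

/-! ### Momentum conservation -/

/-- The momentum of a variable: `±j` for `z_j^±`, and `0` for `y`. -/
def vmom : Var jj → ℤ
  | Sum.inl _ => 0
  | Sum.inr (σ, j) => sgn σ * j

/-- The momentum `π(k, α, β)` of an exponent. -/
def momE (J : Expo jj) : ℤ := ∑ l, jj l * J.1 l + J.2.sum fun x e => vmom x * e

/-- The momentum that the derivative in a direction removes. -/
def dmom : Dir jj → ℤ
  | Sum.inl _ => 0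
  | Sum.inr x => vmom x

theorem dmom_dual (d : Dir jj) : dmom (dual d) = -dmom d := by
  rcases d with h | h | ⟨σ, j⟩
  · simp [dual, dmom, vmom]
  · simp [dual, dmom, vmom]
  · cases σ <;> simp [dual, dmom, vmom, sgn]

theorem momE_add (J K : Expo jj) : momE (J + K) = momE J + momE K := by
  classical
  unfold momE
  rw [Prod.snd_add, Finsupp.sum_add_index' (by simp) (by intros; push_cast; ring)]
  simp only [Prod.fst_add, Pi.add_apply, mul_add, Finset.sum_add_distrib]
  ring

theorem momE_single (x : Var jj) : momE ((0, Finsupp.single x 1) : Expo jj) = vmom x := by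
  simp [momE]

theorem momE_lower {d : Dir jj} {J : Expo jj} (h : mult d J ≠ 0) :
    momE (lower d J) = momE J - dmom d := by
  rcases d with i | x
  · simp [lower, dmom]
  · conv_rhs => rw [← lower_add_single h, momE_add, momE_single]
    simp [dmom]

theorem momE_out {τ : Triple jj} (h : pairMult τ ≠ 0) :
    momE (out τ) = momE τ.2.1 + momE τ.2.2 := by
  unfold pairMult at h
  rw [out, momE_add, momE_lower (left_ne_zero_of_mul h), momE_lower (right_ne_zero_of_mul h),
    dmom_dual]
  ring

/-- The Poisson bracket of two momentum preserving series preserves the momentum. -/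
theorem momE_of_cBracket_ne_zero {Q : Triple jj → ℂ}
    (hQ : ∀ τ, Q τ ≠ 0 → momE τ.2.1 = 0 ∧ momE τ.2.2 = 0) {I : Expo jj} (hI : cBracket Q I ≠ 0) :
    momE I = 0 := by
  classical
  obtain ⟨τ, hτ⟩ : ∃ τ, (if out τ = I then cfac τ * Q τ else 0) ≠ 0 := by
    by_contra! h
    exact hI (by unfold cBracket; simp [h])
  split_ifs at hτ with h
  · have h1 : pairMult τ ≠ 0 := by
      intro h0
      have := enorm_cfac τ
      rw [h0, Nat.cast_zero, enorm_eq_zero] at this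
      simp [this] at hτ
    obtain ⟨h2, h3⟩ := hQ τ (right_ne_zero_of_mul hτ)
    rw [← h, momE_out h1, h2, h3, add_zero]
  · exact absurd rfl hτ

/-- The partial derivatives of the momentum function, at the dual direction. -/
def momDual (v : Phase jj a p) : Dir jj → ℂ
  | Sum.inl h => jj h
  | Sum.inr (Sum.inl _) => 0
  | Sum.inr (Sum.inr (σ, j)) => ((j : ℤ) : ℂ) * coord v (Sum.inr (σ, j))

theorem summable_momentum (ha : 0 ≤ a) (hp : 1 / 2 < p) (z w : SeqSpace jj a p) :
    Summable fun j : Site jj => ((j : ℤ) : ℂ) * z.entry j * w.entry j := by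
  refine summable_of_tsum_enorm (ne_top_of_le_ne_top ?_
    ((ENNReal.tsum_le_tsum fun j => ?_).trans (tsum_abs_mul_le_extNorm ha hp
      (fun j => ‖z.entry j‖ₑ) (fun j => ‖w.entry j‖ₑ))))
  · rw [← enorm_seq_eq, ← enorm_seq_eq]
    exact ENNReal.mul_ne_top enorm_ne_top enorm_ne_top
  · rw [enorm_mul, enorm_mul, mul_assoc, ← ofReal_norm ((j : ℤ) : ℂ),
      Complex.norm_intCast]

theorem pderiv_momentumFun (ha : 0 ≤ a) (hp : 1 / 2 < p) (v : Phase jj a p) (d : Dir jj) :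
    pderiv momentumFun v (dual d) = momDual v d := by
  classical
  have hline : ∀ (e : Phase jj a p) (m : ℂ),
      (∀ t : ℂ, momentumFun (v + t • e) = momentumFun v + t * m) →
      lineDeriv ℂ momentumFun v e = m := by
    intro e m h
    refine HasLineDerivAt.lineDeriv ?_
    unfold HasLineDerivAt
    simp_rw [h]
    simpa using ((hasDerivAt_id (0 : ℂ)).mul_const m).const_add (momentumFun v)
  have hM : ∀ v : Phase jj a p, momentumFun v = ∑ l, (jj l : ℂ) * coord v (Sum.inl l)
      + ∑' j : Site jj, ((j : ℤ) : ℂ) * coord v (Sum.inr (true, j)) * coord v (Sum.inr (false, j)) :=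
    fun v => rfl
  refine hline _ _ fun t => ?_
  rcases d with h | h | ⟨σ, j⟩
  · simp only [hM, coord_add, coord_smul, dual, coord_eDir, momDual, Sum.inl.injEq, reduceCtorEq,
      if_false, mul_zero, add_zero, mul_add, Finset.sum_add_distrib, mul_ite, mul_one]
    rw [Finset.sum_ite_eq' Finset.univ h]
    simp only [Finset.mem_univ, if_true]
    ring
  · simp only [hM, coord_add, coord_smul, dual, coord_eDir_inl, momDual, mul_zero, add_zero]
  · have hs := summable_momentum ha hp (v.z true) (v.z false)
    have key : ∀ i : Site jj, ((i : ℤ) : ℂ)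
        * coord (v + t • eDir a p (dual (Sum.inr (Sum.inr (σ, j))))) (Sum.inr (true, i))
        * coord (v + t • eDir a p (dual (Sum.inr (Sum.inr (σ, j))))) (Sum.inr (false, i))
        = ((i : ℤ) : ℂ) * coord v (Sum.inr (true, i)) * coord v (Sum.inr (false, i))
          + if i = j then t * (((j : ℤ) : ℂ) * coord v (Sum.inr (σ, j))) else 0 := by
      intro i
      simp only [coord_add, coord_smul, dual, coord_eDir, Sum.inr.injEq, Prod.mk.injEq]
      by_cases hij : i = j
      · subst hij
        cases σ <;> simp <;> ring
      · simp [hij]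
    have hl : ∀ l, coord (v + t • eDir a p (dual (Sum.inr (Sum.inr (σ, j))))) (Sum.inl l)
        = coord v (Sum.inl l) := by
      intro l
      simp [coord_add, coord_smul, dual, coord_eDir]
    rw [hM, hM]
    simp_rw [key, hl]
    rw [Summable.tsum_add (by exact hs) (summable_of_ne_finset_zero (s := {j}) (by
      intro i hi; simp only [Finset.mem_singleton] at hi; simp [hi])), tsum_ite_eq, add_assoc]
    rfl

theorem tsum_momDual_le (ha : 0 ≤ a) (hp : 1 / 2 < p) {s r : ℝ} (hs : 0 < s) (hr : 0 < r)
    {g : Dir jj → ℝ≥0∞} (hg : vecNorm a p s r g ≠ ⊤) (v : Phase jj a p) :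
    ∑' d, g d * ‖momDual v d‖ₑ ≠ ⊤ := by
  have hz : ∀ σ, ∑' j : Site jj, g (Sum.inr (Sum.inr (σ, j))) *
      ‖momDual v (Sum.inr (Sum.inr (σ, j)))‖ₑ ≠ ⊤ := by
    intro σ
    refine ne_top_of_le_ne_top ?_ ((ENNReal.tsum_le_tsum fun j => ?_).trans
      (tsum_abs_mul_le_extNorm ha hp (fun j => g (Sum.inr (Sum.inr (σ, j))))
        (fun j => ‖(v.z σ).entry j‖ₑ)))
    · rw [← enorm_seq_eq]
      exact ENNReal.mul_ne_top (ne_top_of_le_ne_top (ne_top_of_mul_ofReal hg)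
        (extNorm_le_vecNorm hr g σ)) enorm_ne_top
    · simp only [momDual, coord]
      rw [enorm_mul, ← ofReal_norm ((j : ℤ) : ℂ), Complex.norm_intCast, mul_left_comm]
  rw [tsum_dir]
  refine ENNReal.add_ne_top.2 ⟨?_, ENNReal.add_ne_top.2 ⟨?_, ENNReal.add_ne_top.2 ⟨hz _, hz _⟩⟩⟩
  · exact ENNReal.sum_ne_top.2 fun h _ =>
      ENNReal.mul_ne_top (ne_top_of_vecNorm hs hr hg _) enorm_ne_top
  · exact ENNReal.sum_ne_top.2 fun h _ =>
      ENNReal.mul_ne_top (ne_top_of_vecNorm hs hr hg _) enorm_ne_top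

theorem hasSum_momentum_term (v : Phase jj a p) (J : Expo jj) :
    HasSum (fun d => sgnD d * (cmult d J * expMon v (lower d J)) * momDual v d)
      (Complex.I * momE J * expMon v J) := by
  classical
  have hx : ∀ x : Var jj, sgnD (Sum.inr x) * (cmult (Sum.inr x) J * expMon v (lower (Sum.inr x) J))
      * momDual v (Sum.inr x) = Complex.I * ((vmom x * J.2 x : ℤ) : ℂ) * expMon v J := by
    intro x
    by_cases h0 : J.2 x = 0
    · simp [cmult, h0]
    rcases x with h | ⟨σ, j⟩
    · simp [momDual, vmom]
    · have h1 : expMon v J = expMon v (lower (Sum.inr (Sum.inr (σ, j))) J)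
          * coord v (Sum.inr (σ, j)) := by
        conv_lhs => rw [← lower_add_single (v := Sum.inr (σ, j)) (J := J) h0, expMon_add]
        simp [expMon]
      rw [h1]
      cases σ <;> simp [sgnD, cmult, momDual, vmom, sgn] <;> ring
  have h2 : HasSum (fun x : Var jj => sgnD (Sum.inr x) *
      (cmult (Sum.inr x) J * expMon v (lower (Sum.inr x) J)) * momDual v (Sum.inr x))
      (∑ x ∈ J.2.support, Complex.I * ((vmom x * J.2 x : ℤ) : ℂ) * expMon v J) := by
    simp_rw [hx]
    refine hasSum_sum_of_ne_finset_zero (s := J.2.support) fun x hx => ?_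
    rw [Finsupp.notMem_support_iff.1 hx]; simp
  have h3 := hasSum_dir
    (f := fun d => sgnD d * (cmult d J * expMon v (lower d J)) * momDual v d) h2
  convert h3 using 1
  symm
  simp only [sgnD, cmult, momDual, lower, momE, Finsupp.sum]
  push_cast
  rw [← Finset.sum_mul, ← Finset.mul_sum, mul_add, add_mul]
  refine congrArg₂ (· + ·) ?_ rfl
  rw [Finset.mul_sum, Finset.sum_mul]
  refine Finset.sum_congr rfl fun i _ => ?_
  ring

/-- The Poisson bracket with the momentum multiplies the coefficients by `i π`. -/
theorem HasExp.poisson_momentumFun (ha : 0 ≤ a) (hp : 1 / 2 < p) {s r σ ρ : ℝ} (hs : 0 < s)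
    (hr : 0 < r) {H : Phase jj a p → ℂ} {c : Expo jj → ℂ} (hH : HasExp σ ρ H c)
    (hc : majNorm a p s r σ ρ (absC c) ≠ ⊤) :
    HasExp σ ρ (QuasiToeplitz.poisson H momentumFun) fun J => c J * (Complex.I * momE J) := by
  intro v hv
  have hp0 : 0 ≤ p := by linarith
  have hw : absCoord v ∈ absBall jj a p ρ := (mem_ballR_iff v).1 hv.2
  have hx : ∀ h, |(v.x h).im| ≤ σ := fun h => (hv.1 h).le
  have hfin := tsum_momDual_le ha hp hs hr (vecNorm_ne_top hc hw) v
  have hpd : ∀ d, pderiv momentumFun v (dual d) = momDual v d := pderiv_momentumFun ha hp v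
  have hpo := poisson_eq_tsum (H := H) (K := momentumFun) (v := v) (by
    simp_rw [hpd]
    rw [hH.pderiv_eq ha hp0 hs hr hc hv]
    exact ne_top_of_le_ne_top hfin (ENNReal.tsum_le_tsum fun d => mul_le_mul'
      (enorm_gradC_le hx (fun _ => le_rfl) _ _) le_rfl))
  simp_rw [hpd] at hpo
  rw [hH.pderiv_eq ha hp0 hs hr hc hv] at hpo
  set F : Expo jj × Dir jj → ℂ := fun q =>
    c q.1 * (sgnD q.2 * (cmult q.2 q.1 * expMon v (lower q.2 q.1)) * momDual v q.2) with hF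
  have hFs : Summable F := by
    refine summable_of_tsum_enorm (ne_top_of_le_ne_top hfin ?_)
    rw [ENNReal.tsum_prod', ENNReal.tsum_comm]
    refine ENNReal.tsum_le_tsum fun d => ?_
    unfold gradMaj
    rw [← ENNReal.tsum_mul_right]
    refine ENNReal.tsum_le_tsum fun J => ?_
    have := mul_le_mul' (enorm_gradC_term_le hx (fun _ => le_rfl) c d J) (le_refl ‖momDual v d‖ₑ)
    refine le_trans (le_of_eq ?_) this
    simp only [hF, enorm_mul, enorm_sgnD]
    ring
  have hsum : HasSum F (QuasiToeplitz.poisson H momentumFun v) := by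
    convert hFs.hasSum using 1
    have h2 : Summable (F ∘ (Equiv.prodComm _ _)) := (Equiv.summable_iff _).2 hFs
    rw [hpo, ← (Equiv.prodComm _ _).tsum_eq F]
    change _ = ∑' q, (F ∘ (Equiv.prodComm _ _)) q
    rw [h2.tsum_prod' fun d => h2.comp_injective fun x y hxy => by simpa using hxy]
    refine tsum_congr fun d => ?_
    rw [gradC, ← tsum_mul_left, ← tsum_mul_right]
    refine tsum_congr fun J => ?_
    simp only [hF, Function.comp, Equiv.prodComm_apply, Prod.swap]
    ring
  have := hsum.prod_fiberwise fun J => (hasSum_momentum_term v J).mul_left (c J)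
  convert this using 2 with J
  ring

/-- Momentum conservation means that only monomials with momentum `0` occur. -/
theorem conservesMomentum_iff (ha : 0 ≤ a) (hp : 1 / 2 < p) {s r σ ρ : ℝ} (hs : 0 < s)
    (hr : 0 < r) (hσ : 0 < σ) (hρ : 0 < ρ) {H : Phase jj a p → ℂ} {c : Expo jj → ℂ}
    (hH : HasExp σ ρ H c) (hc : majNorm a p s r σ ρ (absC c) ≠ ⊤) :
    ConservesMomentum σ ρ H ↔ ∀ J, c J ≠ 0 → momE J = 0 := by
  have h1 := hH.poisson_momentumFun ha hp hs hr hc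
  constructor
  · intro h J hJ
    have h2 : HasExp (a := a) (p := p) σ ρ (fun _ => 0) fun J => c J * (Complex.I * momE J) := by
      intro v hv
      have := h1 v hv
      rwa [h v hv] at this
    have h3 := congrFun (h2.eq_zero hσ hρ) J
    simpa [hJ] using h3
  · intro h v hv
    refine (h1 v hv).unique ?_
    convert hasSum_zero with J
    by_cases hJ : c J = 0
    · simp [hJ]
    · simp [h J hJ]

/-! ### Far variables and bilinear exponents -/

/-- A linear functional of the exponents of the variables. -/
def wsum (ω : Var jj → ℤ) (J : Expo jj) : ℤ := J.2.sum fun x e => ω x * e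

/-- The value of a weight in a direction; it is `0` for the angles. -/
def atDir (ω : Var jj → ℤ) : Dir jj → ℤ
  | Sum.inl _ => 0
  | Sum.inr x => ω x

theorem wsum_add (ω : Var jj → ℤ) (J K : Expo jj) : wsum ω (J + K) = wsum ω J + wsum ω K := by
  classical
  unfold wsum
  rw [Prod.snd_add, Finsupp.sum_add_index' (by simp) (by intros; push_cast; ring)]

theorem wsum_single (ω : Var jj → ℤ) (x : Var jj) :
    wsum ω ((0, Finsupp.single x 1) : Expo jj) = ω x := by
  simp [wsum]

theorem wsum_lower (ω : Var jj → ℤ) {d : Dir jj} {J : Expo jj} (h : mult d J ≠ 0) :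
    wsum ω (lower d J) = wsum ω J - atDir ω d := by
  rcases d with i | x
  · simp [lower, atDir]
  · conv_rhs => rw [← lower_add_single h, wsum_add, wsum_single]
    simp [atDir]

theorem wsum_nonneg {ω : Var jj → ℤ} (h : ∀ x, 0 ≤ ω x) (J : Expo jj) : 0 ≤ wsum ω J :=
  Finset.sum_nonneg fun x _ => mul_nonneg (h x) (by positivity)

theorem wsum_eq_zero {ω : Var jj → ℤ} {J : Expo jj} (h : ∀ x, J.2 x ≠ 0 → ω x = 0) :
    wsum ω J = 0 :=
  Finset.sum_eq_zero fun x hx => by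
    beta_reduce
    rw [h x (by simpa using hx), zero_mul]

theorem wsum_sub (ω ω' : Var jj → ℤ) (J : Expo jj) :
    wsum (fun x => ω x - ω' x) J = wsum ω J - wsum ω' J := by
  unfold wsum Finsupp.sum
  rw [← Finset.sum_sub_distrib]
  exact Finset.sum_congr rfl fun x _ => by ring

theorem abs_wsum_le {ω ω' : Var jj → ℤ} (h : ∀ x, |ω x| ≤ ω' x) (J : Expo jj) :
    |wsum ω J| ≤ wsum ω' J := by
  refine (Finset.abs_sum_le_sum_abs _ _).trans (Finset.sum_le_sum fun x _ => ?_)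
  rw [abs_mul, Nat.abs_cast]
  exact mul_le_mul_of_nonneg_right (h x) (by positivity)

/-- A variable `z_j^±` is far if `|j| > N`. -/
def Far (N : ℕ) (x : Var jj) : Prop := (N : ℤ) < |vmom x|

open Classical in
/-- The number of far variables of an exponent. -/
def farDeg (N : ℕ) : Expo jj → ℤ := wsum fun x => if Far N x then 1 else 0

open Classical in
/-- The sum `∑ |j|` over the variables that are not far. -/
def nearW (N : ℕ) : Expo jj → ℤ := wsum fun x => if Far N x then 0 else |vmom x|

open Classical in
/-- The part of the momentum that comes from the far variables. -/
def farMom (N : ℕ) : Expo jj → ℤ := wsum fun x => if Far N x then vmom x else 0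

open Classical in
/-- The number of far variables with positive momentum minus that with negative momentum. -/
def farSgn (N : ℕ) : Expo jj → ℤ := wsum fun x => if Far N x then (vmom x).sign else 0

theorem nearW_nonneg (N : ℕ) (J : Expo jj) : 0 ≤ nearW N J :=
  wsum_nonneg (fun x => by split_ifs <;> positivity) J

theorem farDeg_nonneg (N : ℕ) (J : Expo jj) : 0 ≤ farDeg N J :=
  wsum_nonneg (fun x => by split_ifs <;> simp) J

theorem exists_far {N : ℕ} {J : Expo jj} (h : farDeg N J ≠ 0) : ∃ x, Far N x ∧ J.2 x ≠ 0 := by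
  by_contra! hc
  refine h (wsum_eq_zero fun x hx => ?_)
  exact if_neg fun hf => hx (hc x hf)

theorem not_far_of_farDeg {N : ℕ} {J : Expo jj} (h : farDeg N J = 0) {x : Var jj}
    (hx : J.2 x ≠ 0) : ¬ Far N x := by
  classical
  intro hf
  have h1 := wsum_lower (fun x => if Far N x then (1 : ℤ) else 0) (d := Sum.inr x) (J := J) hx
  have h2 := farDeg_nonneg N (lower (Sum.inr x) J)
  unfold farDeg at h h2
  rw [h1, h] at h2
  simp [atDir, hf] at h2

theorem farMom_eq_zero {N : ℕ} {J : Expo jj} (h : farDeg N J = 0) : farMom N J = 0 :=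
  wsum_eq_zero fun _ hx => if_neg (not_far_of_farDeg h hx)

theorem abs_sum_le_kappa_mul (k : Fin n → ℤ) : |∑ l, jj l * k l| ≤ (kappa jj : ℤ) * kabs k := by
  refine (Finset.abs_sum_le_sum_abs _ _).trans ?_
  unfold kabs
  push_cast
  rw [Finset.mul_sum]
  refine Finset.sum_le_sum fun l _ => ?_
  rw [abs_mul, Int.abs_eq_natAbs (jj l)]
  refine mul_le_mul_of_nonneg_right ?_ (abs_nonneg _)
  exact_mod_cast Finset.le_sup (f := fun l => (jj l).natAbs) (Finset.mem_univ l)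

theorem momE_eq (J : Expo jj) : momE J = ∑ l, jj l * J.1 l + wsum vmom J := rfl

theorem abs_momE_sub_farMom_le (N : ℕ) (J : Expo jj) :
    |momE J - farMom N J| ≤ (kappa jj : ℤ) * kabs J.1 + nearW N J := by
  classical
  have h1 := abs_sum_le_kappa_mul (jj := jj) J.1
  have h2 : |wsum vmom J - farMom N J| ≤ nearW N J := by
    unfold farMom nearW
    rw [← wsum_sub]
    refine abs_wsum_le (fun x => ?_) J
    split_ifs <;> simp
  rw [momE_eq, add_sub_assoc]
  exact (abs_add_le _ _).trans (add_le_add h1 h2)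

theorem abs_dmom_dual (d : Dir jj) : |dmom (dual d)| = |dmom d| := by rw [dmom_dual, abs_neg]

theorem farDeg_lower {N : ℕ} {d : Dir jj} {J : Expo jj} (h : mult d J ≠ 0) :
    farDeg N (lower d J) = farDeg N J - if (N : ℤ) < |dmom d| then 1 else 0 := by
  unfold farDeg
  rw [wsum_lower _ h]
  congr 1
  rcases d with i | x
  · rw [if_neg (by simp [dmom])]; rfl
  · by_cases hx : Far N x
    · rw [if_pos (by exact hx)]; exact if_pos hx
    · rw [if_neg (by exact hx)]; exact if_neg hx

theorem nearW_lower {N : ℕ} {d : Dir jj} {J : Expo jj} (h : mult d J ≠ 0) :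
    nearW N (lower d J) = nearW N J - if (N : ℤ) < |dmom d| then 0 else |dmom d| := by
  unfold nearW
  rw [wsum_lower _ h]
  congr 1
  rcases d with i | x
  · rw [if_neg (by simp [dmom])]; rfl
  · by_cases hx : Far N x
    · rw [if_pos (by exact hx)]; exact if_pos hx
    · rw [if_neg (by exact hx)]; exact if_neg hx

theorem lower_apply_le (d : Dir jj) (J : Expo jj) (x : Var jj) : (lower d J).2 x ≤ J.2 x := by
  rcases d with i | y
  · exact le_rfl
  · simp [lower]

theorem lower_apply_of_ne {d : Dir jj} {J : Expo jj} {x : Var jj} (h : d ≠ Sum.inr x) :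
    (lower d J).2 x = J.2 x := by
  classical
  rcases d with i | y
  · rfl
  · have : y ≠ x := fun hxy => h (hxy ▸ rfl)
    simp [lower, Finsupp.single_apply, this]

/-- An exponent with a single far variable. -/
theorem exists_far_of_farDeg_one {N : ℕ} {J : Expo jj} (h : farDeg N J = 1) :
    ∃ x, Far N x ∧ J.2 x ≠ 0 ∧ farMom N J = vmom x ∧ farSgn N J = (vmom x).sign ∧
      farDeg N (lower (Sum.inr x) J) = 0 := by
  obtain ⟨x, hx, hJ⟩ := exists_far (N := N) (J := J) (by rw [h]; exact one_ne_zero)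
  have h0 : farDeg N (lower (Sum.inr x) J) = 0 := by
    rw [farDeg_lower (d := Sum.inr x) hJ, h, if_pos (by exact hx), sub_self]
  refine ⟨x, hx, hJ, ?_, ?_, h0⟩
  · have h1 := farMom_eq_zero h0
    unfold farMom at h1 ⊢
    rw [wsum_lower _ (d := Sum.inr x) hJ] at h1
    simp only [atDir, if_pos hx] at h1
    linarith
  · have h1 : farSgn N (lower (Sum.inr x) J) = 0 :=
      wsum_eq_zero fun y hy => if_neg (not_far_of_farDeg h0 hy)
    unfold farSgn at h1 ⊢
    rw [wsum_lower _ (d := Sum.inr x) hJ] at h1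
    simp only [atDir, if_pos hx] at h1
    linarith

theorem exists_far_of_farDeg_two {N : ℕ} {J : Expo jj} (h : farDeg N J = 2) :
    ∃ x y, Far N x ∧ Far N y ∧ J.2 x ≠ 0 ∧ (lower (Sum.inr x) J).2 y ≠ 0 ∧
      farMom N J = vmom x + vmom y ∧ farSgn N J = (vmom x).sign + (vmom y).sign ∧
      farDeg N (lower (Sum.inr y) (lower (Sum.inr x) J)) = 0 := by
  obtain ⟨x, hx, hJ⟩ := exists_far (N := N) (J := J) (by rw [h]; exact two_ne_zero)
  have h0 : farDeg N (lower (Sum.inr x) J) = 1 := by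
    rw [farDeg_lower (d := Sum.inr x) hJ, h, if_pos (by exact hx)]; norm_num
  obtain ⟨y, hy, hJy, h1, h2, h3⟩ := exists_far_of_farDeg_one h0
  refine ⟨x, y, hx, hy, hJ, hJy, ?_, ?_, h3⟩
  · unfold farMom at h1 ⊢
    rw [wsum_lower _ (d := Sum.inr x) hJ] at h1
    simp only [atDir, if_pos hx] at h1
    linarith
  · unfold farSgn at h2 ⊢
    rw [wsum_lower _ (d := Sum.inr x) hJ] at h2
    simp only [atDir, if_pos hx] at h2
    linarith

/-- The exponents of the monomials that are products of two far variables `z_m^± z_n^±` with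
`|m|, |n| > T` and of a low momentum monomial, of momentum `0`. -/
structure Bil (N : ℕ) (T M B : ℝ) (J : Expo jj) : Prop where
  deg : farDeg N J = 2
  high : ∀ x, J.2 x ≠ 0 → Far N x → T < |(vmom x : ℝ)|
  near : (nearW N J : ℝ) < M
  kabs_lt : (kabs J.1 : ℝ) < B
  mom : momE J = 0

theorem Bil.mono {N : ℕ} {T M B T' M' : ℝ} {J : Expo jj} (h : Bil N T' M' B J) (hT : T ≤ T')
    (hM : M' ≤ M) : Bil N T M B J :=
  ⟨h.deg, fun x hx hf => hT.trans_lt (h.high x hx hf), h.near.trans_le hM, h.kabs_lt, h.mom⟩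

theorem Bil.abs_farMom_lt {N : ℕ} {T M B : ℝ} {J : Expo jj} (h : Bil N T M B J) :
    |(farMom N J : ℝ)| < M + kappa jj * B := by
  have h1 := abs_momE_sub_farMom_le N J
  rw [h.mom, zero_sub, abs_neg] at h1
  have h2 : |(farMom N J : ℝ)| ≤ (kappa jj : ℝ) * kabs J.1 + nearW N J := by exact_mod_cast h1
  have h3 : (kappa jj : ℝ) * kabs J.1 ≤ kappa jj * B :=
    mul_le_mul_of_nonneg_left h.kabs_lt.le (by positivity)
  linarith [h.near]

/-- The two far variables of a bilinear exponent have momenta of opposite signs. -/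
theorem Bil.farSgn_eq_zero {N : ℕ} {T M B : ℝ} {J : Expo jj} (h : Bil N T M B J)
    (hN : M + kappa jj * B ≤ N) : farSgn N J = 0 := by
  obtain ⟨x, y, hx, hy, -, -, h1, h2, -⟩ := exists_far_of_farDeg_two h.deg
  have h3 := h.abs_farMom_lt.trans_le hN
  rw [h1] at h3
  have h4 : |vmom x + vmom y| < N := by exact_mod_cast h3
  rw [h2]
  unfold Far at hx hy
  rw [abs_lt] at h4
  rcases lt_trichotomy (vmom x) 0 with h5 | h5 | h5 <;>
    rcases lt_trichotomy (vmom y) 0 with h6 | h6 | h6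
  all_goals first
    | (rw [h5] at hx; simp at hx; omega)
    | (rw [h6] at hy; simp at hy; omega)
    | skip
  · rw [abs_of_neg h5] at hx; rw [abs_of_neg h6] at hy; omega
  · rw [Int.sign_eq_neg_one_of_neg h5, Int.sign_eq_one_of_pos h6]; rfl
  · rw [Int.sign_eq_neg_one_of_neg h6, Int.sign_eq_one_of_pos h5]; rfl
  · rw [abs_of_pos h5] at hx; rw [abs_of_pos h6] at hy; omega

/-- If one factor of a bracket keeps no far variable, then the contracted variable is not far, this
factor has no far variable, and the other one is bilinear. -/
theorem bil_of_farDeg_lower_eq_zero {N : ℕ} {T M B T' M' : ℝ} (hN : M' + kappa jj * B ≤ N)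
    (hM : M' + kappa jj * B ≤ M) (hT : T + (M' + kappa jj * B) ≤ T') (hM0 : 0 ≤ M')
    (hB : 0 ≤ B) {d : Dir jj}
    {J K : Expo jj} (hJ : mult d J ≠ 0) (hK : mult (dual d) K ≠ 0) (hJ0 : momE J = 0)
    (hK0 : momE K = 0) (hJB : (kabs J.1 : ℝ) < B) (hKB : (kabs K.1 : ℝ) < B)
    (hI : Bil N T' M' B (lower d J + lower (dual d) K)) (h0 : farDeg N (lower d J) = 0) :
    ¬ (N : ℤ) < |dmom d| ∧ farDeg N J = 0 ∧ Bil N T M B K := by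
  have hnear : nearW N (lower d J) + nearW N (lower (dual d) K)
      = nearW N (lower d J + lower (dual d) K) := (wsum_add _ _ _).symm
  have hdeg : farDeg N (lower d J) + farDeg N (lower (dual d) K) = 2 := by
    rw [← hI.deg]; exact (wsum_add _ _ _).symm
  have h1 := abs_momE_sub_farMom_le N (lower d J)
  rw [farMom_eq_zero h0, sub_zero, momE_lower hJ, hJ0, zero_sub, abs_neg, lower_fst] at h1
  have h2 : |(dmom d : ℝ)| ≤ (kappa jj : ℝ) * kabs J.1 + nearW N (lower d J) := by exact_mod_cast h1
  have h3 : (kappa jj : ℝ) * kabs J.1 ≤ kappa jj * B :=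
    mul_le_mul_of_nonneg_left hJB.le (by positivity)
  have h4 : (nearW N (lower d J) : ℝ) + nearW N (lower (dual d) K) < M' := by
    have := hI.near
    rw [← hnear] at this
    exact_mod_cast this
  have h5 : (0 : ℝ) ≤ nearW N (lower (dual d) K) := by exact_mod_cast nearW_nonneg N _
  have hd : ¬ (N : ℤ) < |dmom d| := by
    intro hc
    have : (N : ℝ) < |(dmom d : ℝ)| := by exact_mod_cast hc
    linarith
  have hκ : 0 ≤ (kappa jj : ℝ) * B := by positivity
  have hd' : ¬ (N : ℤ) < |dmom (dual d)| := by rwa [abs_dmom_dual]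
  have e1 := farDeg_lower (N := N) hJ
  have e2 := farDeg_lower (N := N) hK
  have e3 := nearW_lower (N := N) hK
  rw [if_neg hd] at e1
  rw [if_neg hd'] at e2 e3
  rw [abs_dmom_dual] at e3
  refine ⟨hd, by omega, ?_⟩
  refine ⟨by omega, fun x hx hf => ?_, ?_, hKB, hK0⟩
  · refine lt_of_le_of_lt (by linarith) (hI.high x ?_ hf)
    have hne : dual d ≠ Sum.inr x := by
      intro he
      rw [he] at hd'
      exact hd' hf
    have h6 : (lower (dual d) K).2 x ≠ 0 := by rwa [lower_apply_of_ne hne]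
    rw [Prod.snd_add, Finsupp.add_apply]
    omega
  · have h6 : (nearW N (lower (dual d) K) : ℝ) = nearW N K - |(dmom d : ℝ)| := by
      exact_mod_cast e3
    linarith

/-- If one factor of a bracket keeps one far variable, then the contracted variable is far and
that factor is bilinear. -/
theorem bil_of_farDeg_lower_eq_one {N : ℕ} {T M B T' M' : ℝ} (hNT : N ≤ T)
    (hM : M' ≤ M) (hT : T + (M' + kappa jj * B) ≤ T') {d : Dir jj}
    {J : Expo jj} (hJ : mult d J ≠ 0) (hJ0 : momE J = 0)
    (hJB : (kabs J.1 : ℝ) < B) (hnear : (nearW N (lower d J) : ℝ) < M')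
    (hhigh : ∀ x, (lower d J).2 x ≠ 0 → Far N x → T' < |(vmom x : ℝ)|)
    (h1 : farDeg N (lower d J) = 1) :
    T < |(dmom d : ℝ)| ∧ Bil N T M B J := by
  obtain ⟨x, hx, hJx, hmom, -, -⟩ := exists_far_of_farDeg_one h1
  have h2 := abs_momE_sub_farMom_le N (lower d J)
  rw [hmom, momE_lower hJ, hJ0, zero_sub, lower_fst] at h2
  have h3 : |(-(dmom d : ℝ)) - vmom x| ≤ (kappa jj : ℝ) * kabs J.1 + nearW N (lower d J) := by
    exact_mod_cast h2
  have h4 : (kappa jj : ℝ) * kabs J.1 ≤ kappa jj * B :=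
    mul_le_mul_of_nonneg_left hJB.le (by positivity)
  have h5 := hhigh x hJx hx
  have h6 : |(vmom x : ℝ)| ≤ |(-(dmom d : ℝ)) - vmom x| + |(dmom d : ℝ)| := by
    have := abs_sub_abs_le_abs_sub (vmom x : ℝ) (-(dmom d : ℝ))
    rw [abs_neg, abs_sub_comm] at this
    linarith
  have hd : T < |(dmom d : ℝ)| := by linarith
  have hdN : (N : ℤ) < |dmom d| := by
    have : (N : ℝ) < |(dmom d : ℝ)| := hNT.trans_lt hd
    exact_mod_cast this
  have e1 := farDeg_lower (N := N) hJ
  have e2 := nearW_lower (N := N) hJ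
  rw [if_pos hdN] at e1 e2
  refine ⟨hd, by omega, fun y hy hf => ?_, ?_, hJB, hJ0⟩
  · by_cases hne : d = Sum.inr y
    · rw [hne] at hd
      exact hd
    · refine lt_of_le_of_lt ?_ (hhigh y (by rwa [lower_apply_of_ne hne]) hf)
      have : 0 ≤ (kappa jj : ℝ) * kabs J.1 + nearW N (lower d J) := (abs_nonneg _).trans h3
      linarith
  · rw [sub_zero] at e2
    rw [← e2]
    linarith

/-- The pairs of monomials that contribute to the bilinear part of a bracket: either a high
variable is contracted and both monomials are bilinear, or the contracted variable is not far, and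
one monomial is bilinear and the other one has no far variable. -/
def BilCases (N : ℕ) (T M B : ℝ) (τ : Triple jj) : Prop :=
  (T < |(dmom τ.1 : ℝ)| ∧ Bil N T M B τ.2.1 ∧ Bil N T M B τ.2.2) ∨
    (¬ (N : ℤ) < |dmom τ.1| ∧ ((Bil N T M B τ.2.1 ∧ farDeg N τ.2.2 = 0) ∨
      (farDeg N τ.2.1 = 0 ∧ Bil N T M B τ.2.2)))

/-- The case distinction is by the distribution of the two far variables of the product over the two
factors: with `1 + 1` the contracted variable is high, and with `2 + 0` it is not far. -/
theorem bilCases_of_out {N : ℕ} {T M B T' M' : ℝ} (hNT : N ≤ T) (hN : M' + kappa jj * B ≤ N)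
    (hM : M' + kappa jj * B ≤ M) (hT : T + (M' + kappa jj * B) ≤ T') (hM0 : 0 ≤ M') (hB : 0 ≤ B)
    {τ : Triple jj} (hτ : pairMult τ ≠ 0) (hI : Bil N T' M' B (out τ)) (h1 : momE τ.2.1 = 0)
    (h2 : momE τ.2.2 = 0) (hB1 : (kabs τ.2.1.1 : ℝ) < B) (hB2 : (kabs τ.2.2.1 : ℝ) < B) :
    BilCases N T M B τ := by
  unfold BilCases
  obtain ⟨d, J, K⟩ := τ
  have hJ : mult d J ≠ 0 := left_ne_zero_of_mul hτ
  have hK : mult (dual d) K ≠ 0 := right_ne_zero_of_mul hτ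
  simp only at h1 h2 hB1 hB2 ⊢
  have hI' : Bil N T' M' B (lower d J + lower (dual d) K) := hI
  have hdeg : farDeg N (lower d J) + farDeg N (lower (dual d) K) = 2 := by
    rw [← hI.deg]; exact (wsum_add _ _ _).symm
  have hnear : nearW N (lower d J) + nearW N (lower (dual d) K)
      = nearW N (lower d J + lower (dual d) K) := (wsum_add _ _ _).symm
  have hn : (nearW N (lower d J) : ℝ) + nearW N (lower (dual d) K) < M' := by
    have := hI'.near
    rw [← hnear] at this
    exact_mod_cast this
  have hn1 : (0 : ℝ) ≤ nearW N (lower d J) := by exact_mod_cast nearW_nonneg N _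
  have hn2 : (0 : ℝ) ≤ nearW N (lower (dual d) K) := by exact_mod_cast nearW_nonneg N _
  have hκ : 0 ≤ (kappa jj : ℝ) * B := by positivity
  have d1 := farDeg_nonneg N (lower d J)
  have d2 := farDeg_nonneg N (lower (dual d) K)
  rcases (by omega : farDeg N (lower d J) = 0 ∨ farDeg N (lower (dual d) K) = 0 ∨
      (farDeg N (lower d J) = 1 ∧ farDeg N (lower (dual d) K) = 1)) with h | h | ⟨h, h'⟩
  · obtain ⟨e1, e2, e3⟩ := bil_of_farDeg_lower_eq_zero hN hM hT hM0 hB hJ hK h1 h2 hB1 hB2 hI' h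
    exact Or.inr ⟨e1, Or.inr ⟨e2, e3⟩⟩
  · obtain ⟨e1, e2, e3⟩ := bil_of_farDeg_lower_eq_zero (d := dual d) (J := K) (K := J) hN hM hT hM0
      hB hK (by rwa [dual_dual]) h2 h1 hB2 hB1 (by rwa [dual_dual, add_comm]) h
    rw [abs_dmom_dual] at e1
    exact Or.inr ⟨e1, Or.inl ⟨e3, e2⟩⟩
  · obtain ⟨e1, e2⟩ := bil_of_farDeg_lower_eq_one hNT (M := M) (M' := M') (by linarith) hT hJ h1 hB1
      (by linarith)
      (fun x hx => hI'.high x (by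
        rw [Prod.snd_add, Finsupp.add_apply]; omega)) h
    obtain ⟨-, e3⟩ := bil_of_farDeg_lower_eq_one hNT (M := M) (M' := M') (by linarith) hT hK h2 hB2
      (by linarith) (fun x hx => hI'.high x (by
        rw [Prod.snd_add, Finsupp.add_apply]; omega)) h'
    exact Or.inl ⟨e1, e2, e3⟩

/-! ### The shift of the far variables -/

open Classical in
/-- The shift of the far variables away from the origin by `u` sites.  It preserves sign, and the
momentum of bilinear exponents. -/
def shiftVar (N u : ℕ) : Var jj → Var jj
  | Sum.inl h => Sum.inl h
  | Sum.inr (σ, j) =>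
    if h : (N : ℤ) < |(j : ℤ)| ∧ (j : ℤ) + u * (j : ℤ).sign ∉ Set.range jj then
      Sum.inr (σ, ⟨(j : ℤ) + u * (j : ℤ).sign, h.2⟩)
    else Sum.inr (σ, j)

theorem abs_le_kappa (l : Fin n) : |jj l| ≤ (kappa jj : ℤ) := by
  rw [Int.abs_eq_natAbs]
  exact_mod_cast Finset.le_sup (f := fun l => (jj l).natAbs) (Finset.mem_univ l)

theorem notMem_range_of_kappa_lt {j : ℤ} (h : (kappa jj : ℤ) < |j|) : j ∉ Set.range jj := by
  rintro ⟨l, rfl⟩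
  exact absurd (abs_le_kappa l) (not_le.2 h)

theorem abs_add_mul_sign {j : ℤ} (u : ℕ) (hj : j ≠ 0) : |j + u * j.sign| = |j| + u := by
  rcases lt_or_gt_of_ne hj with h | h
  · rw [Int.sign_eq_neg_one_of_neg h, abs_of_neg h, abs_of_neg (by omega)]; ring
  · rw [Int.sign_eq_one_of_pos h, abs_of_pos h, abs_of_pos (by omega)]; ring

theorem sign_add_mul_sign {j : ℤ} (u : ℕ) : (j + u * j.sign).sign = j.sign := by
  rcases lt_trichotomy j 0 with h | h | h
  · rw [Int.sign_eq_neg_one_of_neg h, Int.sign_eq_neg_one_of_neg (by omega)]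
  · subst h; simp
  · rw [Int.sign_eq_one_of_pos h, Int.sign_eq_one_of_pos (by omega)]

theorem vmom_inr (σ : Bool) (j : Site jj) : vmom (Sum.inr (σ, j)) = sgn σ * (j : ℤ) := rfl

theorem abs_vmom_inr (σ : Bool) (j : Site jj) : |vmom (Sum.inr (σ, j))| = |(j : ℤ)| := by
  cases σ <;> simp [vmom_inr, sgn]

section shift

variable {N : ℕ} (hκ : kappa jj ≤ N) (u : ℕ)
include hκ

theorem shiftVar_inr_of_far {σ : Bool} {j : Site jj} (h : (N : ℤ) < |(j : ℤ)|) :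
    ∃ h' : (j : ℤ) + u * (j : ℤ).sign ∉ Set.range jj,
      shiftVar N u (Sum.inr (σ, j)) = Sum.inr (σ, ⟨(j : ℤ) + u * (j : ℤ).sign, h'⟩) := by
  have hj : (j : ℤ) ≠ 0 := by
    intro h0; rw [h0, abs_zero] at h; omega
  have h' : (j : ℤ) + u * (j : ℤ).sign ∉ Set.range jj := by
    refine notMem_range_of_kappa_lt ?_
    rw [abs_add_mul_sign u hj]
    omega
  exact ⟨h', dif_pos ⟨h, h'⟩⟩

omit hκ in
theorem shiftVar_of_not_far {x : Var jj} (h : ¬ Far N x) : shiftVar N u x = x := by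
  rcases x with i | ⟨σ, j⟩
  · rfl
  · unfold Far at h
    rw [abs_vmom_inr] at h
    exact dif_neg fun hc => h hc.1

theorem vmom_shiftVar {x : Var jj} (h : Far N x) :
    vmom (shiftVar N u x) = vmom x + u * (vmom x).sign := by
  rcases x with i | ⟨σ, j⟩
  · simp [Far, vmom] at h; omega
  · unfold Far at h
    rw [abs_vmom_inr] at h
    obtain ⟨h', e⟩ := shiftVar_inr_of_far hκ u (σ := σ) h
    rw [e, vmom_inr, vmom_inr]
    cases σ <;> simp [sgn]
    ring

theorem abs_vmom_shiftVar {x : Var jj} (h : Far N x) :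
    |vmom (shiftVar N u x)| = |vmom x| + u := by
  rw [vmom_shiftVar hκ u h, abs_add_mul_sign]
  intro h0
  unfold Far at h
  rw [h0, abs_zero] at h; omega

theorem far_shiftVar (x : Var jj) : Far N (shiftVar N u x) ↔ Far N x := by
  by_cases h : Far N x
  · simp only [h, iff_true]
    unfold Far at h ⊢
    rw [abs_vmom_shiftVar hκ u h]
    omega
  · rw [shiftVar_of_not_far u h]

theorem shiftVar_injective : Function.Injective (shiftVar (jj := jj) N u) := by
  intro x y hxy
  have hf : Far N x ↔ Far N y := by
    rw [← far_shiftVar hκ u x, hxy, far_shiftVar hκ u y]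
  by_cases hx : Far N x
  · have hy := hf.1 hx
    rcases x with i | ⟨σ, j⟩
    · simp [Far, vmom] at hx; omega
    rcases y with i | ⟨σ', j'⟩
    · simp [Far, vmom] at hy; omega
    unfold Far at hx hy
    rw [abs_vmom_inr] at hx hy
    obtain ⟨h1, e1⟩ := shiftVar_inr_of_far hκ u (σ := σ) hx
    obtain ⟨h2, e2⟩ := shiftVar_inr_of_far hκ u (σ := σ') hy
    rw [e1, e2] at hxy
    simp only [Sum.inr.injEq, Prod.mk.injEq, Subtype.mk.injEq] at hxy
    obtain ⟨rfl, h3⟩ := hxy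
    have h4 : (j : ℤ).sign = (j' : ℤ).sign := by
      rw [← sign_add_mul_sign (j := (j : ℤ)) u, h3, sign_add_mul_sign]
    rw [h4] at h3
    have : j = j' := Subtype.ext (by linarith)
    rw [this]
  · rw [shiftVar_of_not_far u hx, shiftVar_of_not_far u (fun h => hx (hf.2 h))] at hxy
    exact hxy

theorem exists_shiftVar_eq {x : Var jj} (h : Far N x → (N : ℤ) + u < |vmom x|) :
    ∃ y, shiftVar N u y = x := by
  by_cases hx : Far N x
  · have h := h hx
    rcases x with i | ⟨σ, j⟩
    · simp [Far, vmom] at hx; omega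
    rw [abs_vmom_inr] at h
    set i : ℤ := (j : ℤ) - u * (j : ℤ).sign with hi
    have h1 : (N : ℤ) < |i| ∧ i + u * i.sign = j := by
      rcases lt_trichotomy (j : ℤ) 0 with h0 | h0 | h0
      · rw [Int.sign_eq_neg_one_of_neg h0] at hi
        rw [abs_of_neg h0] at h
        rw [abs_of_neg (by omega), Int.sign_eq_neg_one_of_neg (by omega)]
        constructor <;> omega
      · rw [h0] at h; simp at h; omega
      · rw [Int.sign_eq_one_of_pos h0] at hi
        rw [abs_of_pos h0] at h
        rw [abs_of_pos (by omega), Int.sign_eq_one_of_pos (by omega)]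
        constructor <;> omega
    have h2 : i ∉ Set.range jj := notMem_range_of_kappa_lt (by omega)
    refine ⟨Sum.inr (σ, ⟨i, h2⟩), ?_⟩
    obtain ⟨h3, e⟩ := shiftVar_inr_of_far hκ u (σ := σ) (j := ⟨i, h2⟩) h1.1
    rw [e]
    congr 2
    exact Subtype.ext h1.2
  · exact ⟨x, shiftVar_of_not_far u hx⟩

end shift

/-- The shift of the far variables of an exponent. -/
def shift (N u : ℕ) (J : Expo jj) : Expo jj := (J.1, J.2.mapDomain (shiftVar N u))

/-- The shift of a direction. -/
def shiftDir (N u : ℕ) : Dir jj → Dir jj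
  | Sum.inl h => Sum.inl h
  | Sum.inr x => Sum.inr (shiftVar N u x)

theorem wsum_shift (ω : Var jj → ℤ) (N u : ℕ) (J : Expo jj) :
    wsum ω (shift N u J) = wsum (fun x => ω (shiftVar N u x)) J := by
  unfold wsum shift
  rw [Finsupp.sum_mapDomain_index (by simp) (by intros; push_cast; ring)]

theorem shift_add (N u : ℕ) (J K : Expo jj) : shift N u (J + K) = shift N u J + shift N u K :=
  Prod.ext rfl Finsupp.mapDomain_add

theorem shift_single (N u : ℕ) (x : Var jj) :
    shift N u ((0, Finsupp.single x 1) : Expo jj) = (0, Finsupp.single (shiftVar N u x) 1) :=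
  Prod.ext rfl Finsupp.mapDomain_single

theorem shift_eq_self {N : ℕ} (u : ℕ) {J : Expo jj} (h : farDeg N J = 0) : shift N u J = J := by
  refine Prod.ext rfl ?_
  change J.2.mapDomain (shiftVar N u) = J.2
  conv_rhs => rw [← Finsupp.mapDomain_id (v := J.2)]
  refine Finsupp.mapDomain_congr fun x hx => ?_
  exact shiftVar_of_not_far u (not_far_of_farDeg h (by simpa using hx))

section shift

variable {N : ℕ} (hκ : kappa jj ≤ N) (u : ℕ)
include hκ

theorem shift_injective : Function.Injective (shift (jj := jj) N u) := by
  intro J K h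
  unfold shift at h
  obtain ⟨h1, h2⟩ := Prod.mk.inj h
  exact Prod.ext h1 (Finsupp.mapDomain_injective (shiftVar_injective hκ u) h2)

theorem shiftDir_injective : Function.Injective (shiftDir (jj := jj) N u) := by
  rintro (h | x) (h' | y) hxy
  · exact hxy
  · cases hxy
  · cases hxy
  · exact congrArg Sum.inr (shiftVar_injective hκ u (Sum.inr.inj hxy))

theorem shift_apply (J : Expo jj) (x : Var jj) : (shift N u J).2 (shiftVar N u x) = J.2 x :=
  Finsupp.mapDomain_apply (shiftVar_injective hκ u) _ _

theorem cmult_shift (d : Dir jj) (J : Expo jj) :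
    cmult (shiftDir N u d) (shift N u J) = cmult d J := by
  rcases d with h | x
  · rfl
  · exact congrArg Nat.cast (shift_apply hκ u J x)

theorem lower_shift (d : Dir jj) (J : Expo jj) :
    lower (shiftDir N u d) (shift N u J) = shift N u (lower d J) := by
  classical
  rcases d with h | x
  · rfl
  · by_cases hJ : J.2 x = 0
    · have h1 : ∀ (K : Expo jj) (y : Var jj), K.2 y = 0 → lower (Sum.inr y) K = K := by
        intro K y hK
        refine Prod.ext rfl (Finsupp.ext fun z => ?_)
        by_cases hz : y = z
        · subst hz; simp [lower, hK]
        · simp [lower, Finsupp.single_apply, hz]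
      rw [h1 J x hJ]
      exact h1 _ _ ((shift_apply hκ u J x).trans hJ)
    · conv_lhs => rw [← lower_add_single (v := x) (J := J) hJ, shift_add, shift_single]
      exact lower_add_self _ _

theorem shiftDir_dual (d : Dir jj) : shiftDir N u (dual d) = dual (shiftDir N u d) := by
  rcases d with h | h | ⟨σ, j⟩
  · rfl
  · rfl
  · by_cases h : (N : ℤ) < |(j : ℤ)|
    · obtain ⟨h1, e1⟩ := shiftVar_inr_of_far hκ u (σ := σ) h
      obtain ⟨h2, e2⟩ := shiftVar_inr_of_far hκ u (σ := !σ) h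
      simp only [shiftDir, dual, e1, e2]
    · have h1 : ∀ τ, ¬ Far N (Sum.inr (τ, j) : Var jj) := fun τ => by
        unfold Far; rwa [abs_vmom_inr]
      simp only [shiftDir, dual, shiftVar_of_not_far u (h1 _)]

theorem sgnD_shiftDir (d : Dir jj) : sgnD (shiftDir N u d) = sgnD d := by
  rcases d with h | h | ⟨σ, j⟩
  · rfl
  · rfl
  · by_cases h : (N : ℤ) < |(j : ℤ)|
    · obtain ⟨h1, e1⟩ := shiftVar_inr_of_far hκ u (σ := σ) h
      simp only [shiftDir, e1, sgnD]
    · have h1 : ¬ Far N (Sum.inr (σ, j) : Var jj) := by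
        unfold Far; rwa [abs_vmom_inr]
      simp only [shiftDir, shiftVar_of_not_far u h1]

theorem farDeg_shift (J : Expo jj) : farDeg N (shift N u J) = farDeg N J := by
  classical
  unfold farDeg
  rw [wsum_shift]
  congr 1
  funext x
  by_cases h : Far N x
  · rw [if_pos h, if_pos ((far_shiftVar hκ u x).2 h)]
  · rw [shiftVar_of_not_far u h]

theorem nearW_shift (J : Expo jj) : nearW N (shift N u J) = nearW N J := by
  unfold nearW
  rw [wsum_shift]
  congr 1
  funext x
  by_cases h : Far N x
  · rw [if_pos h, if_pos ((far_shiftVar hκ u x).2 h)]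
  · rw [shiftVar_of_not_far u h]

theorem farSgn_shift (J : Expo jj) : farSgn N (shift N u J) = farSgn N J := by
  unfold farSgn
  rw [wsum_shift]
  congr 1
  funext x
  by_cases h : Far N x
  · rw [if_pos h, if_pos ((far_shiftVar hκ u x).2 h), vmom_shiftVar hκ u h, sign_add_mul_sign]
  · rw [shiftVar_of_not_far u h]

theorem momE_shift (J : Expo jj) : momE (shift N u J) = momE J + u * farSgn N J := by
  classical
  rw [momE_eq, momE_eq, wsum_shift, add_assoc]
  congr 1
  unfold farSgn wsum Finsupp.sum
  rw [Finset.mul_sum, ← Finset.sum_add_distrib]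
  refine Finset.sum_congr rfl fun x _ => ?_
  beta_reduce
  by_cases h : Far N x
  · rw [if_pos h, vmom_shiftVar hκ u h]; ring
  · rw [if_neg h, shiftVar_of_not_far u h]; ring

theorem exists_of_shift_ne_zero {J : Expo jj} {y : Var jj} (h : (shift N u J).2 y ≠ 0) :
    ∃ x, J.2 x ≠ 0 ∧ y = shiftVar N u x := by
  classical
  have h1 := Finsupp.mapDomain_support (Finsupp.mem_support_iff.2 h)
  obtain ⟨x, hx, rfl⟩ := Finset.mem_image.1 h1
  exact ⟨x, Finsupp.mem_support_iff.1 hx, rfl⟩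

theorem high_shift {T : ℝ} {J : Expo jj}
    (h : ∀ x, J.2 x ≠ 0 → Far N x → T < |(vmom x : ℝ)|) (y : Var jj)
    (hy : (shift N u J).2 y ≠ 0) (hf : Far N y) : T + u < |(vmom y : ℝ)| := by
  obtain ⟨x, hx, rfl⟩ := exists_of_shift_ne_zero hκ u hy
  have hfx := (far_shiftVar hκ u x).1 hf
  have h1 : (|(vmom (shiftVar N u x) : ℝ)|) = |(vmom x : ℝ)| + u := by
    exact_mod_cast abs_vmom_shiftVar hκ u hfx
  rw [h1]
  linarith [h x hx hfx]

theorem Bil.shift {T M B : ℝ} {J : Expo jj} (h : Bil N T M B J) (hN : M + kappa jj * B ≤ N) :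
    Bil N T M B (shift N u J) := by
  refine ⟨(farDeg_shift hκ u J).trans h.deg, fun y hy hf => ?_, ?_, h.kabs_lt, ?_⟩
  · have := high_shift hκ u h.high y hy hf
    have h0 : (0 : ℝ) ≤ u := by positivity
    linarith
  · rw [nearW_shift hκ u]; exact h.near
  · rw [momE_shift hκ u, h.mom, h.farSgn_eq_zero hN, mul_zero, add_zero]

/-- A bilinear exponent whose far variables are sufficiently far is a shift. -/
theorem Bil.exists_shift_eq {T M B : ℝ} {J : Expo jj} (h : Bil N T M B J)
    (hN : M + kappa jj * B ≤ N) (hNT : N ≤ T)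
    (hfar : ∀ x, J.2 x ≠ 0 → Far N x → T + u < |(vmom x : ℝ)|) :
    ∃ K, QuasiToeplitz.shift N u K = J ∧ Bil N T M B K := by
  classical
  have hinj := shiftVar_injective (jj := jj) hκ u
  have hsub : (J.2.support : Set (Var jj)) ⊆ Set.range (shiftVar N u) := by
    intro x hx
    obtain ⟨y, hy⟩ := exists_shiftVar_eq hκ u (x := x) (fun hf => by
      have := hfar x (by simpa using hx) hf
      have h2 : (N : ℝ) + u < |(vmom x : ℝ)| := by linarith
      exact_mod_cast h2)
    exact ⟨y, hy⟩
  set K : Expo jj := (J.1, J.2.comapDomain (shiftVar N u) hinj.injOn) with hK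
  have e : QuasiToeplitz.shift N u K = J :=
    Prod.ext rfl (Finsupp.mapDomain_comapDomain _ hinj _ hsub)
  refine ⟨K, e, ?_, fun x hx hf => ?_, ?_, h.kabs_lt, ?_⟩
  · rw [← farDeg_shift hκ u, e]; exact h.deg
  · have h1 := hfar (shiftVar N u x) (by rw [← e, shift_apply hκ u]; exact hx)
      ((far_shiftVar hκ u x).2 hf)
    have h2 : (|(vmom (shiftVar N u x) : ℝ)|) = |(vmom x : ℝ)| + u := by
      exact_mod_cast abs_vmom_shiftVar hκ u hf
    linarith
  · rw [← nearW_shift hκ u, e]; exact h.near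
  · have h1 := momE_shift hκ u K
    rw [← farSgn_shift hκ u, e, h.mom, h.farSgn_eq_zero hN, mul_zero, add_zero] at h1
    exact h1.symm

end shift

/-! ### Töplitz coefficients and their Poisson bracket -/

/-- Coefficients of a Töplitz function: they are supported on the bilinear exponents, and they do
not change when the far variables are shifted. -/
structure ToepE (N : ℕ) (T M B : ℝ) (t : Expo jj → ℂ) : Prop where
  supp : ∀ J, t J ≠ 0 → Bil N T M B J
  inv : ∀ u J, Bil N T M B J → t (shift N u J) = t J

open Classical in
/-- The bilinear part of a family of coefficients. -/
def bilPart (N : ℕ) (T M B : ℝ) (c : Expo jj → ℂ) : Expo jj → ℂ :=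
  fun J => if Bil N T M B J then c J else 0

open Classical in
/-- The part without far variables and with low frequencies. -/
def nearPart (N : ℕ) (B : ℝ) (c : Expo jj → ℂ) : Expo jj → ℂ :=
  fun J => if farDeg N J = 0 ∧ (kabs J.1 : ℝ) < B then c J else 0

open Classical in
/-- The part with high frequencies. -/
def ultraPart (B : ℝ) (c : Expo jj → ℂ) : Expo jj → ℂ :=
  fun J => if (kabs J.1 : ℝ) < B then 0 else c J

theorem enorm_nearPart_le (N : ℕ) (B : ℝ) (c : Expo jj → ℂ) (J : Expo jj) :
    ‖nearPart N B c J‖ₑ ≤ ‖c J‖ₑ := by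
  unfold nearPart; split_ifs
  · exact le_rfl
  · rw [enorm_zero]; exact zero_le

theorem enorm_ultraPart_le (B : ℝ) (c : Expo jj → ℂ) (J : Expo jj) :
    ‖ultraPart B c J‖ₑ ≤ ‖c J‖ₑ := by
  unfold ultraPart; split_ifs
  · rw [enorm_zero]; exact zero_le
  · exact le_rfl

theorem enorm_bilPart_le (N : ℕ) (T M B : ℝ) (c : Expo jj → ℂ) (J : Expo jj) :
    ‖bilPart N T M B c J‖ₑ ≤ ‖c J‖ₑ := by
  unfold bilPart; split_ifs
  · exact le_rfl
  · rw [enorm_zero]; exact zero_le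

theorem ToepE.restrict {N : ℕ} {T M B T' M' : ℝ} {t : Expo jj → ℂ} (h : ToepE N T M B t)
    (hκ : kappa jj ≤ N) (hN : M' + kappa jj * B ≤ N) (hT : T ≤ T') (hM : M' ≤ M) :
    ToepE N T' M' B (bilPart N T' M' B t) := by
  refine ⟨fun J hJ => ?_, fun u J hJ => ?_⟩
  · by_contra hc
    exact hJ (if_neg hc)
  · unfold bilPart
    rw [if_pos hJ, if_pos (hJ.shift hκ u hN), h.inv u J (hJ.mono hT hM)]

/-- The weight of the Töplitz approximation of a Poisson bracket: two Töplitz coefficients if a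
high variable is contracted, and otherwise one Töplitz coefficient and one coefficient without far
variables. -/
def toepWeight (T : ℝ) (t₁ l₁ t₂ l₂ : Expo jj → ℂ) (τ : Triple jj) : ℂ :=
  if T < |(dmom τ.1 : ℝ)| then t₁ τ.2.1 * t₂ τ.2.2 else t₁ τ.2.1 * l₂ τ.2.2 + l₁ τ.2.1 * t₂ τ.2.2

theorem not_far_of_mult_ne_zero {N : ℕ} {d : Dir jj} {J : Expo jj} (h : mult d J ≠ 0)
    (hJ : farDeg N J = 0) : ¬ (N : ℤ) < |dmom d| := by
  rcases d with i | x
  · simp [dmom]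
  · exact not_far_of_farDeg hJ h

theorem bilCases_of_toepWeight {N : ℕ} {T M B : ℝ} {t₁ l₁ t₂ l₂ : Expo jj → ℂ}
    (h₁ : ToepE N T M B t₁) (h₂ : ToepE N T M B t₂) (hl₁ : ∀ J, l₁ J ≠ 0 → farDeg N J = 0)
    (hl₂ : ∀ J, l₂ J ≠ 0 → farDeg N J = 0) {τ : Triple jj} (hτ : pairMult τ ≠ 0)
    (hW : toepWeight T t₁ l₁ t₂ l₂ τ ≠ 0) : BilCases N T M B τ := by
  unfold toepWeight at hW
  split_ifs at hW with h
  · exact Or.inl ⟨h, h₁.supp _ (left_ne_zero_of_mul hW), h₂.supp _ (right_ne_zero_of_mul hW)⟩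
  · by_cases h1 : t₁ τ.2.1 * l₂ τ.2.2 = 0
    · rw [h1, zero_add] at hW
      have h3 := hl₁ _ (left_ne_zero_of_mul hW)
      exact Or.inr ⟨not_far_of_mult_ne_zero (left_ne_zero_of_mul hτ) h3,
        Or.inr ⟨h3, h₂.supp _ (right_ne_zero_of_mul hW)⟩⟩
    · have h3 := hl₂ _ (right_ne_zero_of_mul h1)
      have h4 := not_far_of_mult_ne_zero (right_ne_zero_of_mul hτ) h3
      rw [abs_dmom_dual] at h4
      exact Or.inr ⟨h4, Or.inl ⟨h₁.supp _ (left_ne_zero_of_mul h1), h3⟩⟩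

/-- The shift of the far variables, for a pair of monomials and a contracted variable. -/
def shiftTriple (N u : ℕ) (τ : Triple jj) : Triple jj :=
  (shiftDir N u τ.1, shift N u τ.2.1, shift N u τ.2.2)

theorem shiftDir_of_not_far {N : ℕ} (u : ℕ) {d : Dir jj} (h : ¬ (N : ℤ) < |dmom d|) :
    shiftDir N u d = d := by
  rcases d with i | x
  · rfl
  · exact congrArg Sum.inr (shiftVar_of_not_far u h)

section shift

variable {N : ℕ} (hκ : kappa jj ≤ N) (u : ℕ)
include hκ

theorem out_shiftTriple (τ : Triple jj) : out (shiftTriple N u τ) = shift N u (out τ) := by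
  simp only [out, shiftTriple, shift_add, lower_shift hκ, ← shiftDir_dual hκ]

theorem cfac_shiftTriple (τ : Triple jj) : cfac (shiftTriple N u τ) = cfac τ := by
  simp only [cfac, shiftTriple, sgnD_shiftDir hκ, cmult_shift hκ, ← shiftDir_dual hκ]

theorem abs_dmom_shiftDir {d : Dir jj} (h : (N : ℤ) < |dmom d|) :
    |dmom (shiftDir N u d)| = |dmom d| + u := by
  rcases d with i | x
  · simp [dmom] at h; omega
  · exact abs_vmom_shiftVar hκ u h

theorem toepWeight_shiftTriple {T M B : ℝ} (hNT : N ≤ T) {t₁ l₁ t₂ l₂ : Expo jj → ℂ}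
    (h₁ : ToepE N T M B t₁) (h₂ : ToepE N T M B t₂) (hl₁ : ∀ J, l₁ J ≠ 0 → farDeg N J = 0)
    (hl₂ : ∀ J, l₂ J ≠ 0 → farDeg N J = 0) {τ : Triple jj} (hτ : BilCases N T M B τ) :
    toepWeight T t₁ l₁ t₂ l₂ (shiftTriple N u τ) = toepWeight T t₁ l₁ t₂ l₂ τ := by
  have hl₁' : ∀ J, farDeg N J ≠ 0 → l₁ J = 0 := fun J hJ => by_contra fun h => hJ (hl₁ J h)
  have hl₂' : ∀ J, farDeg N J ≠ 0 → l₂ J = 0 := fun J hJ => by_contra fun h => hJ (hl₂ J h)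
  unfold toepWeight shiftTriple
  rcases hτ with ⟨hd, hJ, hK⟩ | ⟨hd, h⟩
  · have hdN : (N : ℤ) < |dmom τ.1| := by
      have : (N : ℝ) < |(dmom τ.1 : ℝ)| := hNT.trans_lt hd
      exact_mod_cast this
    have e1 : |(dmom (shiftDir N u τ.1) : ℝ)| = |(dmom τ.1 : ℝ)| + u := by
      exact_mod_cast abs_dmom_shiftDir hκ u hdN
    have hu : (0 : ℝ) ≤ u := by positivity
    rw [if_pos hd, if_pos (by simp only; linarith), h₁.inv u _ hJ, h₂.inv u _ hK]
  · have hdT : ¬ T < |(dmom τ.1 : ℝ)| := by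
      intro hc
      have : (N : ℝ) < |(dmom τ.1 : ℝ)| := hNT.trans_lt hc
      exact hd (by exact_mod_cast this)
    simp only [shiftDir_of_not_far u hd]
    rw [if_neg hdT, if_neg hdT]
    rcases h with ⟨hJ, hK⟩ | ⟨hJ, hK⟩
    · rw [shift_eq_self u hK, h₁.inv u _ hJ, hl₁' τ.2.1 (by rw [hJ.deg]; norm_num),
        hl₁' (shift N u τ.2.1) (by rw [farDeg_shift hκ u, hJ.deg]; norm_num)]
    · rw [shift_eq_self u hJ, h₂.inv u _ hK, hl₂' τ.2.2 (by rw [hK.deg]; norm_num),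
        hl₂' (shift N u τ.2.2) (by rw [farDeg_shift hκ u, hK.deg]; norm_num)]

/-- A pair of monomials whose product is a shifted bilinear monomial is itself shifted. -/
theorem exists_shiftTriple_eq {T M B T' M' : ℝ} (hNT : N ≤ T) (hN : M + kappa jj * B ≤ N)
    (hM : M' ≤ M) (hT : T + (M' + kappa jj * B) ≤ T') (hκB : 0 ≤ M' + kappa jj * B)
    {I : Expo jj} (hI : Bil N T' M' B I) {τ : Triple jj} (hτ : pairMult τ ≠ 0)
    (hc : BilCases N T M B τ) (ho : out τ = shift N u I) :
    ∃ τ₀, shiftTriple N u τ₀ = τ ∧ BilCases N T M B τ₀ := by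
  obtain ⟨d, J, K⟩ := τ
  have hJm : mult d J ≠ 0 := left_ne_zero_of_mul hτ
  have hKm : mult (dual d) K ≠ 0 := right_ne_zero_of_mul hτ
  have hIs := hI.shift hκ u (by linarith)
  have ho' : lower d J + lower (dual d) K = shift N u I := ho
  have hnear : nearW N (lower d J) + nearW N (lower (dual d) K) = nearW N (shift N u I) := by
    rw [← ho']; exact (wsum_add _ _ _).symm
  have hn : (nearW N (lower d J) : ℝ) + nearW N (lower (dual d) K) < M' := by
    have := hIs.near
    rw [← hnear] at this
    exact_mod_cast this
  have hn1 : (0 : ℝ) ≤ nearW N (lower d J) := by exact_mod_cast nearW_nonneg N _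
  have hn2 : (0 : ℝ) ≤ nearW N (lower (dual d) K) := by exact_mod_cast nearW_nonneg N _
  have hu : (0 : ℝ) ≤ u := by positivity
  have hh1 : ∀ x, (lower d J).2 x ≠ 0 → Far N x → T' + u < |(vmom x : ℝ)| := fun x hx hf => by
    refine high_shift hκ u hI.high x ?_ hf
    rw [← ho', Prod.snd_add, Finsupp.add_apply]; omega
  have hh2 : ∀ x, (lower (dual d) K).2 x ≠ 0 → Far N x → T' + u < |(vmom x : ℝ)| :=
    fun x hx hf => by
      refine high_shift hκ u hI.high x ?_ hf
      rw [← ho', Prod.snd_add, Finsupp.add_apply]; omega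
  rcases hc with ⟨hd, hJ, hK⟩ | ⟨hd, h⟩
  -- The contracted variable is not seen in `out τ`; momentum conservation in each factor shows that
  -- it is far enough from the origin to be shifted back together with the other ones.
  · simp only at hd hJ hK
    have hdN : (N : ℤ) < |dmom d| := by
      have : (N : ℝ) < |(dmom d : ℝ)| := hNT.trans_lt hd
      exact_mod_cast this
    obtain ⟨f1, g1⟩ := bil_of_farDeg_lower_eq_one (N := N) (T := T + u) (T' := T' + u) (M := M)
      (M' := M') (B := B) (by linarith) hM (by linarith) hJm hJ.mom hJ.kabs_lt (by linarith) hh1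
      (by rw [farDeg_lower hJm, hJ.deg, if_pos hdN]; norm_num)
    obtain ⟨f2, g2⟩ := bil_of_farDeg_lower_eq_one (N := N) (T := T + u) (T' := T' + u) (M := M)
      (M' := M') (B := B) (by linarith) hM (by linarith) hKm hK.mom hK.kabs_lt (by linarith) hh2
      (by rw [farDeg_lower hKm, hK.deg, if_pos (by rwa [abs_dmom_dual])]; norm_num)
    obtain ⟨J₀, rfl, hJ₀⟩ := hJ.exists_shift_eq hκ u hN hNT g1.high
    obtain ⟨K₀, rfl, hK₀⟩ := hK.exists_shift_eq hκ u hN hNT g2.high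
    obtain ⟨d₀, hd₀, hd₁⟩ : ∃ d₀, shiftDir N u d₀ = d ∧ (N : ℤ) < |dmom d₀| := by
      rcases d with i | x
      · simp [dmom] at hdN; omega
      · obtain ⟨y, hy⟩ := exists_shiftVar_eq hκ u (x := x) (fun _ => by
          have h2 : (N : ℝ) + u < |(vmom x : ℝ)| := lt_of_le_of_lt (by linarith) f1
          exact_mod_cast h2)
        refine ⟨Sum.inr y, congrArg Sum.inr hy, (far_shiftVar hκ u y).1 ?_⟩
        rw [hy]; exact hdN
    refine ⟨(d₀, J₀, K₀), by rw [← hd₀]; rfl, Or.inl ⟨?_, hJ₀, hK₀⟩⟩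
    have e1 : |(dmom (shiftDir N u d₀) : ℝ)| = |(dmom d₀ : ℝ)| + u := by
      exact_mod_cast abs_dmom_shiftDir hκ u hd₁
    rw [hd₀] at e1
    simp only
    linarith
  · simp only at hd h
    rcases h with ⟨hJ, hK⟩ | ⟨hJ, hK⟩
    · obtain ⟨J₀, rfl, hJ₀⟩ := hJ.exists_shift_eq hκ u hN hNT fun x hx hf => by
        have hne : d ≠ Sum.inr x := fun he => hd (by rw [he]; exact hf)
        have := hh1 x (by rwa [lower_apply_of_ne hne]) hf
        linarith
      refine ⟨(d, J₀, K), ?_, Or.inr ⟨hd, Or.inl ⟨hJ₀, hK⟩⟩⟩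
      rw [shiftTriple, shiftDir_of_not_far u hd, shift_eq_self u hK]
    · obtain ⟨K₀, rfl, hK₀⟩ := hK.exists_shift_eq hκ u hN hNT fun x hx hf => by
        have hne : dual d ≠ Sum.inr x := fun he => hd (by
          rw [← abs_dmom_dual, he]; exact hf)
        have := hh2 x (by rwa [lower_apply_of_ne hne]) hf
        linarith
      refine ⟨(d, J, K₀), ?_, Or.inr ⟨hd, Or.inr ⟨hJ, hK₀⟩⟩⟩
      rw [shiftTriple, shiftDir_of_not_far u hd, shift_eq_self u hJ]

/-- The coefficients of the Töplitz approximation of a bracket are Töplitz. -/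
theorem cBracket_toepWeight_shift {T M B T' M' : ℝ} (hNT : N ≤ T) (hN : M + kappa jj * B ≤ N)
    (hM : M' ≤ M) (hT : T + (M' + kappa jj * B) ≤ T') (hκB : 0 ≤ M' + kappa jj * B)
    {t₁ l₁ t₂ l₂ : Expo jj → ℂ}
    (h₁ : ToepE N T M B t₁) (h₂ : ToepE N T M B t₂) (hl₁ : ∀ J, l₁ J ≠ 0 → farDeg N J = 0)
    (hl₂ : ∀ J, l₂ J ≠ 0 → farDeg N J = 0) {I : Expo jj} (hI : Bil N T' M' B I) :
    cBracket (toepWeight T t₁ l₁ t₂ l₂) (shift N u I) = cBracket (toepWeight T t₁ l₁ t₂ l₂) I := by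
  classical
  set W := toepWeight T t₁ l₁ t₂ l₂ with hW
  have hmul : ∀ τ, cfac τ * W τ ≠ 0 → pairMult τ ≠ 0 ∧ BilCases N T M B τ := by
    intro τ h
    have h0 : pairMult τ ≠ 0 := by
      intro h0
      have := enorm_cfac τ
      rw [h0, Nat.cast_zero, enorm_eq_zero] at this
      exact left_ne_zero_of_mul h this
    exact ⟨h0, bilCases_of_toepWeight h₁ h₂ hl₁ hl₂ h0 (right_ne_zero_of_mul h)⟩
  have hval : ∀ τ, BilCases N T M B τ → out τ = I →
      (if out (shiftTriple N u τ) = shift N u I then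
        cfac (shiftTriple N u τ) * W (shiftTriple N u τ) else 0)
      = if out τ = I then cfac τ * W τ else 0 := by
    intro τ hτ ho
    rw [out_shiftTriple hκ, ho, if_pos rfl, if_pos rfl, cfac_shiftTriple hκ,
      hW, toepWeight_shiftTriple hκ u hNT h₁ h₂ hl₁ hl₂ hτ]
  refine tsum_eq_tsum_of_ne_zero_bij
    (fun τ : Function.support fun τ => if out τ = I then cfac τ * W τ else 0 =>
      shiftTriple N u τ.1) ?_ ?_ ?_
  · intro τ τ' h
    apply Subtype.ext
    obtain ⟨h1, h2⟩ := Prod.mk.inj h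
    obtain ⟨h2, h3⟩ := Prod.mk.inj h2
    exact Prod.ext (shiftDir_injective hκ u h1)
      (Prod.ext (shift_injective hκ u h2) (shift_injective hκ u h3))
  · intro τ hτ
    have hτ' : (if out τ = shift N u I then cfac τ * W τ else 0) ≠ 0 := hτ
    split_ifs at hτ' with ho
    · obtain ⟨h1, h2⟩ := hmul τ hτ'
      obtain ⟨τ₀, rfl, h4⟩ := exists_shiftTriple_eq hκ u hNT hN hM hT hκB hI h1 h2 ho
      have ho' : out τ₀ = I := by
        rw [out_shiftTriple hκ] at ho
        exact shift_injective hκ u ho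
      refine ⟨⟨τ₀, ?_⟩, rfl⟩
      rw [Function.mem_support, ← hval τ₀ h4 ho']
      exact hτ
    · exact absurd rfl hτ'
  · rintro ⟨τ, hτ⟩
    have hτ' : (if out τ = I then cfac τ * W τ else 0) ≠ 0 := hτ
    have ho : out τ = I := by
      by_contra hc
      rw [if_neg hc] at hτ'
      exact hτ' rfl
    rw [if_pos ho] at hτ'
    exact hval τ (hmul τ hτ').2 ho

end shift

theorem majBracket_mono_of {Q Q' : Triple jj → ℝ≥0∞} {I : Expo jj}
    (h : ∀ τ, out τ = I → pairMult τ ≠ 0 → Q τ ≤ Q' τ) : majBracket Q I ≤ majBracket Q' I := by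
  unfold majBracket
  refine ENNReal.tsum_le_tsum fun τ => ?_
  split_ifs with ho
  · by_cases hm : pairMult τ = 0
    · simp [hm]
    · exact mul_le_mul' le_rfl (h τ ho hm)
  · exact le_rfl

/-- The weights of the error of the Töplitz approximation of a bracket. -/
def errWeight (c₁ t₁ e₁ u₁ c₂ e₂ u₂ : Expo jj → ℂ) (τ : Triple jj) : ℝ≥0∞ :=
  absC e₁ τ.2.1 * absC c₂ τ.2.2 + absC t₁ τ.2.1 * absC e₂ τ.2.2 + absC c₁ τ.2.1 * absC e₂ τ.2.2
    + (absC u₁ τ.2.1 * absC c₂ τ.2.2 + absC c₁ τ.2.1 * absC u₂ τ.2.2)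

section error

variable {N : ℕ} {T M B T' M' : ℝ} {c₁ t₁ c₂ t₂ : Expo jj → ℂ}

theorem enorm_sub_toepWeight_le_of_bilCases (hNT : N ≤ T) {τ : Triple jj}
    (hτ : BilCases N T M B τ) :
    ‖c₁ τ.2.1 * c₂ τ.2.2
        - toepWeight T t₁ (nearPart N B c₁) t₂ (nearPart N B c₂) τ‖ₑ
      ≤ errWeight c₁ t₁ (fun J => bilPart N T M B c₁ J - bilPart N T M B t₁ J) (ultraPart B c₁) c₂
        (fun J => bilPart N T M B c₂ J - bilPart N T M B t₂ J) (ultraPart B c₂) τ := by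
  unfold toepWeight errWeight absC
  rcases hτ with ⟨hd, hJ, hK⟩ | ⟨hd, h⟩
  · rw [if_pos hd]
    simp only [bilPart, if_pos hJ, if_pos hK]
    have : c₁ τ.2.1 * c₂ τ.2.2 - t₁ τ.2.1 * t₂ τ.2.2
        = (c₁ τ.2.1 - t₁ τ.2.1) * c₂ τ.2.2 + t₁ τ.2.1 * (c₂ τ.2.2 - t₂ τ.2.2) := by ring
    rw [this]
    refine (enorm_add_le _ _).trans ?_
    rw [enorm_mul, enorm_mul, add_assoc]
    exact le_self_add
  · have hdT : ¬ T < |(dmom τ.1 : ℝ)| := by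
      intro hc
      have : (N : ℝ) < |(dmom τ.1 : ℝ)| := hNT.trans_lt hc
      exact hd (by exact_mod_cast this)
    rw [if_neg hdT]
    rcases h with ⟨hJ, hK⟩ | ⟨hJ, hK⟩
    · have h1 : nearPart N B c₁ τ.2.1 = 0 := if_neg fun hc => by rw [hJ.deg] at hc; omega
      rw [h1, zero_mul, add_zero]
      by_cases hB : (kabs τ.2.2.1 : ℝ) < B
      · have h2 : nearPart N B c₂ τ.2.2 = c₂ τ.2.2 := if_pos ⟨hK, hB⟩
        rw [h2, ← sub_mul, enorm_mul]
        simp only [bilPart, if_pos hJ, add_assoc]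
        exact le_self_add
      · have h2 : nearPart N B c₂ τ.2.2 = 0 := if_neg fun hc => hB hc.2
        have h3 : ultraPart B c₂ τ.2.2 = c₂ τ.2.2 := if_neg hB
        rw [h2, mul_zero, sub_zero, enorm_mul, h3, ← add_assoc]
        exact le_add_self
    · have h1 : nearPart N B c₂ τ.2.2 = 0 := if_neg fun hc => by rw [hK.deg] at hc; omega
      rw [h1, mul_zero, zero_add]
      by_cases hB : (kabs τ.2.1.1 : ℝ) < B
      · have h2 : nearPart N B c₁ τ.2.1 = c₁ τ.2.1 := if_pos ⟨hJ, hB⟩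
        rw [h2, ← mul_sub, enorm_mul]
        simp only [bilPart, if_pos hK]
        exact le_add_right le_add_self
      · have h2 : nearPart N B c₁ τ.2.1 = 0 := if_neg fun hc => hB hc.2
        have h3 : ultraPart B c₁ τ.2.1 = c₁ τ.2.1 := if_neg hB
        rw [h2, zero_mul, sub_zero, enorm_mul, h3]
        exact le_add_left le_self_add

theorem enorm_sub_toepWeight_le (hNT : N ≤ T) (hN : M' + kappa jj * B ≤ N)
    (hM : M' + kappa jj * B ≤ M) (hT : T + (M' + kappa jj * B) ≤ T') (hM0 : 0 ≤ M') (hB : 0 ≤ B)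
    (h₁ : ToepE N T M B t₁) (h₂ : ToepE N T M B t₂) (hc₁ : ∀ J, c₁ J ≠ 0 → momE J = 0)
    (hc₂ : ∀ J, c₂ J ≠ 0 → momE J = 0) {τ : Triple jj} (hτ : pairMult τ ≠ 0)
    (hI : Bil N T' M' B (out τ)) :
    ‖c₁ τ.2.1 * c₂ τ.2.2
        - toepWeight T t₁ (nearPart N B c₁) t₂ (nearPart N B c₂) τ‖ₑ
      ≤ errWeight c₁ t₁ (fun J => bilPart N T M B c₁ J - bilPart N T M B t₁ J) (ultraPart B c₁) c₂
        (fun J => bilPart N T M B c₂ J - bilPart N T M B t₂ J) (ultraPart B c₂) τ := by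
  by_cases hc : BilCases N T M B τ
  · exact enorm_sub_toepWeight_le_of_bilCases hNT hc
  have hl : ∀ (c : Expo jj → ℂ) J, nearPart N B c J ≠ 0 → farDeg N J = 0 := by
    intro c J h
    by_contra h0
    exact h (if_neg fun hc => h0 hc.1)
  have hW : toepWeight T t₁ (nearPart N B c₁) t₂ (nearPart N B c₂) τ = 0 := by
    by_contra h
    exact hc (bilCases_of_toepWeight h₁ h₂ (hl c₁) (hl c₂) hτ h)
  rw [hW, sub_zero]
  by_cases h0 : c₁ τ.2.1 * c₂ τ.2.2 = 0
  · rw [h0, enorm_zero]; exact zero_le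
  have hu : (¬ (kabs τ.2.1.1 : ℝ) < B) ∨ ¬ (kabs τ.2.2.1 : ℝ) < B := by
    by_contra! h
    exact hc (bilCases_of_out hNT hN hM hT hM0 hB hτ hI (hc₁ _ (left_ne_zero_of_mul h0))
      (hc₂ _ (right_ne_zero_of_mul h0)) h.1 h.2)
  unfold errWeight absC
  rw [enorm_mul]
  rcases hu with h | h
  · have h3 : ultraPart B c₁ τ.2.1 = c₁ τ.2.1 := if_neg h
    rw [h3]
    exact le_add_left le_self_add
  · have h3 : ultraPart B c₂ τ.2.2 = c₂ τ.2.2 := if_neg h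
    rw [h3]
    exact le_add_left le_add_self

end error

/-! ### Quasi-Töplitz estimates for one Poisson bracket -/

/-- Momentum preserving coefficients `c` with a Töplitz approximation `t`, at the scale `N`: all
three norms in the definition of the quasi-Töplitz semi-norm are at most `x` on the domain of size
`(σ, ρ)`.  The parameters `B`, `T`, `M` stand for `N^b`, `θ N`, `μ N^L`. -/
structure QT (a p s r : ℝ) (N : ℕ) (B T M σ ρ x : ℝ) (c t : Expo jj → ℂ) : Prop where
  mom : ∀ J, c J ≠ 0 → momE J = 0
  toep : ToepE N T M B t
  norm_le : majNorm a p s r σ ρ (absC c) ≤ ENNReal.ofReal x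
  norm_toep_le : majNorm a p s r σ ρ (absC t) ≤ ENNReal.ofReal x
  norm_err_le : (N : ℝ≥0∞) * majNorm a p s r σ ρ (absC fun J => bilPart N T M B c J - t J)
    ≤ ENNReal.ofReal x

section qt

variable {s r : ℝ} {N : ℕ} {B T M σ ρ x T' M' σ' ρ' : ℝ} {c t : Expo jj → ℂ}

theorem ToepE.bilPart_eq (h : ToepE N T M B t) : bilPart N T M B t = t := by
  funext J
  unfold bilPart
  split_ifs with hJ
  · rfl
  · by_contra hc
    exact hJ (h.supp J (Ne.symm hc))

theorem QT.mono (h : QT a p s r N B T M σ ρ x c t) (hκ : kappa jj ≤ N)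
    (hN : M' + kappa jj * B ≤ N) (hT : T ≤ T') (hM : M' ≤ M) (hσ : σ' ≤ σ) (hρ0 : 0 ≤ ρ')
    (hρ : ρ' ≤ ρ) : QT a p s r N B T' M' σ' ρ' x c (bilPart N T' M' B t) := by
  refine ⟨h.mom, h.toep.restrict hκ hN hT hM, ?_, ?_, ?_⟩
  · exact (majNorm_anti hσ hρ0 hρ _).trans h.norm_le
  · exact (majNorm_mono fun J => enorm_bilPart_le _ _ _ _ _ _).trans
      ((majNorm_anti hσ hρ0 hρ _).trans h.norm_toep_le)
  · refine le_trans (mul_le_mul' le_rfl ((majNorm_mono fun J => ?_).trans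
      (majNorm_anti hσ hρ0 hρ _))) h.norm_err_le
    unfold absC bilPart
    beta_reduce
    by_cases hJ : Bil N T' M' B J
    · rw [if_pos hJ, if_pos hJ, if_pos (hJ.mono hT hM)]
    · rw [if_neg hJ, if_neg hJ, sub_zero, enorm_zero]
      exact zero_le

theorem majNorm_bracket_le_of_le {δ y k : ℝ} (hs : 0 < s) (hr : 0 < r) (hδ : 0 < δ)
    (hx : 0 < x) (hy : 0 < y) (hk : 0 < k) (hσ0 : 0 ≤ σ') (hσ : δ * s ≤ σ - σ')
    (hρ : δ * r ≤ ρ - ρ') (hρ0 : 0 ≤ ρ') (hρr : r ≤ ρ + ρ') {A A' : Expo jj → ℝ≥0∞}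
    (hA : ENNReal.ofReal k * majNorm a p s r σ ρ A ≤ ENNReal.ofReal x)
    (hA' : majNorm a p s r σ ρ A' ≤ ENNReal.ofReal y) :
    ENNReal.ofReal k * majNorm a p s r σ' ρ' (majBracket fun τ => A τ.2.1 * A' τ.2.2)
      ≤ ENNReal.ofReal (2 * x * y / δ) := by
  rw [← majNorm_const_mul] at hA
  have := majNorm_majBracket_le hs hr hδ hx hy hσ0 hσ hρ hρ0 hρr hA hA'
  rw [← majNorm_const_mul]
  refine le_trans (majNorm_mono fun I => ?_) this
  rw [← majBracket_const_mul]
  exact (majBracket_mono (fun τ => by rw [mul_assoc]) I)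

theorem majNorm_bracket_le_of_le' {δ y k : ℝ} (hs : 0 < s) (hr : 0 < r) (hδ : 0 < δ)
    (hx : 0 < x) (hy : 0 < y) (hk : 0 < k) (hσ0 : 0 ≤ σ') (hσ : δ * s ≤ σ - σ')
    (hρ : δ * r ≤ ρ - ρ') (hρ0 : 0 ≤ ρ') (hρr : r ≤ ρ + ρ') {A A' : Expo jj → ℝ≥0∞}
    (hA : majNorm a p s r σ ρ A ≤ ENNReal.ofReal x)
    (hA' : ENNReal.ofReal k * majNorm a p s r σ ρ A' ≤ ENNReal.ofReal y) :
    ENNReal.ofReal k * majNorm a p s r σ' ρ' (majBracket fun τ => A τ.2.1 * A' τ.2.2)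
      ≤ ENNReal.ofReal (2 * x * y / δ) := by
  rw [← majNorm_const_mul] at hA'
  have := majNorm_majBracket_le hs hr hδ hx hy hσ0 hσ hρ hρ0 hρr hA hA'
  rw [← majNorm_const_mul]
  refine le_trans (majNorm_mono fun I => ?_) this
  rw [← majBracket_const_mul]
  exact (majBracket_mono (fun τ => by rw [mul_left_comm]) I)

theorem majNorm_ultraPart_le (hσ : σ' ≤ σ) :
    majNorm a p s r σ' ρ (absC (ultraPart B c))
      ≤ ENNReal.ofReal (Real.exp (-(B * (σ - σ')))) * majNorm a p s r σ ρ (absC c) := by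
  refine (majNorm_ultraviolet hσ (K := B) fun J hJ => ?_).trans
    (mul_le_mul' le_rfl (majNorm_mono fun J => enorm_ultraPart_le B c J))
  by_contra hc
  refine hJ ?_
  unfold absC ultraPart
  rw [if_pos (not_le.1 hc), enorm_zero]

theorem majNorm_majBracket_add (Q Q' : Triple jj → ℝ≥0∞) :
    majNorm a p s r σ ρ (majBracket fun τ => Q τ + Q' τ)
      ≤ majNorm a p s r σ ρ (majBracket Q) + majNorm a p s r σ ρ (majBracket Q') := by
  refine le_trans (majNorm_mono fun I => ?_) (majNorm_add _ _)
  exact (majBracket_add Q Q' I).le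

/-- The Töplitz approximation of a Poisson bracket. -/
def toepBracket (N : ℕ) (B T T' M' : ℝ) (c₁ t₁ c₂ t₂ : Expo jj → ℂ) : Expo jj → ℂ :=
  bilPart N T' M' B (cBracket (toepWeight T t₁ (nearPart N B c₁) t₂ (nearPart N B c₂)))

theorem enorm_toepWeight_le (T : ℝ) (t₁ l₁ t₂ l₂ : Expo jj → ℂ) (τ : Triple jj) :
    ‖toepWeight T t₁ l₁ t₂ l₂ τ‖ₑ ≤ absC t₁ τ.2.1 * absC t₂ τ.2.2 +
      (absC t₁ τ.2.1 * absC l₂ τ.2.2 + absC l₁ τ.2.1 * absC t₂ τ.2.2) := by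
  unfold toepWeight absC
  split_ifs
  · rw [enorm_mul]; exact le_self_add
  · refine le_trans (enorm_add_le _ _) ?_
    rw [enorm_mul, enorm_mul]
    exact le_add_self

/-- The Poisson bracket of two quasi-Töplitz functions at one scale, with the loss of domain and of
parameters that it needs.  The constant `14` is that of the error term: three brackets with one
small factor contribute `2` each, and two brackets with high frequencies `4` each. -/
theorem QT.bracket (ha : 0 ≤ a) (hp : 0 ≤ p) {δ y : ℝ} {c₁ t₁ c₂ t₂ : Expo jj → ℂ}
    (h₁ : QT a p s r N B T M σ ρ x c₁ t₁) (h₂ : QT a p s r N B T M σ ρ y c₂ t₂)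
    (hs : 0 < s) (hr : 0 < r) (hδ : 0 < δ) (hx : 0 < x) (hy : 0 < y) (hσ0 : 0 ≤ σ')
    (hσ : δ * s ≤ σ - σ') (hρ : δ * r ≤ ρ - ρ') (hρ0 : 0 ≤ ρ') (hρr : r ≤ ρ + ρ')
    (hκ : kappa jj ≤ N) (hN0 : 0 < N) (hNT : N ≤ T) (hMN : M + kappa jj * B ≤ N)
    (hM : M' + kappa jj * B ≤ M)
    (hT : T + (M' + kappa jj * B) ≤ T') (hM0 : 0 ≤ M') (hB : 0 ≤ B)
    (hUV : Real.log N ≤ B * ((σ - σ') / 2)) :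
    QT a p s r N B T' M' σ' ρ' (14 * x * y / δ) (cBracket fun τ => c₁ τ.2.1 * c₂ τ.2.2)
      (toepBracket N B T T' M' c₁ t₁ c₂ t₂) := by
  have hκB : 0 ≤ (kappa jj : ℝ) * B := by positivity
  have hδs : 0 < σ - σ' := lt_of_lt_of_le (mul_pos hδ hs) hσ
  have hδr : 0 < ρ - ρ' := lt_of_lt_of_le (mul_pos hδ hr) hρ
  have hl : ∀ (c : Expo jj → ℂ) J, nearPart N B c J ≠ 0 → farDeg N J = 0 := by
    intro c J h
    by_contra h0
    exact h (if_neg fun hc => h0 hc.1)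
  have hNpos : (0 : ℝ) < N := by exact_mod_cast hN0
  have hNr : (N : ℝ≥0∞) = ENNReal.ofReal N := (ENNReal.ofReal_natCast N).symm
  have hxyδ : 0 < x * y / δ := by positivity
  have hbr : ∀ {A A' : Expo jj → ℝ≥0∞}, majNorm a p s r σ ρ A ≤ ENNReal.ofReal x →
      majNorm a p s r σ ρ A' ≤ ENNReal.ofReal y →
      majNorm a p s r σ' ρ' (majBracket fun τ => A τ.2.1 * A' τ.2.2)
        ≤ ENNReal.ofReal (2 * x * y / δ) := fun hA hA' =>
    majNorm_majBracket_le hs hr hδ hx hy hσ0 hσ hρ hρ0 hρr hA hA'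
  have hnear1 : majNorm a p s r σ ρ (absC (nearPart N B c₁)) ≤ ENNReal.ofReal x :=
    (majNorm_mono fun J => enorm_nearPart_le _ _ _ _).trans h₁.norm_le
  have hnear2 : majNorm a p s r σ ρ (absC (nearPart N B c₂)) ≤ ENNReal.ofReal y :=
    (majNorm_mono fun J => enorm_nearPart_le _ _ _ _).trans h₂.norm_le
  have hQ : ∀ τ : Triple jj, ‖c₁ τ.2.1 * c₂ τ.2.2‖ₑ = absC c₁ τ.2.1 * absC c₂ τ.2.2 := fun τ => enorm_mul _ _
  have hσρ : 0 ≤ σ ∧ 0 < ρ := ⟨by linarith, by linarith⟩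
  have hfin : ∀ (e₁ e₂ : Expo jj → ℂ), majNorm a p s r σ ρ (absC e₁) ≤ ENNReal.ofReal x →
      majNorm a p s r σ ρ (absC e₂) ≤ ENNReal.ofReal y → ∀ I,
      majBracket (fun τ => absC e₁ τ.2.1 * absC e₂ τ.2.2) I ≠ ⊤ := fun e₁ e₂ h1 h2 I =>
    majBracket_ne_top ha hp hs hr hσρ.1 hσρ.2 (ne_top_of_le_ne_top ENNReal.ofReal_ne_top h1)
      (ne_top_of_le_ne_top ENNReal.ofReal_ne_top h2) I
  refine ⟨fun I hI => momE_of_cBracket_ne_zero (fun τ hτ => ⟨h₁.mom _ (left_ne_zero_of_mul hτ),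
    h₂.mom _ (right_ne_zero_of_mul hτ)⟩) hI, ⟨fun I hI => ?_, fun u I hI => ?_⟩, ?_, ?_, ?_⟩
  · by_contra hc
    exact hI (if_neg hc)
  · have hIs := hI.shift hκ u (by linarith)
    unfold toepBracket bilPart
    rw [if_pos hI, if_pos hIs]
    exact cBracket_toepWeight_shift hκ u hNT hMN (by linarith) hT (by linarith) h₁.toep h₂.toep
      (hl c₁) (hl c₂) hI
  · refine ((majNorm_mono fun I => absC_cBracket_le _ I).trans ?_).trans
      (ENNReal.ofReal_le_ofReal (show 2 * x * y / δ ≤ 14 * x * y / δ by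
        rw [div_le_div_iff_of_pos_right hδ]; nlinarith [mul_pos hx hy]))
    simp_rw [hQ]
    exact hbr h₁.norm_le h₂.norm_le
  · refine le_trans (majNorm_mono fun I => (enorm_bilPart_le _ _ _ _ _ I).trans
      ((absC_cBracket_le _ I).trans (majBracket_mono (fun τ => enorm_toepWeight_le _ _ _ _ _ τ) I))) ?_
    refine (majNorm_majBracket_add _ _).trans ((add_le_add (hbr h₁.norm_toep_le h₂.norm_toep_le)
      ((majNorm_majBracket_add _ _).trans (add_le_add (hbr h₁.norm_toep_le hnear2)
        (hbr hnear1 h₂.norm_toep_le)))).trans ?_)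
    rw [← ENNReal.ofReal_add (by positivity) (by positivity),
      ← ENNReal.ofReal_add (by positivity) (by positivity)]
    refine ENNReal.ofReal_le_ofReal ?_
    have : 2 * x * y / δ + (2 * x * y / δ + 2 * x * y / δ) = 6 * (x * y / δ) := by ring
    rw [this, show 14 * x * y / δ = 14 * (x * y / δ) by ring]
    linarith
  · set e₁ : Expo jj → ℂ := fun J => bilPart N T M B c₁ J - bilPart N T M B t₁ J with he₁
    set e₂ : Expo jj → ℂ := fun J => bilPart N T M B c₂ J - bilPart N T M B t₂ J with he₂
    have hE₁ : ENNReal.ofReal N * majNorm a p s r σ ρ (absC e₁) ≤ ENNReal.ofReal x := by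
      have := h₁.norm_err_le
      rw [hNr] at this
      rwa [he₁, h₁.toep.bilPart_eq]
    have hE₂ : ENNReal.ofReal N * majNorm a p s r σ ρ (absC e₂) ≤ ENNReal.ofReal y := by
      have := h₂.norm_err_le
      rw [hNr] at this
      rwa [he₂, h₂.toep.bilPart_eq]
    have hmain : ∀ I, absC (fun J => bilPart N T' M' B (cBracket fun τ => c₁ τ.2.1 * c₂ τ.2.2) J
        - toepBracket N B T T' M' c₁ t₁ c₂ t₂ J) I
        ≤ majBracket (errWeight c₁ t₁ e₁ (ultraPart B c₁) c₂ e₂ (ultraPart B c₂)) I := by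
      intro I
      unfold absC toepBracket bilPart
      beta_reduce
      by_cases hI : Bil N T' M' B I
      · rw [if_pos hI, if_pos hI]
        have hW : majBracket (fun τ => ‖toepWeight T t₁ (nearPart N B c₁) t₂
            (nearPart N B c₂) τ‖ₑ) I ≠ ⊤ := by
          refine ne_top_of_le_ne_top ?_ (majBracket_mono
            (fun τ => enorm_toepWeight_le _ _ _ _ _ τ) I)
          rw [majBracket_add (fun τ => absC t₁ τ.2.1 * absC t₂ τ.2.2),
            majBracket_add (fun τ => absC t₁ τ.2.1 * absC (nearPart N B c₂) τ.2.2)]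
          exact ENNReal.add_ne_top.2 ⟨hfin _ _ h₁.norm_toep_le h₂.norm_toep_le I,
            ENNReal.add_ne_top.2 ⟨hfin _ _ h₁.norm_toep_le hnear2 I,
              hfin _ _ hnear1 h₂.norm_toep_le I⟩⟩
        have hC : majBracket (fun τ => ‖c₁ τ.2.1 * c₂ τ.2.2‖ₑ) I ≠ ⊤ := by
          simp_rw [hQ]; exact hfin _ _ h₁.norm_le h₂.norm_le I
        refine (enorm_cBracket_sub_le hC hW).trans (majBracket_mono_of fun τ ho hτ => ?_)
        exact enorm_sub_toepWeight_le hNT (by linarith) hM hT hM0 hB h₁.toep h₂.toep h₁.mom h₂.mom hτ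
          (ho ▸ hI)
      · rw [if_neg hI, if_neg hI, sub_zero, enorm_zero]
        exact zero_le
    -- Half of the loss in the angles makes the high frequencies smaller by the factor `N`.  Only the
    -- other half is left for the brackets `b4` and `b5`, whose constant is therefore doubled.
    set σ'' : ℝ := (σ + σ') / 2 with hσ''
    have hlogN : (N : ℝ) * Real.exp (-(B * (σ - σ''))) ≤ 1 := by
      have h1 : σ - σ'' = (σ - σ') / 2 := by rw [hσ'']; ring
      conv_lhs => rw [h1, ← Real.exp_log hNpos, ← Real.exp_add]
      rw [Real.exp_le_one_iff]
      linarith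
    have hU : ∀ {c : Expo jj → ℂ} {z : ℝ}, majNorm a p s r σ ρ (absC c) ≤ ENNReal.ofReal z →
        ENNReal.ofReal N * majNorm a p s r σ'' ρ (absC (ultraPart B c)) ≤ ENNReal.ofReal z := by
      intro c z hz
      refine (mul_le_mul' le_rfl (majNorm_ultraPart_le (σ := σ) (by rw [hσ'']; linarith))).trans ?_
      rw [← mul_assoc, ← ENNReal.ofReal_mul hNpos.le]
      refine (mul_le_of_le_one_left' ?_).trans hz
      exact ENNReal.ofReal_le_one.2 hlogN
    have hlow : ∀ {c : Expo jj → ℂ} {z : ℝ}, majNorm a p s r σ ρ (absC c) ≤ ENNReal.ofReal z →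
        majNorm a p s r σ'' ρ (absC c) ≤ ENNReal.ofReal z := fun h =>
      (majNorm_anti (by rw [hσ'']; linarith) hσρ.2.le le_rfl _).trans h
    have hδ2 : δ / 2 * s ≤ σ'' - σ' := by rw [hσ'']; linarith
    have hδ3 : δ / 2 * r ≤ ρ - ρ' := by nlinarith [mul_pos hδ hr]
    have b1 := majNorm_bracket_le_of_le hs hr hδ hx hy hNpos hσ0 hσ hρ hρ0 hρr hE₁ h₂.norm_le
    have b2 := majNorm_bracket_le_of_le' hs hr hδ hx hy hNpos hσ0 hσ hρ hρ0 hρr h₁.norm_toep_le hE₂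
    have b3 := majNorm_bracket_le_of_le' hs hr hδ hx hy hNpos hσ0 hσ hρ hρ0 hρr h₁.norm_le hE₂
    have b4 := majNorm_bracket_le_of_le hs hr (half_pos hδ) hx hy hNpos hσ0 hδ2 hδ3 hρ0 hρr
      (hU h₁.norm_le) (hlow h₂.norm_le)
    have b5 := majNorm_bracket_le_of_le' hs hr (half_pos hδ) hx hy hNpos hσ0 hδ2 hδ3 hρ0 hρr
      (hlow h₁.norm_le) (hU h₂.norm_le)
    rw [hNr]
    refine (mul_le_mul' le_rfl (majNorm_mono hmain)).trans ?_
    unfold errWeight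
    refine (mul_le_mul' le_rfl ((majNorm_majBracket_add _ _).trans (add_le_add
      ((majNorm_majBracket_add _ _).trans (add_le_add (majNorm_majBracket_add _ _) le_rfl))
      (majNorm_majBracket_add _ _)))).trans ?_
    simp only [mul_add]
    refine (add_le_add (add_le_add (add_le_add b1 b2) b3) (add_le_add b4 b5)).trans ?_
    rw [← ENNReal.ofReal_add (by positivity) (by positivity),
      ← ENNReal.ofReal_add (by positivity) (by positivity),
      ← ENNReal.ofReal_add (by positivity) (by positivity),
      ← ENNReal.ofReal_add (by positivity) (by positivity)]
    refine ENNReal.ofReal_le_ofReal (le_of_eq ?_)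
    field_simp
    ring

end qt

/-! ### Töplitz series and Töplitz coefficients -/

/-- The exponent of the variable `z_j^σ`. -/
def zExpo (σ : Bool) (j : Site jj) : Expo jj := (0, Finsupp.single (Sum.inr (σ, j)) 1)

/-- The exponents of low momentum monomials. -/
def Low (M B : ℝ) (J : Expo jj) : Prop :=
  (wsum (fun x => |vmom x|) J : ℝ) < M ∧ (kabs J.1 : ℝ) < B

theorem wsum_expoEquiv (ω : Var jj → ℤ) (I : MultiIndex jj) :
    wsum ω (expoEquiv I) = (∑ h, ω (Sum.inl h) * I.i h)
      + ((I.ab true).sum fun j e => ω (Sum.inr (true, j)) * e)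
      + ((I.ab false).sum fun j e => ω (Sum.inr (false, j)) * e) :=
  sum_varExpo ω I

theorem isLow_iff {b L : ℝ} {N : ℕ} {μ : ℝ} {I : MultiIndex jj} :
    IsLow b L N μ I ↔ Low (μ * (N : ℝ) ^ L) ((N : ℝ) ^ b) (expoEquiv I) := by
  have h : ((((I.ab true).sum fun j e => (j : ℤ).natAbs * e)
      + ((I.ab false).sum fun j e => (j : ℤ).natAbs * e) : ℕ) : ℤ)
      = wsum (fun x => |vmom x|) (expoEquiv I) := by
    rw [wsum_expoEquiv]
    simp only [abs_vmom_inr, Finsupp.sum]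
    push_cast
    simp [vmom]
  have h' : ((((I.ab true).sum fun j e => (j : ℤ).natAbs * e)
      + ((I.ab false).sum fun j e => (j : ℤ).natAbs * e) : ℕ) : ℝ)
      = (wsum (fun x => |vmom x|) (expoEquiv I) : ℝ) := by
    have h2 := congrArg (fun z : ℤ => (z : ℝ)) h
    simpa only [Int.cast_natCast] using h2
  unfold IsLow Low
  rw [h']
  rfl

theorem momentum_eq (I : MultiIndex jj) : I.momentum = momE (expoEquiv I) := by
  rw [momE_eq, wsum_expoEquiv]
  simp only [vmom, sgn, MultiIndex.momentum, expoEquiv, Equiv.coe_fn_mk, if_true,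
    Bool.false_eq_true, if_false, one_mul, zero_mul, Finset.sum_const_zero, zero_add, Finsupp.sum,
    neg_mul, Finset.sum_neg_distrib]
  ring

theorem isHigh_iff {N : ℕ} {θ : ℝ} (σ : Bool) {m : Site jj} :
    IsHigh N θ m ↔ θ * N < |(vmom (Sum.inr (σ, m)) : ℝ)| := by
  have : |(vmom (Sum.inr (σ, m)) : ℝ)| = |((m : ℤ) : ℝ)| := by exact_mod_cast abs_vmom_inr σ m
  rw [this, IsHigh]

theorem le_wsum {ω : Var jj → ℤ} (h : ∀ x, 0 ≤ ω x) {J : Expo jj} {x : Var jj} (hx : J.2 x ≠ 0) :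
    ω x ≤ wsum ω J := by
  have h1 := wsum_lower ω (d := Sum.inr x) (J := J) hx
  have h2 := wsum_nonneg h (lower (Sum.inr x) J)
  simp only [atDir] at h1
  linarith

theorem Low.farDeg_eq_zero {N : ℕ} {M B : ℝ} {J : Expo jj} (h : Low M B J) (hM : M ≤ N) :
    farDeg N J = 0 := by
  refine wsum_eq_zero fun x hx => if_neg fun hf => ?_
  have h1 := le_wsum (ω := fun x : Var jj => |vmom x|) (fun _ => abs_nonneg _) hx
  have h2 : (wsum (fun x => |vmom x|) J : ℤ) < N := by exact_mod_cast h.1.trans_le hM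
  unfold Far at hf
  beta_reduce at h1
  omega

theorem nearW_eq_of_farDeg {N : ℕ} {J : Expo jj} (h : farDeg N J = 0) :
    nearW N J = wsum (fun x => |vmom x|) J :=
  Finset.sum_congr rfl fun x hx => by
    beta_reduce
    rw [if_neg (not_far_of_farDeg h (by simpa using hx))]

theorem high_ne_inl {T : ℝ} (hT : 0 ≤ T) {x : Var jj} (h : T < |(vmom x : ℝ)|) :
    ∃ σ m, x = Sum.inr (σ, m) := by
  rcases x with i | ⟨σ, m⟩
  · simp [vmom] at h; linarith
  · exact ⟨σ, m, rfl⟩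

/-- The bilinear exponents are those of products of two high variables and of a low momentum
monomial. -/
theorem bil_iff {N : ℕ} {T M B : ℝ} (hNT : N ≤ T) (hM : M ≤ N) {J : Expo jj} :
    Bil N T M B J ↔ ∃ (σ σ' : Bool) (m m' : Site jj) (J₀ : Expo jj),
      T < |(vmom (Sum.inr (σ, m)) : ℝ)| ∧ T < |(vmom (Sum.inr (σ', m')) : ℝ)| ∧ Low M B J₀ ∧
      momE J₀ = - vmom (Sum.inr (σ, m)) - vmom (Sum.inr (σ', m')) ∧
      J = J₀ + zExpo σ' m' + zExpo σ m := by
  have hN0 : (0 : ℝ) ≤ N := by positivity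
  constructor
  · intro h
    obtain ⟨x, y, hx, hy, hJx, hJy, -, -, h0⟩ := exists_far_of_farDeg_two h.deg
    have hJy' : J.2 y ≠ 0 := fun hc => hJy (Nat.le_zero.1 ((lower_apply_le _ _ _).trans hc.le))
    have e1 := lower_add_single (v := x) (J := J) hJx
    have e2 := lower_add_single (v := y) (J := lower (Sum.inr x) J) hJy
    have n1 := nearW_lower (N := N) (d := Sum.inr x) (J := J) hJx
    have n2 := nearW_lower (N := N) (d := Sum.inr y) (J := lower (Sum.inr x) J) hJy
    rw [if_pos (by exact hx), sub_zero] at n1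
    rw [if_pos (by exact hy), sub_zero, n1, nearW_eq_of_farDeg h0] at n2
    have m1 := momE_lower (d := Sum.inr x) (J := J) hJx
    have m2 := momE_lower (d := Sum.inr y) (J := lower (Sum.inr x) J) hJy
    rw [m1, h.mom] at m2
    have hxT := h.high x hJx hx
    have hyT := h.high y hJy' hy
    obtain ⟨σ, m, rfl⟩ := high_ne_inl (by linarith) hxT
    obtain ⟨σ', m', rfl⟩ := high_ne_inl (by linarith) hyT
    refine ⟨σ, σ', m, m', lower (Sum.inr (Sum.inr (σ', m'))) (lower (Sum.inr (Sum.inr (σ, m))) J),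
      hxT, hyT, ⟨?_, ?_⟩, ?_, ?_⟩
    · rw [n2]; exact h.near
    · exact h.kabs_lt
    · rw [m2]; simp [dmom]
    · unfold zExpo; rw [e2, e1]
  · rintro ⟨σ, σ', m, m', J₀, hm, hm', hL, hmom, rfl⟩
    have h0 := hL.farDeg_eq_zero hM
    have hf : ∀ {σ : Bool} {m : Site jj}, T < |(vmom (Sum.inr (σ, m)) : ℝ)| →
        Far N (Sum.inr (σ, m) : Var jj) := fun h => by
      have := hNT.trans_lt h
      unfold Far
      exact_mod_cast this
    refine ⟨?_, fun x hx hfx => ?_, ?_, ?_, ?_⟩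
    · have h1 : farDeg N J₀ = 0 := h0
      unfold farDeg at h1 ⊢
      rw [wsum_add, wsum_add, h1, zExpo, zExpo, wsum_single, wsum_single, if_pos (hf hm),
        if_pos (hf hm')]
      norm_num
    · by_cases h1 : x = Sum.inr (σ, m)
      · rw [h1]; exact hm
      by_cases h2 : x = Sum.inr (σ', m')
      · rw [h2]; exact hm'
      refine absurd hfx (not_far_of_farDeg h0 (x := x) ?_)
      classical
      simpa [zExpo, Finsupp.single_apply, Ne.symm h1, Ne.symm h2] using hx
    · have h1 : nearW N J₀ = wsum (fun x => |vmom x|) J₀ := nearW_eq_of_farDeg h0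
      have h2 : nearW N (J₀ + zExpo σ' m' + zExpo σ m) = nearW N J₀ := by
        unfold nearW
        rw [wsum_add, wsum_add, zExpo, zExpo, wsum_single, wsum_single, if_pos (hf hm),
          if_pos (hf hm'), add_zero, add_zero]
      rw [h2, h1]
      exact hL.1
    · simpa [zExpo] using hL.2
    · rw [momE_add, momE_add, hmom, zExpo, zExpo, momE_single, momE_single]
      ring

theorem isBilinearIndex_iff {b L : ℝ} {N : ℕ} {θ μ : ℝ} (hθ : 1 ≤ θ)
    (hM : μ * (N : ℝ) ^ L ≤ N) {I : MultiIndex jj} :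
    IsBilinearIndex b L N θ μ I
      ↔ Bil N (θ * N) (μ * (N : ℝ) ^ L) ((N : ℝ) ^ b) (expoEquiv I) := by
  have hN0 : (0 : ℝ) ≤ N := by positivity
  rw [bil_iff (by nlinarith) hM]
  constructor
  · rintro ⟨σ, σ', m, m', I₀, hm, hm', hL, hmom, rfl⟩
    refine ⟨σ, σ', m, m', expoEquiv I₀, (isHigh_iff σ).1 hm, (isHigh_iff σ').1 hm', isLow_iff.1 hL,
      ?_, ?_⟩
    · rw [← momentum_eq, hmom, vmom_inr, vmom_inr]; ring
    · rw [expoEquiv_raiseZ, expoEquiv_raiseZ]; rfl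
  · rintro ⟨σ, σ', m, m', J₀, hm, hm', hL, hmom, hJ⟩
    refine ⟨σ, σ', m, m', expoEquiv.symm J₀, (isHigh_iff σ).2 hm, (isHigh_iff σ').2 hm',
      isLow_iff.2 (by rwa [Equiv.apply_symm_apply]), ?_, ?_⟩
    · rw [momentum_eq, Equiv.apply_symm_apply, hmom, vmom_inr, vmom_inr]; ring
    · apply expoEquiv.injective
      rw [hJ, expoEquiv_raiseZ, expoEquiv_raiseZ, Equiv.apply_symm_apply]
      rfl

theorem coeffs_bilinearProj {b L : ℝ} {N : ℕ} {θ μ : ℝ} (hθ : 1 ≤ θ)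
    (hM : μ * (N : ℝ) ^ L ≤ N) (c : Series jj) :
    coeffs (bilinearProj b L N θ μ c)
      = bilPart N (θ * N) (μ * (N : ℝ) ^ L) ((N : ℝ) ^ b) (coeffs c) := by
  funext J
  unfold coeffs bilinearProj bilPart
  have h : IsBilinearIndex b L N θ μ (expoEquiv.symm J)
      ↔ Bil N (θ * N) (μ * (N : ℝ) ^ L) ((N : ℝ) ^ b) J := by
    rw [isBilinearIndex_iff hθ hM, Equiv.apply_symm_apply]
  by_cases hJ : Bil N (θ * N) (μ * (N : ℝ) ^ L) ((N : ℝ) ^ b) J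
  · exact (if_pos (h.2 hJ)).trans (if_pos hJ).symm
  · exact (if_neg (h.not.2 hJ)).trans (if_neg hJ).symm

open Classical in
/-- Multiplication of a series by a variable. -/
def mulE (x : Var jj) (c : Expo jj → ℂ) (J : Expo jj) : ℂ :=
  if J.2 x = 0 then 0 else c (lower (Sum.inr x) J)

theorem coeffs_mulZ (σ : Bool) (j : Site jj) (c : Series jj) :
    coeffs (c.mulZ σ j) = mulE (Sum.inr (σ, j)) (coeffs c) := by
  classical
  funext J
  unfold coeffs Series.mulZ mulE
  refine if_congr (Iff.of_eq rfl) rfl (congrArg c ?_)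
  rw [Equiv.eq_symm_apply]
  refine Prod.ext rfl (Finsupp.ext fun x => ?_)
  rcases x with h | ⟨τ, i⟩
  · change varExpo _ (Sum.inl h) = _
    rw [varExpo_inl]
    simp [expoEquiv, lower]
  · change varExpo _ (Sum.inr (τ, i)) = _
    rw [varExpo_inr]
    by_cases h : τ = σ
    · subst h
      simp [expoEquiv, lower, Finsupp.single_apply]
    · simp [expoEquiv, lower, Function.update_of_ne h, Ne.symm h]

section bilinear

variable {N : ℕ} {θ M B : ℝ} {φ : Bool → Bool → Site jj → Site jj → Series jj}

open Classical in
/-- A summand of a bilinear series. -/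
def bilTerm (N : ℕ) (θ : ℝ) (φ : Bool → Bool → Site jj → Site jj → Series jj) (J : Expo jj)
    (σ σ' : Bool) (q : Site jj × Site jj) : ℂ :=
  if IsHigh N θ q.1 ∧ IsHigh N θ q.2 then
    mulE (Sum.inr (σ, q.1)) (mulE (Sum.inr (σ', q.2)) (coeffs (φ σ σ' q.1 q.2))) J else 0

theorem coeffs_bilinearSeries (J : Expo jj) :
    coeffs (bilinearSeries N θ φ) J = ∑ σ : Bool, ∑ σ' : Bool, ∑ᶠ q, bilTerm N θ φ J σ σ' q := by
  unfold coeffs bilinearSeries bilTerm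
  simp_rw [← coeffs_mulZ]
  rfl

theorem bilTerm_ne_zero {J : Expo jj} {σ σ' : Bool} {q : Site jj × Site jj}
    (h : bilTerm N θ φ J σ σ' q ≠ 0) : IsHigh N θ q.1 ∧ IsHigh N θ q.2 ∧
      J.2 (Sum.inr (σ, q.1)) ≠ 0 ∧ (lower (Sum.inr (Sum.inr (σ, q.1))) J).2 (Sum.inr (σ', q.2)) ≠ 0 ∧
      coeffs (φ σ σ' q.1 q.2)
        (lower (Sum.inr (Sum.inr (σ', q.2))) (lower (Sum.inr (Sum.inr (σ, q.1))) J)) ≠ 0 := by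
  unfold bilTerm mulE at h
  split_ifs at h with h1 h2 h3
  · exact absurd rfl h
  · exact absurd rfl h
  · exact ⟨h1.1, h1.2, h2, h3, h⟩
  · exact absurd rfl h

variable (hφ : ∀ σ σ' m m' J, coeffs (φ σ σ' m m') J ≠ 0 → Low M B J ∧
  momE J = - vmom (Sum.inr (σ, m)) - vmom (Sum.inr (σ', m')))
include hφ

/-- The monomials of a series of bilinear terms with low momentum coefficients are bilinear. -/
theorem bil_of_coeffs_bilinearSeries (hθ : 1 ≤ θ) (hM : M ≤ N) {J : Expo jj}
    (h : coeffs (bilinearSeries N θ φ) J ≠ 0) : Bil N (θ * N) M B J := by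
  have hN0 : (0 : ℝ) ≤ N := by positivity
  obtain ⟨σ, σ', q, hq⟩ : ∃ σ σ' q, bilTerm N θ φ J σ σ' q ≠ 0 := by
    by_contra! hc
    refine h ?_
    rw [coeffs_bilinearSeries]
    simp [hc]
  obtain ⟨h1, h2, h3, h4, h5⟩ := bilTerm_ne_zero hq
  obtain ⟨h6, h7⟩ := hφ _ _ _ _ _ h5
  refine (bil_iff (by nlinarith) hM).2 ⟨σ, σ', q.1, q.2, _, (isHigh_iff σ).1 h1,
    (isHigh_iff σ').1 h2, h6, h7, ?_⟩
  have e1 := lower_add_single (v := Sum.inr (σ, q.1)) (J := J) h3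
  have e2 := lower_add_single (v := Sum.inr (σ', q.2)) h4
  unfold zExpo
  rw [e2, e1]

/-- A bilinear monomial is the product of a low momentum monomial and of two far variables in
exactly two ways, which differ by the order of these variables. -/
theorem coeffs_bilinearSeries_eq (hθ : 1 ≤ θ) (hMN : M + kappa jj * B ≤ N) (hB : 0 ≤ B)
    {J₀ : Expo jj} {σ σ' : Bool} {m m' : Site jj} (hm : IsHigh N θ m) (hm' : IsHigh N θ m')
    (hL : Low M B J₀) (hmom : momE J₀ = - vmom (Sum.inr (σ, m)) - vmom (Sum.inr (σ', m'))) :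
    coeffs (bilinearSeries N θ φ) (J₀ + zExpo σ' m' + zExpo σ m)
      = coeffs (φ σ σ' m m') J₀ + coeffs (φ σ' σ m' m) J₀ := by
  classical
  have hN0 : (0 : ℝ) ≤ N := by positivity
  have hκB : 0 ≤ (kappa jj : ℝ) * B := by positivity
  have hM : M ≤ N := by linarith
  set J := J₀ + zExpo σ' m' + zExpo σ m with hJ
  set x : Var jj := Sum.inr (σ, m) with hx
  set y : Var jj := Sum.inr (σ', m') with hy
  have hbil : Bil N (θ * N) M B J := (bil_iff (by nlinarith) hM).2
    ⟨σ, σ', m, m', J₀, (isHigh_iff σ).1 hm, (isHigh_iff σ').1 hm', hL, hmom, rfl⟩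
  have hfar : ∀ {σ : Bool} {m : Site jj}, IsHigh N θ m → Far N (Sum.inr (σ, m) : Var jj) := by
    intro σ m h
    have h1 := (isHigh_iff σ).1 h
    have h2 : (N : ℝ) < |(vmom (Sum.inr (σ, m)) : ℝ)| := lt_of_le_of_lt (by nlinarith) h1
    unfold Far
    exact_mod_cast h2
  have h0 := hL.farDeg_eq_zero hM
  have hxf : Far N x := hfar hm
  have hyf : Far N y := hfar hm'
  have hJ0 : ∀ z, Far N z → J₀.2 z = 0 := fun z hz => by_contra fun h => not_far_of_farDeg h0 h hz
  have hsgn := hbil.farSgn_eq_zero hMN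
  -- the momenta of the two far variables have opposite signs
  have hxy : x ≠ y := by
    intro hxy
    have h1 : farSgn N J₀ = 0 := wsum_eq_zero fun z hz => if_neg (not_far_of_farDeg h0 hz)
    unfold farSgn at hsgn h1
    rw [hJ, wsum_add, wsum_add, h1, zExpo, zExpo, wsum_single, wsum_single, ← hx, ← hy, ← hxy,
      if_pos hxf] at hsgn
    have h2 : (vmom x).sign = 0 := by omega
    rw [Int.sign_eq_zero_iff_zero] at h2
    unfold Far at hxf
    rw [h2, abs_zero] at hxf
    omega
  have hJapp : ∀ z, J.2 z = J₀.2 z + (if y = z then 1 else 0) + if x = z then 1 else 0 := by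
    intro z
    simp [hJ, zExpo, Finsupp.single_apply, hx, hy]
  have hJx : J.2 x ≠ 0 := by rw [hJapp]; simp
  have hJy : J.2 y ≠ 0 := by rw [hJapp]; simp
  have lx : lower (Sum.inr x) J = J₀ + zExpo σ' m' := lower_add_self _ _
  have ly : lower (Sum.inr y) J = J₀ + zExpo σ m := by
    rw [hJ, add_right_comm]; exact lower_add_self _ _
  have lxy : lower (Sum.inr y) (lower (Sum.inr x) J) = J₀ := by
    rw [lx]; exact lower_add_self _ _
  have lyx : lower (Sum.inr x) (lower (Sum.inr y) J) = J₀ := by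
    rw [ly]; exact lower_add_self _ _
  have hlx : ∀ z, Far N z → (lower (Sum.inr x) J).2 z ≠ 0 → z = y := by
    intro z hz h
    by_contra hne
    refine h ?_
    rw [lx]
    simp [zExpo, Finsupp.single_apply, hJ0 z hz, ← hy, Ne.symm hne]
  have hly : ∀ z, Far N z → (lower (Sum.inr y) J).2 z ≠ 0 → z = x := by
    intro z hz h
    by_contra hne
    refine h ?_
    rw [ly]
    simp [zExpo, Finsupp.single_apply, hJ0 z hz, ← hx, Ne.symm hne]
  have hlxy : (lower (Sum.inr x) J).2 y ≠ 0 := by rw [lx]; simp [zExpo, hy]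
  have hlyx : (lower (Sum.inr y) J).2 x ≠ 0 := by rw [ly]; simp [zExpo, hx]
  have hterm : ∀ σ₁ σ₂ q, bilTerm N θ φ J σ₁ σ₂ q
      = (if (σ₁ = σ ∧ σ₂ = σ') ∧ q = (m, m') then coeffs (φ σ σ' m m') J₀ else 0)
        + if (σ₁ = σ' ∧ σ₂ = σ) ∧ q = (m', m) then coeffs (φ σ' σ m' m) J₀ else 0 := by
    intro σ₁ σ₂ q
    have hA : bilTerm N θ φ J σ σ' (m, m') = coeffs (φ σ σ' m m') J₀ := by
      unfold bilTerm mulE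
      simp only [← hx, ← hy]
      rw [if_pos ⟨hm, hm'⟩, if_neg hJx, if_neg hlxy, lxy]
    have hB : bilTerm N θ φ J σ' σ (m', m) = coeffs (φ σ' σ m' m) J₀ := by
      unfold bilTerm mulE
      simp only [← hx, ← hy]
      rw [if_pos ⟨hm', hm⟩, if_neg hJy, if_neg hlyx, lyx]
    have hdisj : ¬ ((σ = σ' ∧ σ' = σ) ∧ (m, m') = (m', m)) := by
      rintro ⟨⟨h1, -⟩, h2⟩
      exact hxy (by rw [hx, hy, h1, (Prod.mk.inj h2).1])
    by_cases h1 : (σ₁ = σ ∧ σ₂ = σ') ∧ q = (m, m')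
    · obtain ⟨⟨rfl, rfl⟩, rfl⟩ := h1
      rw [if_pos ⟨⟨rfl, rfl⟩, rfl⟩, if_neg hdisj, add_zero, hA]
    by_cases h2 : (σ₁ = σ' ∧ σ₂ = σ) ∧ q = (m', m)
    · rw [if_neg h1, if_pos h2, zero_add]
      obtain ⟨⟨rfl, rfl⟩, rfl⟩ := h2
      exact hB
    rw [if_neg h1, if_neg h2, add_zero]
    by_contra hne
    obtain ⟨f1, f2, f3, f4, -⟩ := bilTerm_ne_zero hne
    have g1 : Far N (Sum.inr (σ₁, q.1) : Var jj) := hfar f1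
    have g2 : Far N (Sum.inr (σ₂, q.2) : Var jj) := hfar f2
    have h3 : (Sum.inr (σ₁, q.1) : Var jj) = x ∨ (Sum.inr (σ₁, q.1) : Var jj) = y := by
      by_contra! hc
      rw [hJapp, hJ0 _ g1, if_neg (Ne.symm hc.2), if_neg (Ne.symm hc.1)] at f3
      exact f3 rfl
    rcases h3 with h3 | h3
    · rw [h3] at f4
      have h4 := hlx _ g2 f4
      rw [hx] at h3; rw [hy] at h4
      simp only [Sum.inr.injEq, Prod.mk.injEq] at h3 h4
      exact h1 ⟨⟨h3.1, h4.1⟩, Prod.ext h3.2 h4.2⟩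
    · rw [h3] at f4
      have h4 := hly _ g2 f4
      rw [hy] at h3; rw [hx] at h4
      simp only [Sum.inr.injEq, Prod.mk.injEq] at h3 h4
      exact h2 ⟨⟨h3.1, h4.1⟩, Prod.ext h3.2 h4.2⟩
  have hfin : ∀ (P : Prop) (q₀ : Site jj × Site jj) (A : ℂ) [∀ q, Decidable (P ∧ q = q₀)],
      (Function.support fun q => if P ∧ q = q₀ then A else 0).Finite := by
    intro P q₀ A _
    refine (Set.finite_singleton q₀).subset fun q hq => ?_
    by_contra hc
    exact hq (if_neg fun h => hc h.2)
  have hval : ∀ (P : Prop) (q₀ : Site jj × Site jj) (A : ℂ) [∀ q, Decidable (P ∧ q = q₀)]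
      [Decidable P], ∑ᶠ q, (if P ∧ q = q₀ then A else 0) = if P then A else 0 := by
    intro P q₀ A _ _
    rw [finsum_eq_single _ q₀ fun q hq => if_neg fun h => hq h.2]
    simp
  have hsum : ∀ σ₁ σ₂, ∑ᶠ q, bilTerm N θ φ J σ₁ σ₂ q
      = (if σ₁ = σ ∧ σ₂ = σ' then coeffs (φ σ σ' m m') J₀ else 0)
        + if σ₁ = σ' ∧ σ₂ = σ then coeffs (φ σ' σ m' m) J₀ else 0 := by
    intro σ₁ σ₂
    rw [finsum_congr (hterm σ₁ σ₂)]
    exact (finsum_add_distrib (hfin _ _ _) (hfin _ _ _)).trans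
      (congrArg₂ _ (hval _ _ _) (hval _ _ _))
  have hbool : ∀ (τ τ' : Bool) (A : ℂ),
      ∑ σ₁ : Bool, ∑ σ₂ : Bool, (if σ₁ = τ ∧ σ₂ = τ' then A else 0) = A := by
    intro τ τ' A
    cases τ <;> cases τ' <;> simp
  rw [coeffs_bilinearSeries]
  simp_rw [hsum, Finset.sum_add_distrib]
  rw [hbool, hbool]

end bilinear

theorem shift_zExpo {N : ℕ} (hκ : kappa jj ≤ N) (u : ℕ) {σ : Bool} {m : Site jj}
    (hm : Far N (Sum.inr (σ, m) : Var jj)) : ∃ m₁ : Site jj,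
      shift N u (zExpo σ m) = zExpo σ m₁ ∧ (m₁ : ℤ) = m + u * (m : ℤ).sign := by
  unfold Far at hm
  rw [abs_vmom_inr] at hm
  obtain ⟨h', e⟩ := shiftVar_inr_of_far hκ u (σ := σ) hm
  exact ⟨_, by unfold zExpo; rw [shift_single, e], rfl⟩

theorem decide_pos_eq_of_sign {m m₁ : ℤ} (h : m.sign = m₁.sign) :
    decide (0 < m) = decide (0 < m₁) := by
  have : ∀ m : ℤ, 0 < m ↔ m.sign = 1 := fun m => Int.sign_eq_one_iff_pos.symm
  simp only [this, h]

/-- Töplitz series have Töplitz coefficients. -/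
theorem toepE_of_isToeplitz {Ξ : Type} {b L s r : ℝ} {N : ℕ} {θ μ : ℝ} (hκ : kappa jj ≤ N)
    (hθ : 1 ≤ θ) (hMN : μ * (N : ℝ) ^ L + kappa jj * (N : ℝ) ^ b ≤ N) {t : Ξ → Series jj}
    (h : IsToeplitz a p b L s r N θ μ t) (ξ : Ξ) :
    ToepE N (θ * N) (μ * (N : ℝ) ^ L) ((N : ℝ) ^ b) (coeffs (t ξ)) := by
  obtain ⟨-, φ, hφ, ht⟩ := h
  have hN0 : (0 : ℝ) ≤ N := by positivity
  have hB : (0 : ℝ) ≤ (N : ℝ) ^ b := by positivity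
  have hκB : 0 ≤ (kappa jj : ℝ) * (N : ℝ) ^ b := by positivity
  have hNT : (N : ℝ) ≤ θ * N := by nlinarith
  set ψ : Bool → Bool → Site jj → Site jj → Series jj := fun σ σ' m m' =>
    φ σ σ' (decide (0 < (m : ℤ))) (sgn σ * m + sgn σ' * m') ξ with hψ
  have hψ0 : ∀ σ σ' m m' J, coeffs (ψ σ σ' m m') J ≠ 0 →
      Low (μ * (N : ℝ) ^ L) ((N : ℝ) ^ b) J ∧
      momE J = - vmom (Sum.inr (σ, m)) - vmom (Sum.inr (σ', m')) := by
    intro σ σ' m m' J hJ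
    obtain ⟨h1, h2⟩ := (hφ σ σ' _ _).2 ξ _ hJ
    rw [isLow_iff, Equiv.apply_symm_apply] at h1
    rw [momentum_eq, Equiv.apply_symm_apply] at h2
    refine ⟨h1, ?_⟩
    rw [vmom_inr, vmom_inr]
    linarith
  refine ⟨fun J hJ => ?_, fun u J hJ => ?_⟩
  · rw [ht] at hJ
    exact bil_of_coeffs_bilinearSeries hψ0 hθ (by linarith) hJ
  · have hJs := hJ.shift hκ u hMN
    have hsg := hJ.farSgn_eq_zero hMN
    obtain ⟨σ, σ', m, m', J₀, hm, hm', hL, hmom, rfl⟩ := (bil_iff hNT (by linarith)).1 hJ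
    have hM : μ * (N : ℝ) ^ L ≤ N := by linarith
    have h0 := hL.farDeg_eq_zero hM
    have hf : ∀ {σ : Bool} {m : Site jj}, θ * N < |(vmom (Sum.inr (σ, m)) : ℝ)| →
        Far N (Sum.inr (σ, m) : Var jj) := fun h => by
      have := hNT.trans_lt h
      unfold Far
      exact_mod_cast this
    have h1 : farSgn N J₀ = 0 := wsum_eq_zero fun z hz => if_neg (not_far_of_farDeg h0 hz)
    have hs2 : sgn σ * (m : ℤ).sign + sgn σ' * (m' : ℤ).sign = 0 := by
      unfold farSgn at hsg h1
      rw [wsum_add, wsum_add, h1, zExpo, zExpo, wsum_single, wsum_single, if_pos (hf hm),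
        if_pos (hf hm'), vmom_inr, vmom_inr, Int.sign_mul, Int.sign_mul] at hsg
      have : ∀ τ, (sgn τ).sign = sgn τ := fun τ => by cases τ <;> rfl
      rw [this, this] at hsg
      linarith
    obtain ⟨m₁, e1, e2⟩ := shift_zExpo hκ u (hf hm)
    obtain ⟨m₁', e1', e2'⟩ := shift_zExpo hκ u (hf hm')
    have e3 : shift N u (J₀ + zExpo σ' m' + zExpo σ m) = J₀ + zExpo σ' m₁' + zExpo σ m₁ := by
      rw [shift_add, shift_add, e1, e1', shift_eq_self u h0]
    have hhigh : ∀ {σ : Bool} {m m₁ : Site jj}, θ * N < |(vmom (Sum.inr (σ, m)) : ℝ)| →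
        (m₁ : ℤ) = m + u * (m : ℤ).sign → IsHigh N θ m₁ := by
      intro σ m m₁ h1 h2
      have h3 := (isHigh_iff σ).2 h1
      unfold IsHigh at h3 ⊢
      have hm0 : (m : ℤ) ≠ 0 := by
        intro h0; rw [h0] at h3; simp at h3; linarith
      have h4 : |((m₁ : ℤ) : ℝ)| = |((m : ℤ) : ℝ)| + u := by
        rw [h2]; exact_mod_cast abs_add_mul_sign u hm0
      have : (0 : ℝ) ≤ u := by positivity
      linarith
    have hsign : ∀ {m m₁ : Site jj}, (m₁ : ℤ) = m + u * (m : ℤ).sign →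
        decide (0 < (m₁ : ℤ)) = decide (0 < (m : ℤ)) := by
      intro m m₁ h2
      apply decide_pos_eq_of_sign
      rw [h2, sign_add_mul_sign]
    have hsum : sgn σ * (m₁ : ℤ) + sgn σ' * m₁' = sgn σ * m + sgn σ' * m' := by
      rw [e2, e2']
      linear_combination (u : ℤ) * hs2
    rw [ht, e3, coeffs_bilinearSeries_eq hψ0 hθ hMN hB (hhigh hm e2) (hhigh hm' e2') hL (by
        rw [hmom]; simp only [vmom_inr]; linarith),
      coeffs_bilinearSeries_eq hψ0 hθ hMN hB ((isHigh_iff σ).2 hm) ((isHigh_iff σ').2 hm') hL hmom]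
    simp only [hψ, hsign e2, hsign e2', hsum]
    rw [add_comm (sgn σ' * (m₁' : ℤ)), hsum, add_comm (sgn σ' * (m' : ℤ))]

/-- A Töplitz coefficient depends only on the low momentum factor, on the sign of the first high
site, and on the sum of the momenta of the two high variables. -/
theorem ToepE.eq_of_same {N : ℕ} {T M B : ℝ} {t : Expo jj → ℂ} (ht : ToepE N T M B t)
    (hκ : kappa jj ≤ N) (hNT : N ≤ T) (hMN : M + kappa jj * B ≤ N) (hM : M ≤ N) {J₀ : Expo jj}
    {σ σ' : Bool} {m m' k k' : Site jj} (hL : Low M B J₀)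
    (hmom : momE J₀ = - vmom (Sum.inr (σ, m)) - vmom (Sum.inr (σ', m')))
    (hm : T < |(vmom (Sum.inr (σ, m)) : ℝ)|) (hm' : T < |(vmom (Sum.inr (σ', m')) : ℝ)|)
    (hk : T < |(vmom (Sum.inr (σ, k)) : ℝ)|) (hk' : T < |(vmom (Sum.inr (σ', k')) : ℝ)|)
    (hsgn : decide (0 < (m : ℤ)) = decide (0 < (k : ℤ)))
    (hsum : sgn σ * (m : ℤ) + sgn σ' * m' = sgn σ * k + sgn σ' * k') :
    t (J₀ + zExpo σ' m' + zExpo σ m) = t (J₀ + zExpo σ' k' + zExpo σ k) := by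
  -- the monomial on the right is then the shift of the one on the left by `|k| - |m|` sites
  wlog hle : |(m : ℤ)| ≤ |(k : ℤ)| generalizing m m' k k'
  · exact (this (by rw [hmom]; simp only [vmom_inr]; linarith) hk hk' hm hm' hsgn.symm hsum.symm
      (le_of_not_ge hle)).symm
  have hJ : Bil N T M B (J₀ + zExpo σ' m' + zExpo σ m) :=
    (bil_iff hNT hM).2 ⟨σ, σ', m, m', J₀, hm, hm', hL, hmom, rfl⟩
  have hsg := hJ.farSgn_eq_zero hMN
  have h0 := hL.farDeg_eq_zero hM
  have hf : ∀ {σ : Bool} {m : Site jj}, T < |(vmom (Sum.inr (σ, m)) : ℝ)| →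
      Far N (Sum.inr (σ, m) : Var jj) := fun h => by
    have := hNT.trans_lt h
    unfold Far
    exact_mod_cast this
  have h1 : farSgn N J₀ = 0 := wsum_eq_zero fun z hz => if_neg (not_far_of_farDeg h0 hz)
  have hs2 : sgn σ * (m : ℤ).sign + sgn σ' * (m' : ℤ).sign = 0 := by
    unfold farSgn at hsg h1
    rw [wsum_add, wsum_add, h1, zExpo, zExpo, wsum_single, wsum_single, if_pos (hf hm),
      if_pos (hf hm'), vmom_inr, vmom_inr, Int.sign_mul, Int.sign_mul] at hsg
    have : ∀ τ, (sgn τ).sign = sgn τ := fun τ => by cases τ <;> rfl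
    rw [this, this] at hsg
    linarith
  obtain ⟨u, hu⟩ : ∃ u : ℕ, |(k : ℤ)| = |(m : ℤ)| + u := ⟨(|(k : ℤ)| - |(m : ℤ)|).toNat, by omega⟩
  obtain ⟨m₁, e1, e2⟩ := shift_zExpo hκ u (hf hm)
  obtain ⟨m₁', e1', e2'⟩ := shift_zExpo hκ u (hf hm')
  have hmk : (m₁ : ℤ) = k := by
    have hm0 : Far N (Sum.inr (σ, m) : Var jj) := hf hm
    have hk0 : Far N (Sum.inr (σ, k) : Var jj) := hf hk
    unfold Far at hm0 hk0
    rw [abs_vmom_inr] at hm0 hk0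
    rw [decide_eq_decide] at hsgn
    rw [e2]
    rcases lt_trichotomy (m : ℤ) 0 with h | h | h
    · rw [Int.sign_eq_neg_one_of_neg h]
      rw [abs_of_neg h] at hu hm0
      have : (k : ℤ) ≤ 0 := by
        by_contra hc
        have := hsgn.2 (by omega)
        omega
      rw [abs_of_nonpos this] at hu
      omega
    · rw [h] at hm0; simp at hm0; omega
    · rw [Int.sign_eq_one_of_pos h]
      rw [abs_of_pos h] at hu
      rw [abs_of_pos (hsgn.1 h)] at hu
      omega
  have hmk' : (m₁' : ℤ) = k' := by
    have h2 : sgn σ' * (m₁' : ℤ) = sgn σ' * k' := by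
      rw [e2']
      rw [e2] at hmk
      rw [← hmk] at hsum
      linear_combination hsum + (u : ℤ) * hs2
    cases σ' <;> simpa [sgn] using h2
  have e3 : shift N u (J₀ + zExpo σ' m' + zExpo σ m) = J₀ + zExpo σ' k' + zExpo σ k := by
    rw [shift_add, shift_add, e1, e1', shift_eq_self u h0, Subtype.ext hmk, Subtype.ext hmk']
  rw [← e3, ht.inv u _ hJ]

/-- Division of a series by two variables, on a smaller domain. -/
theorem exists_majNorm_div_le {s r σ ρ ρ' : ℝ} (hρ0 : 0 ≤ ρ') (hρ : ρ' < ρ) (x y : Var jj) :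
    ∃ C : ℝ≥0∞, C ≠ ⊤ ∧ ∀ A : Expo jj → ℝ≥0∞,
      majNorm a p s r σ ρ' (fun J => A (J + (0, Finsupp.single y 1) + (0, Finsupp.single x 1)))
        ≤ C * majNorm a p s r σ ρ A := by
  classical
  obtain ⟨u, hu, hsupp⟩ := exists_absBall_support (a := a) (p := p) (sub_pos.2 hρ) {x, y}
  have hux : u x ≠ 0 := (hsupp x).2 (by simp)
  have huy : u y ≠ 0 := (hsupp y).2 (by simp)
  have hutop : ∀ z, u z ≠ ⊤ := by
    intro z
    rcases z with h | ⟨τ, j⟩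
    · exact ne_top_of_le_ne_top ENNReal.ofReal_ne_top ((Finset.single_le_sum
        (f := fun h => u (Sum.inl h)) (fun _ _ => zero_le) (Finset.mem_univ h)).trans hu.1.le)
    · intro htop
      have h1 := (le_extNorm (a := a) (p := p) (fun j => u (Sum.inr (τ, j))) j).trans (hu.2 τ).le
      rw [htop, ENNReal.mul_top (eweight_ne_zero _), top_le_iff] at h1
      exact ENNReal.ofReal_ne_top h1
  have hne : u x * u y ≠ 0 := mul_ne_zero hux huy
  have hnt : u x * u y ≠ ⊤ := ENNReal.mul_ne_top (hutop x) (hutop y)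
  refine ⟨(u x * u y)⁻¹, ENNReal.inv_ne_top.2 hne, fun A => iSup₂_le fun w hw => ?_⟩
  have hw' : (fun z => w z + u z) ∈ absBall jj a p ρ :=
    absBall_add hρ0 hρ.le hw (hu.1.le.trans (ENNReal.ofReal_le_ofReal (by nlinarith)))
      fun τ => (hu.2 τ).le
  refine le_trans ?_ (mul_le_mul' le_rfl (le_majNorm hw' A))
  rw [← vecNorm_const_mul]
  refine vecNorm_mono fun d => ?_
  have hkey : ∀ J : Expo jj, u x * u y * dposMon d σ w J ≤ dposMon d σ (fun z => w z + u z)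
      (J + (0, Finsupp.single y 1) + (0, Finsupp.single x 1)) := by
    intro J
    have hstep : ∀ (z : Var jj) (J : Expo jj), u z * dposMon d σ (fun z => w z + u z) J
        ≤ dposMon d σ (fun z => w z + u z) (J + (0, Finsupp.single z 1)) := by
      intro z J
      unfold dposMon
      by_cases h0 : mult d J = 0
      · simp [h0]
      have h1 : lower d (J + (0, Finsupp.single z 1)) = lower d J + (0, Finsupp.single z 1) := by
        rcases d with i | v
        · rfl
        · exact lower_add_of_ne h0 _
      have h2 : mult d J ≤ mult d (J + (0, Finsupp.single z 1)) := by
        rcases d with i | v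
        · simp [mult]
        · simp [mult]
      rw [h1, posMon_add_single, mul_left_comm]
      refine mul_le_mul' (by exact_mod_cast h2) ?_
      rw [mul_comm]
      exact mul_le_mul' le_rfl le_add_self
    calc u x * u y * dposMon d σ w J
        ≤ u x * (u y * dposMon d σ (fun z => w z + u z) J) := by
          rw [mul_assoc]
          exact mul_le_mul' le_rfl (mul_le_mul' le_rfl
            (dposMon_mono le_rfl (fun z => le_self_add) d J))
      _ ≤ _ := (mul_le_mul' le_rfl (hstep y J)).trans (hstep x _)
  rw [← ENNReal.mul_le_iff_le_inv hne hnt]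
  unfold gradMaj
  rw [← ENNReal.tsum_mul_left]
  refine le_trans (ENNReal.tsum_le_tsum fun J => ?_)
    (ENNReal.tsum_comp_le_tsum_of_injective
      (f := fun J : Expo jj => J + (0, Finsupp.single y 1) + (0, Finsupp.single x 1))
      (fun J K h => add_right_cancel (add_right_cancel h)) _)
  rw [mul_left_comm]
  exact mul_le_mul' le_rfl (hkey J)

/-- Töplitz coefficients whose norm is finite on a larger domain are those of a Töplitz series.  The
larger domain serves to divide by two variables, which the norm of the factors `f^{σ,σ'}(ς, h)`
requires. -/
theorem isToeplitz_of_toepE {Ξ : Type} {b L s r ρ : ℝ} {N : ℕ} {θ μ : ℝ} (hr : 0 ≤ r)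
    (hρ : r < ρ) (hκ : kappa jj ≤ N) (hθ : 1 ≤ θ)
    (hMN : μ * (N : ℝ) ^ L + kappa jj * (N : ℝ) ^ b ≤ N) {t : Ξ → Expo jj → ℂ}
    (ht : ∀ ξ, ToepE N (θ * N) (μ * (N : ℝ) ^ L) ((N : ℝ) ^ b) (t ξ)) {X : ℝ≥0∞} (hX : X ≠ ⊤)
    (hn : ∀ ξ, majNorm a p s r s ρ (absC (t ξ)) ≤ X) :
    IsToeplitz a p b L s r N θ μ fun ξ => ofCoeffs (t ξ) := by
  classical
  have hN0 : (0 : ℝ) ≤ N := by positivity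
  have hB : (0 : ℝ) ≤ (N : ℝ) ^ b := by positivity
  have hκB : 0 ≤ (kappa jj : ℝ) * (N : ℝ) ^ b := by positivity
  have hNT : (N : ℝ) ≤ θ * N := by nlinarith
  have hM : μ * (N : ℝ) ^ L ≤ N := by linarith
  refine ⟨lt_of_le_of_lt (iSup_le fun ξ => ?_) (lt_top_iff_ne_top.2 hX), ?_⟩
  · rw [vfNorm_eq, coeffs_ofCoeffs]
    exact (majNorm_anti le_rfl hr hρ.le _).trans (hn ξ)
  -- the high sites of a class of bilinear monomials
  let Q : Bool → Bool → Bool → ℤ → Site jj × Site jj → Prop := fun σ σ' ς h q =>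
    IsHigh N θ q.1 ∧ IsHigh N θ q.2 ∧ decide (0 < (q.1 : ℤ)) = ς ∧
      sgn σ * (q.1 : ℤ) + sgn σ' * q.2 = h
  -- The factor is read off at an arbitrary pair of the class.  The series runs over ordered pairs, so
  -- that each monomial occurs twice; hence the `1 / 2`.
  let ψ : Bool → Bool → Bool → ℤ → Ξ → Expo jj → ℂ := fun σ σ' ς h ξ J₀ =>
    if hq : ∃ q, Q σ σ' ς h q then
      if Low (μ * (N : ℝ) ^ L) ((N : ℝ) ^ b) J₀ ∧ momE J₀ + h = 0 then
        (1 / 2 : ℂ) * t ξ (J₀ + zExpo σ' hq.choose.2 + zExpo σ hq.choose.1) else 0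
    else 0
  have hψsupp : ∀ σ σ' ς h ξ J₀, ψ σ σ' ς h ξ J₀ ≠ 0 →
      Low (μ * (N : ℝ) ^ L) ((N : ℝ) ^ b) J₀ ∧ momE J₀ + h = 0 := by
    intro σ σ' ς h ξ J₀ hne
    simp only [ψ] at hne
    split_ifs at hne with h1 h2
    · exact h2
    · exact absurd rfl hne
    · exact absurd rfl hne
  refine ⟨fun σ σ' ς h ξ => ofCoeffs (ψ σ σ' ς h ξ), fun σ σ' ς h => ⟨?_, fun ξ I hI => ?_⟩,
    fun ξ => ?_⟩
  · by_cases hq : ∃ q, Q σ σ' ς h q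
    · obtain ⟨C, hC, hCA⟩ := exists_majNorm_div_le (a := a) (p := p) (s := s) (r := r) (σ := s) hr hρ
        (Sum.inr (σ, hq.choose.1)) (Sum.inr (σ', hq.choose.2))
      refine lt_of_le_of_lt (iSup_le fun ξ => ?_)
        (lt_top_iff_ne_top.2 (ENNReal.mul_ne_top hC hX))
      rw [vfNorm_eq, coeffs_ofCoeffs]
      refine le_trans (majNorm_mono fun J => ?_)
        ((hCA (absC (t ξ))).trans (mul_le_mul' le_rfl (hn ξ)))
      simp only [absC, ψ, dif_pos hq]
      split_ifs
      · rw [enorm_mul]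
        refine mul_le_of_le_one_left' ?_
        rw [← ofReal_norm]
        refine ENNReal.ofReal_le_one.2 ?_
        norm_num
      · rw [enorm_zero]; exact zero_le
    · refine lt_of_le_of_lt (iSup_le fun ξ => ?_) ENNReal.zero_lt_top
      rw [vfNorm_eq, coeffs_ofCoeffs]
      have : absC (ψ σ σ' ς h ξ) = fun J => 0 * (0 : ℝ≥0∞) := by
        funext J
        simp only [absC, ψ, dif_neg hq, enorm_zero, zero_mul]
      rw [this, majNorm_const_mul, zero_mul]
  · have := hψsupp σ σ' ς h ξ _ hI
    rw [isLow_iff, momentum_eq]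
    exact this
  · have hsupp' : ∀ σ σ' (m m' : Site jj) J, coeffs (ofCoeffs (ψ σ σ' (decide (0 < (m : ℤ)))
        (sgn σ * m + sgn σ' * m') ξ)) J ≠ 0 → Low (μ * (N : ℝ) ^ L) ((N : ℝ) ^ b) J ∧
        momE J = - vmom (Sum.inr (σ, m)) - vmom (Sum.inr (σ', m')) := by
      intro σ σ' m m' J hJ
      rw [coeffs_ofCoeffs] at hJ
      obtain ⟨h1, h2⟩ := hψsupp _ _ _ _ _ _ hJ
      refine ⟨h1, ?_⟩
      rw [vmom_inr, vmom_inr]; linarith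
    have hval : ∀ σ σ' (m m' : Site jj) J₀, IsHigh N θ m → IsHigh N θ m' →
        Low (μ * (N : ℝ) ^ L) ((N : ℝ) ^ b) J₀ →
        momE J₀ = - vmom (Sum.inr (σ, m)) - vmom (Sum.inr (σ', m')) →
        ψ σ σ' (decide (0 < (m : ℤ))) (sgn σ * m + sgn σ' * m') ξ J₀
          = (1 / 2 : ℂ) * t ξ (J₀ + zExpo σ' m' + zExpo σ m) := by
      intro σ σ' m m' J₀ hm hm' hL hmom
      have hq : ∃ q, Q σ σ' (decide (0 < (m : ℤ))) (sgn σ * m + sgn σ' * m') q :=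
        ⟨(m, m'), hm, hm', rfl, rfl⟩
      obtain ⟨q1, q2, q3, q4⟩ := hq.choose_spec
      simp only [ψ, dif_pos hq]
      rw [if_pos ⟨hL, by rw [hmom, vmom_inr, vmom_inr]; ring⟩]
      congr 1
      exact ((ht ξ).eq_of_same hκ hNT hMN hM hL hmom ((isHigh_iff σ).1 hm) ((isHigh_iff σ').1 hm')
        ((isHigh_iff σ).1 q1) ((isHigh_iff σ').1 q2) q3.symm q4.symm).symm
    have hfun : coeffs (bilinearSeries N θ fun σ σ' m m' => ofCoeffs (ψ σ σ'
        (decide (0 < (m : ℤ))) (sgn σ * m + sgn σ' * m') ξ)) = t ξ := by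
      funext J
      by_cases hJ : Bil N (θ * N) (μ * (N : ℝ) ^ L) ((N : ℝ) ^ b) J
      · obtain ⟨σ, σ', m, m', J₀, hm, hm', hL, hmom, rfl⟩ := (bil_iff hNT hM).1 hJ
        have h1 := (isHigh_iff σ).2 hm
        have h2 := (isHigh_iff σ').2 hm'
        rw [coeffs_bilinearSeries_eq hsupp' hθ hMN hB h1 h2 hL hmom, coeffs_ofCoeffs,
          coeffs_ofCoeffs, hval σ σ' m m' J₀ h1 h2 hL hmom,
          hval σ' σ m' m J₀ h2 h1 hL (by rw [hmom]; ring), add_right_comm J₀ (zExpo σ m)]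
        ring
      · have h1 : t ξ J = 0 := by_contra fun h => hJ ((ht ξ).supp J h)
        rw [h1]
        by_contra h
        exact hJ (bil_of_coeffs_bilinearSeries hsupp' hθ hM h)
    have h := congrArg ofCoeffs hfun.symm
    rw [ofCoeffs_coeffs] at h
    exact h

/-! ### Iterated Poisson brackets -/

/-- The coefficients of `ad_F H = {H, F}`, from those of `F` and of `H`. -/
def adC (e c : Expo jj → ℂ) : Expo jj → ℂ := cBracket fun τ => c τ.2.1 * e τ.2.2

theorem mom_adC_iterate {e c : Expo jj → ℂ} (he : ∀ J, e J ≠ 0 → momE J = 0)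
    (hc : ∀ J, c J ≠ 0 → momE J = 0) (j : ℕ) : ∀ J, (adC e)^[j] c J ≠ 0 → momE J = 0 := by
  induction j with
  | zero => exact hc
  | succ j ih =>
    intro J hJ
    rw [Function.iterate_succ_apply'] at hJ
    exact momE_of_cBracket_ne_zero
      (fun τ hτ => ⟨ih _ (left_ne_zero_of_mul hτ), he _ (right_ne_zero_of_mul hτ)⟩) hJ

theorem majNorm_adC_le {s r σ σ' ρ ρ' δ x y : ℝ} (hs : 0 < s) (hr : 0 < r) (hδ : 0 < δ)
    (hx : 0 < x) (hy : 0 < y) (hσ0 : 0 ≤ σ') (hσ : δ * s ≤ σ - σ') (hρ : δ * r ≤ ρ - ρ')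
    (hρ0 : 0 ≤ ρ') (hρr : r ≤ ρ + ρ') {c e : Expo jj → ℂ}
    (hc : majNorm a p s r σ ρ (absC c) ≤ ENNReal.ofReal x)
    (he : majNorm a p s r σ ρ (absC e) ≤ ENNReal.ofReal y) :
    majNorm a p s r σ' ρ' (absC (adC e c)) ≤ ENNReal.ofReal (2 * x * y / δ) := by
  refine le_trans (majNorm_mono fun I => ?_)
    (majNorm_majBracket_le hs hr hδ hx hy hσ0 hσ hρ hρ0 hρr hc he)
  exact (absC_cBracket_le _ I).trans (majBracket_mono (fun τ => (enorm_mul _ _).le) I)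

section chain

variable {s r s' r' δ F G : ℝ} {e c : Expo jj → ℂ}

theorem majNorm_adC_chain {ds dr : ℝ} (hs : 0 < s) (hr : 0 < r) (hδ : 0 < δ) (hds : δ * s ≤ ds)
    (hdr : δ * r ≤ dr) (hF : 0 < F) (hG : 0 < G)
    (he : majNorm a p s r s r (absC e) ≤ ENNReal.ofReal F)
    (hc : majNorm a p s r s r (absC c) ≤ ENNReal.ofReal G) (i : ℕ) (his : i * ds ≤ s)
    (hir : i * dr ≤ r / 2) :
    majNorm a p s r (s - i * ds) (r - i * dr) (absC ((adC e)^[i] c))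
      ≤ ENNReal.ofReal (G * (2 * F / δ) ^ i) := by
  have hds0 : 0 ≤ ds := (by positivity : 0 ≤ δ * s).trans hds
  have hdr0 : 0 ≤ dr := (by positivity : 0 ≤ δ * r).trans hdr
  induction i with
  | zero => simpa using hc
  | succ i ih =>
    push_cast at his hir ⊢
    rw [add_mul, one_mul] at his hir ⊢
    rw [add_mul, one_mul]
    have is0 : 0 ≤ (i : ℝ) * ds := by positivity
    have ir0 : 0 ≤ (i : ℝ) * dr := by positivity
    have h1 := ih (by linarith) (by linarith)
    rw [Function.iterate_succ_apply']
    have h2 := majNorm_adC_le (a := a) (p := p) (σ' := s - (i * ds + ds))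
      (ρ' := r - (i * dr + dr)) hs hr hδ (by positivity : 0 < G * (2 * F / δ) ^ i) hF
      (by linarith) (by linarith) (by linarith) (by linarith) (by linarith) h1
      ((majNorm_anti (by linarith) (by linarith) (by linarith) _).trans he)
    have h3 : 2 * (G * (2 * F / δ) ^ i) * F / δ = G * (2 * F / δ) ^ (i + 1) := by
      rw [pow_succ]; ring
    rwa [h3] at h2

/-- Each of the `j` brackets uses a `j`-th part of the difference of the two domains. -/
theorem majNorm_adC_iterate_le (hs : 0 < s) (hr : 0 < r) (hδ : 0 < δ) (hδs : δ * s ≤ s - s')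
    (hδr : δ * r ≤ r - r') (hs' : 0 ≤ s') (hr' : r / 2 ≤ r') (hF : 0 < F) (hG : 0 < G)
    (he : majNorm a p s r s r (absC e) ≤ ENNReal.ofReal F)
    (hc : majNorm a p s r s r (absC c) ≤ ENNReal.ofReal G) (j : ℕ) :
    majNorm a p s r s' r' (absC ((adC e)^[j] c)) ≤ ENNReal.ofReal (G * (2 * F * j / δ) ^ j) := by
  have hδs0 : 0 < δ * s := by positivity
  have hδr0 : 0 < δ * r := by positivity
  rcases Nat.eq_zero_or_pos j with rfl | hj
  · simpa using (majNorm_anti (by linarith) (by linarith) (by linarith) _).trans hc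
  · have hj' : (0 : ℝ) < j := by exact_mod_cast hj
    have h := majNorm_adC_chain (δ := δ / j) (ds := (s - s') / j) (dr := (r - r') / j) hs hr
      (div_pos hδ hj') (by rw [div_mul_eq_mul_div]; exact div_le_div_of_nonneg_right hδs hj'.le)
      (by rw [div_mul_eq_mul_div]; exact div_le_div_of_nonneg_right hδr hj'.le) hF hG he hc j
      (by rw [mul_div_cancel₀ _ hj'.ne']; linarith) (by rw [mul_div_cancel₀ _ hj'.ne']; linarith)
    rwa [mul_div_cancel₀ _ hj'.ne', mul_div_cancel₀ _ hj'.ne', sub_sub_cancel, sub_sub_cancel,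
      div_div_eq_mul_div] at h

variable {N : ℕ} {B T M T' M' : ℝ} {u t : Expo jj → ℂ}

/-- The bracket estimate used `i` times, with equal losses in each step. -/
theorem exists_qt_chain {ds dr dM dT : ℝ} (ha : 0 ≤ a) (hp : 0 ≤ p) (hs : 0 < s) (hr : 0 < r)
    (hδ : 0 < δ) (hds : δ * s ≤ ds) (hdr : δ * r ≤ dr) (hF : 0 < F)
    (hG : 0 < G) (hκ : kappa jj ≤ N) (hN0 : 0 < N) (hNT : N ≤ T) (hMN : M + kappa jj * B ≤ N)
    (hB : 0 ≤ B) (he : QT a p s r N B T M s r F e u) (hc : QT a p s r N B T M s r G c t)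
    (hM0 : 0 ≤ M) (h1 : kappa jj * B ≤ dM) (h2 : M ≤ dT) (h3 : Real.log N ≤ B * (ds / 2)) (i : ℕ)
    (his : i * ds ≤ s) (hir : i * dr ≤ r / 2) (hiM : i * dM ≤ M) :
    ∃ t', QT a p s r N B (T + i * dT) (M - i * dM) (s - i * ds) (r - i * dr)
      (G * (14 * F / δ) ^ i) ((adC e)^[i] c) t' := by
  have hds0 : 0 ≤ ds := (by positivity : 0 ≤ δ * s).trans hds
  have hdr0 : 0 ≤ dr := (by positivity : 0 ≤ δ * r).trans hdr
  have hκB : 0 ≤ (kappa jj : ℝ) * B := by positivity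
  have hdM0 : 0 ≤ dM := hκB.trans h1
  have hdT0 : 0 ≤ dT := hM0.trans h2
  induction i with
  | zero => exact ⟨t, by simpa using hc⟩
  | succ i ih =>
    push_cast at his hir hiM ⊢
    rw [add_mul, one_mul] at his hir hiM
    rw [add_mul, one_mul, add_mul, one_mul, add_mul, one_mul, add_mul, one_mul]
    have is0 : 0 ≤ (i : ℝ) * ds := by positivity
    have ir0 : 0 ≤ (i : ℝ) * dr := by positivity
    have iM0 : 0 ≤ (i : ℝ) * dM := by positivity
    have iT0 : 0 ≤ (i : ℝ) * dT := by positivity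
    obtain ⟨t', ht'⟩ := ih (by linarith) (by linarith) (by linarith)
    have he' := he.mono (M' := M - i * dM) (T' := T + i * dT) (σ' := s - i * ds)
      (ρ' := r - i * dr) hκ (by linarith) (by linarith) (by linarith) (by linarith) (by linarith)
      (by linarith)
    have key := QT.bracket (T' := T + (i * dT + dT)) (M' := M - (i * dM + dM))
      (σ' := s - (i * ds + ds)) (ρ' := r - (i * dr + dr)) ha hp ht' he' hs hr hδ
      (by positivity) hF (by linarith) (by linarith) (by linarith) (by linarith) (by linarith) hκ
      hN0 (by linarith) (by linarith) (by linarith) (by linarith) (by linarith) hB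
      (by rwa [sub_sub_sub_cancel_left, add_sub_cancel_left])
    have h4 : 14 * (G * (14 * F / δ) ^ i) * F / δ = G * (14 * F / δ) ^ (i + 1) := by
      rw [pow_succ]; ring
    rw [h4] at key
    rw [Function.iterate_succ_apply']
    exact ⟨_, key⟩

theorem toepE_zero : ToepE N T M B (0 : Expo jj → ℂ) :=
  ⟨fun _ h => absurd rfl h, fun _ _ _ => rfl⟩

/-- The iterated brackets `ad_F^j H` are quasi-Töplitz.  For small `j` the bracket estimate is
used `j` times; for `j ≥ ln N` the factor `N` in front of the error is at most `e^j`, so that the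
approximation by `0` is good enough; and for `M' < 0` there are no bilinear monomials. -/
theorem exists_qt_iterate (ha : 0 ≤ a) (hp : 0 ≤ p) (hs : 0 < s) (hr : 0 < r) (hδ : 0 < δ)
    (hδs : δ * s ≤ s - s') (hδr : δ * r ≤ r - r') (hs' : 0 ≤ s') (hr' : r / 2 ≤ r') (hF : 0 < F)
    (hG : 0 < G) (hκ : kappa jj ≤ N) (hN0 : 0 < N) (hNT : N ≤ T) (hMN : M + kappa jj * B ≤ N)
    (hB : 0 ≤ B) (hTT : T ≤ T') (hMM : M' ≤ M)
    (he : QT a p s r N B T M s r F e u) (hc : QT a p s r N B T M s r G c t) (j : ℕ)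
    (h : (j : ℝ) < Real.log N → kappa jj * B * j ≤ M - M' ∧ M * j ≤ T' - T ∧
      Real.log N * (2 * j) ≤ B * (s - s')) :
    ∃ t', QT a p s r N B T' M' s' r' (G * (14 * F * j / δ) ^ j) ((adC e)^[j] c) t' := by
  have hδs0 : 0 < δ * s := by positivity
  have hδr0 : 0 < δ * r := by positivity
  rcases Nat.eq_zero_or_pos j with rfl | hj
  · have h1 := hc.mono hκ (by linarith : M' + kappa jj * B ≤ N) hTT hMM (by linarith : s' ≤ s)
      (by linarith : 0 ≤ r') (by linarith)
    refine ⟨bilPart N T' M' B t, ?_⟩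
    rw [pow_zero, mul_one]
    exact h1
  have hj' : (0 : ℝ) < j := by exact_mod_cast hj
  have hplain := majNorm_adC_iterate_le hs hr hδ hδs hδr hs' hr' hF hG he.norm_le hc.norm_le j
  have hle : G * (2 * F * j / δ) ^ j ≤ G * (14 * F * j / δ) ^ j := by gcongr; norm_num
  have hzero : ∀ {σ ρ}, majNorm a p s r σ ρ (absC (0 : Expo jj → ℂ)) = 0 := by
    intro σ ρ
    have : absC (0 : Expo jj → ℂ) = fun J => 0 * (0 : ℝ≥0∞) := by funext J; simp [absC]
    rw [this, majNorm_const_mul, zero_mul]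
  by_cases hM0 : 0 ≤ M'
  · by_cases hjN : (j : ℝ) < Real.log N
    · obtain ⟨h1, h2, h3⟩ := h hjN
      obtain ⟨t', ht'⟩ := exists_qt_chain (δ := δ / j) (ds := (s - s') / j) (dr := (r - r') / j)
        (dM := (M - M') / j) (dT := (T' - T) / j) ha hp hs hr (div_pos hδ hj')
        (by rw [div_mul_eq_mul_div]; exact div_le_div_of_nonneg_right hδs hj'.le)
        (by rw [div_mul_eq_mul_div]; exact div_le_div_of_nonneg_right hδr hj'.le) hF hG hκ hN0 hNT
        hMN hB he hc (hM0.trans hMM) ((le_div_iff₀ hj').2 h1) ((le_div_iff₀ hj').2 h2)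
        (by rw [div_div, mul_div_assoc', le_div_iff₀ (by positivity), mul_comm (j : ℝ)]; exact h3)
        j (by rw [mul_div_cancel₀ _ hj'.ne']; linarith)
        (by rw [mul_div_cancel₀ _ hj'.ne']; linarith) (by rw [mul_div_cancel₀ _ hj'.ne']; linarith)
      rw [mul_div_cancel₀ _ hj'.ne', mul_div_cancel₀ _ hj'.ne', mul_div_cancel₀ _ hj'.ne',
        mul_div_cancel₀ _ hj'.ne', sub_sub_cancel, sub_sub_cancel, sub_sub_cancel,
        add_sub_cancel, div_div_eq_mul_div] at ht'
      exact ⟨t', ht'⟩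
    -- `7` is the quotient of the constants `14` and `2` of `QT.bracket` and of the plain estimate
    · have hN : (N : ℝ) ≤ 7 ^ j := by
        have hN1 : (0 : ℝ) < N := by exact_mod_cast hN0
        rw [← Real.exp_log hN1]
        refine (Real.exp_le_exp.2 (not_lt.1 hjN)).trans ?_
        rw [← Real.exp_one_pow]
        have := Real.exp_one_lt_d9
        gcongr
        linarith
      refine ⟨0, mom_adC_iterate he.mom hc.mom j, toepE_zero,
        hplain.trans (ENNReal.ofReal_le_ofReal hle), by rw [hzero]; exact zero_le, ?_⟩
      calc (N : ℝ≥0∞) * majNorm a p s r s' r'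
            (absC fun J => bilPart N T' M' B ((adC e)^[j] c) J - (0 : Expo jj → ℂ) J)
          ≤ (N : ℝ≥0∞) * ENNReal.ofReal (G * (2 * F * j / δ) ^ j) := by
            refine mul_le_mul' le_rfl ((majNorm_mono fun J => ?_).trans hplain)
            simp only [absC, Pi.zero_apply, sub_zero]
            exact enorm_bilPart_le _ _ _ _ _ _
        _ = ENNReal.ofReal (N * (G * (2 * F * j / δ) ^ j)) := by
            rw [ENNReal.ofReal_mul (p := (N : ℝ)) (by positivity), ENNReal.ofReal_natCast]
        _ ≤ _ := ENNReal.ofReal_le_ofReal <| by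
            calc (N : ℝ) * (G * (2 * F * j / δ) ^ j) ≤ 7 ^ j * (G * (2 * F * j / δ) ^ j) := by
                  gcongr
              _ = G * (14 * F * j / δ) ^ j := by
                  rw [mul_left_comm, ← mul_pow]; congr 2; ring
  · refine ⟨0, mom_adC_iterate he.mom hc.mom j, toepE_zero,
      hplain.trans (ENNReal.ofReal_le_ofReal hle), by rw [hzero]; exact zero_le, ?_⟩
    have : (fun J => bilPart N T' M' B ((adC e)^[j] c) J - (0 : Expo jj → ℂ) J) = 0 := by
      funext J
      have hJ : ¬ Bil N T' M' B J := fun hJ => by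
        have h1 := hJ.near
        have h2 : (0 : ℤ) ≤ nearW N J := wsum_nonneg (fun x => by split_ifs <;> positivity) J
        have h3 : (0 : ℝ) ≤ nearW N J := by exact_mod_cast h2
        linarith
      simp only [Pi.zero_apply, sub_zero]
      exact if_neg hJ
    rw [this, hzero, mul_zero]
    exact zero_le

end chain

/-! ### Series of iterated brackets -/

theorem ne_top_of_majNorm {s r σ ρ : ℝ} (hs : 0 < s) (hr : 0 < r) (hρ : 0 < ρ)
    {A : Expo jj → ℝ≥0∞} (hA : majNorm a p s r σ ρ A ≠ ⊤) {d : Dir jj} {J : Expo jj}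
    (hd : mult d J ≠ 0) : A J ≠ ⊤ := by
  obtain ⟨w, hw, hsupp⟩ := exists_absBall_support (a := a) (p := p) hρ J.2.support
  have h1 : gradMaj A σ w d ≠ ⊤ := ne_top_of_vecNorm hs hr (vecNorm_ne_top hA hw) d
  have h2 : A J * dposMon d σ w J ≠ ⊤ := ne_top_of_le_ne_top h1 (ENNReal.le_tsum J)
  have h3 : dposMon d σ w J ≠ 0 := by
    refine mul_ne_zero (by exact_mod_cast hd) (mul_ne_zero ?_ ?_)
    · exact (ENNReal.ofReal_pos.2 (Real.exp_pos _)).ne'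
    · refine Finset.prod_ne_zero_iff.2 fun x hx => pow_ne_zero _ ((hsupp x).2 ?_)
      rw [Finsupp.mem_support_iff] at hx ⊢
      exact fun hc => hx (Nat.le_zero.1 ((lower_apply_le d J x).trans hc.le))
  exact fun htop => h2 (by rw [htop, ENNReal.top_mul h3])

section series

variable {s r σ ρ : ℝ} {w x : ℕ → ℝ} {X : ℝ} {c t : ℕ → Expo jj → ℂ}

/-- `∑ w_j c_j`, coefficient by coefficient. -/
def wSeries (w : ℕ → ℝ) (c : ℕ → Expo jj → ℂ) (J : Expo jj) : ℂ := ∑' j, (w j : ℂ) * c j J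

/-- `∑ w_j |c_j|`, coefficient by coefficient. -/
def wMaj (w : ℕ → ℝ) (c : ℕ → Expo jj → ℂ) (J : Expo jj) : ℝ≥0∞ :=
  ∑' j, ENNReal.ofReal (w j) * absC (c j) J

theorem enorm_weight_mul (hw : ∀ j, 0 ≤ w j) (j : ℕ) (z : ℂ) :
    ‖(w j : ℂ) * z‖ₑ = ENNReal.ofReal (w j) * ‖z‖ₑ := by
  rw [enorm_mul, ← ofReal_norm, Complex.norm_real, Real.norm_of_nonneg (hw j)]

theorem enorm_wSeries_le (hw : ∀ j, 0 ≤ w j) (J : Expo jj) : absC (wSeries w c) J ≤ wMaj w c J :=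
  enorm_tsum_le_of_le fun j => (enorm_weight_mul hw j _).le

theorem majNorm_wMaj_le (hw : ∀ j, 0 ≤ w j) (hx0 : ∀ j, 0 ≤ x j) (hx : Summable fun j => w j * x j)
    (hX : ∑' j, w j * x j ≤ X)
    (h : ∀ j, majNorm a p s r σ ρ (absC (c j)) ≤ ENNReal.ofReal (x j)) :
    majNorm a p s r σ ρ (wMaj w c) ≤ ENNReal.ofReal X := by
  refine (majNorm_tsum _).trans ?_
  calc ∑' j, majNorm a p s r σ ρ (fun J => ENNReal.ofReal (w j) * absC (c j) J)
      ≤ ∑' j, ENNReal.ofReal (w j * x j) := ENNReal.tsum_le_tsum fun j => by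
        rw [majNorm_const_mul, ENNReal.ofReal_mul (hw j)]
        exact mul_le_mul' le_rfl (h j)
    _ = ENNReal.ofReal (∑' j, w j * x j) :=
        (ENNReal.ofReal_tsum_of_nonneg (fun j => mul_nonneg (hw j) (hx0 j)) hx).symm
    _ ≤ _ := ENNReal.ofReal_le_ofReal hX

/-- Weighted sums of coefficients and of their Töplitz approximations.  The norms do not control the
constant term, but the error involves bilinear monomials only. -/
theorem QT.wSeries {N : ℕ} {B T M : ℝ} (hs : 0 < s) (hr : 0 < r) (hρ : 0 < ρ) (hw : ∀ j, 0 ≤ w j)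
    (hx0 : ∀ j, 0 ≤ x j) (hx : Summable fun j => w j * x j) (hX : ∑' j, w j * x j ≤ X)
    (h : ∀ j, QT a p s r N B T M σ ρ (x j) (c j) (t j)) :
    QT a p s r N B T M σ ρ X (wSeries w c) (QuasiToeplitz.wSeries w t) := by
  have hc := majNorm_wMaj_le hw hx0 hx hX fun j => (h j).norm_le
  have ht := majNorm_wMaj_le hw hx0 hx hX fun j => (h j).norm_toep_le
  refine ⟨fun J hJ => ?_, ⟨fun J hJ => ?_, fun u J hJ => tsum_congr fun j => ?_⟩,
    (majNorm_mono fun J => enorm_wSeries_le hw J).trans hc,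
    (majNorm_mono fun J => enorm_wSeries_le hw J).trans ht, ?_⟩
  · by_contra hm
    refine hJ ((tsum_congr fun j => ?_).trans tsum_zero)
    rw [by_contra fun h0 => hm ((h j).mom J h0), mul_zero]
  · by_contra hm
    refine hJ ((tsum_congr fun j => ?_).trans tsum_zero)
    rw [by_contra fun h0 => hm ((h j).toep.supp J h0), mul_zero]
  · rw [(h j).toep.inv u J hJ]
  · have herr := majNorm_wMaj_le (c := fun j J => bilPart N T M B (c j) J - t j J)
      (x := fun j => x j) hw hx0 hx hX (a := a) (p := p) (s := s) (r := r) (σ := σ) (ρ := ρ)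
    rw [← majNorm_const_mul]
    refine le_trans (majNorm_mono (A' := fun J => ∑' j, ENNReal.ofReal (w j) *
      (N * absC (fun J => bilPart N T M B (c j) J - t j J) J)) fun J => ?_) ?_
    · by_cases hJ : Bil N T M B J
      · obtain ⟨y, -, -, -, hy, -⟩ := exists_far_of_farDeg_two hJ.deg
        have hsum : ∀ {c : ℕ → Expo jj → ℂ}, majNorm a p s r σ ρ (wMaj w c) ≤ ENNReal.ofReal X →
            Summable fun j => (w j : ℂ) * c j J := fun {c} hc => by
          refine summable_of_tsum_enorm ?_
          simp_rw [enorm_weight_mul hw]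
          exact ne_top_of_majNorm hs hr hρ (ne_top_of_le_ne_top ENNReal.ofReal_ne_top hc)
            (d := Sum.inr y) hy
        have h1 : bilPart N T M B (QuasiToeplitz.wSeries w c) J = QuasiToeplitz.wSeries w c J :=
          if_pos hJ
        have h2 : ∀ j, bilPart N T M B (c j) J = c j J := fun j => if_pos hJ
        simp only [absC, h1, h2, QuasiToeplitz.wSeries]
        rw [← (hsum hc).tsum_sub (hsum ht)]
        simp_rw [← mul_sub]
        refine (mul_le_mul' le_rfl
          (enorm_tsum_le_of_le fun j => (enorm_weight_mul hw j _).le)).trans (le_of_eq ?_)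
        rw [← ENNReal.tsum_mul_left]
        exact tsum_congr fun j => mul_left_comm _ _ _
      · have h1 : bilPart N T M B (QuasiToeplitz.wSeries w c) J = 0 := if_neg hJ
        have h2 : QuasiToeplitz.wSeries w t J = 0 := (tsum_congr fun j => by
          rw [by_contra fun h0 => hJ ((h j).toep.supp J h0), mul_zero]).trans tsum_zero
        simp only [absC, h1, h2, sub_zero, enorm_zero, mul_zero]
        exact zero_le
    · refine (majNorm_tsum _).trans ?_
      calc _ ≤ ∑' j, ENNReal.ofReal (w j * x j) := ENNReal.tsum_le_tsum fun j => by
            rw [majNorm_const_mul, majNorm_const_mul, ENNReal.ofReal_mul (hw j)]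
            exact mul_le_mul' le_rfl (h j).norm_err_le
        _ = ENNReal.ofReal (∑' j, w j * x j) :=
            (ENNReal.ofReal_tsum_of_nonneg (fun j => mul_nonneg (hw j) (hx0 j)) hx).symm
        _ ≤ _ := ENNReal.ofReal_le_ofReal hX

end series

/-! ### Lie series -/

section series

variable {s r σ ρ : ℝ} {w : ℕ → ℝ}

theorem HasExp.ad_iterate (ha : 0 ≤ a) (hp : 0 ≤ p) (hs : 0 < s) (hr : 0 < r)
    {f g : Phase jj a p → ℂ} {e c : Expo jj → ℂ} (hf : HasExp σ ρ f e) (hg : HasExp σ ρ g c)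
    (he : majNorm a p s r σ ρ (absC e) ≠ ⊤)
    (hc : ∀ j, majNorm a p s r σ ρ (absC ((adC e)^[j] c)) ≠ ⊤) (j : ℕ) :
    HasExp σ ρ ((ad f)^[j] g) ((adC e)^[j] c) := by
  induction j with
  | zero => exact hg
  | succ j ih =>
    rw [Function.iterate_succ_apply', Function.iterate_succ_apply']
    exact HasExp.poisson ha hp hs hr ih hf (hc j) he

/-- A weighted sum of expansions converges absolutely, to the sum of the weighted sum of the
series of coefficients. -/
theorem HasExp.wSeries (ha : 0 ≤ a) (hp : 0 ≤ p) (hs : 0 < s) (hr : 0 < r) (hw : ∀ j, 0 ≤ w j)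
    {H : ℕ → Phase jj a p → ℂ} {c : ℕ → Expo jj → ℂ} (h : ∀ j, HasExp σ ρ (H j) (c j))
    (h0 : wMaj w c 0 ≠ ⊤) (hc : majNorm a p s r σ ρ (wMaj w c) ≠ ⊤) :
    (∀ v ∈ dom jj a p σ ρ, Summable fun j => (w j : ℂ) * H j v) ∧
      HasExp σ ρ (fun v => ∑' j, (w j : ℂ) * H j v) (wSeries w c) := by
  have hsum : ∀ v ∈ dom jj a p σ ρ,
      Summable fun q : ℕ × Expo jj => (w q.1 : ℂ) * (c q.1 q.2 * expMon v q.2) := by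
    intro v hv
    have h1 := valMaj_ne_top ha hp hr h0 hc ((mem_ballR_iff v).1 hv.2) hs
    refine summable_of_tsum_enorm (ne_top_of_le_ne_top h1 ?_)
    rw [ENNReal.tsum_prod', ENNReal.tsum_comm]
    refine ENNReal.tsum_le_tsum fun J => ?_
    unfold wMaj
    rw [← ENNReal.tsum_mul_right]
    refine ENNReal.tsum_le_tsum fun j => ?_
    rw [enorm_weight_mul hw, enorm_mul, ← mul_assoc]
    exact mul_le_mul' le_rfl (enorm_expMon_le (fun i => (hv.1 i).le) (fun _ => le_rfl) J)
  have hval : ∀ v ∈ dom jj a p σ ρ, ∀ j,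
      ∑' J, (w j : ℂ) * (c j J * expMon v J) = (w j : ℂ) * H j v := fun v hv j => by
    rw [tsum_mul_left, (h j v hv).tsum_eq]
  refine ⟨fun v hv => ?_, fun v hv => ?_⟩
  · exact (hsum v hv).prod.congr fun j => hval v hv j
  · have h1 := (hsum v hv).prod_symm.hasSum.prod_fiberwise fun J =>
      ((hsum v hv).prod_symm.prod_factor J).hasSum
    have h2 : ∀ J, ∑' j, (w j : ℂ) * (c j J * expMon v J) = QuasiToeplitz.wSeries w c J * expMon v J := by
      intro J
      rw [QuasiToeplitz.wSeries, ← tsum_mul_right]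
      exact tsum_congr fun j => (mul_assoc _ _ _).symm
    have h3 : ∑' q : Expo jj × ℕ, (w q.2 : ℂ) * (c q.2 q.1 * expMon v q.1)
        = ∑' j, (w j : ℂ) * H j v := by
      rw [← (Equiv.prodComm ℕ (Expo jj)).tsum_eq]
      exact (hsum v hv).tsum_prod.trans (tsum_congr (hval v hv))
    have h4 := (congrArg₂ HasSum (funext h2) h3).mp h1
    exact h4

theorem tsum_majBracket (w : ℕ → ℝ≥0∞) (A : ℕ → Expo jj → ℝ≥0∞) (B : Expo jj → ℝ≥0∞)
    (I : Expo jj) : ∑' j, w j * majBracket (fun τ => A j τ.2.1 * B τ.2.2) I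
      = majBracket (fun τ => (∑' j, w j * A j τ.2.1) * B τ.2.2) I := by
  classical
  unfold majBracket
  simp_rw [← ENNReal.tsum_mul_left]
  rw [ENNReal.tsum_comm]
  refine tsum_congr fun τ => ?_
  by_cases h : out τ = I
  · simp only [h, if_true]
    rw [← ENNReal.tsum_mul_right, ← ENNReal.tsum_mul_left]
    exact tsum_congr fun j => by ring
  · simp [h]

theorem wMaj_adC_zero_ne_top (ha : 0 ≤ a) (hp : 0 ≤ p) (hs : 0 < s) (hr : 0 < r) (hσ : 0 ≤ σ)
    (hρ : 0 < ρ) {e c : Expo jj → ℂ} (he : majNorm a p s r σ ρ (absC e) ≠ ⊤)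
    (hc : majNorm a p s r σ ρ (wMaj (fun j => w (j + 1)) fun j => (adC e)^[j] c) ≠ ⊤) :
    wMaj w (fun j => (adC e)^[j] c) 0 ≠ ⊤ := by
  have h1 := majBracket_ne_top ha hp hs hr hσ hρ hc he 0
  unfold wMaj
  rw [tsum_eq_zero_add' ENNReal.summable]
  refine ENNReal.add_ne_top.2 ⟨ENNReal.mul_ne_top ENNReal.ofReal_ne_top enorm_ne_top,
    ne_top_of_le_ne_top h1 ?_⟩
  unfold wMaj
  rw [← tsum_majBracket]
  refine ENNReal.tsum_le_tsum fun j => mul_le_mul' le_rfl ?_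
  beta_reduce
  rw [Function.iterate_succ_apply']
  exact (absC_cBracket_le _ _).trans (majBracket_mono (fun τ => (enorm_mul _ _).le) _)

theorem weight_mul_pow_le {j : ℕ} {F G δ : ℝ} (hF : 0 ≤ F) (hG : 0 ≤ G) (hδ : 0 < δ)
    (hw : w j ≤ 1 / (j.factorial : ℝ)) :
    w j * (G * (F * j / δ) ^ j) ≤ G * (Real.exp 1 * F / δ) ^ j := by
  have h1 := Real.pow_div_factorial_le_exp (j : ℝ) (by positivity) j
  calc w j * (G * (F * j / δ) ^ j) ≤ 1 / (j.factorial : ℝ) * (G * (F * j / δ) ^ j) := by gcongr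
    _ = G * (F / δ) ^ j * ((j : ℝ) ^ j / j.factorial) := by
        rw [show F * j / δ = F / δ * j by ring, mul_pow]; ring
    _ ≤ G * (F / δ) ^ j * Real.exp j := by gcongr
    _ = _ := by rw [← Real.exp_one_pow, mul_div_assoc, mul_pow]; ring

/-- The sum of the bounds for the iterated brackets is a geometric series. -/
theorem tsum_weight_mul_pow_le {F G δ : ℝ} {h : ℕ} (hF : 0 ≤ F) (hG : 0 ≤ G) (hδ : 0 < δ)
    (hw0 : ∀ j, 0 ≤ w j) (hw : ∀ j, w j ≤ 1 / (j.factorial : ℝ)) (hwh : ∀ j < h, w j = 0)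
    (hy : Real.exp 1 * F / δ ≤ 1 / 2) :
    (Summable fun j : ℕ => w j * (G * (F * j / δ) ^ j)) ∧
      ∑' j : ℕ, w j * (G * (F * j / δ) ^ j) ≤ 2 * (Real.exp 1 * F / δ) ^ h * G := by
  set y := Real.exp 1 * F / δ with hy_def
  have hy0 : 0 ≤ y := by positivity
  have hle : ∀ j, w j * (G * (F * j / δ) ^ j) ≤ G * y ^ j := fun j =>
    weight_mul_pow_le hF hG hδ (hw j)
  have hgeo : Summable fun j : ℕ => G * y ^ j :=
    (summable_geometric_of_lt_one hy0 (by linarith)).mul_left G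
  have hsum : Summable fun j : ℕ => w j * (G * (F * j / δ) ^ j) :=
    hgeo.of_nonneg_of_le (fun j => mul_nonneg (hw0 j) (by positivity)) hle
  refine ⟨hsum, ?_⟩
  rw [← hsum.sum_add_tsum_nat_add h,
    Finset.sum_eq_zero fun j hj => by rw [hwh j (Finset.mem_range.1 hj), zero_mul], zero_add]
  calc ∑' j : ℕ, w (j + h) * (G * (F * (j + h : ℕ) / δ) ^ (j + h))
      ≤ ∑' j : ℕ, G * y ^ h * y ^ j := by
        refine ((summable_nat_add_iff h).2 hsum).tsum_le_tsum (fun j => (hle _).trans ?_)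
          ((summable_geometric_of_lt_one hy0 (by linarith)).mul_left _)
        rw [pow_add]
        exact le_of_eq (by ring)
    _ = G * y ^ h * (1 - y)⁻¹ := by
        rw [tsum_mul_left, tsum_geometric_of_lt_one hy0 (by linarith)]
    _ ≤ G * y ^ h * 2 := by
        gcongr
        rw [inv_le_comm₀ (by linarith) two_pos]
        linarith
    _ = _ := by ring

end series

/-! ### The semi-norm and its scales -/

section norm

variable {Ξ : Type} {b L s r : ℝ} {N₀ : ℕ} {θ μ : ℝ}

/-- A quasi-Töplitz function, scale by scale. -/
theorem exists_qt_of_tNorm_lt (ha : 0 ≤ a) (hp : 1 / 2 < p) (hs : 0 < s) (hr : 0 < r)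
    (hθ : 1 ≤ θ)
    (hN : ∀ N, N₀ ≤ N → kappa jj ≤ N ∧ μ * (N : ℝ) ^ L + kappa jj * (N : ℝ) ^ b ≤ N)
    {f : Ξ → Phase jj a p → ℂ} (hf : ∀ ξ, ConservesMomentum s r (f ξ)) {X : ℝ}
    (hX : tNorm b L s r N₀ θ μ f < ENNReal.ofReal X) :
    ∃ e : Ξ → Expo jj → ℂ, (∀ ξ, HasExp s r (f ξ) (e ξ)) ∧ ∀ N, N₀ ≤ N →
      ∃ u : Ξ → Expo jj → ℂ, ∀ ξ, QT a p s r N ((N : ℝ) ^ b) (θ * N) (μ * (N : ℝ) ^ L) s r X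
        (e ξ) (u ξ) := by
  unfold tNorm at hX
  simp only [iInf_lt_iff] at hX
  obtain ⟨c, hc, hcX⟩ := hX
  refine ⟨fun ξ => coeffs (c ξ), fun ξ => hasExp_coeffs (hc ξ), fun N hN0 => ?_⟩
  obtain ⟨hκ, hMN⟩ := hN N hN0
  have hκB : 0 ≤ (kappa jj : ℝ) * (N : ℝ) ^ b := by positivity
  have h1 := (le_iSup₂ (f := fun (N : ℕ) (_ : N₀ ≤ N) => ⨅ (t : Ξ → Series jj)
    (_ : IsToeplitz a p b L s r N θ μ t), max (vfNormSup a p s r c) (max (vfNormSup a p s r t)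
      (vfNormSup a p s r fun ξ I => (N : ℂ) * (bilinearProj b L N θ μ (c ξ) I - t ξ I)))) N
    hN0).trans_lt hcX
  simp only [iInf_lt_iff] at h1
  obtain ⟨t, ht, htX⟩ := h1
  rw [max_lt_iff, max_lt_iff] at htX
  obtain ⟨g1, g2, g3⟩ := htX
  have hn : ∀ {c : Ξ → Series jj}, vfNormSup a p s r c < ENNReal.ofReal X → ∀ ξ,
      majNorm a p s r s r (absC (coeffs (c ξ))) ≤ ENNReal.ofReal X := fun {c} h ξ => by
    rw [← vfNorm_eq]
    exact (le_iSup (fun ξ => vfNorm a p s r (c ξ)) ξ).trans h.le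
  refine ⟨fun ξ => coeffs (t ξ), fun ξ => ⟨?_, toepE_of_isToeplitz hκ hθ hMN ht ξ, hn g1 ξ, hn g2 ξ,
    ?_⟩⟩
  · exact (conservesMomentum_iff ha hp hs hr hs hr (hasExp_coeffs (hc ξ))
      (ne_top_of_le_ne_top ENNReal.ofReal_ne_top (hn g1 ξ))).1 (hf ξ)
  · refine le_trans (le_of_eq ?_) (hn g3 ξ)
    rw [← majNorm_const_mul]
    congr 1
    funext J
    have h2 := congrFun (coeffs_bilinearProj (b := b) hθ (by linarith : μ * (N : ℝ) ^ L ≤ N) (c ξ)) J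
    unfold absC
    beta_reduce
    rw [← h2]
    change _ = ‖(N : ℂ) * (_ - _)‖ₑ
    rw [enorm_mul, ← ofReal_norm (N : ℂ), Complex.norm_natCast, ENNReal.ofReal_natCast]
    rfl

/-- Estimates at all scales on a slightly larger domain give a quasi-Töplitz function. -/
theorem isQuasiToeplitz_of_qt (ha : 0 ≤ a) (hp : 1 / 2 < p) {s' r' ρ X : ℝ} (hs : 0 < s)
    (hr : 0 < r) (hs' : 0 < s') (hr' : 0 < r') (hrr : r' ≤ r) (hρ : r' < ρ) (hX : 0 ≤ X)
    (hθ : 1 ≤ θ)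
    (hN : ∀ N, N₀ ≤ N → kappa jj ≤ N ∧ μ * (N : ℝ) ^ L + kappa jj * (N : ℝ) ^ b ≤ N)
    {H : Ξ → Phase jj a p → ℂ} {c : Ξ → Expo jj → ℂ} (hH : ∀ ξ, HasExp s' r' (H ξ) (c ξ))
    (hc : ∀ N, N₀ ≤ N → ∃ u : Ξ → Expo jj → ℂ, ∀ ξ,
      QT a p s r N ((N : ℝ) ^ b) (θ * N) (μ * (N : ℝ) ^ L) s' ρ X (c ξ) (u ξ)) :
    IsQuasiToeplitz b L s' r' N₀ θ μ H ∧
      tNorm b L s' r' N₀ θ μ H ≤ ENNReal.ofReal (max (s / s') ((r / r') ^ 2) * X) := by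
  set K := max (s / s') ((r / r') ^ 2)
  have hK : 0 ≤ K := le_max_of_le_left (by positivity)
  have hn : ∀ {A : Expo jj → ℝ≥0∞}, majNorm a p s r s' ρ A ≤ ENNReal.ofReal X →
      majNorm a p s' r' s' ρ A ≤ ENNReal.ofReal (K * X) := fun {A} h => by
    rw [ENNReal.ofReal_mul hK]
    exact (majNorm_le_max_mul hs hs' hr' hrr A).trans (mul_le_mul' le_rfl h)
  have hn' : ∀ {c : Ξ → Expo jj → ℂ}, (∀ ξ, majNorm a p s r s' ρ (absC (c ξ)) ≤ ENNReal.ofReal X) →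
      vfNormSup a p s' r' (fun ξ => ofCoeffs (c ξ)) ≤ ENNReal.ofReal (K * X) := fun {c} h =>
    iSup_le fun ξ => by
      rw [vfNorm_eq, coeffs_ofCoeffs]
      exact (majNorm_anti le_rfl hr'.le hρ.le _).trans (hn (h ξ))
  have hexp : ∀ ξ, IsExpansion s' r' (H ξ) (ofCoeffs (c ξ)) := fun ξ => isExpansion_ofCoeffs (hH ξ)
  have hcN : ∀ ξ, majNorm a p s r s' ρ (absC (c ξ)) ≤ ENNReal.ofReal X := fun ξ => by
    obtain ⟨u, hu⟩ := hc N₀ le_rfl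
    exact (hu ξ).norm_le
  have hT : tNorm b L s' r' N₀ θ μ H ≤ ENNReal.ofReal (K * X) := by
    refine (iInf₂_le _ hexp).trans (iSup₂_le fun N hN0 => ?_)
    obtain ⟨u, hu⟩ := hc N hN0
    obtain ⟨hκ, hMN⟩ := hN N hN0
    have hκB : 0 ≤ (kappa jj : ℝ) * (N : ℝ) ^ b := by positivity
    refine (iInf₂_le (fun ξ => ofCoeffs (u ξ)) (isToeplitz_of_toepE hr'.le hρ hκ hθ hMN
      (fun ξ => (hu ξ).toep) ENNReal.ofReal_ne_top fun ξ => hn (hu ξ).norm_toep_le)).trans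
      (max_le (hn' fun ξ => (hu ξ).norm_le) (max_le (hn' fun ξ => (hu ξ).norm_toep_le) ?_))
    have h1 : (fun ξ I => (N : ℂ) * (bilinearProj b L N θ μ (ofCoeffs (c ξ)) I
        - ofCoeffs (u ξ) I)) = fun ξ => ofCoeffs fun J => (N : ℂ) *
        (bilPart N (θ * N) (μ * (N : ℝ) ^ L) ((N : ℝ) ^ b) (c ξ) J - u ξ J) := by
      funext ξ I
      have h2 := coeffs_bilinearProj (b := b) hθ (by linarith : μ * (N : ℝ) ^ L ≤ N)
        (ofCoeffs (c ξ))
      rw [coeffs_ofCoeffs] at h2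
      have h3 := congrFun h2 (expoEquiv I)
      rw [coeffs, Equiv.symm_apply_apply] at h3
      rw [h3]
      rfl
    rw [h1]
    refine hn' fun ξ => le_trans (le_of_eq ?_) (hu ξ).norm_err_le
    rw [← majNorm_const_mul]
    congr 1
    funext J
    unfold absC
    rw [enorm_mul, ← ofReal_norm (N : ℂ), Complex.norm_natCast, ENNReal.ofReal_natCast]
  refine ⟨⟨?_, fun ξ => ?_, hT.trans_lt ENNReal.ofReal_lt_top⟩, hT⟩
  · exact ((iInf₂_le _ hexp).trans (hn' hcN)).trans_lt ENNReal.ofReal_lt_top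
  · refine (conservesMomentum_iff ha hp hs hr hs' hr' (hH ξ) ?_).2 ?_
    · exact ne_top_of_le_ne_top ENNReal.ofReal_ne_top
        ((majNorm_anti le_rfl hr'.le hρ.le _).trans (hcN ξ))
    · obtain ⟨u, hu⟩ := hc N₀ le_rfl
      exact (hu ξ).mom

/-- The conditions on the scale `N` under which `j < ln N` brackets fit between the two sets of
parameters. -/
def ScaleGap (jj : Fin n → ℤ) (b L s s' θ θ' μ μ' : ℝ) (N : ℕ) : Prop :=
  ∀ j : ℕ, (j : ℝ) < Real.log N →
    kappa jj * (N : ℝ) ^ b * j ≤ μ * (N : ℝ) ^ L - μ' * (N : ℝ) ^ L ∧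
    μ * (N : ℝ) ^ L * j ≤ θ' * N - θ * N ∧ Real.log N * (2 * j) ≤ (N : ℝ) ^ b * (s - s')

/-- Weighted Lie series are quasi-Töplitz.  The bounds `F`, `G` are strictly larger than the
semi-norms, because the infimum over the Töplitz approximations need not be attained. -/
theorem isQuasiToeplitz_lieSeries (ha : 0 ≤ a) (hp : 1 / 2 < p) {s' r' δ θ' μ' F G : ℝ}
    {N₀' h : ℕ} {w : ℕ → ℝ} (hs : 0 < s) (hr : 0 < r) (hs' : 0 < s') (hr2 : r / 2 ≤ r')
    (hδ : 0 < δ) (hδs : δ * s ≤ s - s') (hδr : δ * r ≤ r - r') (hN0 : 0 < N₀) (hNN : N₀ ≤ N₀')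
    (hθ : 1 ≤ θ) (hθ' : θ ≤ θ') (hμ' : μ' ≤ μ)
    (hN : ∀ N, N₀ ≤ N → kappa jj ≤ N ∧ μ * (N : ℝ) ^ L + kappa jj * (N : ℝ) ^ b ≤ N)
    (hgap : ∀ N, N₀' ≤ N → ScaleGap jj b L s s' θ θ' μ μ' N)
    {f g : Ξ → Phase jj a p → ℂ} (hf : ∀ ξ, ConservesMomentum s r (f ξ))
    (hg : ∀ ξ, ConservesMomentum s r (g ξ)) (hF : tNorm b L s r N₀ θ μ f < ENNReal.ofReal F)
    (hG : tNorm b L s r N₀ θ μ g < ENNReal.ofReal G) (hw0 : ∀ j, 0 ≤ w j)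
    (hw : ∀ j, w j ≤ 1 / (j.factorial : ℝ)) (hwh : ∀ j < h, w j = 0)
    (hy : 28 * Real.exp 1 * F / δ ≤ 1 / 2) :
    (∀ ξ, ∀ v ∈ dom jj a p s' r', Summable fun j : ℕ => (w j : ℂ) * ((ad (f ξ))^[j] (g ξ)) v) ∧
    IsQuasiToeplitz b L s' r' N₀' θ' μ'
      (fun ξ v => ∑' j : ℕ, (w j : ℂ) * ((ad (f ξ))^[j] (g ξ)) v) ∧
    tNorm b L s' r' N₀' θ' μ' (fun ξ v => ∑' j : ℕ, (w j : ℂ) * ((ad (f ξ))^[j] (g ξ)) v)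
      ≤ ENNReal.ofReal (max (s / s') ((r / r') ^ 2) * (2 * (28 * Real.exp 1 * F / δ) ^ h * G)) := by
  have hF0 : 0 < F := ENNReal.ofReal_pos.1 (bot_le.trans_lt hF)
  have hG0 : 0 < G := ENNReal.ofReal_pos.1 (bot_le.trans_lt hG)
  have hp0 : 0 ≤ p := by linarith
  have hδs0 : 0 < δ * s := by positivity
  have hδr0 : 0 < δ * r := by positivity
  obtain ⟨e, he, heN⟩ := exists_qt_of_tNorm_lt ha hp hs hr hθ hN hf hF
  obtain ⟨c, hc, hcN⟩ := exists_qt_of_tNorm_lt ha hp hs hr hθ hN hg hG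
  -- half of the difference of the radii is left for the coefficients of the Töplitz series
  set ρ := (r + r') / 2 with hρ
  have hδ2s : δ / 2 * s ≤ s - s' := by linarith
  have hδ2r : δ / 2 * r ≤ r - ρ := by rw [hρ]; linarith
  have hyF : Real.exp 1 * (14 * F) / (δ / 2) = 28 * Real.exp 1 * F / δ := by field_simp; norm_num
  have hit : ∀ N, N₀' ≤ N → ∀ ξ (j : ℕ), ∃ t', QT a p s r N ((N : ℝ) ^ b) (θ' * N) (μ' * (N : ℝ) ^ L)
      s' ρ (G * (14 * F * j / (δ / 2)) ^ j) ((adC (e ξ))^[j] (c ξ)) t' := by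
    intro N hN' ξ j
    obtain ⟨u, hu⟩ := heN N (hNN.trans hN')
    obtain ⟨t, ht⟩ := hcN N (hNN.trans hN')
    obtain ⟨hκ, hMN⟩ := hN N (hNN.trans hN')
    have hN1 : 0 < N := by omega
    exact exists_qt_iterate ha hp0 hs hr (half_pos hδ) hδ2s hδ2r hs'.le (by rw [hρ]; linarith) hF0
      hG0 hκ hN1 (by nlinarith [(Nat.cast_nonneg N : (0 : ℝ) ≤ N)]) hMN (by positivity)
      (by gcongr) (by gcongr) (hu ξ) (ht ξ) j (hgap N hN' j)
  have hcj : ∀ ξ j, majNorm a p s r s' ρ (absC ((adC (e ξ))^[j] (c ξ)))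
      ≤ ENNReal.ofReal (G * (14 * F * j / (δ / 2)) ^ j) := fun ξ j => by
    obtain ⟨t, ht⟩ := hit N₀' le_rfl ξ j
    exact ht.norm_le
  have hx0 : ∀ j : ℕ, 0 ≤ G * (14 * F * j / (δ / 2)) ^ j := fun j => by positivity
  obtain ⟨hsum, htsum⟩ := tsum_weight_mul_pow_le (F := 14 * F) (G := G) (δ := δ / 2) (by positivity)
    hG0.le (half_pos hδ) hw0 hw hwh (by rw [hyF]; exact hy)
  rw [hyF] at htsum
  have hen : ∀ ξ, majNorm a p s r s' ρ (absC (e ξ)) ≠ ⊤ := fun ξ => by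
    obtain ⟨u, hu⟩ := heN N₀ le_rfl
    exact ne_top_of_le_ne_top ENNReal.ofReal_ne_top
      ((majNorm_anti (by linarith) (by linarith) (by linarith) _).trans (hu ξ).norm_le)
  have hexp := fun ξ => HasExp.ad_iterate ha hp0 hs hr
    ((he ξ).mono (σ' := s') (ρ' := ρ) (by linarith) (by linarith) (by linarith))
    ((hc ξ).mono (by linarith) (by linarith) (by linarith)) (hen ξ)
    fun j => ne_top_of_le_ne_top ENNReal.ofReal_ne_top (hcj ξ j)
  have hser := fun ξ => HasExp.wSeries ha hp0 hs hr hw0 (hexp ξ)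
    (wMaj_adC_zero_ne_top ha hp0 hs hr hs'.le (by linarith) (hen ξ) (by
      obtain ⟨hsum1, -⟩ := tsum_weight_mul_pow_le (w := fun j => w (j + 1)) (F := 14 * F) (G := G)
        (δ := δ / 2) (h := 0) (by positivity) hG0.le (half_pos hδ) (fun j => hw0 _)
        (fun j => (hw _).trans (one_div_le_one_div_of_le (by positivity)
          (by exact_mod_cast Nat.factorial_le (Nat.le_succ j)))) (by simp) (by rw [hyF]; exact hy)
      exact ne_top_of_le_ne_top ENNReal.ofReal_ne_top
        (majNorm_wMaj_le (fun j => hw0 _) hx0 hsum1 le_rfl (hcj ξ))))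
    (ne_top_of_le_ne_top ENNReal.ofReal_ne_top (majNorm_wMaj_le hw0 hx0 hsum le_rfl (hcj ξ)))
  have hdom : dom jj a p s' r' ⊆ dom jj a p s' ρ := fun v hv =>
    ⟨hv.1, (mem_ballR_iff v).2 (absBall_mono (by linarith) (by linarith) ((mem_ballR_iff v).1 hv.2))⟩
  refine ⟨fun ξ v hv => (hser ξ).1 v (hdom hv), ?_⟩
  refine isQuasiToeplitz_of_qt (ρ := ρ) (X := 2 * (28 * Real.exp 1 * F / δ) ^ h * G) ha hp hs hr hs'
    (by linarith) (by linarith) (by linarith) (by positivity) (by linarith) (fun N hN' => ?_)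
    (fun ξ => (hser ξ).2.mono le_rfl (by linarith) (by linarith)) fun N hN' => ?_
  · obtain ⟨hκ, hMN⟩ := hN N (hNN.trans hN')
    refine ⟨hκ, le_trans ?_ hMN⟩
    gcongr
  · choose t ht using hit N hN'
    exact ⟨fun ξ => wSeries w (t ξ), fun ξ => QT.wSeries hs hr (by linarith) hw0 hx0 hsum htsum
      (ht ξ)⟩

end norm

/-! ### The conditions on the parameters -/

section parameters

variable {b L θ μ s s' θ' μ' : ℝ} {κ N₀ N : ℕ}

/-- The condition on `N₀` holds at all scales `N ≥ N₀`, and implies that a low momentum monomial has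
no far variables. -/
theorem scale_bounds (hb : 0 < b) (hbL : b < L) (hL : L < 1) (hμ : μ < 6) (hN0 : 0 < N₀)
    (h : 12 * (N₀ : ℝ) ^ (L - 1) + 2 * (κ : ℝ) * (N₀ : ℝ) ^ (b - 1) < 1) (hN : N₀ ≤ N) :
    κ ≤ N ∧ μ * (N : ℝ) ^ L + κ * (N : ℝ) ^ b ≤ N := by
  have h0 : (0 : ℝ) < N₀ := by exact_mod_cast hN0
  have hNN : (N₀ : ℝ) ≤ N := by exact_mod_cast hN
  have h1 : (1 : ℝ) ≤ N := by exact_mod_cast (by omega : 1 ≤ N)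
  have hN1 : (0 : ℝ) < N := by linarith
  have e1 := Real.rpow_le_rpow_of_nonpos h0 hNN (by linarith : L - 1 ≤ 0)
  have e2 := Real.rpow_le_rpow_of_nonpos h0 hNN (by linarith : b - 1 ≤ 0)
  have f1 : (N : ℝ) ^ L = N ^ (L - 1) * N := by
    rw [Real.rpow_sub_one hN1.ne', div_mul_cancel₀ _ hN1.ne']
  have f2 : (N : ℝ) ^ b = N ^ (b - 1) * N := by
    rw [Real.rpow_sub_one hN1.ne', div_mul_cancel₀ _ hN1.ne']
  have hκ : (0 : ℝ) ≤ κ := by positivity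
  have p1 : (0 : ℝ) < (N : ℝ) ^ (L - 1) := by positivity
  have p2 : (0 : ℝ) < (N : ℝ) ^ (b - 1) := by positivity
  have e3 := mul_le_mul_of_nonneg_left e2 hκ
  have e4 : 12 * (N : ℝ) ^ (L - 1) + 2 * (κ * (N : ℝ) ^ (b - 1)) ≤ 1 := by linarith
  have e5 : 12 * (N : ℝ) ^ L + 2 * (κ * (N : ℝ) ^ b) ≤ N := by
    rw [f1, f2]
    have := mul_le_mul_of_nonneg_right e4 hN1.le
    linarith
  have g1 : (1 : ℝ) ≤ (N : ℝ) ^ b := Real.one_le_rpow h1 hb.le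
  have g2 : (0 : ℝ) < (N : ℝ) ^ L := by positivity
  have g3 : (κ : ℝ) ≤ κ * (N : ℝ) ^ b := le_mul_of_one_le_right hκ g1
  constructor
  · have : (κ : ℝ) ≤ N := by linarith
    exact_mod_cast this
  · have := mul_le_mul_of_nonneg_right hμ.le g2.le
    linarith

/-- `ln N / N^α` decreases for `N ≥ e^{α⁻¹}`. -/
theorem rpow_neg_mul_log_le {α x y : ℝ} (hα : 0 < α) (hx : Real.exp α⁻¹ ≤ x) (hxy : x ≤ y) :
    y ^ (-α) * Real.log y ≤ x ^ (-α) * Real.log x := by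
  have h := Real.log_div_self_rpow_antitoneOn hα (Set.mem_Ici.2 hx)
    (Set.mem_Ici.2 (hx.trans hxy)) hxy
  have hx0 : 0 < x := (Real.exp_pos _).trans_le hx
  simp only at h
  rwa [div_eq_mul_inv, div_eq_mul_inv, ← Real.rpow_neg hx0.le,
    ← Real.rpow_neg (hx0.le.trans hxy), mul_comm, mul_comm (Real.log x)] at h

/-- The three conditions on `N₀'` involve functions `ln N / N^α` that decrease for `N ≥ nBar`, and
therefore hold at all larger scales. -/
theorem scaleGap_of_le {N₀' : ℕ} (hb : 0 < b) (hbL : b < L) (hL : L < 1) (hμ : μ < 6)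
    (hss : s' < s) (hN' : nBar b L ≤ (N₀' : ℝ))
    (h1 : (kappa jj : ℝ) * (N₀' : ℝ) ^ (b - L) * Real.log N₀' ≤ μ - μ')
    (h2 : (6 + (kappa jj : ℝ)) * (N₀' : ℝ) ^ (L - 1) * Real.log N₀' ≤ θ' - θ)
    (h3 : 2 * (N₀' : ℝ) ^ (-b) * Real.log N₀' ^ 2 ≤ b * (s - s')) (hN : N₀' ≤ N) :
    ScaleGap jj b L s s' θ θ' μ μ' N := by
  intro j hj
  have hNN : (N₀' : ℝ) ≤ N := by exact_mod_cast hN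
  have b1 : Real.exp (2 / b) ≤ N₀' :=
    (Real.exp_le_exp.2 ((le_max_left _ _).trans (le_max_left _ _))).trans hN'
  have b2 : Real.exp (1 / (L - b)) ≤ N₀' :=
    (Real.exp_le_exp.2 ((le_max_right _ _).trans (le_max_left _ _))).trans hN'
  have b3 : Real.exp (1 / (1 - L)) ≤ N₀' :=
    (Real.exp_le_exp.2 ((le_max_left _ _).trans (le_max_right _ _))).trans hN'
  have hN1 : (1 : ℝ) ≤ N₀' := (Real.one_le_exp (by positivity)).trans b1
  have hNp : (0 : ℝ) < N := by linarith
  have hlog : 0 ≤ Real.log N := Real.log_nonneg (by linarith)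
  have hlog0 : 0 ≤ Real.log N₀' := Real.log_nonneg hN1
  have hj0 : (0 : ℝ) ≤ j := by positivity
  have c2 := rpow_neg_mul_log_le (sub_pos.2 hbL) (by rwa [← one_div]) hNN
  have c3 := rpow_neg_mul_log_le (sub_pos.2 hL) (by rwa [← one_div]) hNN
  rw [neg_sub] at c2 c3
  have c1 := rpow_neg_mul_log_le (half_pos hb) (by rwa [inv_div]) hNN
  have c4 := pow_le_pow_left₀ (by positivity) c1 2
  rw [mul_pow, mul_pow, ← Real.rpow_natCast, ← Real.rpow_natCast (_ ^ _), ← Real.rpow_mul hNp.le,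
    ← Real.rpow_mul (by linarith), show -(b / 2) * (2 : ℕ) = -b by push_cast; ring] at c4
  have hκ : (0 : ℝ) ≤ kappa jj := by positivity
  have p1 : (0 : ℝ) < (N : ℝ) ^ (b - L) := by positivity
  have p2 : (0 : ℝ) < (N : ℝ) ^ (L - 1) := by positivity
  have p3 : (0 : ℝ) < (N : ℝ) ^ L := by positivity
  have p4 : (0 : ℝ) < (N : ℝ) ^ b := by positivity
  have f1 : (N : ℝ) ^ b = N ^ (b - L) * N ^ L := by rw [← Real.rpow_add hNp]; congr 1; ring
  have f2 : (N : ℝ) ^ L = N ^ (L - 1) * N := by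
    rw [Real.rpow_sub_one hNp.ne', div_mul_cancel₀ _ hNp.ne']
  refine ⟨?_, ?_, ?_⟩
  · have g1 : kappa jj * ((N : ℝ) ^ (b - L) * j) ≤ μ - μ' := by
      refine le_trans (mul_le_mul_of_nonneg_left ?_ hκ) ((mul_assoc _ _ _).symm.le.trans h1)
      exact (mul_le_mul_of_nonneg_left hj.le p1.le).trans c2
    have := mul_le_mul_of_nonneg_right g1 p3.le
    rw [f1]
    linarith
  · have g1 : 6 * ((N : ℝ) ^ (L - 1) * j) ≤ θ' - θ := by
      have q1 : (N : ℝ) ^ (L - 1) * j ≤ (N₀' : ℝ) ^ (L - 1) * Real.log N₀' :=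
        (mul_le_mul_of_nonneg_left hj.le p2.le).trans c3
      have q2 : 0 ≤ (kappa jj : ℝ) * ((N₀' : ℝ) ^ (L - 1) * Real.log N₀') := by positivity
      linarith
    have g2 := mul_le_mul_of_nonneg_right g1 hNp.le
    have g3 : μ * (N : ℝ) ^ L * j ≤ 6 * (N : ℝ) ^ L * j := by gcongr
    rw [f2] at g3 ⊢
    linarith
  · have hb1 : b ≤ 1 := by linarith
    have g1 : 2 * ((N : ℝ) ^ (-b) * Real.log N ^ 2) ≤ s - s' := by
      have q1 : b * (s - s') ≤ s - s' := mul_le_of_le_one_left (by linarith) hb1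
      linarith
    have g2 : (N : ℝ) ^ b * (N : ℝ) ^ (-b) = 1 := by
      rw [← Real.rpow_add hNp, add_neg_cancel, Real.rpow_zero]
    have g3 := mul_le_mul_of_nonneg_left g1 p4.le
    have g4 : Real.log N * (2 * j) ≤ 2 * Real.log N ^ 2 := by
      have := mul_le_mul_of_nonneg_left hj.le hlog
      linarith
    calc Real.log N * (2 * j) ≤ 2 * Real.log N ^ 2 := g4
      _ = (N : ℝ) ^ b * (2 * ((N : ℝ) ^ (-b) * Real.log N ^ 2)) := by
          linear_combination (-(2 * Real.log N ^ 2)) * g2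
      _ ≤ _ := g3

theorem delta_pos {r r' : ℝ} (hs : 0 < s) (hr : 0 < r) (hss : s' < s) (hrr : r' < r) :
    0 < delta s' s r' r :=
  lt_min (sub_pos.2 ((div_lt_one hs).2 hss)) (sub_pos.2 ((div_lt_one hr).2 hrr))

theorem delta_mul_le {r r' : ℝ} (hs : 0 < s) (hr : 0 < r) :
    delta s' s r' r * s ≤ s - s' ∧ delta s' s r' r * r ≤ r - r' := by
  constructor
  · have h := mul_le_mul_of_nonneg_right (min_le_left (1 - s' / s) (1 - r' / r)) hs.le
    rwa [sub_mul, div_mul_cancel₀ _ hs.ne', one_mul] at h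
  · have h := mul_le_mul_of_nonneg_right (min_le_right (1 - s' / s) (1 - r' / r)) hr.le
    rwa [sub_mul, div_mul_cancel₀ _ hr.ne', one_mul] at h

end parameters

/-! ### The Lie transform -/

theorem expAd_eq (F H : Phase jj a p → ℂ) (v : Phase jj a p) :
    expAd F H v = ∑' j : ℕ, (((1 / (j.factorial : ℝ)) : ℝ) : ℂ) * ((ad F)^[j] H) v :=
  tsum_congr fun j => by push_cast; ring

theorem adTail_eq (β : ℕ → ℝ) (h : ℕ) (F H : Phase jj a p → ℂ) (v : Phase jj a p) :
    adTail β h F H v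
      = ∑' j : ℕ, ((if j < h then 0 else β j : ℝ) : ℂ) * ((ad F)^[j] H) v := by
  refine Eq.trans (tsum_congr fun j => ?_) (Function.Injective.tsum_eq (add_right_injective h)
    (f := fun j => ((if j < h then 0 else β j : ℝ) : ℂ) * ((ad F)^[j] H) v) ?_)
  · beta_reduce
    rw [if_neg (by omega)]
  · intro j hj
    refine ⟨j - h, Nat.add_sub_cancel' (not_lt.1 fun hjh => hj ?_)⟩
    beta_reduce
    rw [if_pos hjh]
    simp

section lie

variable {Ξ : Type} {b L s r s' r' θ μ θ' μ' : ℝ} {N₀ N₀' : ℕ}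

/-- The Lie series estimate, with the semi-norms themselves in place of upper bounds, by a limit
`ε → 0`.  The constant `84` bounds `28 e`. -/
theorem lieSeries_estimate (ha : 0 ≤ a) (hp : 1 / 2 < p) (hb : 0 < b) (hbL : b < L) (hL : L < 1)
    (hN0 : 0 < N₀) (hθ : 1 < θ) (hμ : μ < 6)
    (hκ : 12 * (N₀ : ℝ) ^ (L - 1) + 2 * (kappa jj : ℝ) * (N₀ : ℝ) ^ (b - 1) < 1)
    (hs : 0 < s) (hr : 0 < r) (hs2 : s / 2 ≤ s') (hss : s' < s) (hr2 : r / 2 ≤ r') (hrr : r' < r)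
    {f g : Ξ → Phase jj a p → ℂ} (hf : IsQuasiToeplitz b L s r N₀ θ μ f)
    (hg : IsQuasiToeplitz b L s r N₀ θ μ g)
    (hfδ : tNorm b L s r N₀ θ μ f ≤ ENNReal.ofReal (delta s' s r' r / 400))
    (hNN : N₀ ≤ N₀') (hN' : nBar b L ≤ (N₀' : ℝ)) (hμ' : μ' < μ) (hθ' : θ < θ')
    (h1 : (kappa jj : ℝ) * (N₀' : ℝ) ^ (b - L) * Real.log N₀' ≤ μ - μ')
    (h2 : (6 + (kappa jj : ℝ)) * (N₀' : ℝ) ^ (L - 1) * Real.log N₀' ≤ θ' - θ)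
    (h3 : 2 * (N₀' : ℝ) ^ (-b) * Real.log N₀' ^ 2 ≤ b * (s - s')) {h : ℕ} {w : ℕ → ℝ}
    (hw0 : ∀ j, 0 ≤ w j) (hw : ∀ j, w j ≤ 1 / (j.factorial : ℝ)) (hwh : ∀ j < h, w j = 0) :
    (∀ ξ, ∀ v ∈ dom jj a p s' r', Summable fun j : ℕ => (w j : ℂ) * ((ad (f ξ))^[j] (g ξ)) v) ∧
    IsQuasiToeplitz b L s' r' N₀' θ' μ'
      (fun ξ v => ∑' j : ℕ, (w j : ℂ) * ((ad (f ξ))^[j] (g ξ)) v) ∧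
    tNorm b L s' r' N₀' θ' μ' (fun ξ v => ∑' j : ℕ, (w j : ℂ) * ((ad (f ξ))^[j] (g ξ)) v)
      ≤ ENNReal.ofReal (2 * max (s / s') ((r / r') ^ 2))
        * ENNReal.ofReal (84 / delta s' s r' r * (tNorm b L s r N₀ θ μ f).toReal) ^ h
        * tNorm b L s r N₀ θ μ g := by
  set δ := delta s' s r' r with hδ_def
  have hδ : 0 < δ := delta_pos hs hr hss hrr
  obtain ⟨hδs, hδr⟩ := delta_mul_le (s' := s') (r' := r') hs hr
  set φ := (tNorm b L s r N₀ θ μ f).toReal with hφ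
  set γ := (tNorm b L s r N₀ θ μ g).toReal with hγ
  have hφ0 : 0 ≤ φ := ENNReal.toReal_nonneg
  have hγ0 : 0 ≤ γ := ENNReal.toReal_nonneg
  have hft : tNorm b L s r N₀ θ μ f = ENNReal.ofReal φ := (ENNReal.ofReal_toReal hf.2.2.ne).symm
  have hgt : tNorm b L s r N₀ θ μ g = ENNReal.ofReal γ := (ENNReal.ofReal_toReal hg.2.2.ne).symm
  have hφδ : φ ≤ δ / 400 := by
    rw [hft] at hfδ
    exact (ENNReal.ofReal_le_ofReal_iff (by positivity)).1 hfδ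
  have hexp : Real.exp 1 < 3 := Real.exp_one_lt_d9.trans (by norm_num)
  have hexp0 : 0 < Real.exp 1 := Real.exp_pos 1
  set K := max (s / s') ((r / r') ^ 2)
  have hK : 0 ≤ K := le_max_of_le_left (div_nonneg hs.le (by linarith))
  have hlie : ∀ ε, 0 < ε → ε < δ / 400 → _ := fun ε hε hεδ =>
    isQuasiToeplitz_lieSeries (F := φ + ε) (G := γ + ε) (h := h) ha hp hs hr (by linarith) hr2 hδ hδs
      hδr hN0 hNN hθ.le hθ'.le hμ'.le (fun N hN => scale_bounds hb hbL hL hμ hN0 hκ hN)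
      (fun N hN => scaleGap_of_le hb hbL hL hμ hss hN' h1 h2 h3 hN) hf.2.1 hg.2.1
      (by rw [hft]; exact (ENNReal.ofReal_lt_ofReal_iff (by linarith)).2 (by linarith))
      (by rw [hgt]; exact (ENNReal.ofReal_lt_ofReal_iff (by linarith)).2 (by linarith)) hw0 hw hwh
      (by
        rw [div_le_iff₀ hδ]
        have : 28 * Real.exp 1 * (φ + ε) ≤ 28 * 3 * (δ / 400 + δ / 400) := by gcongr
        linarith)
  obtain ⟨g1, g2, -⟩ := hlie (δ / 800) (by linarith) (by linarith)
  refine ⟨g1, g2, ?_⟩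
  have hle : tNorm b L s' r' N₀' θ' μ' (fun ξ v => ∑' j : ℕ, (w j : ℂ) * ((ad (f ξ))^[j] (g ξ)) v)
      ≤ ENNReal.ofReal (K * (2 * (28 * Real.exp 1 * (φ + 0) / δ) ^ h * (γ + 0))) := by
    have hcont : Continuous fun ε : ℝ =>
        ENNReal.ofReal (K * (2 * (28 * Real.exp 1 * (φ + ε) / δ) ^ h * (γ + ε))) := by
      refine ENNReal.continuous_ofReal.comp ?_
      fun_prop
    refine ge_of_tendsto (x := 𝓝[>] (0 : ℝ)) ((hcont.tendsto 0).mono_left nhdsWithin_le_nhds) ?_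
    filter_upwards [Ioo_mem_nhdsGT (by linarith : (0 : ℝ) < δ / 400)] with ε hε
    exact (hlie ε hε.1 hε.2).2.2
  refine hle.trans ?_
  rw [hgt, ← ENNReal.ofReal_pow (by positivity), ← ENNReal.ofReal_mul (by positivity),
    ← ENNReal.ofReal_mul (by positivity), add_zero, add_zero]
  refine ENNReal.ofReal_le_ofReal ?_
  calc K * (2 * (28 * Real.exp 1 * φ / δ) ^ h * γ) ≤ K * (2 * (28 * 3 * φ / δ) ^ h * γ) := by gcongr
    _ = _ := by rw [show 28 * 3 * φ / δ = 84 / δ * φ by ring]; ring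

end lie

/-! ### Holomorphic maps between Banach spaces -/

section holomorphic

variable {V W : Type*} [NormedAddCommGroup V] [NormedSpace ℂ V] [NormedAddCommGroup W]
  [NormedSpace ℂ W]

/-- Cauchy's estimate, with a factor `2` that spares a limit in the radius. -/
theorem norm_fderiv_le_of_ball {f : V → W} {v : V} {ρ M : ℝ} (hρ : 0 < ρ)
    (hf : ∀ w ∈ Metric.ball v ρ, DifferentiableAt ℂ f w) (hM : ∀ w ∈ Metric.ball v ρ, ‖f w‖ ≤ M) :
    ‖fderiv ℂ f v‖ ≤ 2 * M / ρ := by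
  have hM0 : 0 ≤ M := (norm_nonneg _).trans (hM v (Metric.mem_ball_self hρ))
  refine ContinuousLinearMap.opNorm_le_bound _ (by positivity) fun u => ?_
  rcases eq_or_ne u 0 with rfl | hu
  · simp
  have hu0 : 0 < ‖u‖ := norm_pos_iff.2 hu
  have hmem : ∀ z : ℂ, ‖z‖ ≤ ρ / (2 * ‖u‖) → v + z • u ∈ Metric.ball v ρ := by
    intro z hz
    rw [mem_ball_iff_norm, add_sub_cancel_left, norm_smul]
    rw [le_div_iff₀ (by positivity)] at hz
    linarith
  have hline : ∀ z : ℂ, HasDerivAt (fun z : ℂ => v + z • u) u z := fun z => by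
    simpa using ((hasDerivAt_id z).smul_const u).const_add v
  have hd : ∀ z : ℂ, ‖z‖ ≤ ρ / (2 * ‖u‖) →
      HasDerivAt (fun z : ℂ => f (v + z • u)) (fderiv ℂ f (v + z • u) u) z := fun z hz =>
    (hf _ (hmem z hz)).hasFDerivAt.comp_hasDerivAt z (hline z)
  have h := Complex.norm_deriv_le_of_forall_mem_sphere_norm_le (c := 0) (R := ρ / (2 * ‖u‖))
    (C := M) (f := fun z : ℂ => f (v + z • u)) (by positivity)
    (DifferentiableOn.diffContOnCl fun z hz => by
      rw [closure_ball _ (by positivity), mem_closedBall_zero_iff] at hz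
      exact (hd z hz).differentiableAt.differentiableWithinAt)
    (fun z hz => hM _ (hmem z (mem_sphere_zero_iff_norm.1 hz).le))
  rw [(hd 0 (by rw [norm_zero]; positivity)).deriv, zero_smul, add_zero] at h
  refine h.trans (le_of_eq ?_)
  field_simp

/-- A bounded holomorphic map is Lipschitz on a ball of half the radius. -/
theorem norm_sub_le_of_ball {f : V → W} {v : V} {ρ M : ℝ} (hρ : 0 < ρ)
    (hf : ∀ w ∈ Metric.ball v ρ, DifferentiableAt ℂ f w) (hM : ∀ w ∈ Metric.ball v ρ, ‖f w‖ ≤ M) :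
    (∀ w ∈ Metric.ball v (ρ / 2), ‖fderiv ℂ f w‖ ≤ 4 * M / ρ) ∧
      ∀ w ∈ Metric.ball v (ρ / 2), ∀ w' ∈ Metric.ball v (ρ / 2),
        ‖f w' - f w‖ ≤ 4 * M / ρ * ‖w' - w‖ := by
  have hsub : ∀ w ∈ Metric.ball v (ρ / 2), Metric.ball w (ρ / 2) ⊆ Metric.ball v ρ := fun w hw =>
    Metric.ball_subset_ball' (by rw [Metric.mem_ball] at hw; linarith)
  have h1 : ∀ w ∈ Metric.ball v (ρ / 2), ‖fderiv ℂ f w‖ ≤ 4 * M / ρ := fun w hw => by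
    refine (norm_fderiv_le_of_ball (half_pos hρ) (fun x hx => hf x (hsub w hw hx))
      fun x hx => hM x (hsub w hw hx)).trans (le_of_eq ?_)
    field_simp
    ring
  have hball : Metric.ball v (ρ / 2) ⊆ Metric.ball v ρ := Metric.ball_subset_ball (by linarith)
  letI : NormedSpace ℝ V := NormedSpace.restrictScalars ℝ ℂ V
  exact ⟨h1, fun w hw w' hw' => Convex.norm_image_sub_le_of_norm_fderiv_le
    (fun x hx => hf x (hball hx)) h1 (convex_ball v (ρ / 2)) hw hw'⟩

/-- A Fréchet differentiable map over `ℂ` is continuously differentiable: the derivative of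
`f (· + h) - f` is small by Cauchy's estimate. -/
theorem continuousAt_fderiv_of_ball {f : V → W} {D : Set V} (hD : IsOpen D)
    (hf : ∀ w ∈ D, DifferentiableAt ℂ f w) {v : V} (hv : v ∈ D) : ContinuousAt (fderiv ℂ f) v := by
  obtain ⟨ρ, hρ, hball, hbd⟩ : ∃ ρ > 0, Metric.ball v ρ ⊆ D ∧
      ∀ w ∈ Metric.ball v ρ, ‖f w‖ ≤ ‖f v‖ + 1 := by
    have h1 : ∀ᶠ w in 𝓝 v, w ∈ D ∧ ‖f w‖ < ‖f v‖ + 1 :=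
      Filter.Eventually.and (hD.mem_nhds hv) ((hf v hv).continuousAt.norm.eventually_lt_const (by linarith))
    obtain ⟨ρ, hρ, h⟩ := Metric.eventually_nhds_iff_ball.1 h1
    exact ⟨ρ, hρ, fun w hw => (h w hw).1, fun w hw => (h w hw).2.le⟩
  set M := ‖f v‖ + 1
  have hM0 : 0 ≤ M := by positivity
  have hlip := (norm_sub_le_of_ball hρ (fun w hw => hf w (hball hw)) hbd).2
  have hmain : ∀ h : V, ‖h‖ < ρ / 4 →
      ‖fderiv ℂ f (v + h) - fderiv ℂ f v‖ ≤ 32 * M / ρ ^ 2 * ‖h‖ := by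
    intro h hh
    have hmem : ∀ w ∈ Metric.ball v (ρ / 4),
        w ∈ Metric.ball v (ρ / 2) ∧ w + h ∈ Metric.ball v (ρ / 2) := fun w hw => by
      rw [mem_ball_iff_norm] at hw
      refine ⟨mem_ball_iff_norm.2 (by linarith), mem_ball_iff_norm.2 ?_⟩
      rw [add_sub_right_comm]
      exact (norm_add_le _ _).trans_lt (by linarith)
    have hhalf : Metric.ball v (ρ / 2) ⊆ D := (Metric.ball_subset_ball (by linarith)).trans hball
    have hder : ∀ w ∈ Metric.ball v (ρ / 4), HasFDerivAt (fun x => f (x + h) - f x)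
        (fderiv ℂ f (w + h) - fderiv ℂ f w) w := fun w hw => by
      have e1 := (hf _ (hhalf (hmem w hw).2)).hasFDerivAt.comp w ((hasFDerivAt_id w).add_const h)
      rw [ContinuousLinearMap.comp_id] at e1
      exact e1.sub (hf _ (hhalf (hmem w hw).1)).hasFDerivAt
    have hv4 : v ∈ Metric.ball v (ρ / 4) := Metric.mem_ball_self (by linarith)
    rw [← (hder v hv4).fderiv]
    refine (norm_fderiv_le_of_ball (M := 4 * M / ρ * ‖h‖) (by linarith : 0 < ρ / 4)
      (fun w hw => (hder w hw).differentiableAt) fun w hw => ?_).trans (le_of_eq ?_)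
    · simpa using hlip w (hmem w hw).1 (w + h) (hmem w hw).2
    · field_simp
      ring
  rw [Metric.continuousAt_iff']
  intro ε hε
  have h1 : ∀ᶠ w in 𝓝 v, ‖w - v‖ < min (ρ / 4) (ε / (32 * M / ρ ^ 2 + 1)) := by
    have : ContinuousAt (fun w : V => ‖w - v‖) v := by fun_prop
    refine this.eventually_lt_const ?_
    change ‖v - v‖ < _
    rw [sub_self, norm_zero]
    positivity
  filter_upwards [h1] with w hw
  rw [lt_min_iff] at hw
  have h2 := hmain (w - v) hw.1
  rw [add_sub_cancel] at h2
  rw [dist_eq_norm]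
  have h3 := hw.2
  rw [lt_div_iff₀ (by positivity)] at h3
  nlinarith [norm_nonneg (w - v)]

theorem contDiffOn_one_of_differentiableAt {f : V → W} {D : Set V} (hD : IsOpen D)
    (hf : ∀ w ∈ D, DifferentiableAt ℂ f w) : ContDiffOn ℂ 1 f D := by
  rw [← zero_add (1 : WithTop ℕ∞), contDiffOn_succ_iff_fderiv_of_isOpen hD]
  refine ⟨fun w hw => (hf w hw).differentiableWithinAt, by simp, ?_⟩
  rw [contDiffOn_zero]
  exact fun v hv => (continuousAt_fderiv_of_ball hD hf hv).continuousWithinAt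

/-- A uniform limit of holomorphic maps is holomorphic, and the derivatives converge. -/
theorem hasFDerivAt_of_uniform_limit [CompleteSpace W] {f : ℕ → V → W} {g : V → W} {D : Set V}
    (hD : IsOpen D) (hf : ∀ N, ∀ w ∈ D, DifferentiableAt ℂ (f N) w) {ε : ℕ → ℝ}
    (hε : Filter.Tendsto ε Filter.atTop (𝓝 0)) (hfg : ∀ N, ∀ w ∈ D, ‖f N w - g w‖ ≤ ε N) {v : V}
    (hv : v ∈ D) : ∃ A : V →L[ℂ] W, HasFDerivAt g A v ∧
      Filter.Tendsto (fun N => fderiv ℂ (f N) v) Filter.atTop (𝓝 A) := by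
  obtain ⟨ρ, hρ, hball⟩ := Metric.isOpen_iff.1 hD v hv
  have hsub : ∀ w ∈ Metric.ball v (ρ / 2), Metric.ball w (ρ / 2) ⊆ D := fun w hw =>
    (Metric.ball_subset_ball' (by rw [Metric.mem_ball] at hw; linarith)).trans hball
  have hdiff : ∀ w ∈ Metric.ball v (ρ / 2), ∀ N M,
      ‖fderiv ℂ (f N) w - fderiv ℂ (f M) w‖ ≤ 4 / ρ * (ε N + ε M) := by
    intro w hw N M
    have hwD : w ∈ D := hsub w hw (Metric.mem_ball_self (half_pos hρ))
    rw [← fderiv_fun_sub (hf N w hwD) (hf M w hwD)]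
    refine (norm_fderiv_le_of_ball (half_pos hρ) (fun x hx =>
      (hf N x (hsub w hw hx)).sub (hf M x (hsub w hw hx))) (M := ε N + ε M) fun x hx => ?_).trans
      (le_of_eq (by field_simp; ring))
    change ‖f N x - f M x‖ ≤ _
    rw [← sub_sub_sub_cancel_right _ _ (g x)]
    exact (norm_sub_le _ _).trans (add_le_add (hfg N x (hsub w hw hx)) (hfg M x (hsub w hw hx)))
  have hcauchy : UniformCauchySeqOn (fun N w => fderiv ℂ (f N) w) Filter.atTop
      (Metric.ball v (ρ / 2)) := by
    rw [Metric.uniformCauchySeqOn_iff]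
    intro η hη
    obtain ⟨N₀, hN₀⟩ := Filter.eventually_atTop.1
      (hε.eventually_lt_const (by positivity : 0 < η * ρ / 8))
    refine ⟨N₀, fun N hN M hM w hw => ?_⟩
    rw [dist_eq_norm]
    refine (hdiff w hw N M).trans_lt ?_
    have := hN₀ N hN
    have := hN₀ M hM
    rw [div_mul_eq_mul_div, div_lt_iff₀ hρ]
    linarith
  have hlim : ∀ w : V, ∃ A : V →L[ℂ] W, w ∈ Metric.ball v (ρ / 2) →
      Filter.Tendsto (fun N => fderiv ℂ (f N) w) Filter.atTop (𝓝 A) := by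
    intro w
    by_cases hw : w ∈ Metric.ball v (ρ / 2)
    · obtain ⟨A, hA⟩ := cauchySeq_tendsto_of_complete (hcauchy.cauchySeq hw)
      exact ⟨A, fun _ => hA⟩
    · exact ⟨0, fun h => absurd h hw⟩
  choose A hA using hlim
  have hv2 : v ∈ Metric.ball v (ρ / 2) := Metric.mem_ball_self (half_pos hρ)
  refine ⟨A v, ?_, hA v hv2⟩
  refine hasFDerivAt_of_tendstoUniformlyOn Metric.isOpen_ball
    (hcauchy.tendstoUniformlyOn_of_tendsto hA) (fun N w hw =>
      (hf N w (hsub w hw (Metric.mem_ball_self (half_pos hρ)))).hasFDerivAt)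
    (fun w hw => ?_) hv2
  rw [tendsto_iff_norm_sub_tendsto_zero]
  exact squeeze_zero (fun _ => norm_nonneg _)
    (fun N => hfg N w (hsub w hw (Metric.mem_ball_self (half_pos hρ)))) hε

end holomorphic

/-! ### Flows of bounded holomorphic vector fields -/

section flow

open Set

variable {V : Type*} [NormedAddCommGroup V] [NormedSpace ℂ V] [NormedSpace ℝ V]
  [IsScalarTower ℝ ℂ V]

/-- One step of Euler's method. -/
def eulerStep (X : V → V) (h : ℝ) (w : V) : V := w + h • X w

theorem one_add_pow_le_three {h : ℝ} (hh : 0 ≤ h) {i : ℕ} (hi : i * h ≤ 1) : (1 + h) ^ i ≤ 3 := by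
  have h1 : (1 + h) ^ i ≤ Real.exp h ^ i :=
    pow_le_pow_left₀ (by linarith) (by linarith [Real.add_one_le_exp h]) i
  rw [← Real.exp_nat_mul] at h1
  exact h1.trans ((Real.exp_le_exp.2 hi).trans (by linarith [Real.exp_one_lt_d9]))

/-- A curve moves by at most the bound of its velocity. -/
theorem norm_sub_le_of_isIntegral {X : V → V} {F : ℝ} {γ : ℝ → V}
    (hγ : ∀ t ∈ Icc (0 : ℝ) 1, ‖X (γ t)‖ ≤ F ∧ HasDerivWithinAt γ (X (γ t)) (Icc 0 1) t) :
    ∀ t ∈ Icc (0 : ℝ) 1, ‖γ t - γ 0‖ ≤ F := by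
  intro t ht
  have hF : 0 ≤ F := (norm_nonneg _).trans (hγ t ht).1
  have h := norm_image_sub_le_of_norm_deriv_le_segment' (fun x hx => (hγ x hx).2)
    (fun x hx => (hγ x (Ico_subset_Icc_self hx)).1) t ht
  exact h.trans (mul_le_of_le_one_right hF (by linarith [ht.2]))

section ball

variable {X : V → V} {v : V} {ε F : ℝ}

theorem lipschitz_of_ball (hε : 0 < ε) (hX : ∀ w ∈ Metric.ball v ε, DifferentiableAt ℂ X w)
    (hb : ∀ w ∈ Metric.ball v ε, ‖X w‖ ≤ F) (hF : F ≤ ε / 4) :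
    (∀ w ∈ Metric.ball v (ε / 2), ‖fderiv ℂ X w‖ ≤ 1) ∧
      ∀ w ∈ Metric.ball v (ε / 2), ∀ w' ∈ Metric.ball v (ε / 2), ‖X w' - X w‖ ≤ ‖w' - w‖ := by
  obtain ⟨h1, h2⟩ := norm_sub_le_of_ball hε hX hb
  have hK : 4 * F / ε ≤ 1 := by
    rw [div_le_one hε]
    linarith
  exact ⟨fun w hw => (h1 w hw).trans hK, fun w hw w' hw' => (h2 w hw w' hw').trans
    (mul_le_of_le_one_left (norm_nonneg _) hK)⟩

/-- The integral curve through the centre of a ball of radius `ε` exists up to time `1` if the vector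
field is bounded by `ε / 4`. -/
theorem exists_isIntegral [CompleteSpace V] (hε : 0 < ε)
    (hX : ∀ w ∈ Metric.ball v ε, DifferentiableAt ℂ X w)
    (hb : ∀ w ∈ Metric.ball v ε, ‖X w‖ ≤ F) (hF : F ≤ ε / 4) :
    ∃ γ : ℝ → V, γ 0 = v ∧ ∀ t ∈ Icc (0 : ℝ) 1, γ t ∈ Metric.ball v (ε / 2) ∧
      HasDerivWithinAt γ (X (γ t)) (Icc 0 1) t := by
  classical
  have hF0 : 0 ≤ F := (norm_nonneg _).trans (hb v (Metric.mem_ball_self hε))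
  have hsub : Metric.closedBall v (ε / 4) ⊆ Metric.ball v (ε / 2) :=
    Metric.closedBall_subset_ball (by linarith)
  have hsub' : Metric.ball v (ε / 2) ⊆ Metric.ball v ε := Metric.ball_subset_ball (by linarith)
  -- Outside the ball the vector field is replaced by `0`: a solution of the modified equation
  -- then moves by at most `F`, so that it never leaves the ball.
  set Y : V → V := fun w => if w ∈ Metric.closedBall v (ε / 4) then X w else 0 with hY
  have hYX : ∀ w ∈ Metric.closedBall v (ε / 4), Y w = X w := fun w hw => if_pos hw
  have hYF : ∀ w, ‖Y w‖ ≤ F := fun w => by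
    by_cases hw : w ∈ Metric.closedBall v (ε / 4)
    · rw [hYX w hw]
      exact hb w (hsub' (hsub hw))
    · have : Y w = 0 := if_neg hw
      rw [this, norm_zero]
      exact hF0
  have hPL : IsPicardLindelof (fun _ : ℝ => Y) (tmin := 0) (tmax := 1)
      ⟨0, left_mem_Icc.2 zero_le_one⟩ v ⟨ε / 4, by linarith⟩ 0 ⟨F, hF0⟩ 1 := by
    refine IsPicardLindelof.of_time_independent (fun w _ => hYF w) ?_ ?_
    · refine LipschitzOnWith.of_dist_le_mul fun w hw w' hw' => ?_
      have hw1 : w ∈ Metric.closedBall v (ε / 4) := hw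
      have hw2 : w' ∈ Metric.closedBall v (ε / 4) := hw'
      rw [hYX w hw1, hYX w' hw2, dist_eq_norm, dist_eq_norm, NNReal.coe_one, one_mul]
      exact (lipschitz_of_ball hε hX hb hF).2 w' (hsub hw2) w (hsub hw1)
    · have : F * max (1 - 0) (0 - 0) ≤ ε / 4 - 0 := by simpa using hF
      exact this
  obtain ⟨γ, h0, hγ⟩ := hPL.exists_eq_forall_mem_Icc_hasDerivWithinAt₀
  have h0' : γ 0 = v := h0
  have hstay : ∀ t ∈ Icc (0 : ℝ) 1, γ t ∈ Metric.closedBall v (ε / 4) := fun t ht => by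
    rw [mem_closedBall_iff_norm, ← h0']
    exact (norm_sub_le_of_isIntegral (X := Y) (fun t ht => ⟨hYF _, hγ t ht⟩) t ht).trans hF
  refine ⟨γ, h0', fun t ht => ⟨hsub (hstay t ht), ?_⟩⟩
  have := hγ t ht
  rwa [hYX _ (hstay t ht)] at this

/-- The curves need not lie in the ball, on which the vector field is Lipschitz: they stay there
because the bound on the velocity holds along them. -/
theorem isIntegral_unique (hε : 0 < ε)
    (hX : ∀ w ∈ Metric.ball v ε, DifferentiableAt ℂ X w)
    (hb : ∀ w ∈ Metric.ball v ε, ‖X w‖ ≤ F) (hF : F ≤ ε / 4) {γ γ' : ℝ → V} (h0 : γ 0 = v)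
    (h0' : γ' 0 = v)
    (hγ : ∀ t ∈ Icc (0 : ℝ) 1, ‖X (γ t)‖ ≤ F ∧ HasDerivWithinAt γ (X (γ t)) (Icc 0 1) t)
    (hγ' : ∀ t ∈ Icc (0 : ℝ) 1, ‖X (γ' t)‖ ≤ F ∧ HasDerivWithinAt γ' (X (γ' t)) (Icc 0 1) t) :
    EqOn γ γ' (Icc 0 1) := by
  have hright : ∀ δ : ℝ → V,
      (∀ t ∈ Icc (0 : ℝ) 1, ‖X (δ t)‖ ≤ F ∧ HasDerivWithinAt δ (X (δ t)) (Icc 0 1) t) →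
      ∀ t ∈ Ico (0 : ℝ) 1, HasDerivWithinAt δ (X (δ t)) (Ici t) t := fun δ hδ t ht =>
    (hδ t (Ico_subset_Icc_self ht)).2.mono_of_mem_nhdsWithin
      (Filter.mem_of_superset (Icc_mem_nhdsGE ht.2) (Icc_subset_Icc_left ht.1))
  have hmem : ∀ δ : ℝ → V, δ 0 = v →
      (∀ t ∈ Icc (0 : ℝ) 1, ‖X (δ t)‖ ≤ F ∧ HasDerivWithinAt δ (X (δ t)) (Icc 0 1) t) →
      ∀ t ∈ Ico (0 : ℝ) 1, δ t ∈ Metric.ball v (ε / 2) := fun δ e hδ t ht => by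
    rw [mem_ball_iff_norm, ← e]
    exact (norm_sub_le_of_isIntegral hδ t (Ico_subset_Icc_self ht)).trans_lt (by linarith)
  refine ODE_solution_unique_of_mem_Icc_right (v := fun _ => X)
    (s := fun _ => Metric.ball v (ε / 2)) (K := 1) (fun t _ => ?_)
    (fun t ht => (hγ t ht).2.continuousWithinAt) (hright γ hγ) (hmem γ h0 hγ)
    (fun t ht => (hγ' t ht).2.continuousWithinAt) (hright γ' hγ') (hmem γ' h0' hγ')
    (h0.trans h0'.symm)
  refine LipschitzOnWith.of_dist_le_mul fun w hw w' hw' => ?_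
  rw [dist_eq_norm, dist_eq_norm, NNReal.coe_one, one_mul]
  exact (lipschitz_of_ball hε hX hb hF).2 w' hw' w hw

theorem eulerStep_iterate_mem (hε : 0 < ε) (hb : ∀ w ∈ Metric.ball v ε, ‖X w‖ ≤ F)
    (hF : F ≤ ε / 4) {h : ℝ} (hh : 0 ≤ h) {i : ℕ} (hi : i * h ≤ 1) :
    ‖(eulerStep X h)^[i] v - v‖ ≤ i * h * F ∧ (eulerStep X h)^[i] v ∈ Metric.ball v (ε / 2) := by
  have hF0 : 0 ≤ F := (norm_nonneg _).trans (hb v (Metric.mem_ball_self hε))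
  have key : ∀ i : ℕ, i * h ≤ 1 → ‖(eulerStep X h)^[i] v - v‖ ≤ i * h * F →
      (eulerStep X h)^[i] v ∈ Metric.ball v (ε / 2) := fun i hi h1 => by
    rw [mem_ball_iff_norm]
    have := mul_le_mul_of_nonneg_right hi hF0
    linarith
  suffices h1 : ‖(eulerStep X h)^[i] v - v‖ ≤ i * h * F from ⟨h1, key i hi h1⟩
  induction i with
  | zero => simp
  | succ i ih =>
    push_cast at hi ⊢
    have hi' : i * h ≤ 1 := by linarith
    have h2 := hb _ (Metric.ball_subset_ball (by linarith) (key i hi' (ih hi')))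
    rw [Function.iterate_succ_apply']
    set w := (eulerStep X h)^[i] v
    have h3 : eulerStep X h w - v = (w - v) + h • X w := by
      rw [eulerStep]
      abel
    rw [h3]
    refine (norm_add_le _ _).trans ?_
    rw [norm_smul, Real.norm_of_nonneg hh]
    have := mul_le_mul_of_nonneg_left h2 hh
    have := ih hi'
    linarith

/-- The Euler iterates are holomorphic, and they preserve a form `ω` for which the vector field is
an infinitesimal symmetry up to an error of second order in the step. -/
theorem hasFDerivAt_eulerStep_iterate (hε : 0 < ε)
    (hX : ∀ w ∈ Metric.ball v ε, DifferentiableAt ℂ X w)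
    (hb : ∀ w ∈ Metric.ball v ε, ‖X w‖ ≤ F) (hF : F ≤ ε / 4) {h : ℝ} (hh : 0 ≤ h) {i : ℕ}
    (hi : i * h ≤ 1) (ω : V →L[ℂ] V →L[ℂ] ℂ)
    (hω : ∀ w ∈ Metric.ball v ε, ∀ u u', ω (fderiv ℂ X w u) u' + ω u (fderiv ℂ X w u') = 0) :
    ∃ A : V →L[ℂ] V, HasFDerivAt (eulerStep X h)^[i] A v ∧ ‖A‖ ≤ (1 + h) ^ i ∧
      ∀ u u', ‖ω (A u) (A u') - ω u u'‖ ≤ i * h ^ 2 * (9 * ‖ω‖ * ‖u‖ * ‖u'‖) := by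
  induction i with
  | zero =>
    refine ⟨ContinuousLinearMap.id ℂ V, hasFDerivAt_id v, ?_, fun u u' => by simp⟩
    rw [pow_zero]
    exact ContinuousLinearMap.norm_id_le
  | succ i ih =>
    have hi' : i * h ≤ 1 := by
      push_cast at hi
      linarith
    obtain ⟨A, hA, hA1, hA2⟩ := ih hi'
    have hmem := (eulerStep_iterate_mem hε hb hF hh hi').2
    set w := (eulerStep X h)^[i] v
    have hw : w ∈ Metric.ball v ε := Metric.ball_subset_ball (by linarith) hmem
    set B := fderiv ℂ X w
    have hB : ‖B‖ ≤ 1 := (lipschitz_of_ball hε hX hb hF).1 w hmem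
    have hfun : eulerStep X h = fun w => w + (h : ℂ) • X w := by
      funext w
      rw [eulerStep, ← algebraMap_smul ℂ h (X w)]
      rfl
    have hstep : HasFDerivAt (eulerStep X h) (ContinuousLinearMap.id ℂ V + (h : ℂ) • B) w := by
      rw [hfun]
      exact (hasFDerivAt_id w).add ((hX w hw).hasFDerivAt.const_smul (h : ℂ))
    have hnh : ‖(h : ℂ)‖ = h := by rw [Complex.norm_real, Real.norm_of_nonneg hh]
    refine ⟨(ContinuousLinearMap.id ℂ V + (h : ℂ) • B).comp A, ?_, ?_, fun u u' => ?_⟩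
    · rw [Function.iterate_succ']
      exact hstep.comp v hA
    · refine (ContinuousLinearMap.opNorm_comp_le _ _).trans ?_
      rw [pow_succ']
      refine mul_le_mul ?_ hA1 (norm_nonneg _) (by linarith)
      refine (norm_add_le _ _).trans (add_le_add ContinuousLinearMap.norm_id_le ?_)
      rw [norm_smul, hnh]
      exact mul_le_of_le_one_right hh hB
    · have hA3 : ‖A‖ ≤ 3 := hA1.trans (one_add_pow_le_three hh hi')
      have hAu : ∀ u, ‖B (A u)‖ ≤ 3 * ‖u‖ := fun u => by
        refine (B.le_opNorm _).trans ((mul_le_of_le_one_left (norm_nonneg _) hB).trans ?_)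
        exact (A.le_opNorm u).trans (mul_le_mul_of_nonneg_right hA3 (norm_nonneg _))
      have hsplit : ω ((ContinuousLinearMap.id ℂ V + (h : ℂ) • B).comp A u)
          ((ContinuousLinearMap.id ℂ V + (h : ℂ) • B).comp A u') - ω u u' =
          (ω (A u) (A u') - ω u u') + (h : ℂ) ^ 2 * ω (B (A u)) (B (A u')) := by
        have e := hω w hw (A u) (A u')
        simp only [ContinuousLinearMap.comp_apply, add_apply, ContinuousLinearMap.id_apply,
          smul_apply, map_add, map_smul, smul_eq_mul]
        linear_combination (h : ℂ) * e
      rw [hsplit]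
      refine (norm_add_le _ _).trans ?_
      have h4 : ‖(h : ℂ) ^ 2 * ω (B (A u)) (B (A u'))‖ ≤ h ^ 2 * (9 * ‖ω‖ * ‖u‖ * ‖u'‖) := by
        rw [norm_mul, norm_pow, hnh]
        refine mul_le_mul_of_nonneg_left ?_ (by positivity)
        refine (ω.le_opNorm₂ _ _).trans ?_
        calc ‖ω‖ * ‖B (A u)‖ * ‖B (A u')‖ ≤ ‖ω‖ * (3 * ‖u‖) * (3 * ‖u'‖) := by
              gcongr <;> exact hAu _
          _ = 9 * ‖ω‖ * ‖u‖ * ‖u'‖ := by ring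
      have := hA2 u u'
      push_cast
      linarith

/-- The global error of Euler's method, for a vector field of Lipschitz constant `1`: each step adds
an error `F h²`, and multiplies the previous ones by at most `1 + h`. -/
theorem norm_sub_eulerStep_iterate_le (hε : 0 < ε)
    (hX : ∀ w ∈ Metric.ball v ε, DifferentiableAt ℂ X w)
    (hb : ∀ w ∈ Metric.ball v ε, ‖X w‖ ≤ F) (hF : F ≤ ε / 4) {h : ℝ} (hh : 0 ≤ h)
    {γ : ℝ → V} (h0 : γ 0 = v)
    (hγ : ∀ t ∈ Icc (0 : ℝ) 1, γ t ∈ Metric.ball v (ε / 2) ∧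
      HasDerivWithinAt γ (X (γ t)) (Icc 0 1) t) {i : ℕ} (hi : i * h ≤ 1) :
    ‖γ (i * h) - (eulerStep X h)^[i] v‖ ≤ i * (F * h ^ 2) * (1 + h) ^ i := by
  have hF0 : 0 ≤ F := (norm_nonneg _).trans (hb v (Metric.mem_ball_self hε))
  have hlip := (lipschitz_of_ball hε hX hb hF).2
  have hbF : ∀ t ∈ Icc (0 : ℝ) 1, ‖X (γ t)‖ ≤ F := fun t ht =>
    hb _ (Metric.ball_subset_ball (by linarith) (hγ t ht).1)
  induction i with
  | zero => simp [h0]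
  | succ i ih =>
    have hi1 : (i : ℝ) * h + h ≤ 1 := by
      push_cast at hi
      linarith
    have hi' : i * h ≤ 1 := by linarith
    set t₀ : ℝ := i * h with ht₀
    have ht0 : 0 ≤ t₀ := by positivity
    have hsub : Icc t₀ (t₀ + h) ⊆ Icc 0 1 := Icc_subset_Icc ht0 hi1
    have ht0m : t₀ ∈ Icc (0 : ℝ) 1 := ⟨ht0, hi'⟩
    have hmove : ∀ t ∈ Icc t₀ (t₀ + h), ‖γ t - γ t₀‖ ≤ F * h := fun t ht => by
      have e := norm_image_sub_le_of_norm_deriv_le_segment'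
        (fun x hx => (hγ x (hsub hx)).2.mono hsub)
        (fun x hx => hbF x (hsub (Ico_subset_Icc_self hx))) t ht
      exact e.trans (mul_le_mul_of_nonneg_left (by linarith [ht.2]) hF0)
    have hlocal : ‖γ (t₀ + h) - γ t₀ - h • X (γ t₀)‖ ≤ F * h * h := by
      have e := norm_image_sub_le_of_norm_deriv_le_segment' (f := fun t => γ t - t • X (γ t₀))
        (f' := fun t => X (γ t) - X (γ t₀)) (a := t₀) (b := t₀ + h) (C := F * h)
        (fun x hx => by
          have e1 := ((hasDerivAt_id x).smul_const (X (γ t₀))).hasDerivWithinAt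
            (s := Icc t₀ (t₀ + h))
          rw [one_smul] at e1
          exact ((hγ x (hsub hx)).2.mono hsub).sub e1)
        (fun x hx => by
          have hx' := Ico_subset_Icc_self hx
          exact (hlip _ (hγ t₀ ht0m).1 _ (hγ x (hsub hx')).1).trans (hmove x hx'))
        (t₀ + h) (right_mem_Icc.2 (by linarith))
      have e2 : γ (t₀ + h) - γ t₀ - h • X (γ t₀) =
          γ (t₀ + h) - (t₀ + h) • X (γ t₀) - (γ t₀ - t₀ • X (γ t₀)) := by
        rw [add_smul]
        abel
      rw [e2]
      refine e.trans (le_of_eq ?_)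
      ring
    have hmem := (eulerStep_iterate_mem hε hb hF hh hi').2
    have hprev := ih hi'
    rw [Function.iterate_succ_apply']
    set w := (eulerStep X h)^[i] v
    have e3 : γ (t₀ + h) - eulerStep X h w =
        (γ (t₀ + h) - γ t₀ - h • X (γ t₀)) + ((γ t₀ - w) + h • (X (γ t₀) - X w)) := by
      rw [eulerStep, smul_sub]
      abel
    have e4 : (((i + 1 : ℕ) : ℝ)) * h = t₀ + h := by
      push_cast
      ring
    rw [e4, e3]
    refine (norm_add_le _ _).trans ((add_le_add hlocal (norm_add_le _ _)).trans ?_)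
    rw [norm_smul, Real.norm_of_nonneg hh]
    have h5 := mul_le_mul_of_nonneg_left (hlip w hmem _ (hγ t₀ ht0m).1) hh
    have h6 := mul_le_mul_of_nonneg_left hprev (by linarith : 0 ≤ 1 + h)
    have h7 : 1 ≤ (1 + h) ^ (i + 1) := one_le_pow₀ (by linarith)
    have h8 := mul_le_mul_of_nonneg_left h7 (by positivity : 0 ≤ F * h ^ 2)
    have h9 : ((i + 1 : ℕ) : ℝ) * (F * h ^ 2) * (1 + h) ^ (i + 1) =
        (1 + h) * (i * (F * h ^ 2) * (1 + h) ^ i) + F * h ^ 2 * (1 + h) ^ (i + 1) := by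
      push_cast
      ring
    rw [h9]
    linarith

end ball

/-- The flow at time `1` of a holomorphic vector field that is bounded by a quarter of the distance
to the boundary.  It is the uniform limit of the Euler iterates `(1 + X / N)^N`, and hence inherits
from these the differentiability and the invariance of `ω`. -/
theorem exists_flow [CompleteSpace V] {X : V → V} {U U' : Set V} (hU' : IsOpen U') {ε F : ℝ}
    (hε : 0 < ε) (hX : ∀ w ∈ U, DifferentiableAt ℂ X w) (hb : ∀ w ∈ U, ‖X w‖ ≤ F)
    (hF : F ≤ ε / 4) (hU : ∀ v ∈ U', Metric.ball v ε ⊆ U) (ω : V →L[ℂ] V →L[ℂ] ℂ)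
    (hω : ∀ w ∈ U, ∀ u u', ω (fderiv ℂ X w u) u' + ω u (fderiv ℂ X w u') = 0) :
    ∃ Φ : ℝ → V → V,
      (∀ v ∈ U', Φ 0 v = v ∧
        (∀ t ∈ Icc (0 : ℝ) 1, Φ t v ∈ U ∧
          HasDerivWithinAt (fun t => Φ t v) (X (Φ t v)) (Icc 0 1) t) ∧
        ∀ γ : ℝ → V, γ 0 = v → (∀ t ∈ Icc (0 : ℝ) 1, γ t ∈ U ∧
          HasDerivWithinAt γ (X (γ t)) (Icc 0 1) t) → ∀ t ∈ Icc (0 : ℝ) 1, γ t = Φ t v) ∧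
      ∀ v ∈ U', ∃ A : V →L[ℂ] V, HasFDerivAt (Φ 1) A v ∧ ∀ u u', ω (A u) (A u') = ω u u' := by
  have hXv : ∀ v ∈ U', ∀ w ∈ Metric.ball v ε, DifferentiableAt ℂ X w := fun v hv w hw =>
    hX w (hU v hv hw)
  have hbv : ∀ v ∈ U', ∀ w ∈ Metric.ball v ε, ‖X w‖ ≤ F := fun v hv w hw => hb w (hU v hv hw)
  have hhalf : ∀ v ∈ U', Metric.ball v (ε / 2) ⊆ U := fun v hv =>
    (Metric.ball_subset_ball (by linarith)).trans (hU v hv)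
  have hex : ∀ v, ∃ γ : ℝ → V, v ∈ U' → γ 0 = v ∧ ∀ t ∈ Icc (0 : ℝ) 1,
      γ t ∈ Metric.ball v (ε / 2) ∧ HasDerivWithinAt γ (X (γ t)) (Icc 0 1) t := fun v => by
    by_cases hv : v ∈ U'
    · obtain ⟨γ, h⟩ := exists_isIntegral hε (hXv v hv) (hbv v hv) hF
      exact ⟨γ, fun _ => h⟩
    · exact ⟨fun _ => v, fun h => absurd h hv⟩
  choose Ψ hΨ using hex
  refine ⟨fun t v => Ψ v t, fun v hv => ⟨(hΨ v hv).1, fun t ht =>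
    ⟨hhalf v hv ((hΨ v hv).2 t ht).1, ((hΨ v hv).2 t ht).2⟩, fun γ h0 hγ t ht => ?_⟩,
    fun v hv => ?_⟩
  · exact isIntegral_unique hε (hXv v hv) (hbv v hv) hF h0 (hΨ v hv).1
      (fun t ht => ⟨hb _ (hγ t ht).1, (hγ t ht).2⟩)
      (fun t ht => ⟨hb _ (hhalf v hv ((hΨ v hv).2 t ht).1), ((hΨ v hv).2 t ht).2⟩) ht
  · have hF0 : 0 ≤ F := (norm_nonneg _).trans (hbv v hv v (Metric.mem_ball_self hε))
    set η : ℕ → ℝ := fun N => 1 / ((N : ℝ) + 1) with hη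
    have hη0 : ∀ N, 0 ≤ η N := fun N => by positivity
    have hη1 : ∀ N : ℕ, ((N + 1 : ℕ) : ℝ) * η N = 1 := fun N => by
      rw [hη]
      push_cast
      field_simp
    have hηlim : Filter.Tendsto η Filter.atTop (𝓝 0) := tendsto_one_div_add_atTop_nhds_zero_nat
    have hconv : ∀ N, ∀ w ∈ U', ‖(eulerStep X (η N))^[N + 1] w - Ψ w 1‖ ≤ 3 * F * η N := by
      intro N w hw
      have h1 := norm_sub_eulerStep_iterate_le hε (hXv w hw) (hbv w hw) hF (hη0 N) (hΨ w hw).1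
        (hΨ w hw).2 (hη1 N).le
      rw [hη1] at h1
      rw [norm_sub_rev]
      refine h1.trans ?_
      have h2 := one_add_pow_le_three (hη0 N) (hη1 N).le
      have h3 : ((N + 1 : ℕ) : ℝ) * (F * η N ^ 2) = F * η N := by
        linear_combination F * η N * hη1 N
      rw [h3]
      have := mul_le_mul_of_nonneg_left h2 (mul_nonneg hF0 (hη0 N))
      linarith
    obtain ⟨A, hA, hlim⟩ := hasFDerivAt_of_uniform_limit hU'
      (f := fun N => (eulerStep X (η N))^[N + 1]) (g := fun w => Ψ w 1) (fun N w hw => by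
        obtain ⟨B, hB, -⟩ := hasFDerivAt_eulerStep_iterate hε (hXv w hw) (hbv w hw) hF (hη0 N)
          (hη1 N).le ω fun x hx => hω x (hU w hw hx)
        exact hB.differentiableAt)
      (by simpa using hηlim.const_mul (3 * F)) hconv hv
    refine ⟨A, hA, fun u u' => ?_⟩
    have happ : ∀ x, Filter.Tendsto (fun N => fderiv ℂ (eulerStep X (η N))^[N + 1] v x)
        Filter.atTop (𝓝 (A x)) := fun x =>
      ((ContinuousLinearMap.apply ℂ V x).continuous.tendsto A).comp hlim
    have hl1 : Filter.Tendsto (fun N => ω (fderiv ℂ (eulerStep X (η N))^[N + 1] v u)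
        (fderiv ℂ (eulerStep X (η N))^[N + 1] v u')) Filter.atTop (𝓝 (ω (A u) (A u'))) :=
      (((ω.isBoundedBilinearMap.continuous).tendsto (A u, A u')).comp
        ((happ u).prodMk_nhds (happ u')))
    refine tendsto_nhds_unique hl1 ?_
    rw [tendsto_iff_norm_sub_tendsto_zero]
    refine squeeze_zero (fun _ => norm_nonneg _) (fun N => ?_)
      (by simpa using hηlim.mul_const (9 * ‖ω‖ * ‖u‖ * ‖u'‖))
    obtain ⟨B, hB, -, hB2⟩ := hasFDerivAt_eulerStep_iterate hε (hXv v hv) (hbv v hv) hF (hη0 N)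
      (hη1 N).le ω fun x hx => hω x (hU v hv hx)
    rw [hB.fderiv]
    refine (hB2 u u').trans (le_of_eq ?_)
    have h3 : ((N + 1 : ℕ) : ℝ) * η N ^ 2 = η N := by linear_combination η N * hη1 N
    rw [h3]

end flow

/-! ### Phase space as a Banach space with a symplectic form -/

/-- The isometry `z ↦ (e^{a|j|} ⟨j⟩^p z_j)_j` onto `ℓ²`. -/
def seqIsometry : SeqSpace jj a p ≃ₗᵢ[ℂ] lp (fun _ : Site jj => ℂ) 2 :=
  LinearIsometryEquiv.ofSurjective ⟨SeqSpace.toLp, fun _ => rfl⟩ fun f => by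
    have h : Memℓp (fun j : Site jj => (weight a p j : ℂ) * ((weight a p j : ℂ)⁻¹ * f j)) 2 := by
      convert lp.memℓp f using 1
      funext j
      exact mul_inv_cancel_left₀ (Complex.ofReal_ne_zero.2 (weight_pos a p j).ne') _
    refine ⟨⟨fun j => (weight a p j : ℂ)⁻¹ * f j, (memlp_iff jj a p _).1 h⟩, ?_⟩
    ext j
    exact mul_inv_cancel_left₀ (Complex.ofReal_ne_zero.2 (weight_pos a p j).ne') _

instance : CompleteSpace (SeqSpace jj a p) :=
  (seqIsometry (jj := jj) (a := a) (p := p)).toIsometryEquiv.completeSpace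

theorem hasSum_basis (z : SeqSpace jj a p) :
    HasSum (fun j => z.entry j • (SeqSpace.basis j : SeqSpace jj a p)) z := by
  classical
  have h := (lp.hasSum_single (p := 2) (by simp) (seqIsometry z)).mapL
    (seqIsometry (jj := jj) (a := a) (p := p)).symm.toContinuousLinearEquiv.toContinuousLinearMap
  have e : seqIsometry.symm (seqIsometry z) = z := LinearIsometryEquiv.symm_apply_apply _ _
  change HasSum _ (seqIsometry.symm (seqIsometry z)) at h
  rw [e] at h
  convert h using 1
  funext j
  change _ = seqIsometry.symm (lp.single 2 j (seqIsometry z j))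
  rw [LinearIsometryEquiv.eq_symm_apply]
  ext i
  change (weight a p i : ℂ) * ((z.entry j • (SeqSpace.basis j : SeqSpace jj a p)).entry i) = _
  rw [entry_smul, entry_basis, lp.single_apply]
  by_cases h : i = j
  · subst h
    rw [if_pos rfl, mul_one, Pi.single_eq_same]
    rfl
  · rw [if_neg h, mul_zero, mul_zero, Pi.single_eq_of_ne h]

/-- Continuous linear maps on phase space that agree on the basis vectors are equal. -/
theorem clm_ext {F : Type*} [NormedAddCommGroup F] [NormedSpace ℂ F]
    {φ ψ : Phase jj a p →L[ℂ] F} (h : ∀ d, φ (eDir a p d) = ψ (eDir a p d)) : φ = ψ := by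
  have hseq : ∀ φ' ψ' : SeqSpace jj a p →L[ℂ] F,
      (∀ j, φ' (SeqSpace.basis j) = ψ' (SeqSpace.basis j)) → φ' = ψ' := fun φ' ψ' h' => by
    ext z
    have h1 := (hasSum_basis z).mapL φ'
    have h2 := (hasSum_basis z).mapL ψ'
    simp only [map_smul, h'] at h1 h2
    exact h1.unique h2
  have hx : φ.comp (ContinuousLinearMap.inl ℂ _ _) = ψ.comp (ContinuousLinearMap.inl ℂ _ _) :=
    ContinuousLinearMap.coe_injective (LinearMap.pi_ext' fun i => LinearMap.ext_ring (h (.inl i)))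
  have hy : (φ.comp (ContinuousLinearMap.inr ℂ _ _)).comp (ContinuousLinearMap.inl ℂ _ _) =
      (ψ.comp (ContinuousLinearMap.inr ℂ _ _)).comp (ContinuousLinearMap.inl ℂ _ _) :=
    ContinuousLinearMap.coe_injective
      (LinearMap.pi_ext' fun i => LinearMap.ext_ring (h (.inr (.inl i))))
  refine ContinuousLinearMap.prod_ext hx (ContinuousLinearMap.prod_ext hy
    (ContinuousLinearMap.prod_ext ?_ ?_))
  · exact hseq _ _ fun j => h (.inr (.inr (true, j)))
  · exact hseq _ _ fun j => h (.inr (.inr (false, j)))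

theorem tsum_enorm_mul_entry_le (ha : 0 ≤ a) (hp : 0 ≤ p) (z w : SeqSpace jj a p) :
    ∑' j, ‖z.entry j * w.entry j‖ₑ ≤ ‖z‖ₑ * ‖w‖ₑ := by
  rw [enorm_seq_eq, enorm_seq_eq]
  simp only [enorm_mul]
  exact tsum_mul_le_extNorm ha hp _ _

theorem summable_mul_entry (ha : 0 ≤ a) (hp : 0 ≤ p) (z w : SeqSpace jj a p) :
    Summable fun j => z.entry j * w.entry j :=
  summable_of_tsum_enorm (ne_top_of_le_ne_top (ENNReal.mul_ne_top enorm_ne_top enorm_ne_top)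
    (tsum_enorm_mul_entry_le ha hp z w))

/-- The pairing `∑ z_j w_j`. -/
def pairing (ha : 0 ≤ a) (hp : 0 ≤ p) : SeqSpace jj a p →L[ℂ] SeqSpace jj a p →L[ℂ] ℂ :=
  LinearMap.mkContinuous₂ (LinearMap.mk₂ ℂ (fun z w => ∑' j, z.entry j * w.entry j)
    (fun z z' w => by
      simp only [entry_add, add_mul]
      exact (summable_mul_entry ha hp z w).tsum_add (summable_mul_entry ha hp z' w))
    (fun c z w => by simp only [entry_smul, mul_assoc, tsum_mul_left, smul_eq_mul])
    (fun z w w' => by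
      simp only [entry_add, mul_add]
      exact (summable_mul_entry ha hp z w).tsum_add (summable_mul_entry ha hp z w'))
    (fun c z w => by simp only [entry_smul, mul_left_comm _ c, tsum_mul_left, smul_eq_mul])) 1
    fun z w => by
      have h := enorm_tsum_le_tsum_enorm.trans (tsum_enorm_mul_entry_le ha hp z w)
      rw [← ofReal_norm, ← ofReal_norm, ← ofReal_norm,
        ← ENNReal.ofReal_mul (norm_nonneg _), ENNReal.ofReal_le_ofReal_iff (by positivity)] at h
      rw [one_mul]
      exact h

theorem pairing_apply (ha : 0 ≤ a) (hp : 0 ≤ p) (z w : SeqSpace jj a p) :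
    pairing ha hp z w = ∑' j, z.entry j * w.entry j := rfl

/-- The angle `x_h` as a continuous functional. -/
def xCLM (a p : ℝ) (h : Fin n) : Phase jj a p →L[ℂ] ℂ :=
  (ContinuousLinearMap.proj h).comp (ContinuousLinearMap.fst ℂ _ _)

/-- The action `y_h` as a continuous functional. -/
def yCLM (a p : ℝ) (h : Fin n) : Phase jj a p →L[ℂ] ℂ :=
  (ContinuousLinearMap.proj h).comp ((ContinuousLinearMap.fst ℂ _ _).comp
    (ContinuousLinearMap.snd ℂ _ _))

/-- The projection to `z^σ`. -/
def zCLM (a p : ℝ) (σ : Bool) : Phase jj a p →L[ℂ] SeqSpace jj a p :=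
  if σ then (ContinuousLinearMap.fst ℂ _ _).comp ((ContinuousLinearMap.snd ℂ _ _).comp
    (ContinuousLinearMap.snd ℂ _ _))
  else (ContinuousLinearMap.snd ℂ _ _).comp ((ContinuousLinearMap.snd ℂ _ _).comp
    (ContinuousLinearMap.snd ℂ _ _))

theorem xCLM_apply (h : Fin n) (v : Phase jj a p) : xCLM a p h v = v.x h := rfl

theorem yCLM_apply (h : Fin n) (v : Phase jj a p) : yCLM a p h v = v.y h := rfl

theorem zCLM_apply (σ : Bool) (v : Phase jj a p) : zCLM a p σ v = v.z σ := by
  cases σ <;> rfl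

/-- The symplectic form as a bounded bilinear map. -/
def symplCLM (ha : 0 ≤ a) (hp : 0 ≤ p) : Phase jj a p →L[ℂ] Phase jj a p →L[ℂ] ℂ :=
  ∑ h, ((xCLM a p h).smulRight (yCLM a p h) - (yCLM a p h).smulRight (xCLM a p h)) +
    Complex.I • ((pairing ha hp).bilinearComp (zCLM a p true) (zCLM a p false) -
      (pairing ha hp).bilinearComp (zCLM a p false) (zCLM a p true))

theorem symplCLM_apply (ha : 0 ≤ a) (hp : 0 ≤ p) (u w : Phase jj a p) :
    symplCLM ha hp u w = symplForm u w := by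
  rw [symplForm, (summable_mul_entry ha hp _ _).tsum_sub (summable_mul_entry ha hp _ _)]
  simp only [symplCLM, add_apply, sum_apply, sub_apply, smul_apply,
    ContinuousLinearMap.smulRight_apply, ContinuousLinearMap.bilinearComp_apply, zCLM_apply,
    xCLM_apply, yCLM_apply, pairing_apply, smul_eq_mul]

theorem symplForm_antisymm (u w : Phase jj a p) : symplForm u w = - symplForm w u := by
  simp only [symplForm, neg_add, ← Finset.sum_neg_distrib, ← mul_neg, ← tsum_neg]
  congr 1
  · exact Finset.sum_congr rfl fun h _ => by ring
  · congr 1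
    exact tsum_congr fun j => by ring

/-- The rescaling of the variables by `1/s`, `1/r²`, `1/r`, `1/r`. -/
def scaling (a p : ℝ) {s r : ℝ} (hs : 0 < s) (hr : 0 < r) : Phase jj a p ≃L[ℂ] Phase jj a p :=
  (ContinuousLinearEquiv.smulLeft
      (Units.mk0 ((s⁻¹ : ℝ) : ℂ) (Complex.ofReal_ne_zero.2 (inv_pos.2 hs).ne'))).prodCongr
    ((ContinuousLinearEquiv.smulLeft
      (Units.mk0 (((r ^ 2)⁻¹ : ℝ) : ℂ) (Complex.ofReal_ne_zero.2 (inv_pos.2 (pow_pos hr 2)).ne'))).prodCongr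
    (ContinuousLinearEquiv.smulLeft
      (Units.mk0 ((r⁻¹ : ℝ) : ℂ) (Complex.ofReal_ne_zero.2 (inv_pos.2 hr).ne'))))

section scaling

variable {s r : ℝ} (hs : 0 < s) (hr : 0 < r)

theorem norm_x_scaling (v : Phase jj a p) (h : Fin n) :
    ‖(scaling a p hs hr v).x h‖ = ‖v.x h‖ / s := by
  change ‖((s⁻¹ : ℝ) : ℂ) * v.x h‖ = _
  rw [norm_mul, Complex.norm_real, Real.norm_of_nonneg (inv_pos.2 hs).le, inv_mul_eq_div]

theorem norm_y_scaling (v : Phase jj a p) (h : Fin n) :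
    ‖(scaling a p hs hr v).y h‖ = ‖v.y h‖ / r ^ 2 := by
  change ‖(((r ^ 2)⁻¹ : ℝ) : ℂ) * v.y h‖ = _
  rw [norm_mul, Complex.norm_real, Real.norm_of_nonneg (inv_pos.2 (pow_pos hr 2)).le,
    inv_mul_eq_div]

theorem norm_z_scaling (v : Phase jj a p) (σ : Bool) :
    ‖(scaling a p hs hr v).z σ‖ = ‖v.z σ‖ / r := by
  have h : (scaling a p hs hr v).z σ = ((r⁻¹ : ℝ) : ℂ) • v.z σ := by cases σ <;> rfl
  rw [h, norm_smul, Complex.norm_real, Real.norm_of_nonneg (inv_pos.2 hr).le, inv_mul_eq_div]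

/-- Around `D(s',r')` there is room for a ball of radius `δ / (n + 1)` in the rescaled norm. -/
theorem add_mem_dom_of_norm_scaling_lt {s' r' δ : ℝ} (hδ : 0 < δ) (hr' : 0 ≤ r')
    (hδs : δ * s ≤ s - s') (hδr : δ * r ≤ r - r') {v u : Phase jj a p}
    (hv : v ∈ dom jj a p s' r') (hu : ‖scaling a p hs hr u‖ < δ / (n + 1)) :
    v + u ∈ dom jj a p s r := by
  have hn : (0 : ℝ) < n + 1 := by positivity
  have hδn : δ / (n + 1) ≤ δ := div_le_self hδ.le (by linarith [n.cast_nonneg (α := ℝ)])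
  have hx : ∀ h, ‖u.x h‖ ≤ δ * s := fun h => by
    have := (norm_x_le (scaling a p hs hr u) h).trans (hu.le.trans hδn)
    rwa [norm_x_scaling, div_le_iff₀ hs] at this
  have hz : ∀ σ, ‖u.z σ‖ ≤ δ * r := fun σ => by
    have := (norm_z_le (scaling a p hs hr u) σ).trans (hu.le.trans hδn)
    rwa [norm_z_scaling, div_le_iff₀ hr] at this
  have hy : ∀ h, ‖u.y h‖ ≤ δ / (n + 1) * r ^ 2 := fun h => by
    have := (norm_y_le (scaling a p hs hr u) h).trans hu.le
    rwa [norm_y_scaling, div_le_iff₀ (pow_pos hr 2)] at this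
  have hysum : ∑ h, ‖u.y h‖ ≤ δ * r ^ 2 := by
    refine (Finset.sum_le_sum fun h _ => hy h).trans ?_
    rw [Finset.sum_const, Finset.card_univ, Fintype.card_fin, nsmul_eq_mul, ← mul_assoc]
    refine mul_le_mul_of_nonneg_right ?_ (by positivity)
    rw [mul_div_assoc', div_le_iff₀ hn]
    nlinarith
  obtain ⟨hvx, hvy, hvz, hvz'⟩ := hv
  refine ⟨fun h => ?_, ?_, ?_, ?_⟩
  · have h1 : ((v + u).x h).im = (v.x h).im + (u.x h).im := by
      rw [x_add]
      rfl
    rw [h1]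
    have := (abs_add_le _ _).trans_lt (add_lt_add_of_lt_of_le (hvx h)
      ((Complex.abs_im_le_norm _).trans (hx h)))
    linarith
  · have h1 : ∑ h, ‖(v + u).y h‖ ≤ ∑ h, ‖v.y h‖ + ∑ h, ‖u.y h‖ := by
      rw [← Finset.sum_add_distrib]
      exact Finset.sum_le_sum fun h _ => by
        rw [y_add]
        exact norm_add_le _ _
    have h2 := mul_le_mul_of_nonneg_right hδr hr.le
    have h3 : 0 ≤ r - r' := (mul_nonneg hδ.le hr.le).trans hδr
    have h4 := mul_nonneg hr' h3
    nlinarith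
  · rw [z_add]
    linarith [norm_add_le (v.z true) (u.z true), hz true]
  · rw [z_add]
    linarith [norm_add_le (v.z false) (u.z false), hz false]

end scaling

/-! ### The Hamiltonian vector field and its flow -/

/-- The vector `(∂_y H, -∂_x H, -i ∂_{z̄} H, i ∂_z H)` that belongs to the gradient `g`. -/
def hamVec (a p : ℝ) (g : Dir jj → ℂ) : Phase jj a p :=
  (fun h => g (.inr (.inl h)), fun h => - g (.inl h),
    seqOf a p fun j => - Complex.I * g (.inr (.inr (false, j))),
    seqOf a p fun j => Complex.I * g (.inr (.inr (true, j))))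

section hamVec

variable {s r : ℝ} (hs : 0 < s) (hr : 0 < r)

theorem enorm_I : ‖Complex.I‖ₑ = 1 := by
  rw [← ofReal_norm, Complex.norm_I, ENNReal.ofReal_one]

theorem extNorm_ne_top_of_vecNorm (hr : 0 < r) {g : Dir jj → ℝ≥0∞} (h : vecNorm a p s r g ≠ ⊤)
    (σ : Bool) : extNorm a p (fun j => g (.inr (.inr (σ, j)))) ≠ ⊤ :=
  ne_top_of_le_ne_top (ENNReal.mul_ne_top ENNReal.ofReal_ne_top h) (extNorm_le_vecNorm hr g σ)

theorem entry_hamVec (hr : 0 < r) {g : Dir jj → ℂ} (h : vecNorm a p s r (fun d => ‖g d‖ₑ) ≠ ⊤)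
    (j : Site jj) :
    ((hamVec a p g).z true).entry j = - Complex.I * g (.inr (.inr (false, j))) ∧
      ((hamVec a p g).z false).entry j = Complex.I * g (.inr (.inr (true, j))) := by
  refine ⟨entry_seqOf ?_ j, entry_seqOf ?_ j⟩
  · simpa [enorm_I] using extNorm_ne_top_of_vecNorm hr h false
  · simpa [enorm_I] using extNorm_ne_top_of_vecNorm hr h true

theorem phase_ext {u v : Phase jj a p} (hx : ∀ h, u.x h = v.x h) (hy : ∀ h, u.y h = v.y h)
    (hz : ∀ σ j, (u.z σ).entry j = (v.z σ).entry j) : u = v :=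
  Prod.ext (funext hx) (Prod.ext (funext hy) (Prod.ext (SeqSpace.ext_entry (hz true))
    (SeqSpace.ext_entry (hz false))))

theorem hamVec_add (hr : 0 < r) {g g' : Dir jj → ℂ}
    (h : vecNorm a p s r (fun d => ‖g d‖ₑ) ≠ ⊤) (h' : vecNorm a p s r (fun d => ‖g' d‖ₑ) ≠ ⊤) :
    hamVec a p (fun d => g d + g' d) = hamVec a p g + hamVec a p g' := by
  have h2 : vecNorm a p s r (fun d => ‖g d + g' d‖ₑ) ≠ ⊤ :=
    ne_top_of_le_ne_top (ENNReal.add_ne_top.2 ⟨h, h'⟩)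
      ((vecNorm_mono fun d => enorm_add_le _ _).trans (vecNorm_add _ _))
  refine phase_ext (fun h => rfl) (fun h => neg_add _ _) fun σ j => ?_
  rw [z_add, entry_add]
  cases σ
  · rw [(entry_hamVec hr h j).2, (entry_hamVec hr h' j).2, (entry_hamVec hr h2 j).2]
    ring
  · rw [(entry_hamVec hr h j).1, (entry_hamVec hr h' j).1, (entry_hamVec hr h2 j).1]
    ring

theorem hamVec_smul (hr : 0 < r) {g : Dir jj → ℂ} (h : vecNorm a p s r (fun d => ‖g d‖ₑ) ≠ ⊤)
    (t : ℂ) : hamVec a p (fun d => t * g d) = t • hamVec a p g := by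
  have h2 : vecNorm a p s r (fun d => ‖t * g d‖ₑ) ≠ ⊤ := by
    simp only [enorm_mul, vecNorm_const_mul]
    exact ENNReal.mul_ne_top enorm_ne_top h
  refine phase_ext (fun h => rfl) (fun h => (mul_neg _ _).symm) fun σ j => ?_
  rw [z_smul, entry_smul]
  cases σ
  · rw [(entry_hamVec hr h j).2, (entry_hamVec hr h2 j).2]
    ring
  · rw [(entry_hamVec hr h j).1, (entry_hamVec hr h2 j).1]
    ring

theorem norm_scaling_hamVec_le {g : Dir jj → ℂ} {M : ℝ} (hM : 0 ≤ M)
    (h : vecNorm a p s r (fun d => ‖g d‖ₑ) ≤ ENNReal.ofReal M) :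
    ‖scaling a p hs hr (hamVec a p g)‖ ≤ M := by
  have hfin : vecNorm a p s r (fun d => ‖g d‖ₑ) ≠ ⊤ := ne_top_of_le_ne_top ENNReal.ofReal_ne_top h
  have key : ∀ {E : Type} [NormedAddCommGroup E] {w : E} {c : ℝ}, 0 < c →
      ‖w‖ₑ ≤ ENNReal.ofReal c * vecNorm a p s r (fun d => ‖g d‖ₑ) → ‖w‖ / c ≤ M := by
    intro E _ w c hc hw
    have h1 := hw.trans (mul_le_mul' le_rfl h)
    rw [← ENNReal.ofReal_mul hc.le, ← ofReal_norm,
      ENNReal.ofReal_le_ofReal_iff (by positivity)] at h1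
    rwa [div_le_iff₀ hc, mul_comm]
  refine phase_norm_le hM (fun i => ?_) (fun i => ?_) fun σ => ?_
  · rw [norm_x_scaling]
    exact key hs ((le_iSup (fun i => ‖g (.inr (.inl i))‖ₑ) i).trans
      (iSup_actions_le_vecNorm hs fun d => ‖g d‖ₑ))
  · rw [norm_y_scaling]
    refine key (pow_pos hr 2) (le_trans ?_ (sum_angles_le_vecNorm hr fun d => ‖g d‖ₑ))
    have h1 : (hamVec a p g).y i = - g (.inl i) := rfl
    rw [h1, enorm_neg]
    exact Finset.single_le_sum (f := fun i => ‖g (.inl i)‖ₑ) (fun _ _ => zero_le)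
      (Finset.mem_univ i)
  · rw [norm_z_scaling]
    refine key hr ?_
    rw [enorm_seq_eq]
    cases σ
    · refine le_trans (le_of_eq ?_) (extNorm_le_vecNorm hr (fun d => ‖g d‖ₑ) true)
      congr 1
      funext j
      rw [(entry_hamVec hr hfin j).2, enorm_mul, enorm_I, one_mul]
    · refine le_trans (le_of_eq ?_) (extNorm_le_vecNorm hr (fun d => ‖g d‖ₑ) false)
      congr 1
      funext j
      rw [(entry_hamVec hr hfin j).1, enorm_mul, enorm_neg, enorm_I, one_mul]

theorem symplForm_hamVec (hr : 0 < r) {g : Dir jj → ℂ}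
    (h : vecNorm a p s r (fun d => ‖g d‖ₑ) ≠ ⊤) (d : Dir jj) :
    symplForm (hamVec a p g) (eDir a p d) = g d := by
  classical
  have hX : ∀ i, (hamVec a p g).x i = g (.inr (.inl i)) := fun _ => rfl
  have hY : ∀ i, (hamVec a p g).y i = - g (.inl i) := fun _ => rfl
  have h0 : ∀ j : Site jj, (0 : SeqSpace jj a p).entry j = 0 := entry_zero
  rcases d with i | i | ⟨σ, i⟩
  · rw [symplForm]
    have h1 : ∀ σ, (eDir a p (.inl i) : Phase jj a p).z σ = 0 := fun σ => by cases σ <;> rfl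
    have h2 : ∀ k, (eDir a p (.inl i) : Phase jj a p).x k = if k = i then 1 else 0 := fun k =>
      Pi.single_apply i 1 k
    have h3 : ∀ k, (eDir a p (.inl i) : Phase jj a p).y k = 0 := fun _ => rfl
    simp [h1, h2, h3, hY]
  · rw [symplForm]
    have h1 : ∀ σ, (eDir a p (.inr (.inl i)) : Phase jj a p).z σ = 0 := fun σ => by
      cases σ <;> rfl
    have h2 : ∀ k, (eDir a p (.inr (.inl i)) : Phase jj a p).y k = if k = i then 1 else 0 :=
      fun k => Pi.single_apply i 1 k
    have h3 : ∀ k, (eDir a p (.inr (.inl i)) : Phase jj a p).x k = 0 := fun _ => rfl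
    simp [h1, h2, h3, hX]
  · have hx : ∀ k, (eDir a p (.inr (.inr (σ, i))) : Phase jj a p).x k = 0 := fun k => by
      cases σ <;> rfl
    have hy : ∀ k, (eDir a p (.inr (.inr (σ, i))) : Phase jj a p).y k = 0 := fun k => by
      cases σ <;> rfl
    simp only [symplForm, hx, hy, mul_zero, sub_zero, Finset.sum_const_zero, zero_add]
    cases σ
    · have h1 : (eDir a p (.inr (.inr (false, i))) : Phase jj a p).z true = 0 := rfl
      have h2 : (eDir a p (.inr (.inr (false, i))) : Phase jj a p).z false = SeqSpace.basis i := rfl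
      simp only [h1, h2, h0, entry_basis, mul_ite, mul_one, mul_zero, sub_zero, tsum_ite_eq]
      rw [(entry_hamVec hr h i).1]
      linear_combination -g (.inr (.inr (false, i))) * Complex.I_mul_I
    · have h1 : (eDir a p (.inr (.inr (true, i))) : Phase jj a p).z false = 0 := rfl
      have h2 : (eDir a p (.inr (.inr (true, i))) : Phase jj a p).z true = SeqSpace.basis i := rfl
      simp only [h1, h2, h0, entry_basis, mul_ite, mul_one, mul_zero, zero_sub, tsum_neg,
        tsum_ite_eq]
      rw [(entry_hamVec hr h i).2]
      linear_combination -g (.inr (.inr (true, i))) * Complex.I_mul_I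

end hamVec

section field

variable {s r σ ρ : ℝ}

theorem vecNorm_gradC_le {c : Expo jj → ℂ} {v : Phase jj a p} (hv : v ∈ dom jj a p σ ρ) :
    vecNorm a p s r (fun d => ‖gradC c v d‖ₑ) ≤ majNorm a p s r σ ρ (absC c) :=
  (vecNorm_mono fun d => enorm_gradC_le (fun h => (hv.1 h).le) (fun _ => le_rfl) c d).trans
    (le_majNorm ((mem_ballR_iff v).1 hv.2) _)

/-- The Hamiltonian vector field of an expansion with finite majorant norm is holomorphic as a map
into phase space: Taylor's formula holds for each monomial of each component, with a remainder
that is controlled by the majorants. -/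
theorem differentiableAt_hamVec (hs : 0 < s) (hr : 0 < r) {c : Expo jj → ℂ}
    (hc : majNorm a p s r σ ρ (absC c) ≠ ⊤) {v : Phase jj a p} (hv : v ∈ dom jj a p σ ρ) :
    DifferentiableAt ℂ (fun v => hamVec a p (gradC c v)) v := by
  obtain ⟨ε, hε, hball⟩ := exists_ball_dom hv
  set M := majNorm a p s r σ ρ (absC c) with hM
  set P : Dir jj → Expo jj → Phase jj a p → ℂ := fun d J v => cmult d J * expMon v (lower d J)
    with hP
  have hPd : ∀ d J, Differentiable ℂ (P d J) := fun d J =>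
    (differentiable_expMon (lower d J)).const_mul _
  have hmem : ∀ u : Phase jj a p, ‖u‖ ≤ ε → ∀ t : ℂ, ‖t‖ ≤ 1 → v + t • u ∈ dom jj a p σ ρ := by
    intro u hu t ht
    have h1 : ‖t • u‖ ≤ ε := by
      rw [norm_smul]
      exact (mul_le_of_le_one_left (norm_nonneg _) ht).trans hu
    exact add_mem_dom (hball _ h1).1 (hball _ h1).2
  have hterm : ∀ u : Phase jj a p, ‖u‖ ≤ ε → ∀ d J, ∀ t : ℂ, ‖t‖ ≤ 1 →
      ‖P d J (v + t • u)‖ₑ ≤ dposMon d σ (fun x => absCoord v x + absCoord u x) J := by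
    intro u hu d J t ht
    rw [hP, enorm_mul, enorm_cmult]
    refine mul_le_mul' le_rfl (enorm_expMon_le (fun h => ((hmem u hu t ht).1 h).le)
      (fun x => ?_) _)
    refine (absCoord_add_le _ _ x).trans (add_le_add le_rfl ?_)
    rw [absCoord_smul]
    refine mul_le_of_le_one_left' ?_
    rw [← ofReal_norm]
    exact ENNReal.ofReal_le_one.2 ht
  have htay := fun (u : Phase jj a p) (hu : ‖u‖ ≤ ε) (d : Dir jj) (J : Expo jj) =>
    enorm_taylor_le (hPd d J) (hterm u hu d J)
  have hgrad : ∀ u : Phase jj a p, ‖u‖ ≤ ε → vecNorm a p s r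
      (gradMaj (absC c) σ fun x => absCoord v x + absCoord u x) ≤ M := fun u hu =>
    le_majNorm (hball u hu).2 _
  -- the sum of the absolute values of the terms of the derivative
  set T : Phase jj a p → Dir jj → ℝ≥0∞ := fun u d => ∑' J, ‖c J * fderiv ℂ (P d J) v u‖ₑ with hT
  have hTsmall : ∀ u : Phase jj a p, ‖u‖ ≤ ε → vecNorm a p s r (T u) ≤ M := fun u hu => by
    refine (vecNorm_mono fun d => ENNReal.tsum_le_tsum fun J => ?_).trans (hgrad u hu)
    rw [enorm_mul]
    exact mul_le_mul' le_rfl (htay u hu d J).1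
  have hTsmul : ∀ (t : ℂ) (u : Phase jj a p), vecNorm a p s r (T (t • u)) =
      ‖t‖ₑ * vecNorm a p s r (T u) := fun t u => by
    rw [← vecNorm_const_mul]
    congr 1
    funext d
    rw [hT, ← ENNReal.tsum_mul_left]
    refine tsum_congr fun J => ?_
    rw [map_smul, smul_eq_mul, mul_left_comm, enorm_mul]
  have hTtop : ∀ u, vecNorm a p s r (T u) ≠ ⊤ := fun u => by
    have hpos : 0 < ε / (‖u‖ + 1) := by positivity
    have h1 : ‖((ε / (‖u‖ + 1) : ℝ) : ℂ) • u‖ ≤ ε := by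
      rw [norm_smul, Complex.norm_real, Real.norm_of_nonneg hpos.le, div_mul_eq_mul_div,
        div_le_iff₀ (by positivity)]
      nlinarith [norm_nonneg u]
    have h2 := ne_top_of_le_ne_top hc (hTsmall _ h1)
    rw [hTsmul] at h2
    intro h3
    rw [h3, ENNReal.mul_top] at h2
    · exact h2 rfl
    · rw [enorm_ne_zero]
      exact Complex.ofReal_ne_zero.2 hpos.ne'
  have hsum : ∀ u d, Summable fun J => c J * fderiv ℂ (P d J) v u := fun u d =>
    summable_of_tsum_enorm (ne_top_of_vecNorm hs hr (hTtop u) d)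
  set D : Phase jj a p → Dir jj → ℂ := fun u d => ∑' J, c J * fderiv ℂ (P d J) v u with hD
  have hDT : ∀ u, vecNorm a p s r (fun d => ‖D u d‖ₑ) ≤ vecNorm a p s r (T u) := fun u =>
    vecNorm_mono fun d => enorm_tsum_le_tsum_enorm
  have hDtop : ∀ u, vecNorm a p s r (fun d => ‖D u d‖ₑ) ≠ ⊤ := fun u =>
    ne_top_of_le_ne_top (hTtop u) (hDT u)
  let S := scaling (jj := jj) a p hs hr
  let Λ : Phase jj a p →ₗ[ℂ] Phase jj a p :=
    { toFun := fun u => S (hamVec a p (D u))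
      map_add' := fun u u' => by
        rw [← map_add, ← hamVec_add hr (hDtop u) (hDtop u')]
        congr 2
        funext d
        rw [hD]
        simp only [map_add, mul_add]
        exact (hsum u d).tsum_add (hsum u' d)
      map_smul' := fun t u => by
        rw [RingHom.id_apply, ← map_smul, ← hamVec_smul hr (hDtop u)]
        congr 2
        funext d
        rw [hD]
        simp only [map_smul, smul_eq_mul, mul_left_comm _ t, tsum_mul_left] }
  have hMR : M = ENNReal.ofReal M.toReal := (ENNReal.ofReal_toReal hc).symm
  have hM0 : 0 ≤ M.toReal := ENNReal.toReal_nonneg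
  have hq : ∀ u, ‖u‖ ≤ ε → ∀ t : ℂ, ‖t‖ ≤ 1 / 2 →
      ‖S (hamVec a p (gradC c (v + t • u))) - S (hamVec a p (gradC c v)) - t • Λ u‖
        ≤ 16 * ‖t‖ ^ 2 * M.toReal := by
    intro u hu t ht
    have ht1 : ‖t‖ ≤ 1 := ht.trans (by norm_num)
    have hm := hmem u hu t ht1
    have hg1 := ne_top_of_le_ne_top hc (vecNorm_gradC_le (s := s) (r := r) (c := c) hm)
    have hg0 := ne_top_of_le_ne_top hc (vecNorm_gradC_le (s := s) (r := r) (c := c) hv)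
    have hneg : ∀ {g : Dir jj → ℂ}, vecNorm a p s r (fun d => ‖g d‖ₑ) ≠ ⊤ →
        ∀ t : ℂ, vecNorm a p s r (fun d => ‖t * g d‖ₑ) ≠ ⊤ := fun h t => by
      simp only [enorm_mul, vecNorm_const_mul]
      exact ENNReal.mul_ne_top enorm_ne_top h
    have hlin : S (hamVec a p (gradC c (v + t • u))) - S (hamVec a p (gradC c v)) - t • Λ u =
        S (hamVec a p fun d => gradC c (v + t • u) d + (-1 * gradC c v d + (-t) * D u d)) := by
      have h2 : vecNorm a p s r (fun d => ‖-1 * gradC c v d + (-t) * D u d‖ₑ) ≠ ⊤ :=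
        ne_top_of_le_ne_top (ENNReal.add_ne_top.2 ⟨hneg hg0 (-1), hneg (hDtop u) (-t)⟩)
          ((vecNorm_mono fun d => enorm_add_le _ _).trans (vecNorm_add _ _))
      rw [hamVec_add hr hg1 h2, hamVec_add hr (hneg hg0 (-1)) (hneg (hDtop u) (-t)),
        hamVec_smul hr hg0, hamVec_smul hr (hDtop u), map_add, map_add, map_smul, map_smul]
      change _ - _ - t • S (hamVec a p (D u)) = _
      rw [neg_one_smul, neg_smul, sub_eq_add_neg, sub_eq_add_neg, add_assoc]
    rw [hlin]
    refine norm_scaling_hamVec_le hs hr (by positivity) ?_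
    have hcoord : ∀ d, ‖gradC c (v + t • u) d + (-1 * gradC c v d + (-t) * D u d)‖ₑ ≤
        16 * ENNReal.ofReal (‖t‖ ^ 2) *
          gradMaj (absC c) σ (fun x => absCoord v x + absCoord u x) d := by
      intro d
      have hsm : ∀ w ∈ dom jj a p σ ρ, HasSum (fun J => c J * P d J w) (gradC c w d) :=
        fun w hw => by
        refine (summable_of_tsum_enorm (ne_top_of_le_ne_top (ne_top_of_vecNorm hs hr
          (vecNorm_ne_top hc ((mem_ballR_iff w).1 hw.2)) d) (ENNReal.tsum_le_tsum fun J =>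
          enorm_gradC_term_le (fun h => (hw.1 h).le) (fun _ => le_rfl) c d J))).hasSum
      have h3 := ((hsm _ hm).sub (hsm _ hv)).sub ((hsum u d).hasSum.mul_left t)
      have e1 : gradC c (v + t • u) d + (-1 * gradC c v d + (-t) * D u d) =
          gradC c (v + t • u) d - gradC c v d - t * D u d := by ring
      rw [e1, ← h3.tsum_eq, gradMaj, ← ENNReal.tsum_mul_left]
      refine enorm_tsum_le_of_le fun J => ?_
      have := mul_le_mul' (le_refl ‖c J‖ₑ) ((htay u hu d J).2 t ht)
      rw [← enorm_mul] at this
      refine le_trans (le_of_eq (congrArg _ (by ring))) (this.trans (le_of_eq ?_))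
      unfold absC
      ring
    refine (vecNorm_mono hcoord).trans ?_
    rw [vecNorm_const_mul]
    refine (mul_le_mul' le_rfl (hgrad u hu)).trans (le_of_eq ?_)
    rw [ENNReal.ofReal_mul (by positivity), ENNReal.ofReal_mul (by norm_num), ← hMR]
    norm_num
  obtain ⟨L', -, hd⟩ := exists_hasFDerivAt_of_quadratic (f := fun v => S (hamVec a p (gradC c v)))
    Λ hε (fun u hu => norm_scaling_hamVec_le hs hr hM0
      (((hDT u).trans (hTsmall u hu)).trans hMR.le)) hq
  have h4 := S.symm.differentiable.differentiableAt.comp v hd.differentiableAt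
  refine h4.congr_of_eventuallyEq (Filter.Eventually.of_forall fun w => ?_)
  exact (S.symm_apply_apply _).symm

/-- `ω(X_H, ·) = dH`. -/
theorem HasExp.hasFDerivAt_symplCLM (ha : 0 ≤ a) (hp : 0 ≤ p) (hs : 0 < s) (hr : 0 < r)
    {H : Phase jj a p → ℂ} {c : Expo jj → ℂ} (hH : HasExp σ ρ H c)
    (hc : majNorm a p s r σ ρ (absC c) ≠ ⊤) {v : Phase jj a p} (hv : v ∈ dom jj a p σ ρ) :
    HasFDerivAt H (symplCLM ha hp (hamVec a p (gradC c v))) v := by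
  obtain ⟨Λ, -, hΛ⟩ := hH.exists_hasFDerivAt ha hp hs hr hc hv
  have h : Λ = symplCLM ha hp (hamVec a p (gradC c v)) := clm_ext fun d => by
    rw [symplCLM_apply, symplForm_hamVec hr (ne_top_of_le_ne_top hc (vecNorm_gradC_le hv)),
      ← hH.lineDeriv_eq ha hp hs hr hc hv d]
    exact (hΛ.hasLineDerivAt _).lineDeriv.symm
  rwa [← h]

/-- The Hamiltonian vector field is an infinitesimal symmetry of the symplectic form, by the
symmetry of the second derivative of the Hamiltonian. -/
theorem HasExp.symplCLM_fderiv_add (ha : 0 ≤ a) (hp : 0 ≤ p) (hs : 0 < s) (hr : 0 < r)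
    {H : Phase jj a p → ℂ} {c : Expo jj → ℂ} (hH : HasExp σ ρ H c)
    (hc : majNorm a p s r σ ρ (absC c) ≠ ⊤) {v : Phase jj a p} (hv : v ∈ dom jj a p σ ρ)
    (u w : Phase jj a p) :
    symplCLM ha hp (fderiv ℂ (fun v => hamVec a p (gradC c v)) v u) w +
      symplCLM ha hp u (fderiv ℂ (fun v => hamVec a p (gradC c v)) v w) = 0 := by
  have h1 : ∀ᶠ y in 𝓝 v, HasFDerivAt H (symplCLM ha hp (hamVec a p (gradC c y))) y := by
    filter_upwards [(isOpen_dom σ ρ).mem_nhds hv] with y hy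
    exact hH.hasFDerivAt_symplCLM ha hp hs hr hc hy
  have h2 : HasFDerivAt (fun y => symplCLM ha hp (hamVec a p (gradC c y)))
      ((symplCLM ha hp).comp (fderiv ℂ (fun v => hamVec a p (gradC c v)) v)) v :=
    (symplCLM ha hp).hasFDerivAt.comp v (differentiableAt_hamVec hs hr hc hv).hasFDerivAt
  have h3 := second_derivative_symmetric_of_eventually h1 h2 u w
  rw [ContinuousLinearMap.comp_apply, ContinuousLinearMap.comp_apply] at h3
  rw [h3, symplCLM_apply, symplCLM_apply, symplForm_antisymm]
  exact neg_add_cancel _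

theorem HasExp.isHamVector_iff (ha : 0 ≤ a) (hp : 0 ≤ p) (hs : 0 < s) (hr : 0 < r)
    {H : Phase jj a p → ℂ} {c : Expo jj → ℂ} (hH : HasExp σ ρ H c)
    (hc : majNorm a p s r σ ρ (absC c) ≠ ⊤) {v w : Phase jj a p} (hv : v ∈ dom jj a p σ ρ) :
    IsHamVector H v w ↔ w = hamVec a p (gradC c v) := by
  have hd : ∀ d, lineDeriv ℂ H v (eDir a p d) = gradC c v d := hH.lineDeriv_eq ha hp hs hr hc hv
  have hX : ∀ h, partialX h H v = gradC c v (.inl h) := fun h => hd (.inl h)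
  have hY : ∀ h, partialY h H v = gradC c v (.inr (.inl h)) := fun h => hd (.inr (.inl h))
  have hZ : ∀ τ j, partialZ τ j H v = gradC c v (.inr (.inr (τ, j))) := fun τ j =>
    hd (.inr (.inr (τ, j)))
  have he := entry_hamVec hr (ne_top_of_le_ne_top hc (vecNorm_gradC_le (s := s) (r := r) hv))
  generalize gradC c v = g at hX hY hZ he
  simp only [IsHamVector, hX, hY, hZ]
  constructor
  · rintro ⟨h1, h2, h3, h4⟩
    refine phase_ext h1 h2 fun τ j => ?_
    cases τ
    · rw [h4, (he j).2]
    · rw [h3, (he j).1]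
  · rintro rfl
    exact ⟨fun _ => rfl, fun _ => rfl, fun j => (he j).1, fun j => (he j).2⟩

end field

/-- `exists_flow` in linear coordinates `S` in which the vector field is small. -/
theorem exists_flow_of_equiv {V : Type*} [NormedAddCommGroup V] [NormedSpace ℂ V]
    [NormedSpace ℝ V] [IsScalarTower ℝ ℂ V] [CompleteSpace V] (S : V ≃L[ℂ] V) {X : V → V}
    {U U' : Set V} (hU' : IsOpen U') {ε F : ℝ} (hε : 0 < ε)
    (hX : ∀ w ∈ U, DifferentiableAt ℂ X w) (hb : ∀ w ∈ U, ‖S (X w)‖ ≤ F) (hF : F ≤ ε / 4)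
    (hU : ∀ v ∈ U', ∀ u, ‖S u‖ < ε → v + u ∈ U) (ω : V →L[ℂ] V →L[ℂ] ℂ)
    (hω : ∀ w ∈ U, ∀ u u', ω (fderiv ℂ X w u) u' + ω u (fderiv ℂ X w u') = 0) :
    ∃ Φ : ℝ → V → V,
      (∀ v ∈ U', Φ 0 v = v ∧
        (∀ t ∈ Set.Icc (0 : ℝ) 1, Φ t v ∈ U ∧
          HasDerivWithinAt (fun t => Φ t v) (X (Φ t v)) (Set.Icc 0 1) t) ∧
        ∀ γ : ℝ → V, γ 0 = v → (∀ t ∈ Set.Icc (0 : ℝ) 1, γ t ∈ U ∧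
          HasDerivWithinAt γ (X (γ t)) (Set.Icc 0 1) t) →
            ∀ t ∈ Set.Icc (0 : ℝ) 1, γ t = Φ t v) ∧
      ∀ v ∈ U', ∃ A : V →L[ℂ] V, HasFDerivAt (Φ 1) A v ∧ ∀ u u', ω (A u) (A u') = ω u u' := by
  have hcurve : ∀ (T : V →L[ℂ] V) {γ : ℝ → V} {γ' : V} {t : ℝ},
      HasDerivWithinAt γ γ' (Set.Icc 0 1) t →
      HasDerivWithinAt (fun t => T (γ t)) (T γ') (Set.Icc 0 1) t := fun T _ _ t h =>
    (T.restrictScalars ℝ).hasFDerivAt.comp_hasDerivWithinAt t h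
  have hder : ∀ w, S.symm w ∈ U → HasFDerivAt (fun w => S (X (S.symm w)))
      ((S : V →L[ℂ] V).comp ((fderiv ℂ X (S.symm w)).comp (S.symm : V →L[ℂ] V))) w := fun w hw =>
    (S : V →L[ℂ] V).hasFDerivAt.comp w
      ((hX _ hw).hasFDerivAt.comp w (S.symm : V →L[ℂ] V).hasFDerivAt)
  obtain ⟨Ψ, h1, h2⟩ := exists_flow (X := fun w => S (X (S.symm w))) (U := S.symm ⁻¹' U)
    (U' := S.symm ⁻¹' U') (hU'.preimage S.symm.continuous) hε
    (fun w hw => (hder w hw).differentiableAt) (fun w hw => hb _ hw) hF (fun v hv w hw => by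
      have := hU _ hv (S.symm (w - v)) (by
        rw [S.apply_symm_apply]
        exact mem_ball_iff_norm.1 hw)
      rwa [← map_add, add_sub_cancel] at this)
    (ω.bilinearComp (S.symm : V →L[ℂ] V) (S.symm : V →L[ℂ] V)) (fun w hw u u' => by
      rw [(hder w hw).fderiv]
      have := hω _ hw (S.symm u) (S.symm u')
      simpa using this)
  have hmem : ∀ {v}, v ∈ U' → S v ∈ S.symm ⁻¹' U' := fun {v} hv => by
    rw [Set.mem_preimage, S.symm_apply_apply]
    exact hv
  refine ⟨fun t v => S.symm (Ψ t (S v)), fun v hv => ?_, fun v hv => ?_⟩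
  · obtain ⟨h0, hsol, huniq⟩ := h1 _ (hmem hv)
    refine ⟨?_, fun t ht => ⟨(hsol t ht).1, ?_⟩, fun γ hγ0 hγ t ht => ?_⟩
    · change S.symm (Ψ 0 (S v)) = v
      rw [h0, S.symm_apply_apply]
    · have := hcurve (S.symm : V →L[ℂ] V) (hsol t ht).2
      simpa using this
    · have := huniq (fun t => S (γ t)) (by rw [hγ0]) (fun t ht => by
        refine ⟨?_, ?_⟩
        · rw [Set.mem_preimage, S.symm_apply_apply]
          exact (hγ t ht).1
        · have := hcurve (S : V →L[ℂ] V) (hγ t ht).2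
          simpa using this) t ht
      change γ t = S.symm (Ψ t (S v))
      rw [← this, S.symm_apply_apply]
  · obtain ⟨A, hA, hAω⟩ := h2 _ (hmem hv)
    refine ⟨(S.symm : V →L[ℂ] V).comp (A.comp (S : V →L[ℂ] V)),
      (S.symm : V →L[ℂ] V).hasFDerivAt.comp v (hA.comp v (S : V →L[ℂ] V).hasFDerivAt),
      fun u u' => ?_⟩
    have := hAω (S u) (S u')
    simpa using this

/-- The flow of a Hamiltonian whose majorant norm is at most a quarter of the room around the small
domain. -/
theorem HasExp.hasGoodFlow (ha : 0 ≤ a) (hp : 0 ≤ p) {s r s' r' δ F : ℝ} (hs : 0 < s)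
    (hr : 0 < r) (hr' : 0 ≤ r') (hδ : 0 < δ) (hδs : δ * s ≤ s - s') (hδr : δ * r ≤ r - r')
    {H : Phase jj a p → ℂ} {c : Expo jj → ℂ} (hH : HasExp s r H c) (hF0 : 0 ≤ F)
    (hF : F ≤ δ / (n + 1) / 4) (hc : majNorm a p s r s r (absC c) ≤ ENNReal.ofReal F) :
    HasGoodFlow s' r' s r H := by
  have hct : majNorm a p s r s r (absC c) ≠ ⊤ := ne_top_of_le_ne_top ENNReal.ofReal_ne_top hc
  obtain ⟨Φ, h1, h2⟩ := exists_flow_of_equiv (scaling (jj := jj) a p hs hr)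
    (X := fun v => hamVec a p (gradC c v)) (isOpen_dom s' r')
    (by positivity : 0 < δ / (n + 1)) (U := dom jj a p s r)
    (fun w hw => differentiableAt_hamVec hs hr hct hw)
    (fun w hw => norm_scaling_hamVec_le hs hr hF0 ((vecNorm_gradC_le hw).trans hc)) hF
    (fun v hv u hu => add_mem_dom_of_norm_scaling_lt hs hr hδ hr' hδs hδr hv hu)
    (symplCLM ha hp) (fun w hw u u' => hH.symplCLM_fderiv_add ha hp hs hr hct hw u u')
  have hsol : ∀ γ : ℝ → Phase jj a p, IsSolution s r H γ ↔ ∀ t ∈ Set.Icc (0 : ℝ) 1,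
      γ t ∈ dom jj a p s r ∧
        HasDerivWithinAt γ (hamVec a p (gradC c (γ t))) (Set.Icc 0 1) t := fun γ => by
    refine forall₂_congr fun t _ => and_congr_right fun hm => ⟨?_, fun h => ?_⟩
    · rintro ⟨w, hw, h⟩
      rwa [(hH.isHamVector_iff ha hp hs hr hct hm).1 hw] at h
    · exact ⟨_, (hH.isHamVector_iff ha hp hs hr hct hm).2 rfl, h⟩
  refine ⟨Φ, fun v hv => ⟨(h1 v hv).1, (hsol _).2 (h1 v hv).2.1, fun γ h0 hγ =>
    (h1 v hv).2.2 γ h0 ((hsol γ).1 hγ)⟩, fun v hv =>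
    ((h1 v hv).2.1 1 (Set.right_mem_Icc.2 zero_le_one)).1, ?_, fun v hv u w => ?_⟩
  · exact contDiffOn_one_of_differentiableAt (isOpen_dom s' r') fun v hv =>
      (h2 v hv).choose_spec.1.differentiableAt
  · obtain ⟨A, hA, hAω⟩ := h2 v hv
    rw [hA.fderiv, ← symplCLM_apply ha hp, ← symplCLM_apply ha hp]
    exact hAω u w

end QuasiToeplitz

end

theorem proposition3p2 (n : ℕ) :
    ∃ c C : ℝ, 0 < c ∧ 0 < C ∧
      ∀ (jj : Fin n → ℤ), Function.Injective jj →
      ∀ (a p : ℝ), 0 ≤ a → 1 / 2 < p →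
      ∀ (b L : ℝ), 0 < b → b < L → L < 1 →
      ∀ (N₀ : ℕ) (θ μ : ℝ), 0 < N₀ → 1 < θ → θ < 6 → 1 < μ → μ < 6 →
        12 * (N₀ : ℝ) ^ (L - 1) + 2 * (QuasiToeplitz.kappa jj : ℝ) * (N₀ : ℝ) ^ (b - 1) < 1 →
      ∀ (s r s' r' : ℝ), 0 < s → 0 < r →
        s / 2 ≤ s' → s' < s → r / 2 ≤ r' → r' < r →
      ∀ (O : Set (Fin n → ℝ)) (f g : O → QuasiToeplitz.Phase jj a p → ℂ),
        QuasiToeplitz.IsQuasiToeplitz b L s r N₀ θ μ f →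
        QuasiToeplitz.IsQuasiToeplitz b L s r N₀ θ μ g →
        QuasiToeplitz.tNorm b L s r N₀ θ μ f
          ≤ ENNReal.ofReal (c * QuasiToeplitz.delta s' s r' r) →
        (∀ ξ, QuasiToeplitz.HasGoodFlow s' r' s r (f ξ)) ∧
        ∀ (N₀' : ℕ) (θ' μ' : ℝ),
          N₀ ≤ N₀' → QuasiToeplitz.nBar b L ≤ (N₀' : ℝ) → μ' < μ → θ < θ' →
          (QuasiToeplitz.kappa jj : ℝ) * (N₀' : ℝ) ^ (b - L) * Real.log N₀' ≤ μ - μ' →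
          (6 + (QuasiToeplitz.kappa jj : ℝ)) * (N₀' : ℝ) ^ (L - 1) * Real.log N₀' ≤ θ' - θ →
          2 * (N₀' : ℝ) ^ (-b) * Real.log N₀' ^ 2 ≤ b * (s - s') →
          -- `e^{ad_f} g`
          ((∀ ξ, ∀ v ∈ QuasiToeplitz.dom jj a p s' r',
              Summable fun j : ℕ => ((QuasiToeplitz.ad (f ξ))^[j] (g ξ)) v / (j.factorial : ℂ)) ∧
            QuasiToeplitz.IsQuasiToeplitz b L s' r' N₀' θ' μ'
              (fun ξ => QuasiToeplitz.expAd (f ξ) (g ξ)) ∧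
            QuasiToeplitz.tNorm b L s' r' N₀' θ' μ'
                (fun ξ => QuasiToeplitz.expAd (f ξ) (g ξ))
              ≤ ENNReal.ofReal (2 * max (s / s') ((r / r') ^ 2))
                * QuasiToeplitz.tNorm b L s r N₀ θ μ g) ∧
          -- the tails
          ∀ β : ℕ → ℝ, (∀ j, 0 ≤ β j ∧ β j ≤ 1 / (j.factorial : ℝ)) →
            (∀ ξ, ∀ v ∈ QuasiToeplitz.dom jj a p s' r',
              Summable fun j : ℕ => (β j : ℂ) * ((QuasiToeplitz.ad (f ξ))^[j] (g ξ)) v) ∧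
            (∀ h : ℕ, h ≤ 2 → QuasiToeplitz.IsQuasiToeplitz b L s' r' N₀' θ' μ'
              (fun ξ => QuasiToeplitz.adTail β h (f ξ) (g ξ))) ∧
            QuasiToeplitz.tNorm b L s' r' N₀' θ' μ'
                (fun ξ => QuasiToeplitz.adTail β 0 (f ξ) (g ξ))
              ≤ ENNReal.ofReal (2 * max (s / s') ((r / r') ^ 2))
                * QuasiToeplitz.tNorm b L s r N₀ θ μ g ∧
            ∀ h : ℕ, 1 ≤ h → h ≤ 2 →
              QuasiToeplitz.tNorm b L s' r' N₀' θ' μ'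
                  (fun ξ => QuasiToeplitz.adTail β h (f ξ) (g ξ))
                ≤ 2 * (ENNReal.ofReal (C / QuasiToeplitz.delta s' s r' r)
                      * QuasiToeplitz.tNorm b L s r N₀ θ μ f) ^ h
                  * QuasiToeplitz.tNorm b L s r N₀ θ μ g := by
  have hn : (0 : ℝ) < n + 1 := by positivity
  -- The Lie series needs `‖f‖ ≤ δ / 400`, and the flow `‖f‖ < δ / (4 (n + 1))`.  The constant `336` is
  -- `4 * 84`: for `h ≥ 1` the factor `max {s/s', (r/r')²} ≤ 4` goes into the `h`-th power.
  refine ⟨1 / (400 * (n + 1)), 336, by positivity, by norm_num, ?_⟩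
  intro jj _ a p ha hp b L hb hbL hL N₀ θ μ hN0 hθ _ _ hμ hκ s r s' r' hs hr hs2 hss hr2 hrr O f g
    hf hg hfc
  set δ := QuasiToeplitz.delta s' s r' r with hδdef
  have hδ : 0 < δ := QuasiToeplitz.delta_pos hs hr hss hrr
  obtain ⟨hδs, hδr⟩ := QuasiToeplitz.delta_mul_le (s' := s') (r' := r') hs hr
  have hs'0 : 0 < s' := by linarith
  have hr'0 : 0 < r' := by linarith
  have hcδ : 1 / (400 * ((n : ℝ) + 1)) * δ = δ / (n + 1) / 400 := by
    field_simp
  have hq : 0 < δ / ((n : ℝ) + 1) := by positivity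
  refine ⟨fun ξ => ?_, ?_⟩
  · obtain ⟨e, he, heN⟩ := QuasiToeplitz.exists_qt_of_tNorm_lt ha hp hs hr hθ.le
      (fun N hN => QuasiToeplitz.scale_bounds hb hbL hL hμ hN0 hκ hN) hf.2.1
      (hfc.trans_lt ((ENNReal.ofReal_lt_ofReal_iff (q := δ / (n + 1) / 4) (by positivity)).2 (by
        rw [hcδ]
        linarith)))
    obtain ⟨u, hu⟩ := heN N₀ le_rfl
    exact (he ξ).hasGoodFlow ha (by linarith) hs hr hr'0.le hδ hδs hδr (by positivity) le_rfl
      (hu ξ).norm_le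
  · intro N₀' θ' μ' hNN hN' hμ' hθ' h1 h2 h3
    have hf400 : QuasiToeplitz.tNorm b L s r N₀ θ μ f ≤ ENNReal.ofReal (δ / 400) := by
      refine hfc.trans (ENNReal.ofReal_le_ofReal ?_)
      rw [hcδ]
      have : δ / ((n : ℝ) + 1) ≤ δ := div_le_self hδ.le (by linarith [n.cast_nonneg (α := ℝ)])
      linarith
    have key := fun (h : ℕ) (w : ℕ → ℝ) (hw0 : ∀ j, 0 ≤ w j)
        (hw : ∀ j, w j ≤ 1 / (j.factorial : ℝ)) (hwh : ∀ j < h, w j = 0) =>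
      QuasiToeplitz.lieSeries_estimate ha hp hb hbL hL hN0 hθ hμ hκ hs hr hs2 hss hr2 hrr hf hg
        hf400 hNN hN' hμ' hθ' h1 h2 h3 hw0 hw hwh
    refine ⟨?_, fun β hβ => ?_⟩
    · obtain ⟨e1, e2, e3⟩ := key 0 (fun j => 1 / (j.factorial : ℝ)) (fun j => by positivity)
        (fun j => le_rfl) (fun j hj => absurd hj (Nat.not_lt_zero j))
      rw [pow_zero, mul_one] at e3
      have hexp : (fun ξ => QuasiToeplitz.expAd (f ξ) (g ξ)) = fun ξ v => ∑' j : ℕ,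
          (((1 / (j.factorial : ℝ)) : ℝ) : ℂ) * ((QuasiToeplitz.ad (f ξ))^[j] (g ξ)) v := by
        funext ξ v
        exact QuasiToeplitz.expAd_eq _ _ v
      rw [hexp]
      refine ⟨fun ξ v hv => (e1 ξ v hv).congr fun j => ?_, e2, e3⟩
      push_cast
      ring
    · have htail : ∀ h, (fun ξ => QuasiToeplitz.adTail β h (f ξ) (g ξ)) = fun ξ v => ∑' j : ℕ,
          ((if j < h then 0 else β j : ℝ) : ℂ) * ((QuasiToeplitz.ad (f ξ))^[j] (g ξ)) v :=
        fun h => by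
        funext ξ v
        exact QuasiToeplitz.adTail_eq β h _ _ v
      have keyh := fun h : ℕ => key h (fun j => if j < h then 0 else β j)
        (fun j => by
          split_ifs
          exacts [le_rfl, (hβ j).1])
        (fun j => by
          split_ifs
          exacts [by positivity, (hβ j).2])
        (fun j hj => if_pos hj)
      refine ⟨fun ξ v hv => ?_, fun h _ => ?_, ?_, fun h hh _ => ?_⟩
      · simpa using (keyh 0).1 ξ v hv
      · rw [htail]
        exact (keyh h).2.1
      · have := (keyh 0).2.2
        rw [pow_zero, mul_one] at this
        rw [htail]
        exact this
      · rw [htail]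
        refine (keyh h).2.2.trans (mul_le_mul' ?_ le_rfl)
        have hT : QuasiToeplitz.tNorm b L s r N₀ θ μ f ≠ ⊤ :=
          ne_top_of_le_ne_top ENNReal.ofReal_ne_top hfc
        have h84 : (0 : ℝ) ≤ 84 / δ := by positivity
        have e336 : ENNReal.ofReal (336 / δ) = 4 * ENNReal.ofReal (84 / δ) := by
          have e4 : (4 : ENNReal) = ENNReal.ofReal 4 := by norm_num
          rw [e4, ← ENNReal.ofReal_mul (by norm_num)]
          congr 1
          ring
        rw [ENNReal.ofReal_mul h84, ENNReal.ofReal_toReal hT, e336, mul_assoc 4, mul_pow 4,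
          ← mul_assoc 2]
        refine mul_le_mul' ?_ le_rfl
        have hmax : max (s / s') ((r / r') ^ 2) ≤ 4 := by
          refine max_le ?_ ?_
          · rw [div_le_iff₀ hs'0]
            linarith
          · have hq2 : r / r' ≤ 2 := by
              rw [div_le_iff₀ hr'0]
              linarith
            have hq0 : 0 ≤ r / r' := by positivity
            nlinarith
        calc ENNReal.ofReal (2 * max (s / s') ((r / r') ^ 2)) ≤ ENNReal.ofReal (2 * 4) :=
              ENNReal.ofReal_le_ofReal (by linarith)
          _ = 2 * 4 ^ 1 := by
              rw [ENNReal.ofReal_mul (by norm_num)]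
              norm_num
          _ ≤ 2 * 4 ^ h := mul_le_mul' le_rfl (pow_le_pow_right₀ (by norm_num) hh)
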